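/- **Setting.** Let $n,m\ge 1$, $\gamma>0$, write $z=(x,y)\in\mathbb R^n\times\mathbb R^m$, let $Q=n+(1+\gamma)m$, and let $\Omega\subset\mathbb R^{n+m}$ be a bounded domain (open, connected, non-empty). Put $\nabla_\gamma u=(\nabla_x u,(1+\gamma)|x|^\gamma\nabla_y u)$ (weak derivatives) and $\Delta_\gamma=\Delta_x+(1+\gamma)^2|x|^{2\gamma}\Delta_y$. Let $H^1_\gamma(\Omega)=\{u\in L^2(\Omega):|\nabla_\gamma u|\in L^2(\Omega)\}$ and let $H^1_{0,\gamma}(\Omega)$ be the completion of $C_c^\infty(\Omega)$ for $\|u\|=(\int_\Omega|\nabla_\gamma u|^2dz)^{1/2}$. Consider $$-\Delta_\gamma u+g(z,u)=f(z,u)\ \text{ in }\Omega,\qquad u=0\ \text{ on }\partial\Omega. \tag{P}$$ **Assumptions.** (A1') $f:\Omega\times\mathbb R\to\mathbb R$ is a Carathéodory function, and for every $M>0$ there is a nonnegative $a_4\in L^{2Q/(Q+2)}(\Omega)$ with $|f(z,t)|\le a_4(z)$ for a.e. $z\in\Omega$ and all $|t|\le M$. (A2) $g:\Omega\times\mathbb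 R\to[-\infty,\infty]$ and $G:\Omega\times\mathbb R\to(-\infty,\infty]$ are measurable in $z$ for each $t$. For a.e. $z$: $G(z,\cdot)$ is convex and lower semicontinuous; on the interior of $\{G(z,\cdot)<\infty\}$ it is differentiable with $\partial_tG(z,t)=g(z,t)$; and $G(z,\cdot)$ and $g(z,\cdot)$ (the latter with values in $[-\infty,\infty]$) are continuous on $\{G(z,\cdot)<\infty\}$. There are nonnegative $a_2\in L^{2Q/(Q+2)}(\Omega)$, $a_3\in L^1(\Omega)$ with $G(z,t)\ge -a_2(z)|t|-a_3(z)$ for a.e. $z$ and all $t\in\mathbb R$. (A3') For every $M>0$ there is a nonnegative $a_5\in L^{Q/2}(\Omega)$ with $\frac{f(z,s)-f(z,t)}{s-t}\le a_5(z)$ for a.e. $z$ and all $s\ne t$ with $|s|,|t|\le M$. **Definitions.** A function $\varphi$ is a subsolution (resp. supersolution) of (P) if $\varphi\in H^1_\gamma(\Omega)$, $\varphi^+\in H^1_{0,\gamma}(\Omega)$ (resp. $\varphi^-\in H^1_{0,\gamma}(\Omega)$), $g(\cdot,\varphi)$ and $f(\cdot,\varphi)$ belong to $L^1_{loc}(\Omega)$,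 and $-\Delta_\gamma\varphi+g(z,\varphi)-f(z,\varphi)\le0$ (resp. $\ge0$) in the sense of distributions. A weak solution is a function that is both a subsolution and a supersolution. A supersolution $\varphi$ is strict if moreover $g^-(\cdot,\varphi)\in L^{2Q/(Q+2)}(\Omega)$ and $\int_\Omega(\nabla_\gamma\varphi\cdot\nabla_\gamma v+g(z,\varphi)v-f(z,\varphi)v)\,dz>0$ (the value $+\infty$ is allowed) for all $v\in H^1_{0,\gamma}(\Omega)\setminus\{0\}$ with $v\ge0$. Let $F:\Omega\times\mathbb R\to\mathbb R$ be a Carathéodory function with $F(\cdot,0)\in L^1(\Omega)$ and $\partial_tF=f$. For $u\in H^1_{0,\gamma}(\Omega)$ let $I(u)=\frac12\int_\Omega|\nabla_\gamma u|^2+\int_\Omega G(z,u)-\int_\Omega F(z,u)$ if $G(\cdot,u),F(\cdot,u)\in L^1(\Omega)$, and $I(u)=\infty$ otherwise. For functions $\varphi,\psi$ on $\Omega$ let $K_\varphi^\psi=\{u\in H^1_{0,\gamma}(\Omega):\varphi\le u\le\psi\text{ a.e.}\}$. For $K\subset H^1_{0,\gamma}(\Omega)$ let $I_K=I$ on $K$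 and $I_K=\infty$ off $K$. **Theorem.** Assume (A1'), (A2), (A3'). Let $\varphi_1$ be a subsolution and $\varphi_2$ a supersolution of (P), where $\varphi_2$ is not a weak solution of (P). Suppose that $\varphi_1,\varphi_2\in L^\infty(\Omega)$, that $\varphi_1\le\varphi_2$ a.e., that $G(\cdot,\varphi_1),G(\cdot,\varphi_2)\in L^1_{loc}(\Omega)$, and that there is $w\in H^1_{0,\gamma}(\Omega)$ with $\varphi_1\le w\le\varphi_2$ a.e. and $G(\cdot,w)\in L^1(\Omega)$. Assume that at least one of the following holds: (i) for every subdomain $\Omega'\Subset\Omega$ there is $M>0$ such that, for a.e. $z\in\Omega'$ and all $t$ with $\varphi_1(z)\le t<\varphi_2(z)$, $$\frac{g(z,\varphi_2(z))-g(z,t)}{\varphi_2(z)-t}\le M\quad\text{and}\quad\frac{f(z,\varphi_2(z))-f(z,t)}{\varphi_2(z)-t}\ge-M;$$ (ii) $\varphi_2$ is a strict supersolution of (P). Then there is a weak solution $u$ of (P) such that * $\varphi_1\le u\le\varphi_2$ a.e. in $\Omega$; * for every $v\in H^1_{0,\gamma}(\Omega)\cap L^\infty(\Omega)$ with $v\ge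 u$ a.e., $u$ is a local minimizer of $I_{K_{\varphi_1}^v}$: $I_{K_{\varphi_1}^v}(u)<\infty$, and there is $\rho>0$ with $I_{K_{\varphi_1}^v}(u)\le I_{K_{\varphi_1}^v}(w)$ for all $w\in H^1_{0,\gamma}(\Omega)$ with $\|w-u\|<\rho$; * if (i) holds, then $u<\varphi_2$ a.e. in $\Omega$. -/

import Mathlib

open MeasureTheory Filter Topology
open scoped ContDiff

noncomputable section

namespace Grushin

/-- The space `ℝⁿ × ℝᵐ` of points `z = (x, y)`, with Lebesgue measure. -/
abbrev Pt (n m : ℕ) : Type := EuclideanSpace ℝ (Fin n) × EuclideanSpace ℝ (Fin m)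

/-- Values of the Grushin gradient: `n` components in `x` and `m` components in `y`. -/
abbrev Vec (n m : ℕ) : Type := EuclideanSpace ℝ (Fin n ⊕ Fin m)

/-- The homogeneous dimension for the dilations `(x, y) ↦ (t x, t ^ (1 + γ) y)`. -/
def homDim (n m : ℕ) (γ : ℝ) : ℝ := n + (1 + γ) * m

variable {n m : ℕ}

/-- The Grushin gradient `(∇ₓ ψ, (1 + γ) |x| ^ γ ∇_y ψ)` of a differentiable function. -/
def grad (γ : ℝ) (ψ : Pt n m → ℝ) (z : Pt n m) : Vec n m :=
  WithLp.toLp 2 (Sum.elim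
    (fun i => fderiv ℝ ψ z (EuclideanSpace.single i 1, 0))
    (fun j => (1 + γ) * ‖z.1‖ ^ γ * fderiv ℝ ψ z (0, EuclideanSpace.single j 1)))

/-- `ψ ∈ C_c^∞(Ω)`. -/
structure IsTest (Ω : Set (Pt n m)) (ψ : Pt n m → ℝ) : Prop where
  smooth : ContDiff ℝ ∞ ψ
  compact : HasCompactSupport ψ
  supp : tsupport ψ ⊆ Ω

/-- `U` is the Grushin gradient of `u` in the sense of distributions on `Ω`. The coefficient
`(1 + γ) |x| ^ γ` does not depend on `y`, so each of the vector fields is formally skew-adjoint. -/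
def IsWeakGrad (γ : ℝ) (Ω : Set (Pt n m)) (u : Pt n m → ℝ) (U : Pt n m → Vec n m) : Prop :=
  ∀ ψ : Pt n m → ℝ, IsTest Ω ψ → ∀ j : Fin n ⊕ Fin m,
    ∫ z in Ω, u z * grad γ ψ z j = -∫ z in Ω, U z j * ψ z

/-- `u ∈ H¹_γ(Ω)`: `u` and its weak Grushin gradient are square integrable. -/
def MemH1 (γ : ℝ) (Ω : Set (Pt n m)) (u : Pt n m → ℝ) : Prop :=
  MemLp u 2 (volume.restrict Ω) ∧
    ∃ U : Pt n m → Vec n m, MemLp U 2 (volume.restrict Ω) ∧ IsWeakGrad γ Ω u U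

open Classical in
/-- The weak Grushin gradient of `u ∈ H¹_γ(Ω)` (unique up to null sets). -/
def weakGrad (γ : ℝ) (Ω : Set (Pt n m)) (u : Pt n m → ℝ) : Pt n m → Vec n m :=
  if h : ∃ U : Pt n m → Vec n m, MemLp U 2 (volume.restrict Ω) ∧ IsWeakGrad γ Ω u U
  then h.choose else 0

/-- `u ∈ H¹_{0,γ}(Ω)`, the completion of `C_c^∞(Ω)` for the norm `‖∇_γ ·‖_{L²}`, realised inside
`L²(Ω)`. For bounded `Ω` the Poincaré inequality makes the convergence in `L²` automatic for a
sequence in `C_c^∞(Ω)` that is Cauchy in this norm. -/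
def MemH10 (γ : ℝ) (Ω : Set (Pt n m)) (u : Pt n m → ℝ) : Prop :=
  MemH1 γ Ω u ∧ ∃ ψ : ℕ → Pt n m → ℝ, (∀ k, IsTest Ω (ψ k)) ∧
    Tendsto (fun k => eLpNorm (fun z => ψ k z - u z) 2 (volume.restrict Ω)) atTop (𝓝 0) ∧
    Tendsto (fun k => eLpNorm (fun z => grad γ (ψ k) z - weakGrad γ Ω u z) 2
      (volume.restrict Ω)) atTop (𝓝 0)

/-- The norm `(∫_Ω |∇_γ u|²)^{1/2}` of `H¹_{0,γ}(Ω)`. -/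
def h10Norm (γ : ℝ) (Ω : Set (Pt n m)) (u : Pt n m → ℝ) : ℝ :=
  Real.sqrt (∫ z in Ω, ‖weakGrad γ Ω u z‖ ^ 2)

/-- An extended-real-valued function belongs to `L¹(Ω)`. -/
def MemL1 (Ω : Set (Pt n m)) (h : Pt n m → EReal) : Prop :=
  (∀ᵐ z ∂volume.restrict Ω, h z ≠ ⊤ ∧ h z ≠ ⊥) ∧
    Integrable (fun z => (h z).toReal) (volume.restrict Ω)

/-- An extended-real-valued function belongs to `L¹_loc(Ω)`. -/
def MemL1loc (Ω : Set (Pt n m)) (h : Pt n m → EReal) : Prop :=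
  (∀ᵐ z ∂volume.restrict Ω, h z ≠ ⊤ ∧ h z ≠ ⊥) ∧
    LocallyIntegrableOn (fun z => (h z).toReal) Ω volume

/-- Carathéodory functions on `Ω × ℝ`. -/
structure IsCaratheodory (Ω : Set (Pt n m)) (f : Pt n m → ℝ → ℝ) : Prop where
  measurable : ∀ t : ℝ, AEMeasurable (fun z => f z t) (volume.restrict Ω)
  continuous : ∀ᵐ z ∂volume.restrict Ω, Continuous (f z)

/-- `f` is Carathéodory and, for bounded `t`, dominated by a function in `L^{2Q/(Q+2)}(Ω)`. -/
structure LocalGrowth (γ : ℝ) (Ω : Set (Pt n m)) (f : Pt n m → ℝ → ℝ) : Prop where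
  caratheodory : IsCaratheodory Ω f
  bound : ∀ M : ℝ, 0 < M → ∃ a₄ : Pt n m → ℝ,
    MemLp a₄ (ENNReal.ofReal (2 * homDim n m γ / (homDim n m γ + 2))) (volume.restrict Ω) ∧
    (∀ z ∈ Ω, 0 ≤ a₄ z) ∧
    ∀ᵐ z ∂volume.restrict Ω, ∀ t : ℝ, |t| ≤ M → |f z t| ≤ a₄ z

/-- `G : Ω × ℝ → (-∞, ∞]` is a convex lower semicontinuous primitive of `g : Ω × ℝ → [-∞, ∞]` in
the second variable. `continuous_g` fixes `g` at those end points of `{G(z, ·) < ∞}` that belong to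
this set. -/
structure ConvexPrimitive (γ : ℝ) (Ω : Set (Pt n m)) (g G : Pt n m → ℝ → EReal) : Prop where
  G_ne_bot : ∀ z ∈ Ω, ∀ t : ℝ, G z t ≠ ⊥
  measurable_g : ∀ t : ℝ, AEMeasurable (fun z => g z t) (volume.restrict Ω)
  measurable_G : ∀ t : ℝ, AEMeasurable (fun z => G z t) (volume.restrict Ω)
  lsc : ∀ᵐ z ∂volume.restrict Ω, LowerSemicontinuous (G z)
  convex : ∀ᵐ z ∂volume.restrict Ω, ∀ s t a b : ℝ, 0 < a → 0 < b → a + b = 1 →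
    G z (a * s + b * t) ≤ (a : EReal) * G z s + (b : EReal) * G z t
  deriv : ∀ᵐ z ∂volume.restrict Ω, ∀ t ∈ interior {s : ℝ | G z s < ⊤},
    ∃ d : ℝ, HasDerivAt (fun s => (G z s).toReal) d t ∧ g z t = (d : EReal)
  continuous_G : ∀ᵐ z ∂volume.restrict Ω, ContinuousOn (G z) {s : ℝ | G z s < ⊤}
  continuous_g : ∀ᵐ z ∂volume.restrict Ω, ContinuousOn (g z) {s : ℝ | G z s < ⊤}
  lower_bound : ∃ a₂ a₃ : Pt n m → ℝ,
    MemLp a₂ (ENNReal.ofReal (2 * homDim n m γ / (homDim n m γ + 2))) (volume.restrict Ω) ∧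
    Integrable a₃ (volume.restrict Ω) ∧ (∀ z ∈ Ω, 0 ≤ a₂ z) ∧ (∀ z ∈ Ω, 0 ≤ a₃ z) ∧
    ∀ᵐ z ∂volume.restrict Ω, ∀ t : ℝ, ((-a₂ z * |t| - a₃ z : ℝ) : EReal) ≤ G z t

/-- The difference quotients of `f` on bounded intervals are at most a function in
`L^{Q/2}(Ω)`. -/
def LocalOneSidedLipschitz (γ : ℝ) (Ω : Set (Pt n m)) (f : Pt n m → ℝ → ℝ) : Prop :=
  ∀ M : ℝ, 0 < M → ∃ a₅ : Pt n m → ℝ,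
    MemLp a₅ (ENNReal.ofReal (homDim n m γ / 2)) (volume.restrict Ω) ∧
    (∀ z ∈ Ω, 0 ≤ a₅ z) ∧
    ∀ᵐ z ∂volume.restrict Ω, ∀ s t : ℝ, s ≠ t → |s| ≤ M → |t| ≤ M →
      (f z s - f z t) / (s - t) ≤ a₅ z

/-- `F` is a Carathéodory primitive of `f` in the second variable with `F(·, 0) ∈ L¹(Ω)`. -/
structure IsPrimitive (Ω : Set (Pt n m)) (f F : Pt n m → ℝ → ℝ) : Prop where
  caratheodory : IsCaratheodory Ω F
  integrable_zero : Integrable (fun z => F z 0) (volume.restrict Ω)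
  deriv : ∀ᵐ z ∂volume.restrict Ω, ∀ t : ℝ, HasDerivAt (F z) (f z t) t

/-- The integrand `∇_γ φ · ∇_γ v + g(z, φ) v - f(z, φ) v`, where `V` is the gradient of `v`. -/
def weakIntegrand (γ : ℝ) (Ω : Set (Pt n m)) (g : Pt n m → ℝ → EReal) (f : Pt n m → ℝ → ℝ)
    (φ v : Pt n m → ℝ) (V : Pt n m → Vec n m) (z : Pt n m) : ℝ :=
  inner ℝ (weakGrad γ Ω φ z) (V z) + (g z (φ z)).toReal * v z - f z (φ z) * v z

/-- Subsolutions of `-Δ_γ u + g(z, u) = f(z, u)` in `Ω`, `u = 0` on `∂Ω`. Local integrability of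
`f(·, φ)` gives a meaning to the inequality in the sense of distributions. -/
structure IsSubsolution (γ : ℝ) (Ω : Set (Pt n m)) (g : Pt n m → ℝ → EReal)
    (f : Pt n m → ℝ → ℝ) (φ : Pt n m → ℝ) : Prop where
  memH1 : MemH1 γ Ω φ
  posPart : MemH10 γ Ω (fun z => max (φ z) 0)
  g_loc : MemL1loc Ω (fun z => g z (φ z))
  f_loc : LocallyIntegrableOn (fun z => f z (φ z)) Ω volume
  ineq : ∀ ψ : Pt n m → ℝ, IsTest Ω ψ → (∀ z, 0 ≤ ψ z) →
    ∫ z in Ω, weakIntegrand γ Ω g f φ ψ (grad γ ψ) z ≤ 0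

/-- Supersolutions of `-Δ_γ u + g(z, u) = f(z, u)` in `Ω`, `u = 0` on `∂Ω`. -/
structure IsSupersolution (γ : ℝ) (Ω : Set (Pt n m)) (g : Pt n m → ℝ → EReal)
    (f : Pt n m → ℝ → ℝ) (φ : Pt n m → ℝ) : Prop where
  memH1 : MemH1 γ Ω φ
  negPart : MemH10 γ Ω (fun z => max (-φ z) 0)
  g_loc : MemL1loc Ω (fun z => g z (φ z))
  f_loc : LocallyIntegrableOn (fun z => f z (φ z)) Ω volume
  ineq : ∀ ψ : Pt n m → ℝ, IsTest Ω ψ → (∀ z, 0 ≤ ψ z) →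
    0 ≤ ∫ z in Ω, weakIntegrand γ Ω g f φ ψ (grad γ ψ) z

/-- Strict supersolutions. The integral in the last clause may be `+∞`, so its positivity is
written as `∫ h⁻ < ∫ h⁺` for the integrand `h`. -/
structure IsStrictSupersolution (γ : ℝ) (Ω : Set (Pt n m)) (g : Pt n m → ℝ → EReal)
    (f : Pt n m → ℝ → ℝ) (φ : Pt n m → ℝ) : Prop where
  isSupersolution : IsSupersolution γ Ω g f φ
  g_negPart : MemLp (fun z => max (-(g z (φ z)).toReal) 0)
    (ENNReal.ofReal (2 * homDim n m γ / (homDim n m γ + 2))) (volume.restrict Ω)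
  strict : ∀ v : Pt n m → ℝ, MemH10 γ Ω v → (∀ᵐ z ∂volume.restrict Ω, 0 ≤ v z) →
    ¬ (∀ᵐ z ∂volume.restrict Ω, v z = 0) →
    ∫⁻ z in Ω, ENNReal.ofReal (-weakIntegrand γ Ω g f φ v (weakGrad γ Ω v) z) <
      ∫⁻ z in Ω, ENNReal.ofReal (weakIntegrand γ Ω g f φ v (weakGrad γ Ω v) z)

/-- Weak solutions: both a subsolution and a supersolution. -/
def IsWeakSolution (γ : ℝ) (Ω : Set (Pt n m)) (g : Pt n m → ℝ → EReal)
    (f : Pt n m → ℝ → ℝ) (φ : Pt n m → ℝ) : Prop :=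
  IsSubsolution γ Ω g f φ ∧ IsSupersolution γ Ω g f φ

/-- The order interval `K_{φ}^{ψ}` in `H¹_{0,γ}(Ω)`. -/
def orderInterval (γ : ℝ) (Ω : Set (Pt n m)) (φ ψ : Pt n m → ℝ) : Set (Pt n m → ℝ) :=
  {u | MemH10 γ Ω u ∧ ∀ᵐ z ∂volume.restrict Ω, φ z ≤ u z ∧ u z ≤ ψ z}

open Classical in
/-- The functional `I(u) = ½ ∫ |∇_γ u|² + ∫ G(z, u) - ∫ F(z, u)` if `G(·, u), F(·, u) ∈ L¹(Ω)`,
and `I(u) = ∞` otherwise. -/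
def energy (γ : ℝ) (Ω : Set (Pt n m)) (G : Pt n m → ℝ → EReal) (F : Pt n m → ℝ → ℝ)
    (u : Pt n m → ℝ) : EReal :=
  if MemL1 Ω (fun z => G z (u z)) ∧ Integrable (fun z => F z (u z)) (volume.restrict Ω) then
    (((1 / 2) * (∫ z in Ω, ‖weakGrad γ Ω u z‖ ^ 2) + (∫ z in Ω, (G z (u z)).toReal)
      - ∫ z in Ω, F z (u z) : ℝ) : EReal)
  else ⊤

open Classical in
/-- The restricted functional `I_K`. -/
def energyOn (γ : ℝ) (Ω : Set (Pt n m)) (G : Pt n m → ℝ → EReal) (F : Pt n m → ℝ → ℝ)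
    (K : Set (Pt n m → ℝ)) (u : Pt n m → ℝ) : EReal :=
  if u ∈ K then energy γ Ω G F u else ⊤

/-- `u` lies in the effective domain of `I_K` and is a local minimizer of `I_K` with respect to
the norm of `H¹_{0,γ}(Ω)`. -/
def IsLocalMinimizer (γ : ℝ) (Ω : Set (Pt n m)) (G : Pt n m → ℝ → EReal) (F : Pt n m → ℝ → ℝ)
    (K : Set (Pt n m → ℝ)) (u : Pt n m → ℝ) : Prop :=
  MemH10 γ Ω u ∧ energyOn γ Ω G F K u < ⊤ ∧
    ∃ ρ : ℝ, 0 < ρ ∧ ∀ w : Pt n m → ℝ, MemH10 γ Ω w →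
      h10Norm γ Ω (fun z => w z - u z) < ρ →
        energyOn γ Ω G F K u ≤ energyOn γ Ω G F K w

/-- The local one-sided Lipschitz condition on `g` and `f` between `φ₁` and `φ₂`: on each
subdomain `Ω' ⋐ Ω` the difference quotients of `g` at `φ₂` are at most `M` and those of `f` are at
least `-M`. -/
def QuotientCondition (Ω : Set (Pt n m)) (g : Pt n m → ℝ → EReal) (f : Pt n m → ℝ → ℝ)
    (φ₁ φ₂ : Pt n m → ℝ) : Prop :=
  ∀ Ω' : Set (Pt n m), IsOpen Ω' → IsConnected Ω' → IsCompact (closure Ω') → closure Ω' ⊆ Ω →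
    ∃ M : ℝ, 0 < M ∧ ∀ᵐ z ∂volume.restrict Ω', ∀ t : ℝ, φ₁ z ≤ t → t < φ₂ z →
      (g z (φ₂ z) - g z t) / ((φ₂ z - t : ℝ) : EReal) ≤ (M : EReal) ∧
      -M ≤ (f z (φ₂ z) - f z t) / (φ₂ z - t)

end Grushin

end

open scoped ENNReal

noncomputable section

namespace Grushin

variable {n m : ℕ}

/-! The solution is a minimizer `u` of the functional over the order interval between `φ₁` and `φ₂`
(`OrderedPair.exists_minimizer`). All values there are bounded, so `F` is dominated by an integrable
function and `G` is bounded below by one; coercivity of the Dirichlet integral, Rellich's theorem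
and Fatou's lemma give the minimum.

The minimizer solves the equation although only variations inside the interval are admissible
(`OrderedPair.variational_ineq`). Let d = σ(φ - u) ≥ 0, where (φ, σ) is (φ₂, 1) or (φ₁, -1). The
competitor u + σ min(tψ, d) stays in the interval, and the part (tψ - d)⁺ that was cut off is
compensated by using it as a test function in the inequality for φ. After division by t the surplus
gradient term lives on {tψ > d}; as t tends to 0 only {d = 0} remains, and there ∇d = 0 almost
everywhere.

Under (i), d = φ₂ - u satisfies -Δd + 2Md ≥ 0 on balls. Testing with ψ²/(d + ε) bounds ψ∇log(d + ε)
in L² uniformly in ε (`H1Pair.caccioppoli_log`). Hence log(1 + d/ε)/log(1 + 1/ε) tends to the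
indicator of {d > 0} while its gradient tends to 0, so that this indicator is locally constant
(`H1Pair.indicator_pos`, `H1Pair.ae_const_of_grad_eq_zero`). By connectedness u = φ₂ almost
everywhere or u < φ₂ almost everywhere, and the former would make φ₂ a weak solution.

For local minimality, suppose that competitors w of smaller energy approach u, and put h = (w -
φ₂)⁺. Since min(w, φ₂) lies in the interval, convexity of `G` and the one-sided Lipschitz bound on
`f` give ½‖∇h‖² + L(h) < ½∫ah², where L(h) ≥ 0 is the supersolution inequality of φ₂ tested with h
(`OrderedPair.energy_comparison`). If u < φ₂, then h is eventually 0 at almost every point, and the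
inequalities of Hölder and Sobolev give a contradiction. If φ₂ is strict, the functions h divided by
(∫ah²)^{1/2} have a limit v ≥ 0 with v ≠ 0 and L(v) ≤ 0, which strictness forbids
(`exists_blowUp_limit`).

The underlying function space theory rests on two devices. Faber–Krahn, and through it Sobolev and
Poincaré, as well as Rellich, come from comparing a function with its averages over boxes translated
away from the singular set {x = 0}. Smooth approximation uses mollifiers much narrower in x than in
y, which makes the commutator with the degenerate weight small. -/

instance : (volume : Measure (Pt n m)).IsAddHaarMeasure :=
  Measure.prod.instIsAddHaarMeasure volume volume

/-! ### Calculus of the classical Grushin gradient and of test functions. -/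

lemma continuous_grad {γ : ℝ} (hγ : 0 < γ) {ψ : Pt n m → ℝ} (hψ : ContDiff ℝ 1 ψ) :
    Continuous (grad γ ψ) := by
  have h1 : Continuous (fderiv ℝ ψ) := hψ.continuous_fderiv one_ne_zero
  have h2 : Continuous fun z : Pt n m => ‖z.1‖ ^ γ :=
    (continuous_norm.comp continuous_fst).rpow_const fun _ => Or.inr hγ.le
  unfold grad
  refine (PiLp.continuous_toLp 2 _).comp (continuous_pi fun j => ?_)
  rcases j with i | j
  · exact h1.clm_apply continuous_const
  · exact (continuous_const.mul h2).mul (h1.clm_apply continuous_const)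

@[simp] lemma grad_inl (γ : ℝ) (ψ : Pt n m → ℝ) (z : Pt n m) (i : Fin n) :
    grad γ ψ z (Sum.inl i) = fderiv ℝ ψ z (EuclideanSpace.single i 1, 0) := rfl

@[simp] lemma grad_inr (γ : ℝ) (ψ : Pt n m → ℝ) (z : Pt n m) (j : Fin m) :
    grad γ ψ z (Sum.inr j) =
      (1 + γ) * ‖z.1‖ ^ γ * fderiv ℝ ψ z (0, EuclideanSpace.single j 1) := rfl

lemma grad_eq_zero_of_fderiv {γ : ℝ} {ψ : Pt n m → ℝ} {z : Pt n m} (h : fderiv ℝ ψ z = 0) :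
    grad γ ψ z = 0 := by
  ext j; rcases j with i | j <;> simp [h]

lemma grad_eq_zero {γ : ℝ} {ψ : Pt n m → ℝ} {z : Pt n m} (h : z ∉ tsupport ψ) :
    grad γ ψ z = 0 :=
  grad_eq_zero_of_fderiv (Function.notMem_support.1 fun h' => h (support_fderiv_subset ℝ h'))

lemma grad_mul {γ : ℝ} {φ ψ : Pt n m → ℝ} {z : Pt n m} (hφ : DifferentiableAt ℝ φ z)
    (hψ : DifferentiableAt ℝ ψ z) :
    grad γ (fun z => φ z * ψ z) z = φ z • grad γ ψ z + ψ z • grad γ φ z := by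
  ext j; rcases j with i | j
  · simp [fderiv_fun_mul hφ hψ]
  · simp [fderiv_fun_mul hφ hψ]; ring

lemma grad_comp {γ : ℝ} {θ : ℝ → ℝ} {φ : Pt n m → ℝ} {z : Pt n m}
    (hθ : DifferentiableAt ℝ θ (φ z)) (hφ : DifferentiableAt ℝ φ z) :
    grad γ (fun z => θ (φ z)) z = deriv θ (φ z) • grad γ φ z := by
  have h : fderiv ℝ (fun z => θ (φ z)) z = deriv θ (φ z) • fderiv ℝ φ z :=
    (hθ.hasDerivAt.comp_hasFDerivAt z hφ.hasFDerivAt).fderiv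
  ext j; rcases j with i | j
  · simp [h]
  · simp [h]; ring

lemma grad_sub {γ : ℝ} {φ ψ : Pt n m → ℝ} {z : Pt n m} (hφ : DifferentiableAt ℝ φ z)
    (hψ : DifferentiableAt ℝ ψ z) :
    grad γ (fun z => φ z - ψ z) z = grad γ φ z - grad γ ψ z := by
  ext j; rcases j with i | j <;> simp [fderiv_fun_sub hφ hψ, mul_sub]

lemma grad_const_mul {γ : ℝ} {ψ : Pt n m → ℝ} {z : Pt n m} (c : ℝ)
    (hψ : DifferentiableAt ℝ ψ z) :
    grad γ (fun z => c * ψ z) z = c • grad γ ψ z := by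
  ext j; rcases j with i | j
  · simp [fderiv_const_mul hψ]
  · simp [fderiv_const_mul hψ]; ring

lemma hasCompactSupport_grad {γ : ℝ} {ψ : Pt n m → ℝ} (h : HasCompactSupport ψ) :
    HasCompactSupport (grad γ ψ) :=
  h.mono' fun z hz => by
    by_contra hc
    exact hz (grad_eq_zero hc)

/-- Integration by parts for the Grushin gradient. -/
lemma integral_mul_grad {γ : ℝ} (hγ : 0 < γ) {φ ψ : Pt n m → ℝ} (hφ : ContDiff ℝ 1 φ)
    (hψ : ContDiff ℝ 1 ψ) (hc : HasCompactSupport ψ) (j : Fin n ⊕ Fin m) :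
    ∫ z, φ z * grad γ ψ z j = -∫ z, grad γ φ z j * ψ z := by
  have cg : ∀ {χ : Pt n m → ℝ}, ContDiff ℝ 1 χ → Continuous fun z => grad γ χ z j := fun h =>
    (EuclideanSpace.proj (𝕜 := ℝ) j).continuous.comp (continuous_grad hγ h)
  have hcg : HasCompactSupport fun z => grad γ ψ z j :=
    (hasCompactSupport_grad hc).comp_left (g := fun v : Vec n m => v j) (by simp)
  have i1 : Integrable fun z => φ z * grad γ ψ z j :=
    (hφ.continuous.mul (cg hψ)).integrable_of_hasCompactSupport (hcg.mul_left)
  have i2 : Integrable fun z => grad γ φ z j * ψ z :=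
    ((cg hφ).mul hψ.continuous).integrable_of_hasCompactSupport (hc.mul_left)
  have dφ : Differentiable ℝ φ := hφ.differentiable one_ne_zero
  have dψ : Differentiable ℝ ψ := hψ.differentiable one_ne_zero
  rcases j with i | j
  · exact integral_mul_fderiv_eq_neg_fderiv_mul_of_integrable i2 i1
      ((hφ.continuous.mul hψ.continuous).integrable_of_hasCompactSupport hc.mul_left)
      (fun x _ => dφ x) (fun x _ => dψ x)
  · have h2 : Continuous fun z : Pt n m => ‖z.1‖ ^ γ :=
      (continuous_norm.comp continuous_fst).rpow_const fun _ => Or.inr hγ.le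
    -- The weight is absorbed into `ψ`. It is constant along the `y`-directions, so the line
    -- derivative exists even where `‖x‖ ^ γ` is not differentiable.
    have := integral_bilinear_hasLineDerivAt_right_eq_neg_left_of_integrable
      (μ := (volume : Measure (Pt n m))) (B := ContinuousLinearMap.mul ℝ ℝ)
      (f := φ) (f' := fun z => fderiv ℝ φ z (0, EuclideanSpace.single j 1))
      (g := fun z => (1 + γ) * ‖z.1‖ ^ γ * ψ z) (g' := fun z => grad γ ψ z (Sum.inr j))
      (v := (0, EuclideanSpace.single j 1)) (by
        refine i2.congr (Eventually.of_forall fun z => ?_)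
        simp only [grad_inr, ContinuousLinearMap.mul_apply']
        ring) (by simpa using i1) (by
        simp only [ContinuousLinearMap.mul_apply']
        refine (hφ.continuous.mul ((continuous_const.mul h2).mul hψ.continuous)
          ).integrable_of_hasCompactSupport ?_
        exact hc.mul_left.mul_left) (fun x _ => (dφ x).hasFDerivAt.hasLineDerivAt _) (by
        intro x _
        have := ((dψ x).hasFDerivAt.hasLineDerivAt (0, EuclideanSpace.single j 1)).const_mul
          ((1 + γ) * ‖x.1‖ ^ γ)
        unfold HasLineDerivAt at this ⊢
        simpa using this)
    simp only [ContinuousLinearMap.mul_apply'] at this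
    rw [this]
    congr 1
    refine integral_congr_ae (Eventually.of_forall fun z => ?_)
    simp only [grad_inr]
    ring

lemma IsTest.grad_eq_zero {γ : ℝ} {Ω : Set (Pt n m)} {ψ : Pt n m → ℝ} (h : IsTest Ω ψ)
    {z : Pt n m} (hz : z ∉ Ω) : grad γ ψ z = 0 :=
  Grushin.grad_eq_zero fun h' => hz (h.supp h')

lemma IsTest.eq_zero {Ω : Set (Pt n m)} {ψ : Pt n m → ℝ} (h : IsTest Ω ψ)
    {z : Pt n m} (hz : z ∉ Ω) : ψ z = 0 :=
  image_eq_zero_of_notMem_tsupport fun h' => hz (h.supp h')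

lemma IsTest.contDiff_one {Ω : Set (Pt n m)} {ψ : Pt n m → ℝ} (h : IsTest Ω ψ) :
    ContDiff ℝ 1 ψ := h.smooth.of_le (by exact_mod_cast le_top)

lemma IsTest.mono {Ω Ω' : Set (Pt n m)} {ψ : Pt n m → ℝ} (h : IsTest Ω ψ) (hs : Ω ⊆ Ω') :
    IsTest Ω' ψ := ⟨h.smooth, h.compact, h.supp.trans hs⟩

lemma IsTest.mul_smooth {Ω : Set (Pt n m)} {ψ χ : Pt n m → ℝ} (h : IsTest Ω ψ)
    (hχ : ContDiff ℝ ∞ χ) : IsTest Ω fun z => χ z * ψ z :=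
  ⟨hχ.mul h.smooth, h.compact.mul_left, (tsupport_mul_subset_right).trans h.supp⟩

lemma IsTest.add {Ω : Set (Pt n m)} {ψ χ : Pt n m → ℝ} (h : IsTest Ω ψ)
    (hχ : IsTest Ω χ) : IsTest Ω fun z => ψ z + χ z :=
  ⟨h.smooth.add hχ.smooth, h.compact.add hχ.compact,
    (tsupport_add ψ χ).trans (Set.union_subset h.supp hχ.supp)⟩

lemma IsTest.const_mul {Ω : Set (Pt n m)} {ψ : Pt n m → ℝ} (h : IsTest Ω ψ) (c : ℝ) :
    IsTest Ω fun z => c * ψ z := h.mul_smooth contDiff_const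

lemma IsTest.memLp {Ω : Set (Pt n m)} {ψ : Pt n m → ℝ} (h : IsTest Ω ψ) (p : ℝ≥0∞)
    (μ : Measure (Pt n m)) [IsLocallyFiniteMeasure μ] :
    MemLp ψ p μ :=
  h.smooth.continuous.memLp_of_hasCompactSupport h.compact

lemma IsTest.memLp_grad {γ : ℝ} (hγ : 0 < γ) {Ω : Set (Pt n m)} {ψ : Pt n m → ℝ}
    (h : IsTest Ω ψ) (p : ℝ≥0∞) (μ : Measure (Pt n m)) [IsLocallyFiniteMeasure μ] :
    MemLp (grad γ ψ) p μ :=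
  (continuous_grad hγ h.contDiff_one).memLp_of_hasCompactSupport (hasCompactSupport_grad h.compact)

lemma setIntegral_eq_of_zero {E : Type*} [NormedAddCommGroup E] [NormedSpace ℝ E]
    {Ω : Set (Pt n m)} {f : Pt n m → E} (h : ∀ z, z ∉ Ω → f z = 0) :
    ∫ z in Ω, f z = ∫ z, f z :=
  setIntegral_eq_integral_of_forall_compl_eq_zero h

/-! ### Weak gradients: uniqueness, linearity, products, closedness. -/

/-- A continuously differentiable function has its Grushin gradient as weak gradient. -/
lemma isWeakGrad_of_contDiff {γ : ℝ} (hγ : 0 < γ) (Ω : Set (Pt n m)) {φ : Pt n m → ℝ}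
    (hφ : ContDiff ℝ 1 φ) : IsWeakGrad γ Ω φ (grad γ φ) := by
  intro ψ hψ j
  rw [setIntegral_eq_of_zero, setIntegral_eq_of_zero]
  · exact integral_mul_grad hγ hφ hψ.contDiff_one hψ.compact j
  · intro z hz; simp [hψ.eq_zero hz]
  · intro z hz; simp [hψ.grad_eq_zero hz]

lemma memLp_coord {μ : Measure (Pt n m)} {p : ℝ≥0∞} {U : Pt n m → Vec n m} (h : MemLp U p μ)
    (j : Fin n ⊕ Fin m) : MemLp (fun z => U z j) p μ :=
  (EuclideanSpace.proj (𝕜 := ℝ) j).comp_memLp' h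

/-- `u` and `U` are square integrable on `Ω`, and `U` is the weak Grushin gradient of `u`. -/
structure H1Pair (γ : ℝ) (Ω : Set (Pt n m)) (u : Pt n m → ℝ) (U : Pt n m → Vec n m) : Prop where
  memLp : MemLp u 2 (volume.restrict Ω)
  memLp_grad : MemLp U 2 (volume.restrict Ω)
  weak : IsWeakGrad γ Ω u U

lemma memH1_iff {γ : ℝ} {Ω : Set (Pt n m)} {u : Pt n m → ℝ} :
    MemH1 γ Ω u ↔ ∃ U, H1Pair γ Ω u U :=
  ⟨fun h => h.2.elim fun U hU => ⟨U, h.1, hU.1, hU.2⟩, fun ⟨U, h⟩ => ⟨h.1, U, h.2, h.3⟩⟩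

lemma MemH1.pair {γ : ℝ} {Ω : Set (Pt n m)} {u : Pt n m → ℝ} (h : MemH1 γ Ω u) :
    H1Pair γ Ω u (weakGrad γ Ω u) := by
  unfold weakGrad
  rw [dif_pos h.2]
  exact ⟨h.1, h.2.choose_spec.1, h.2.choose_spec.2⟩

lemma H1Pair.memH1 {γ : ℝ} {Ω : Set (Pt n m)} {u : Pt n m → ℝ} {U : Pt n m → Vec n m}
    (h : H1Pair γ Ω u U) : MemH1 γ Ω u := memH1_iff.2 ⟨U, h⟩

lemma IsTest.h1Pair {γ : ℝ} (hγ : 0 < γ) {Ω : Set (Pt n m)} {ψ : Pt n m → ℝ}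
    {Ω' : Set (Pt n m)} (h : IsTest Ω' ψ) : H1Pair γ Ω ψ (grad γ ψ) :=
  ⟨h.memLp _ _, h.memLp_grad hγ _ _, isWeakGrad_of_contDiff hγ Ω h.contDiff_one⟩

lemma ae_eq_of_integral_test {Ω : Set (Pt n m)} (hΩ : IsOpen Ω) {f g : Pt n m → ℝ}
    (hf : LocallyIntegrableOn f Ω) (hg : LocallyIntegrableOn g Ω)
    (h : ∀ ψ, IsTest Ω ψ → ∫ z in Ω, f z * ψ z = ∫ z in Ω, g z * ψ z) :
    f =ᵐ[volume.restrict Ω] g := by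
  have key := IsOpen.ae_eq_zero_of_integral_contDiff_smul_eq_zero (μ := volume) hΩ (hf.sub hg)
    (fun ψ h1 h2 h3 => by
      have ht : IsTest Ω ψ := ⟨h1, h2, h3⟩
      have hi : ∀ {f : Pt n m → ℝ}, LocallyIntegrableOn f Ω →
          Integrable (fun z => f z * ψ z) (volume.restrict Ω) := by
        intro f hf
        have h4 : IntegrableOn f (tsupport ψ) := hf.integrableOn_compact_subset h3 h2
        have h5 : IntegrableOn (fun z => f z * ψ z) (tsupport ψ) := by
          obtain ⟨C, hC⟩ := h2.exists_bound_of_continuous h1.continuous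
          exact Integrable.mul_bdd (c := C) h4 h1.continuous.aestronglyMeasurable
            (Eventually.of_forall hC)
        refine IntegrableOn.integrable ?_
        refine IntegrableOn.of_forall_sdiff_eq_zero h5 hΩ.measurableSet fun z hz => ?_
        simp [image_eq_zero_of_notMem_tsupport hz.2]
      rw [← setIntegral_eq_of_zero (Ω := Ω) (fun z hz => by simp [ht.eq_zero hz])]
      have := h ψ ht
      simp only [smul_eq_mul, Pi.sub_apply, mul_sub]
      rw [integral_sub]
      · simp only [mul_comm (ψ _), this, sub_self]
      · simpa only [mul_comm (ψ _)] using hi hf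
      · simpa only [mul_comm (ψ _)] using hi hg)
  rw [Filter.EventuallyEq, ae_restrict_iff' hΩ.measurableSet]
  filter_upwards [key] with z hz hzΩ
  have := hz hzΩ
  simpa [sub_eq_zero] using this

lemma locallyIntegrableOn_of_memLp {Ω : Set (Pt n m)} (hΩ : IsOpen Ω) {f : Pt n m → ℝ}
    (hf : MemLp f 2 (volume.restrict Ω)) : LocallyIntegrableOn f Ω := by
  rw [locallyIntegrableOn_iff hΩ.isLocallyClosed]
  intro k hk hc
  have : MemLp f 2 (volume.restrict k) := hf.mono_measure (Measure.restrict_mono hk le_rfl)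
  have hfin : IsFiniteMeasure (volume.restrict k) :=
    isFiniteMeasure_restrict.2 hc.measure_lt_top.ne
  exact this.integrable (by norm_num)

/-- Weak gradients are unique up to null sets. -/
lemma IsWeakGrad.unique {γ : ℝ} {Ω : Set (Pt n m)} (hΩ : IsOpen Ω) {u : Pt n m → ℝ}
    {U V : Pt n m → Vec n m} (hU : IsWeakGrad γ Ω u U) (hV : IsWeakGrad γ Ω u V)
    (hU2 : MemLp U 2 (volume.restrict Ω)) (hV2 : MemLp V 2 (volume.restrict Ω)) :
    U =ᵐ[volume.restrict Ω] V := by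
  have : ∀ j, (fun z => U z j) =ᵐ[volume.restrict Ω] fun z => V z j := fun j =>
    ae_eq_of_integral_test hΩ (locallyIntegrableOn_of_memLp hΩ (memLp_coord hU2 j))
      (locallyIntegrableOn_of_memLp hΩ (memLp_coord hV2 j)) fun ψ hψ => by
        have := (hU ψ hψ j).symm.trans (hV ψ hψ j)
        exact neg_injective this
  filter_upwards [ae_all_iff.2 this] with z hz
  ext j; exact hz j

/-- `weakGrad` is an arbitrary choice, so computations are made with explicit pairs `(u, U)` and are
transferred to `weakGrad` here by uniqueness. -/
lemma H1Pair.weakGrad_ae {γ : ℝ} {Ω : Set (Pt n m)} (hΩ : IsOpen Ω) {u : Pt n m → ℝ}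
    {U : Pt n m → Vec n m} (h : H1Pair γ Ω u U) :
    weakGrad γ Ω u =ᵐ[volume.restrict Ω] U :=
  h.memH1.pair.weak.unique hΩ h.weak h.memH1.pair.memLp_grad h.memLp_grad

lemma H1Pair.unique {γ : ℝ} {Ω : Set (Pt n m)} (hΩ : IsOpen Ω) {u : Pt n m → ℝ}
    {U V : Pt n m → Vec n m} (h : H1Pair γ Ω u U) (h' : H1Pair γ Ω u V) :
    U =ᵐ[volume.restrict Ω] V := h.weak.unique hΩ h'.weak h.memLp_grad h'.memLp_grad

lemma H1Pair.congr {γ : ℝ} {Ω : Set (Pt n m)} {u v : Pt n m → ℝ}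
    {U V : Pt n m → Vec n m} (h : H1Pair γ Ω u U) (hu : u =ᵐ[volume.restrict Ω] v)
    (hU : U =ᵐ[volume.restrict Ω] V) : H1Pair γ Ω v V := by
  refine ⟨h.memLp.ae_eq hu, h.memLp_grad.ae_eq hU, fun ψ hψ j => ?_⟩
  rw [← integral_congr_ae (f := fun z => u z * grad γ ψ z j), h.weak ψ hψ j]
  · congr 1
    refine integral_congr_ae ?_
    filter_upwards [hU] with z hz
    rw [hz]
  · filter_upwards [hu] with z hz
    rw [hz]

lemma integral_mul_add {μ : Measure (Pt n m)} {f g h : Pt n m → ℝ} (hf : MemLp f 2 μ)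
    (hg : MemLp g 2 μ) (hh : MemLp h 2 μ) :
    ∫ z, (f z + g z) * h z ∂μ = ∫ z, f z * h z ∂μ + ∫ z, g z * h z ∂μ := by
  simp only [add_mul]
  exact integral_add (hf.integrable_mul hh) (hg.integrable_mul hh)

lemma H1Pair.add {γ : ℝ} (hγ : 0 < γ) {Ω : Set (Pt n m)} {u v : Pt n m → ℝ}
    {U V : Pt n m → Vec n m} (h : H1Pair γ Ω u U) (h' : H1Pair γ Ω v V) :
    H1Pair γ Ω (fun z => u z + v z) (fun z => U z + V z) := by
  refine ⟨h.memLp.add h'.memLp, h.memLp_grad.add h'.memLp_grad, fun ψ hψ j => ?_⟩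
  rw [integral_mul_add h.memLp h'.memLp (memLp_coord (hψ.memLp_grad hγ _ _) j), h.weak ψ hψ j,
    h'.weak ψ hψ j]
  have := integral_mul_add (memLp_coord h.memLp_grad j) (memLp_coord h'.memLp_grad j)
    (hψ.memLp 2 (volume.restrict Ω))
  simp only [PiLp.add_apply, this]
  ring

lemma H1Pair.const_mul {γ : ℝ} {Ω : Set (Pt n m)} {u : Pt n m → ℝ}
    {U : Pt n m → Vec n m} (h : H1Pair γ Ω u U) (c : ℝ) :
    H1Pair γ Ω (fun z => c * u z) (fun z => c • U z) := by
  refine ⟨h.memLp.const_mul c, h.memLp_grad.const_smul c, fun ψ hψ j => ?_⟩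
  have := h.weak ψ hψ j
  simp only [mul_assoc, PiLp.smul_apply, smul_eq_mul, integral_const_mul, this]
  ring

lemma H1Pair.neg {γ : ℝ} {Ω : Set (Pt n m)} {u : Pt n m → ℝ}
    {U : Pt n m → Vec n m} (h : H1Pair γ Ω u U) :
    H1Pair γ Ω (fun z => -u z) (fun z => -U z) := by
  simpa using h.const_mul (-1)

lemma H1Pair.sub {γ : ℝ} (hγ : 0 < γ) {Ω : Set (Pt n m)} {u v : Pt n m → ℝ}
    {U V : Pt n m → Vec n m} (h : H1Pair γ Ω u U) (h' : H1Pair γ Ω v V) :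
    H1Pair γ Ω (fun z => u z - v z) (fun z => U z - V z) := by
  simpa [sub_eq_add_neg] using h.add hγ h'.neg

lemma H1Pair.mono {γ : ℝ} {Ω Ω' : Set (Pt n m)} {u : Pt n m → ℝ}
    {U : Pt n m → Vec n m} (h : H1Pair γ Ω u U) (hs : Ω' ⊆ Ω) :
    H1Pair γ Ω' u U := by
  refine ⟨h.memLp.mono_measure (Measure.restrict_mono hs le_rfl),
    h.memLp_grad.mono_measure (Measure.restrict_mono hs le_rfl), fun ψ hψ j => ?_⟩
  have := h.weak ψ (hψ.mono hs) j
  rwa [setIntegral_eq_of_zero, setIntegral_eq_of_zero, ← setIntegral_eq_of_zero (Ω := Ω'),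
    ← setIntegral_eq_of_zero (Ω := Ω') (f := fun z => U z j * ψ z)] at this
  · intro z hz; simp [hψ.eq_zero hz]
  · intro z hz; simp [hψ.grad_eq_zero hz]
  · intro z hz; simp [hψ.eq_zero fun h => hz (hs h)]
  · intro z hz; simp [hψ.grad_eq_zero fun h => hz (hs h)]

lemma MemLp.mul_bounded {E : Type*} [NormedAddCommGroup E] [NormedSpace ℝ E]
    {μ : Measure (Pt n m)} {f : Pt n m → E} {p : ℝ≥0∞} (hf : MemLp f p μ) {χ : Pt n m → ℝ}
    (hχ : AEStronglyMeasurable χ μ) {C : ℝ} (hC : ∀ᵐ z ∂μ, |χ z| ≤ C) :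
    MemLp (fun z => χ z • f z) p μ := by
  refine MemLp.of_le_mul (c := C) hf (hχ.smul hf.1) ?_
  filter_upwards [hC] with z hz
  rw [norm_smul]
  exact mul_le_mul_of_nonneg_right hz (norm_nonneg _)

/-- The product rule for a weakly differentiable function and a test function. -/
lemma H1Pair.mul_test {γ : ℝ} (hγ : 0 < γ) {Ω Ω' : Set (Pt n m)} {u : Pt n m → ℝ}
    {U : Pt n m → Vec n m} (h : H1Pair γ Ω u U) {ζ : Pt n m → ℝ} (hζ : IsTest Ω' ζ) :
    H1Pair γ Ω (fun z => ζ z * u z) (fun z => ζ z • U z + u z • grad γ ζ z) := by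
  obtain ⟨C, hC⟩ := hζ.compact.exists_bound_of_continuous hζ.smooth.continuous
  obtain ⟨C', hC'⟩ := (hasCompactSupport_grad (γ := γ) hζ.compact).exists_bound_of_continuous
    (continuous_grad hγ hζ.contDiff_one)
  have mζ : AEStronglyMeasurable ζ (volume.restrict Ω) := hζ.smooth.continuous.aestronglyMeasurable
  have h1 : MemLp (fun z => u z • grad γ ζ z) 2 (volume.restrict Ω) := by
    refine MemLp.of_le_mul (c := C') h.memLp (h.memLp.1.smul
      (continuous_grad hγ hζ.contDiff_one).aestronglyMeasurable) (Eventually.of_forall fun z => ?_)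
    rw [norm_smul, mul_comm]
    exact mul_le_mul_of_nonneg_right (hC' z) (norm_nonneg _)
  have h2 := MemLp.mul_bounded h.memLp mζ (Eventually.of_forall hC)
  have h3 := MemLp.mul_bounded h.memLp_grad mζ (Eventually.of_forall hC)
  refine ⟨h2, h3.add h1, fun ψ hψ j => ?_⟩
  have hw := h.weak _ (hψ.mul_smooth hζ.smooth) j
  have e1 : ∀ z, u z * grad γ (fun z => ζ z * ψ z) z j
      = ζ z * u z * grad γ ψ z j + (u z • grad γ ζ z) j * ψ z := fun z => by
    rw [grad_mul (hζ.contDiff_one.differentiable one_ne_zero z)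
      (hψ.contDiff_one.differentiable one_ne_zero z)]
    simp; ring
  have m1 : MemLp ψ 2 (volume.restrict Ω) := hψ.memLp _ _
  have e3 := integral_add
    (h2.integrable_mul (memLp_coord (hψ.memLp_grad hγ 2 (volume.restrict Ω)) j))
    ((memLp_coord h1 j).integrable_mul m1)
  simp only [Pi.mul_apply, smul_eq_mul] at e3
  rw [integral_congr_ae (Eventually.of_forall e1), e3] at hw
  have := integral_mul_add (memLp_coord h3 j) (memLp_coord h1 j) m1
  simp only [PiLp.add_apply, this]
  have e2 : ∫ z in Ω, (ζ z • U z) j * ψ z = ∫ z in Ω, U z j * (ζ z * ψ z) :=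
    integral_congr_ae (Eventually.of_forall fun z => by simp; ring)
  rw [e2]
  linarith

/-- Convergence of `L²` inner products. -/
lemma tendsto_integral_inner {α E : Type*} [MeasurableSpace α] {μ : Measure α}
    [NormedAddCommGroup E] [InnerProductSpace ℝ E] {U V : ℕ → α → E} {U₀ V₀ : α → E}
    (hU : ∀ k, MemLp (U k) 2 μ) (hV : ∀ k, MemLp (V k) 2 μ) (hU₀ : MemLp U₀ 2 μ)
    (hV₀ : MemLp V₀ 2 μ) (h1 : Tendsto (fun k => eLpNorm (fun z => U k z - U₀ z) 2 μ) atTop (𝓝 0))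
    (h2 : Tendsto (fun k => eLpNorm (fun z => V k z - V₀ z) 2 μ) atTop (𝓝 0)) :
    Tendsto (fun k => ∫ z, inner ℝ (U k z) (V k z) ∂μ) atTop (𝓝 (∫ z, inner ℝ (U₀ z) (V₀ z) ∂μ)) := by
  have t1 := (Lp.tendsto_Lp_iff_tendsto_eLpNorm'' U hU U₀ hU₀).2 h1
  have t2 := (Lp.tendsto_Lp_iff_tendsto_eLpNorm'' V hV V₀ hV₀).2 h2
  have key : ∀ {A B : α → E} (hA : MemLp A 2 μ) (hB : MemLp B 2 μ),
      inner ℝ (hA.toLp A) (hB.toLp B) = ∫ z, inner ℝ (A z) (B z) ∂μ := by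
    intro A B hA hB
    rw [L2.inner_def]
    refine integral_congr_ae ?_
    filter_upwards [hA.coeFn_toLp, hB.coeFn_toLp] with z h1 h2
    rw [h1, h2]
  have := t1.inner (𝕜 := ℝ) t2
  simpa only [key] using this

lemma eLpNorm_const_tendsto {α E : Type*} [MeasurableSpace α] {μ : Measure α}
    [NormedAddCommGroup E] (V : α → E) :
    Tendsto (fun _ : ℕ => eLpNorm (fun z => V z - V z) 2 μ) atTop (𝓝 0) := by
  simp

lemma tendsto_integral_mul {α : Type*} [MeasurableSpace α] {μ : Measure α}
    {u : ℕ → α → ℝ} {u₀ v : α → ℝ}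
    (hu : ∀ k, MemLp (u k) 2 μ) (hu₀ : MemLp u₀ 2 μ) (hv : MemLp v 2 μ)
    (h1 : Tendsto (fun k => eLpNorm (fun z => u k z - u₀ z) 2 μ) atTop (𝓝 0)) :
    Tendsto (fun k => ∫ z, u k z * v z ∂μ) atTop (𝓝 (∫ z, u₀ z * v z ∂μ)) := by
  have := tendsto_integral_inner (fun _ => hv) hu hv hu₀ (eLpNorm_const_tendsto v) h1
  simpa using this

lemma eLpNorm_coord_tendsto {μ : Measure (Pt n m)} {U : ℕ → Pt n m → Vec n m}
    {U₀ : Pt n m → Vec n m} (h : Tendsto (fun k => eLpNorm (fun z => U k z - U₀ z) 2 μ) atTop (𝓝 0))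
    (j : Fin n ⊕ Fin m) :
    Tendsto (fun k => eLpNorm (fun z => U k z j - U₀ z j) 2 μ) atTop (𝓝 0) := by
  refine tendsto_of_tendsto_of_tendsto_of_le_of_le tendsto_const_nhds h (fun _ => zero_le)
    fun k => eLpNorm_mono fun z => ?_
  exact PiLp.norm_apply_le (U k z - U₀ z) j

/-- The graph of the weak gradient is closed. -/
lemma h1Pair_of_tendsto {γ : ℝ} (hγ : 0 < γ) {Ω : Set (Pt n m)} {u : ℕ → Pt n m → ℝ}
    {U : ℕ → Pt n m → Vec n m} {u₀ : Pt n m → ℝ} {U₀ : Pt n m → Vec n m}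
    (h : ∀ k, H1Pair γ Ω (u k) (U k)) (hu₀ : MemLp u₀ 2 (volume.restrict Ω))
    (hU₀ : MemLp U₀ 2 (volume.restrict Ω))
    (h1 : Tendsto (fun k => eLpNorm (fun z => u k z - u₀ z) 2 (volume.restrict Ω)) atTop (𝓝 0))
    (h2 : Tendsto (fun k => eLpNorm (fun z => U k z - U₀ z) 2 (volume.restrict Ω)) atTop (𝓝 0)) :
    H1Pair γ Ω u₀ U₀ := by
  refine ⟨hu₀, hU₀, fun ψ hψ j => ?_⟩
  have t1 := tendsto_integral_mul (fun k => (h k).memLp) hu₀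
    (memLp_coord (hψ.memLp_grad hγ _ _) j) h1
  have t2 := tendsto_integral_mul (fun k => memLp_coord (h k).memLp_grad j) (memLp_coord hU₀ j)
    (hψ.memLp 2 _) (eLpNorm_coord_tendsto h2 j)
  refine tendsto_nhds_unique t1 ?_
  simp only [(h _).weak ψ hψ j]
  exact t2.neg

/-! ### The Faber–Krahn and critical Sobolev inequalities for smooth functions. -/

lemma lintegral_mul_sq_le {α : Type*} [MeasurableSpace α] (μ : Measure α) {f g : α → ℝ≥0∞}
    (hf : AEMeasurable f μ) (hg : AEMeasurable g μ) :
    (∫⁻ a, f a * g a ∂μ) ^ 2 ≤ (∫⁻ a, f a ^ 2 ∂μ) * ∫⁻ a, g a ^ 2 ∂μ := by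
  have h := ENNReal.lintegral_mul_le_Lp_mul_Lq μ Real.HolderConjugate.two_two hf hg
  simp only [Pi.mul_apply, ENNReal.rpow_two] at h
  calc (∫⁻ a, f a * g a ∂μ) ^ 2 ≤ _ := pow_le_pow_left' h 2
    _ = _ := by
      rw [mul_pow, ← ENNReal.rpow_two, ← ENNReal.rpow_two, ← ENNReal.rpow_mul, ← ENNReal.rpow_mul]
      norm_num

lemma lintegral_sq_le {α : Type*} [MeasurableSpace α] (μ : Measure α) {f : α → ℝ≥0∞}
    (hf : AEMeasurable f μ) :
    (∫⁻ a, f a ∂μ) ^ 2 ≤ μ Set.univ * ∫⁻ a, f a ^ 2 ∂μ := by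
  have := lintegral_mul_sq_le μ (f := fun _ => 1) aemeasurable_const hf
  simpa using this

lemma eLpNorm_two_sq {α E : Type*} [MeasurableSpace α] [NormedAddCommGroup E] (μ : Measure α)
    (f : α → E) : eLpNorm f 2 μ ^ 2 = ∫⁻ a, ‖f a‖ₑ ^ 2 ∂μ := by
  have := eLpNorm_nnreal_pow_eq_lintegral (f := f) (μ := μ) (p := 2) two_ne_zero
  simpa using this

lemma ennreal_add_sq_le (a b : ℝ≥0∞) : (a + b) ^ 2 ≤ 2 * a ^ 2 + 2 * b ^ 2 := by
  have h := ENNReal.rpow_add_le_mul_rpow_add_rpow a b (p := 2) (by norm_num)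
  norm_num at h
  simpa [mul_add] using h

/-- The `L²` size of a difference quotient is controlled by the directional derivative. -/
lemma lintegral_translate_sub_le {ψ : Pt n m → ℝ} (hψ : ContDiff ℝ 1 ψ) {A A' : Set (Pt n m)}
    (hA' : MeasurableSet A') {h : Pt n m}
    (hAA : ∀ z ∈ A, ∀ s ∈ Set.Ioc (0 : ℝ) 1, z + s • h ∈ A') (hA : MeasurableSet A) :
    ∫⁻ z in A, ‖ψ (z + h) - ψ z‖ₑ ^ 2 ≤ ∫⁻ z in A', ‖fderiv ℝ ψ z h‖ₑ ^ 2 := by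
  have cD : Continuous fun z => fderiv ℝ ψ z h :=
    (hψ.continuous_fderiv one_ne_zero).clm_apply continuous_const
  have step : ∀ z, ‖ψ (z + h) - ψ z‖ₑ ^ 2 ≤
      ∫⁻ s in Set.Ioc (0 : ℝ) 1, ‖fderiv ℝ ψ (z + s • h) h‖ₑ ^ 2 := by
    intro z
    have cs : Continuous fun s : ℝ => fderiv ℝ ψ (z + s • h) h := cD.comp (by fun_prop)
    have hd : ∀ s ∈ Set.uIcc (0 : ℝ) 1, HasDerivAt (fun s : ℝ => ψ (z + s • h))
        (fderiv ℝ ψ (z + s • h) h) s := by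
      intro s _
      have h1 : HasDerivAt (fun s : ℝ => z + s • h) h s := by
        simpa using ((hasDerivAt_id s).smul_const h).const_add z
      exact (hψ.differentiable one_ne_zero _).hasFDerivAt.comp_hasDerivAt s h1
    have := intervalIntegral.integral_eq_sub_of_hasDerivAt hd (cs.intervalIntegrable 0 1)
    simp only [one_smul, zero_smul, add_zero] at this
    rw [← this, intervalIntegral.integral_of_le zero_le_one]
    calc ‖∫ s in Set.Ioc (0 : ℝ) 1, fderiv ℝ ψ (z + s • h) h‖ₑ ^ 2
        ≤ (∫⁻ s in Set.Ioc (0 : ℝ) 1, ‖fderiv ℝ ψ (z + s • h) h‖ₑ) ^ 2 :=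
          pow_le_pow_left' (enorm_integral_le_lintegral_enorm _) 2
      _ ≤ _ := by
          refine (lintegral_sq_le _ cs.enorm.measurable.aemeasurable).trans ?_
          simp
  have cj : Continuous fun p : Pt n m × ℝ => fderiv ℝ ψ (p.1 + p.2 • h) h :=
    cD.comp (by fun_prop)
  calc ∫⁻ z in A, ‖ψ (z + h) - ψ z‖ₑ ^ 2
      ≤ ∫⁻ z in A, ∫⁻ s in Set.Ioc (0 : ℝ) 1, ‖fderiv ℝ ψ (z + s • h) h‖ₑ ^ 2 :=
        lintegral_mono step
    _ = ∫⁻ s in Set.Ioc (0 : ℝ) 1, ∫⁻ z in A, ‖fderiv ℝ ψ (z + s • h) h‖ₑ ^ 2 :=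
        lintegral_lintegral_swap (cj.enorm.measurable.pow_const 2).aemeasurable
    _ ≤ ∫⁻ s in Set.Ioc (0 : ℝ) 1, ∫⁻ z in A', ‖fderiv ℝ ψ z h‖ₑ ^ 2 := by
        refine setLIntegral_mono' measurableSet_Ioc fun s hs => ?_
        calc ∫⁻ z in A, ‖fderiv ℝ ψ (z + s • h) h‖ₑ ^ 2
            ≤ ∫⁻ z, A'.indicator (fun z => ‖fderiv ℝ ψ z h‖ₑ ^ 2) (z + s • h) := by
              rw [← lintegral_indicator hA]
              refine lintegral_mono fun z => ?_
              by_cases hz : z ∈ A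
              · simp [hz, hAA z hz s hs]
              · simp [hz]
          _ = ∫⁻ z in A', ‖fderiv ℝ ψ z h‖ₑ ^ 2 := by
              rw [lintegral_add_right_eq_self (μ := (volume : Measure (Pt n m)))
                (A'.indicator (fun z => ‖fderiv ℝ ψ z h‖ₑ ^ 2)) (s • h), lintegral_indicator hA']
    _ = _ := by simp

lemma norm_fderiv_x_le {γ : ℝ} (ψ : Pt n m → ℝ) (z : Pt n m) (a : EuclideanSpace ℝ (Fin n)) :
    ‖fderiv ℝ ψ z (a, 0)‖ ≤ ‖a‖ * ‖grad γ ψ z‖ := by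
  have h : fderiv ℝ ψ z (a, 0) =
      inner ℝ (WithLp.toLp 2 (Sum.elim a 0) : Vec n m) (grad γ ψ z) := by
    have h1 : ((a, 0) : Pt n m) = ∑ i, a i • (EuclideanSpace.single i (1 : ℝ), 0) := by
      refine Prod.ext ?_ ?_
      · rw [Prod.fst_sum]
        ext i
        simp [Pi.single_apply]
      · rw [Prod.snd_sum]; simp
    rw [h1, map_sum]
    simp only [map_smul]
    simp [PiLp.inner_apply, Fintype.sum_sum_type, mul_comm]
  rw [h]
  refine (norm_inner_le_norm _ _).trans_eq ?_
  congr 1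
  simp [EuclideanSpace.norm_eq, Fintype.sum_sum_type]

/-- At distance `r` from `{x = 0}` the weight is at least `r ^ γ`, so a `y`-derivative costs only
the factor `r ^ (-γ)`. This is why `avgBox` has radius `r ^ (1 + γ)` in `y`. -/
lemma norm_fderiv_y_le {γ : ℝ} (hγ : 0 < γ) (ψ : Pt n m → ℝ) {z : Pt n m} {r : ℝ} (hr : 0 < r)
    (hz : r ≤ ‖z.1‖) (b : EuclideanSpace ℝ (Fin m)) :
    ‖fderiv ℝ ψ z (0, b)‖ ≤ ‖b‖ * r ^ (-γ) * ‖grad γ ψ z‖ := by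
  have h : (1 + γ) * ‖z.1‖ ^ γ * fderiv ℝ ψ z (0, b) =
      inner ℝ (WithLp.toLp 2 (Sum.elim 0 b) : Vec n m) (grad γ ψ z) := by
    have h1 : ((0, b) : Pt n m) = ∑ i, b i • (0, EuclideanSpace.single i (1 : ℝ)) := by
      refine Prod.ext ?_ ?_
      · rw [Prod.fst_sum]; simp
      · rw [Prod.snd_sum]
        ext i
        simp [Pi.single_apply]
    rw [h1, map_sum, Finset.mul_sum]
    simp only [map_smul]
    simp [PiLp.inner_apply, Fintype.sum_sum_type, mul_comm, mul_left_comm]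
  have h2 : ‖(1 + γ) * ‖z.1‖ ^ γ * fderiv ℝ ψ z (0, b)‖ ≤ ‖b‖ * ‖grad γ ψ z‖ := by
    rw [h]
    refine (norm_inner_le_norm _ _).trans_eq ?_
    congr 1
    simp [EuclideanSpace.norm_eq, Fintype.sum_sum_type]
  have h3 : r ^ γ ≤ (1 + γ) * ‖z.1‖ ^ γ := by
    have := Real.rpow_le_rpow hr.le hz hγ.le
    nlinarith [Real.rpow_nonneg (norm_nonneg z.1) γ]
  have h4 : 0 < r ^ γ := Real.rpow_pos_of_pos hr γ
  rw [norm_mul, Real.norm_of_nonneg (h4.le.trans h3)] at h2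
  have h5 : r ^ γ * ‖fderiv ℝ ψ z (0, b)‖ ≤ ‖b‖ * ‖grad γ ψ z‖ :=
    (mul_le_mul_of_nonneg_right h3 (norm_nonneg _)).trans h2
  rw [Real.rpow_neg hr.le, mul_right_comm, ← div_eq_mul_inv, le_div_iff₀ h4, mul_comm]
  exact h5

lemma enorm_sq_le_ofReal {E F : Type*} [NormedAddCommGroup E] [NormedAddCommGroup F] {x : E}
    {y : F} {c : ℝ} (h : ‖x‖ ≤ c * ‖y‖) :
    ‖x‖ₑ ^ 2 ≤ ENNReal.ofReal (c ^ 2) * ‖y‖ₑ ^ 2 := by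
  rw [← ofReal_norm, ← ofReal_norm, ← ENNReal.ofReal_pow (norm_nonneg _),
    ← ENNReal.ofReal_pow (norm_nonneg _), ← ENNReal.ofReal_mul (by positivity), ← mul_pow]
  exact ENNReal.ofReal_le_ofReal (pow_le_pow_left₀ (norm_nonneg _) h 2)

/-- The half space on the positive side of the hyperplane orthogonal to `(e, 0)`. -/
def halfSpace (e : EuclideanSpace ℝ (Fin n)) : Set (Pt n m) := {z | 0 ≤ inner ℝ e z.1}

/-- The box of Grushin size `r` used for averaging; adding its elements to points of `halfSpace e`
leads to points at distance at least `r` from the singular set `{x = 0}`. -/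
def avgBox (m : ℕ) (γ : ℝ) (e : EuclideanSpace ℝ (Fin n)) (r : ℝ) : Set (Pt n m) :=
  Metric.ball ((2 * r) • e) r ×ˢ Metric.ball 0 (r ^ (1 + γ))

lemma measurableSet_halfSpace (e : EuclideanSpace ℝ (Fin n)) :
    MeasurableSet (halfSpace (m := m) e) :=
  (isClosed_le continuous_const (by fun_prop)).measurableSet

lemma measurableSet_avgBox {γ : ℝ} (e : EuclideanSpace ℝ (Fin n)) (r : ℝ) :
    MeasurableSet (avgBox m γ e r) := measurableSet_ball.prod measurableSet_ball

/-- The translation is split into two moves: first `h` in `x`, which carries the half space to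
points with `‖x‖ ≥ r`, then `k` in `y`, where the degenerate derivative is under control. Since `‖h‖
≤ 3r` and `‖k‖ r ^ (-γ) ≤ r`, the constant is `20 = 2 · 9 + 2 · 1`. -/
lemma lintegral_halfSpace_translate_le {γ : ℝ} (hγ : 0 < γ) {ψ : Pt n m → ℝ}
    (hψ : ContDiff ℝ 1 ψ) {e : EuclideanSpace ℝ (Fin n)} (he : ‖e‖ = 1) {r : ℝ} (hr : 0 < r)
    {b : Pt n m} (hb : b ∈ avgBox m γ e r) :
    ∫⁻ z in halfSpace e, ‖ψ (z + b) - ψ z‖ₑ ^ 2 ≤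
      ENNReal.ofReal (20 * r ^ 2) * ∫⁻ z, ‖grad γ ψ z‖ₑ ^ 2 := by
  obtain ⟨hb1, hb2⟩ := hb
  obtain ⟨h, k⟩ := b
  simp only at hb1 hb2
  rw [mem_ball_iff_norm] at hb1
  rw [mem_ball_zero_iff] at hb2
  have hh : ‖h‖ ≤ 3 * r := by
    have : ‖(2 * r) • e‖ = 2 * r := by rw [norm_smul, he, Real.norm_of_nonneg (by positivity)]; ring
    have h2 := norm_sub_norm_le h ((2 * r) • e)
    linarith
  have hin : r ≤ inner ℝ e h := by
    have h1 : inner ℝ e h = inner ℝ e (h - (2 * r) • e) + 2 * r := by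
      rw [inner_sub_right, real_inner_smul_right, real_inner_self_eq_norm_sq, he]; ring
    have h2 := abs_real_inner_le_norm e (h - (2 * r) • e)
    rw [he, one_mul] at h2
    have := (abs_le.1 (h2.trans hb1.le)).1
    linarith
  set A2 : Set (Pt n m) := {z | r ≤ inner ℝ e z.1} with hA2
  have mA2 : MeasurableSet A2 := (isClosed_le continuous_const (by fun_prop)).measurableSet
  have hnorm : ∀ z ∈ A2, r ≤ ‖z.1‖ := fun z hz => by
    have := (le_abs_self _).trans (abs_real_inner_le_norm e z.1)
    rw [he, one_mul] at this
    exact le_trans hz this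
  set G := ∫⁻ z, ‖grad γ ψ z‖ₑ ^ 2 with hG
  have p1 : ∫⁻ z in halfSpace e, ‖ψ (z + (h, 0)) - ψ z‖ₑ ^ 2 ≤ ENNReal.ofReal (9 * r ^ 2) * G := by
    refine (lintegral_translate_sub_le hψ MeasurableSet.univ (fun _ _ _ _ => Set.mem_univ _)
      (measurableSet_halfSpace e)).trans ?_
    rw [Measure.restrict_univ, ← lintegral_const_mul' _ _ ENNReal.ofReal_ne_top]
    refine lintegral_mono fun z => ?_
    have := enorm_sq_le_ofReal (c := 3 * r) ((norm_fderiv_x_le (γ := γ) ψ z h).trans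
      (mul_le_mul_of_nonneg_right hh (norm_nonneg _)))
    convert this using 3
    ring
  have p2 : ∫⁻ z in halfSpace e, ‖ψ (z + (h, k)) - ψ (z + (h, 0))‖ₑ ^ 2 ≤
      ENNReal.ofReal (r ^ 2) * G := by
    calc ∫⁻ z in halfSpace e, ‖ψ (z + (h, k)) - ψ (z + (h, 0))‖ₑ ^ 2
        ≤ ∫⁻ z, A2.indicator (fun z => ‖ψ (z + (0, k)) - ψ z‖ₑ ^ 2) (z + (h, 0)) := by
          rw [← lintegral_indicator (measurableSet_halfSpace e)]
          refine lintegral_mono fun z => ?_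
          by_cases hz : z ∈ halfSpace e
          · have hz2 : z + (h, 0) ∈ A2 := by
              simp only [hA2, Set.mem_ofPred_eq, Prod.fst_add, inner_add_right]
              have : 0 ≤ inner ℝ e z.1 := hz
              linarith
            have e1 : z + (h, 0) + (0, k) = z + (h, k) := by
              rw [add_assoc]; congr 1; simp
            simp only [Set.indicator_of_mem hz, Set.indicator_of_mem hz2, e1, le_refl]
          · simp [hz]
      _ = ∫⁻ z in A2, ‖ψ (z + (0, k)) - ψ z‖ₑ ^ 2 := by
          rw [lintegral_add_right_eq_self (μ := (volume : Measure (Pt n m)))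
            (A2.indicator (fun z => ‖ψ (z + (0, k)) - ψ z‖ₑ ^ 2)) (h, 0), lintegral_indicator mA2]
      _ ≤ ∫⁻ z in A2, ‖fderiv ℝ ψ z (0, k)‖ₑ ^ 2 := by
          refine lintegral_translate_sub_le hψ mA2 (fun z hz s _ => ?_) mA2
          simpa [hA2] using hz
      _ ≤ ∫⁻ z in A2, ENNReal.ofReal (r ^ 2) * ‖grad γ ψ z‖ₑ ^ 2 := by
          refine setLIntegral_mono' mA2 fun z hz => enorm_sq_le_ofReal ?_
          refine (norm_fderiv_y_le hγ ψ hr (hnorm z hz) k).trans ?_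
          refine mul_le_mul_of_nonneg_right ?_ (norm_nonneg _)
          calc ‖k‖ * r ^ (-γ) ≤ r ^ (1 + γ) * r ^ (-γ) :=
                mul_le_mul_of_nonneg_right hb2.le (Real.rpow_nonneg hr.le _)
            _ = r := by rw [← Real.rpow_add hr]; simp
      _ ≤ ∫⁻ z, ENNReal.ofReal (r ^ 2) * ‖grad γ ψ z‖ₑ ^ 2 := setLIntegral_le_lintegral _ _
      _ = _ := lintegral_const_mul' _ _ ENNReal.ofReal_ne_top
  have cψ := hψ.continuous
  calc ∫⁻ z in halfSpace e, ‖ψ (z + (h, k)) - ψ z‖ₑ ^ 2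
      ≤ ∫⁻ z in halfSpace e, (2 * ‖ψ (z + (h, k)) - ψ (z + (h, 0))‖ₑ ^ 2 +
          2 * ‖ψ (z + (h, 0)) - ψ z‖ₑ ^ 2) := by
        refine lintegral_mono fun z => le_trans (pow_le_pow_left' ?_ 2) (ennreal_add_sq_le _ _)
        have : ψ (z + (h, k)) - ψ z = (ψ (z + (h, k)) - ψ (z + (h, 0))) +
          (ψ (z + (h, 0)) - ψ z) := by ring
        rw [this]
        exact enorm_add_le _ _
    _ = 2 * (∫⁻ z in halfSpace e, ‖ψ (z + (h, k)) - ψ (z + (h, 0))‖ₑ ^ 2) +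
          2 * ∫⁻ z in halfSpace e, ‖ψ (z + (h, 0)) - ψ z‖ₑ ^ 2 := by
        rw [lintegral_add_left (by fun_prop), lintegral_const_mul' _ _ (by simp),
          lintegral_const_mul' _ _ (by simp)]
    _ ≤ 2 * (ENNReal.ofReal (r ^ 2) * G) + 2 * (ENNReal.ofReal (9 * r ^ 2) * G) := by gcongr
    _ = _ := by
        rw [← ENNReal.ofReal_ofNat 2, ← mul_assoc, ← mul_assoc, ← ENNReal.ofReal_mul (by norm_num),
          ← ENNReal.ofReal_mul (by norm_num), ← add_mul, ← ENNReal.ofReal_add (by positivity)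
          (by positivity)]
        congr 2; ring

lemma halfSpace_union (e : EuclideanSpace ℝ (Fin n)) :
    halfSpace (m := m) e ∪ halfSpace (-e) = Set.univ := by
  ext z
  simp only [halfSpace, Set.mem_union, Set.mem_ofPred_eq, inner_neg_left, Set.mem_univ, iff_true]
  rcases le_total 0 (inner ℝ e z.1) with h | h
  · exact Or.inl h
  · exact Or.inr (by linarith)

/-- The volume of the averaging boxes. -/
lemma exists_volume_avgBox (n m : ℕ) (γ : ℝ) :
    ∃ c : ℝ, 0 < c ∧ ∀ (e : EuclideanSpace ℝ (Fin n)) (r : ℝ), 0 < r →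
      volume (avgBox m γ e r) = ENNReal.ofReal (c * r ^ homDim n m γ) := by
  set v1 := volume (Metric.ball (0 : EuclideanSpace ℝ (Fin n)) 1)
  set v2 := volume (Metric.ball (0 : EuclideanSpace ℝ (Fin m)) 1)
  have f1 : v1 ≠ ⊤ := measure_ball_lt_top.ne
  have f2 : v2 ≠ ⊤ := measure_ball_lt_top.ne
  refine ⟨v1.toReal * v2.toReal, mul_pos (ENNReal.toReal_pos (Metric.measure_ball_pos _ _
    one_pos).ne' f1) (ENNReal.toReal_pos (Metric.measure_ball_pos _ _ one_pos).ne' f2),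
    fun e r hr => ?_⟩
  rw [avgBox, Measure.volume_eq_prod, Measure.prod_prod, Measure.addHaar_ball_of_pos _ _ hr,
    Measure.addHaar_ball_of_pos _ _ (Real.rpow_pos_of_pos hr _), finrank_euclideanSpace_fin,
    finrank_euclideanSpace_fin]
  have e1 : r ^ homDim n m γ = r ^ n * (r ^ (1 + γ)) ^ m := by
    rw [homDim, Real.rpow_add hr, Real.rpow_natCast, Real.rpow_mul hr.le, Real.rpow_natCast]
  rw [e1, ENNReal.ofReal_mul (by positivity), ENNReal.ofReal_mul (by positivity),
    ENNReal.ofReal_mul (by positivity), ENNReal.ofReal_toReal f1, ENNReal.ofReal_toReal f2]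
  ring

lemma homDim_gt_two (hn : 1 ≤ n) (hm : 1 ≤ m) {γ : ℝ} (hγ : 0 < γ) : 2 < homDim n m γ := by
  have h1 : (1 : ℝ) ≤ n := by exact_mod_cast hn
  have h2 : (1 : ℝ) ≤ m := by exact_mod_cast hm
  unfold homDim
  nlinarith

/-- The box has twice the volume allowed for `{ψ ≠ 0}`, so for every `z` at least half of the
translates `z + b` are zeros of `ψ`. Hence `|ψ z|²` is at most twice the box average of `|ψ (z + b)
- ψ z|²`, and the translation estimate applies with the constant doubled. -/
lemma lintegral_halfSpace_le {γ : ℝ} (hγ : 0 < γ) {ψ : Pt n m → ℝ}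
    (hψ : ContDiff ℝ 1 ψ) {e : EuclideanSpace ℝ (Fin n)} (he : ‖e‖ = 1) {r : ℝ} (hr : 0 < r)
    {v : ℝ} (hv0 : 0 < v) (hv : volume (avgBox m γ e r) = ENNReal.ofReal (2 * v))
    (hS : volume {z | ψ z ≠ 0} ≤ ENNReal.ofReal v) :
    ∫⁻ z in halfSpace e, ‖ψ z‖ₑ ^ 2 ≤ ENNReal.ofReal (40 * r ^ 2) * ∫⁻ z, ‖grad γ ψ z‖ₑ ^ 2 := by
  set B := avgBox m γ e r
  have mB : MeasurableSet B := measurableSet_avgBox e r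
  set G := ∫⁻ z, ‖grad γ ψ z‖ₑ ^ 2 with hG
  have cψ := hψ.continuous
  have low : ∀ z, ENNReal.ofReal v * ‖ψ z‖ₑ ^ 2 ≤ ∫⁻ b in B, ‖ψ (z + b) - ψ z‖ₑ ^ 2 := by
    intro z
    set T := {b | ψ (z + b) ≠ 0}
    have mT : MeasurableSet T := (isOpen_ne_fun (by fun_prop) continuous_const).measurableSet
    have hT : volume T ≤ ENNReal.ofReal v := by
      have : T = (fun b => z + b) ⁻¹' {z | ψ z ≠ 0} := rfl
      rw [this, measure_preimage_add]
      exact hS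
    have hBT : ENNReal.ofReal v ≤ volume (B \ T) := by
      have h1 : volume B ≤ volume (B \ T) + volume T := by
        refine (measure_mono ?_).trans (measure_union_le _ _)
        intro b hb
        by_cases hbT : b ∈ T
        · exact Or.inr hbT
        · exact Or.inl ⟨hb, hbT⟩
      rw [hv, two_mul, ENNReal.ofReal_add hv0.le hv0.le] at h1
      exact (ENNReal.add_le_add_iff_right ENNReal.ofReal_ne_top).1 (h1.trans (add_le_add_right hT _))
    calc ENNReal.ofReal v * ‖ψ z‖ₑ ^ 2 ≤ volume (B \ T) * ‖ψ z‖ₑ ^ 2 := by gcongr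
      _ = ∫⁻ b in B \ T, ‖ψ z‖ₑ ^ 2 := by rw [setLIntegral_const, mul_comm]
      _ = ∫⁻ b in B \ T, ‖ψ (z + b) - ψ z‖ₑ ^ 2 := by
          refine setLIntegral_congr_fun (mB.diff mT) fun b hb => ?_
          have : ψ (z + b) = 0 := by
            by_contra h; exact hb.2 h
          simp [this]
      _ ≤ _ := lintegral_mono_set Set.sdiff_subset
  have up : ∫⁻ z in halfSpace e, ∫⁻ b in B, ‖ψ (z + b) - ψ z‖ₑ ^ 2 ≤
      ENNReal.ofReal (2 * v) * (ENNReal.ofReal (20 * r ^ 2) * G) := by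
    have cj : Continuous fun p : Pt n m × Pt n m => ψ (p.1 + p.2) - ψ p.1 := by fun_prop
    rw [lintegral_lintegral_swap (cj.enorm.measurable.pow_const 2).aemeasurable]
    calc ∫⁻ b in B, ∫⁻ z in halfSpace e, ‖ψ (z + b) - ψ z‖ₑ ^ 2
        ≤ ∫⁻ b in B, ENNReal.ofReal (20 * r ^ 2) * G :=
          setLIntegral_mono' mB fun b hb => lintegral_halfSpace_translate_le hγ hψ he hr hb
      _ = _ := by rw [setLIntegral_const, hv, mul_comm]
  have h1 : ENNReal.ofReal v * ∫⁻ z in halfSpace e, ‖ψ z‖ₑ ^ 2 ≤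
      ENNReal.ofReal v * (ENNReal.ofReal (40 * r ^ 2) * G) := by
    rw [← lintegral_const_mul' _ _ ENNReal.ofReal_ne_top]
    refine (lintegral_mono low).trans (up.trans_eq ?_)
    rw [← mul_assoc, ← mul_assoc, ← ENNReal.ofReal_mul (by positivity),
      ← ENNReal.ofReal_mul (by positivity)]
    congr 2; ring
  exact (ENNReal.mul_le_mul_iff_right (by simpa using hv0) ENNReal.ofReal_ne_top).1 h1

/-- A Faber–Krahn inequality for the Grushin gradient. -/
theorem exists_faberKrahn (hn : 1 ≤ n) (hm : 1 ≤ m) {γ : ℝ} (hγ : 0 < γ) :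
    ∃ C : ℝ, 0 < C ∧ ∀ ψ : Pt n m → ℝ, ContDiff ℝ 1 ψ → HasCompactSupport ψ →
      ∫⁻ z, ‖ψ z‖ₑ ^ 2 ≤ ENNReal.ofReal C * volume {z | ψ z ≠ 0} ^ (2 / homDim n m γ) *
        ∫⁻ z, ‖grad γ ψ z‖ₑ ^ 2 := by
  obtain ⟨c, hc, hvol⟩ := exists_volume_avgBox n m γ
  have hQ := homDim_gt_two hn hm hγ
  set Q := homDim n m γ
  refine ⟨80 * (2 / c) ^ (2 / Q), by positivity, fun ψ hψ hcs => ?_⟩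
  have fS : volume {z | ψ z ≠ 0} < ⊤ :=
    (measure_mono (subset_tsupport ψ)).trans_lt hcs.measure_lt_top
  set S := volume {z | ψ z ≠ 0} with hS
  by_cases hS0 : S = 0
  · have : ∀ᵐ z, ψ z = 0 := by
      rw [ae_iff]; exact hS0
    have h0 : ∫⁻ z, ‖ψ z‖ₑ ^ 2 = 0 := by
      rw [lintegral_congr_ae (g := fun _ => 0) (this.mono fun z hz => by simp [hz])]
      simp
    rw [h0]; exact zero_le
  set s := S.toReal with hs
  have s0 : 0 < s := ENNReal.toReal_pos hS0 fS.ne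
  have hSs : S = ENNReal.ofReal s := (ENNReal.ofReal_toReal fS.ne).symm
  -- The size for which the averaging box has exactly twice the volume of `{ψ ≠ 0}`.
  set r := (2 * s / c) ^ (1 / Q) with hr
  have r0 : 0 < r := by positivity
  have hrQ : c * r ^ Q = 2 * s := by
    rw [hr, ← Real.rpow_mul (by positivity), one_div_mul_cancel (by linarith), Real.rpow_one]
    field_simp
  -- The translations must lead away from `{x = 0}`, so each direction serves one half space only.
  -- The directions `e` and `-e` together cover everything, whence `80 = 2 · 40`.
  obtain ⟨i⟩ : Nonempty (Fin n) := ⟨⟨0, hn⟩⟩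
  set e : EuclideanSpace ℝ (Fin n) := EuclideanSpace.single i 1
  have he : ‖e‖ = 1 := by simp [e]
  have h1 := lintegral_halfSpace_le hγ hψ he r0 s0 (by rw [hvol e r r0, hrQ]) (hSs ▸ le_rfl)
  have h2 := lintegral_halfSpace_le hγ hψ (e := -e) (by simpa using he) r0 s0
    (by rw [hvol _ r r0, hrQ]) (hSs ▸ le_rfl)
  calc ∫⁻ z, ‖ψ z‖ₑ ^ 2 = ∫⁻ z in halfSpace e ∪ halfSpace (-e), ‖ψ z‖ₑ ^ 2 := by
        rw [halfSpace_union, Measure.restrict_univ]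
    _ ≤ _ := lintegral_union_le _ _ _
    _ ≤ _ := add_le_add h1 h2
    _ = _ := by
      have e1 : r ^ 2 = (2 / c) ^ (2 / Q) * s ^ (2 / Q) := by
        rw [hr, ← Real.rpow_natCast, ← Real.rpow_mul (by positivity),
          ← Real.mul_rpow (by positivity) s0.le]
        congr 1 <;> [ring; (push_cast; ring)]
      rw [← add_mul, ← ENNReal.ofReal_add (by positivity) (by positivity), hSs,
        ENNReal.ofReal_rpow_of_pos s0, ← ENNReal.ofReal_mul (by positivity), e1]
      congr 2; ring

/-- A smooth even cutoff that vanishes for `s ^ 2 ≤ 2` and equals one for `4 ≤ s ^ 2`. -/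
def levelCutoff (s : ℝ) : ℝ := Real.smoothTransition ((s ^ 2 - 2) / 2)

lemma contDiff_levelCutoff : ContDiff ℝ ∞ levelCutoff :=
  Real.smoothTransition.contDiff.comp (by fun_prop)

lemma levelCutoff_eq_zero {s : ℝ} (h : s ^ 2 ≤ 2) : levelCutoff s = 0 :=
  Real.smoothTransition.zero_of_nonpos (by linarith)

lemma levelCutoff_eq_one {s : ℝ} (h : 4 ≤ s ^ 2) : levelCutoff s = 1 :=
  Real.smoothTransition.one_of_one_le (by linarith)

lemma deriv_levelCutoff_eq_zero {s : ℝ} (h : ¬(1 < |s| ∧ |s| ≤ 2)) : deriv levelCutoff s = 0 := by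
  rw [not_and_or, not_lt, not_le] at h
  rcases h with h | h
  · have h1 : s ^ 2 < 2 := by
      have := (sq_le_one_iff_abs_le_one s).2 h
      linarith
    have : levelCutoff =ᶠ[𝓝 s] fun _ => 0 := by
      filter_upwards [(isOpen_lt (continuous_id.pow 2) continuous_const).mem_nhds h1] with t ht
      exact levelCutoff_eq_zero (le_of_lt ht)
    rw [this.deriv_eq]; simp
  · have h1 : 4 < s ^ 2 := by
      rw [← sq_abs]; nlinarith
    have : levelCutoff =ᶠ[𝓝 s] fun _ => 1 := by
      filter_upwards [(isOpen_lt continuous_const (continuous_id.pow 2)).mem_nhds h1] with t ht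
      exact levelCutoff_eq_one (le_of_lt ht)
    rw [this.deriv_eq]; simp

lemma exists_bound_deriv_levelCutoff : ∃ C : ℝ, 0 < C ∧ ∀ s, ‖deriv levelCutoff s‖ ≤ C := by
  have hc : HasCompactSupport (deriv levelCutoff) := by
    refine HasCompactSupport.intro (isCompact_Icc (a := (-2 : ℝ)) (b := 2)) fun s hs => ?_
    refine deriv_levelCutoff_eq_zero fun h => hs ?_
    exact abs_le.1 h.2
  obtain ⟨C, hC⟩ := hc.exists_bound_of_continuous
    (contDiff_levelCutoff.continuous_deriv (by exact_mod_cast le_top))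
  exact ⟨max C 1, by positivity, fun s => (hC s).trans (le_max_left _ _)⟩

/-- The critical Sobolev exponent. -/
def sobExp (n m : ℕ) (γ : ℝ) : ℝ := 2 * homDim n m γ / (homDim n m γ - 2)

lemma sobExp_pos (hn : 1 ≤ n) (hm : 1 ≤ m) {γ : ℝ} (hγ : 0 < γ) : 2 < sobExp n m γ := by
  have := homDim_gt_two hn hm hγ
  rw [sobExp, lt_div_iff₀ (by linarith)]
  linarith

/-- Faber–Krahn is applied to the cutoff of `ψ` between the levels `t` and `2t`. The gradient of the
cutoff function lives on `t < |ψ| ≤ 2t`, and the measure of its support is bounded by Chebyshev's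
inequality through the integral of `|ψ| ^ q`. -/
lemma sobolev_level (hn : 1 ≤ n) (hm : 1 ≤ m) {γ : ℝ} (hγ : 0 < γ) :
    ∃ K : ℝ, 0 < K ∧ ∀ ψ : Pt n m → ℝ, ContDiff ℝ 1 ψ → HasCompactSupport ψ → ∀ t : ℝ, 0 < t →
      ENNReal.ofReal (t ^ sobExp n m γ) * volume {z | 2 * t < |ψ z|} ≤
        ENNReal.ofReal K * (∫⁻ z, ‖ψ z‖ₑ ^ sobExp n m γ) ^ (2 / homDim n m γ) *
          ∫⁻ z in {z | t < |ψ z| ∧ |ψ z| ≤ 2 * t}, ‖grad γ ψ z‖ₑ ^ 2 := by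
  obtain ⟨C, hC, hFK⟩ := exists_faberKrahn hn hm hγ
  obtain ⟨C', hC', hτ⟩ := exists_bound_deriv_levelCutoff
  have hQ := homDim_gt_two hn hm hγ
  have hq := sobExp_pos hn hm hγ
  -- The relation that balances the powers of `t`: the part `t ^ (2q/Q)` goes into Chebyshev's
  -- inequality, and `t ^ 2` cancels the derivative of the rescaled cutoff.
  have hqQ : sobExp n m γ = 2 + 2 * sobExp n m γ / homDim n m γ := by
    rw [sobExp]
    have : homDim n m γ - 2 ≠ 0 := by linarith
    have : homDim n m γ ≠ 0 := by linarith
    field_simp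
    ring
  set Q := homDim n m γ
  set q := sobExp n m γ
  refine ⟨C * C' ^ 2, by positivity, fun ψ hψ hcs t ht => ?_⟩
  set v : Pt n m → ℝ := fun z => levelCutoff (t⁻¹ * ψ z) with hv
  have cψ := hψ.continuous
  have hv1 : ContDiff ℝ 1 v := (contDiff_levelCutoff.of_le (by exact_mod_cast le_top)).comp
    (contDiff_const.mul hψ)
  have hvz : ∀ z, v z ≠ 0 → t < |ψ z| := by
    intro z hz
    by_contra h
    refine hz (levelCutoff_eq_zero ?_)
    rw [not_lt] at h
    have h1 : |t⁻¹ * ψ z| ≤ 1 := by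
      rw [abs_mul, abs_inv, abs_of_pos ht, inv_mul_le_iff₀ ht, mul_one]; exact h
    have := (sq_le_one_iff_abs_le_one _).2 h1
    linarith
  have hvc : HasCompactSupport v := hcs.mono fun z hz => by
    have := hvz z hz
    intro h; rw [h] at this; simp at this; linarith
  set I := ∫⁻ z, ‖ψ z‖ₑ ^ q with hI
  set E := {z | t < |ψ z| ∧ |ψ z| ≤ 2 * t} with hE
  have mE : MeasurableSet E :=
    (isOpen_lt continuous_const cψ.abs).measurableSet.inter
      (isClosed_le cψ.abs continuous_const).measurableSet
  have hfk := hFK v hv1 hvc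
  have low : volume {z | 2 * t < |ψ z|} ≤ ∫⁻ z, ‖v z‖ₑ ^ 2 := by
    have mF : MeasurableSet {z | 2 * t < |ψ z|} := (isOpen_lt continuous_const cψ.abs).measurableSet
    rw [← lintegral_indicator_one mF]
    refine lintegral_mono fun z => ?_
    by_cases hz : 2 * t < |ψ z|
    · have : v z = 1 := by
        refine levelCutoff_eq_one ?_
        have h1 : 2 ≤ |t⁻¹ * ψ z| := by
          rw [abs_mul, abs_inv, abs_of_pos ht, le_inv_mul_iff₀ ht]; linarith
        rw [← sq_abs]; nlinarith
      simp only [this, Set.indicator_apply]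
      split_ifs <;> simp
    · simp [hz]
  have gr : ∫⁻ z, ‖grad γ v z‖ₑ ^ 2 ≤
      ENNReal.ofReal ((C' * t⁻¹) ^ 2) * ∫⁻ z in E, ‖grad γ ψ z‖ₑ ^ 2 := by
    rw [← lintegral_indicator mE, ← lintegral_const_mul' _ _ ENNReal.ofReal_ne_top]
    refine lintegral_mono fun z => ?_
    have dψ := hψ.differentiable one_ne_zero z
    have e1 : grad γ v z = (deriv levelCutoff (t⁻¹ * ψ z) * t⁻¹) • grad γ ψ z := by
      rw [hv, grad_comp (φ := fun z => t⁻¹ * ψ z)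
        (contDiff_levelCutoff.differentiable (by simp) _) (dψ.const_mul _),
        grad_const_mul _ dψ, smul_smul]
    by_cases hz : z ∈ E
    · simp only [Set.indicator_of_mem hz]
      refine enorm_sq_le_ofReal ?_
      rw [e1, norm_smul, norm_mul, norm_inv, Real.norm_of_nonneg ht.le]
      have := hτ (t⁻¹ * ψ z)
      gcongr
    · have : grad γ v z = 0 := by
        rw [e1, deriv_levelCutoff_eq_zero, zero_mul, zero_smul]
        rw [abs_mul, abs_inv, abs_of_pos ht, inv_mul_le_iff₀ ht, lt_inv_mul_iff₀ ht, mul_one,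
          mul_comm]
        exact hz
      simp [this]
  have cheb : ENNReal.ofReal (t ^ (2 * q / Q)) * volume {z | v z ≠ 0} ^ (2 / Q) ≤ I ^ (2 / Q) := by
    have h1 : ENNReal.ofReal (t ^ q) * volume {z | v z ≠ 0} ≤ I := by
      have mV : MeasurableSet {z | v z ≠ 0} :=
        (isOpen_ne_fun hv1.continuous continuous_const).measurableSet
      rw [← setLIntegral_const]
      refine (setLIntegral_mono' mV fun z hz => ?_).trans (setLIntegral_le_lintegral _ _)
      rw [← ENNReal.ofReal_rpow_of_pos ht]
      refine ENNReal.rpow_le_rpow ?_ (by linarith)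
      rw [← ofReal_norm]
      exact ENNReal.ofReal_le_ofReal (hvz z hz).le
    have h2 := ENNReal.rpow_le_rpow h1 (z := 2 / Q) (by positivity)
    rwa [ENNReal.mul_rpow_of_nonneg _ _ (by positivity), ENNReal.ofReal_rpow_of_pos (by positivity),
      ← Real.rpow_mul ht.le, show q * (2 / Q) = 2 * q / Q by ring] at h2
  have e2 : t ^ q = t ^ (2 * q / Q) * t ^ 2 := by
    rw [← Real.rpow_natCast, ← Real.rpow_add ht]
    congr 1; push_cast; rw [add_comm]; exact hqQ
  calc ENNReal.ofReal (t ^ q) * volume {z | 2 * t < |ψ z|}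
      ≤ ENNReal.ofReal (t ^ (2 * q / Q)) * ENNReal.ofReal (t ^ 2) * (ENNReal.ofReal C *
          volume {z | v z ≠ 0} ^ (2 / Q) * (ENNReal.ofReal ((C' * t⁻¹) ^ 2) *
            ∫⁻ z in E, ‖grad γ ψ z‖ₑ ^ 2)) := by
        rw [e2, ENNReal.ofReal_mul (by positivity)]
        gcongr
        exact low.trans (hfk.trans (by gcongr))
    _ = (ENNReal.ofReal (t ^ 2) * ENNReal.ofReal C * ENNReal.ofReal ((C' * t⁻¹) ^ 2)) *
          (ENNReal.ofReal (t ^ (2 * q / Q)) * volume {z | v z ≠ 0} ^ (2 / Q)) *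
            ∫⁻ z in E, ‖grad γ ψ z‖ₑ ^ 2 := by ring
    _ ≤ _ := by
        gcongr
        rw [← ENNReal.ofReal_mul (by positivity), ← ENNReal.ofReal_mul (by positivity)]
        refine ENNReal.ofReal_le_ofReal (le_of_eq ?_)
        field_simp

/-- The critical Sobolev inequality for the Grushin gradient. -/
theorem exists_sobolev (hn : 1 ≤ n) (hm : 1 ≤ m) {γ : ℝ} (hγ : 0 < γ) :
    ∃ K : ℝ, 0 < K ∧ ∀ ψ : Pt n m → ℝ, ContDiff ℝ 1 ψ → HasCompactSupport ψ →
      eLpNorm ψ (ENNReal.ofReal (sobExp n m γ)) volume ≤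
        ENNReal.ofReal K * eLpNorm (grad γ ψ) 2 volume := by
  obtain ⟨K, hK, hlev⟩ := sobolev_level hn hm hγ
  have hQ := homDim_gt_two hn hm hγ
  have hq := sobExp_pos hn hm hγ
  set Q := homDim n m γ with hQdef
  have hqQ : 1 / sobExp n m γ = (1 - 2 / Q) * 2⁻¹ := by
    rw [sobExp]
    have : homDim n m γ - 2 ≠ 0 := by linarith
    have : homDim n m γ ≠ 0 := by linarith
    field_simp
    rw [hQdef]; ring
  set q := sobExp n m γ
  set K' := (4 : ℝ) ^ q * K with hK'
  have K'0 : 0 < K' := by positivity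
  refine ⟨Real.sqrt K', Real.sqrt_pos.2 K'0, fun ψ hψ hcs => ?_⟩
  have cψ := hψ.continuous
  have q0 : 0 < q := by linarith
  set I := ∫⁻ z, ‖ψ z‖ₑ ^ q with hI
  set G := ∫⁻ z, ‖grad γ ψ z‖ₑ ^ 2 with hG
  have eI : eLpNorm ψ (ENNReal.ofReal q) volume = I ^ (1 / q) := by
    rw [eLpNorm_eq_lintegral_rpow_enorm_toReal (by simpa using q0) ENNReal.ofReal_ne_top,
      ENNReal.toReal_ofReal q0.le]
  have fI : I < ⊤ := by
    have := (cψ.memLp_of_hasCompactSupport (p := ENNReal.ofReal q) (μ := volume) hcs).2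
    rw [eI] at this
    by_contra h
    rw [not_lt, top_le_iff] at h
    rw [h, ENNReal.top_rpow_of_pos (by positivity)] at this
    exact lt_irrefl _ this
  -- Maz'ya's truncation: the shell `A k`, which lies directly above `E k`, is estimated by the
  -- gradient on `E k`. The shells `E k` are disjoint, so the estimates add up to the whole
  -- Dirichlet integral.
  set A : ℤ → Set (Pt n m) := fun k => {z | 2 * (2 : ℝ) ^ k < |ψ z| ∧ |ψ z| ≤ 4 * (2 : ℝ) ^ k}
    with hA
  set E : ℤ → Set (Pt n m) := fun k => {z | (2 : ℝ) ^ k < |ψ z| ∧ |ψ z| ≤ 2 * (2 : ℝ) ^ k} with hE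
  have mA : ∀ k, MeasurableSet (A k) := fun k =>
    (isOpen_lt continuous_const cψ.abs).measurableSet.inter
      (isClosed_le cψ.abs continuous_const).measurableSet
  have mE : ∀ k, MeasurableSet (E k) := fun k =>
    (isOpen_lt continuous_const cψ.abs).measurableSet.inter
      (isClosed_le cψ.abs continuous_const).measurableSet
  have dE : Pairwise (Function.onFun Disjoint E) := by
    have key : ∀ j k : ℤ, j < k → Disjoint (E j) (E k) := by
      intro j k hjk
      rw [Set.disjoint_left]
      intro z hj hk
      have h1 : (2 : ℝ) ^ (j + 1) ≤ 2 ^ k := zpow_le_zpow_right₀ (by norm_num) hjk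
      rw [zpow_add_one₀ (by norm_num)] at h1
      linarith [hj.2, hk.1]
    intro j k hjk
    rcases lt_or_gt_of_ne hjk with h | h
    · exact key j k h
    · exact (key k j h).symm
  have b1 : I ≤ ∑' k : ℤ, ENNReal.ofReal ((4 * (2 : ℝ) ^ k) ^ q) * volume (A k) := by
    have : ∀ k : ℤ, ENNReal.ofReal ((4 * (2 : ℝ) ^ k) ^ q) * volume (A k) =
        ∫⁻ z, (A k).indicator (fun _ => ENNReal.ofReal ((4 * (2 : ℝ) ^ k) ^ q)) z := fun k => by
      rw [lintegral_indicator (mA k), setLIntegral_const]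
    simp_rw [this]
    rw [← lintegral_tsum fun k => (measurable_const.indicator (mA k)).aemeasurable]
    refine lintegral_mono fun z => ?_
    by_cases hz : ψ z = 0
    · simp [hz, q0]
    · obtain ⟨k, hk1, hk2⟩ := exists_mem_Ioc_zpow (x := |ψ z| / 2) (y := 2) (by positivity)
        (by norm_num)
      rw [zpow_add_one₀ (by norm_num)] at hk2
      have hzk : z ∈ A k := ⟨by linarith, by linarith⟩
      refine le_trans ?_ (ENNReal.le_tsum k)
      simp only [Set.indicator_of_mem hzk]
      rw [← ofReal_norm, ENNReal.ofReal_rpow_of_nonneg (norm_nonneg _) q0.le]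
      exact ENNReal.ofReal_le_ofReal (Real.rpow_le_rpow (norm_nonneg _) hzk.2 q0.le)
  have b2 : I ≤ ENNReal.ofReal K' * I ^ (2 / Q) * G := by
    calc I ≤ _ := b1
      _ ≤ ∑' k : ℤ, ENNReal.ofReal K' * I ^ (2 / Q) * ∫⁻ z in E k, ‖grad γ ψ z‖ₑ ^ 2 := by
        refine ENNReal.tsum_le_tsum fun k => ?_
        have h2 : (0 : ℝ) < 2 ^ k := by positivity
        have h1 := hlev ψ hψ hcs (2 ^ k) h2
        rw [Real.mul_rpow (by norm_num) h2.le, ENNReal.ofReal_mul (by positivity), hK',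
          ENNReal.ofReal_mul (by positivity)]
        simp only [mul_assoc] at h1 ⊢
        refine mul_le_mul_right ?_ _
        exact (mul_le_mul_right (measure_mono fun z hz => hz.1) _).trans h1
      _ = ENNReal.ofReal K' * I ^ (2 / Q) * ∫⁻ z in ⋃ k, E k, ‖grad γ ψ z‖ₑ ^ 2 := by
        rw [ENNReal.tsum_mul_left, lintegral_iUnion mE dE]
      _ ≤ _ := by gcongr; exact setLIntegral_le_lintegral _ _
  -- A factor `I ^ (2 / Q)` is divided out, which is allowed because `I` is finite by compactness of
  -- the support.
  have b3 : I ^ (1 - 2 / Q) ≤ ENNReal.ofReal K' * G := by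
    by_cases hI0 : I = 0
    · have : 2 / Q < 1 := by rw [div_lt_one (by linarith)]; exact hQ
      rw [hI0, ENNReal.zero_rpow_of_pos (by linarith)]
      exact zero_le
    · rw [ENNReal.rpow_sub _ _ hI0 fI.ne, ENNReal.rpow_one]
      refine ENNReal.div_le_of_le_mul (b2.trans_eq (by ring))
  have e3 : ENNReal.ofReal K' * G = (ENNReal.ofReal √K' * eLpNorm (grad γ ψ) 2 volume) ^ (2 : ℝ) := by
    rw [ENNReal.rpow_two, mul_pow, eLpNorm_two_sq, ← ENNReal.ofReal_pow (Real.sqrt_nonneg _),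
      Real.sq_sqrt K'0.le]
  rw [eI, hqQ, ENNReal.rpow_mul]
  refine (ENNReal.rpow_le_rpow (b3.trans_eq e3) (by norm_num)).trans_eq ?_
  rw [← ENNReal.rpow_mul]
  norm_num

/-! ### The space `H¹₀`: weak compactness, Sobolev and Poincaré inequalities, Rellich's theorem. -/

/-- A bounded sequence in a separable Hilbert space has a weakly convergent subsequence. -/
lemma exists_weak_subseq {H : Type*} [NormedAddCommGroup H] [InnerProductSpace ℝ H]
    [CompleteSpace H] [TopologicalSpace.SeparableSpace H] {x : ℕ → H} {C : ℝ}
    (hx : ∀ k, ‖x k‖ ≤ C) : ∃ (y : H) (s : ℕ → ℕ), StrictMono s ∧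
      ∀ h : H, Tendsto (fun k => (inner ℝ (x (s k)) h : ℝ)) atTop (𝓝 (inner ℝ y h)) := by
  obtain ⟨ξ, _, s, hs, hlim⟩ := WeakDual.isSeqCompact_closedBall ℝ H 0 C
    (x := fun k => StrongDual.toWeakDual (InnerProductSpace.toDual ℝ H (x k))) (fun k => by
      simpa using hx k)
  refine ⟨(InnerProductSpace.toDual ℝ H).symm (WeakDual.toStrongDual ξ), s, hs, fun h => ?_⟩
  have := ((WeakDual.eval_continuous h).tendsto ξ).comp hlim
  simp only [InnerProductSpace.toDual_symm_apply]
  exact this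

/-- The Hilbert space of pairs of a scalar and a vector field in `L²`. -/
abbrev GraphSpace (Ω : Set (Pt n m)) : Type :=
  WithLp 2 (Lp ℝ 2 (volume.restrict Ω) × Lp (Vec n m) 2 (volume.restrict Ω))

instance (Ω : Set (Pt n m)) : TopologicalSpace.SeparableSpace (GraphSpace Ω) := by
  have : Fact ((2 : ℝ≥0∞) ≠ ⊤) := ⟨by simp⟩
  have : SFinite (volume.restrict Ω) := inferInstance
  have h1 : SecondCountableTopology (Lp ℝ 2 (volume.restrict Ω)) := inferInstance
  have h2 : SecondCountableTopology (Lp (Vec n m) 2 (volume.restrict Ω)) := inferInstance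
  exact (WithLp.homeomorphProd 2 _ _).symm.surjective.denseRange.separableSpace
    (WithLp.homeomorphProd 2 _ _).symm.continuous

/-- `u` and `U` are the limits in `L²(Ω)` of a sequence of test functions and of the sequence of
their Grushin gradients. -/
structure H10Pair (γ : ℝ) (Ω : Set (Pt n m)) (u : Pt n m → ℝ) (U : Pt n m → Vec n m) : Prop where
  memLp : MemLp u 2 (volume.restrict Ω)
  memLp_grad : MemLp U 2 (volume.restrict Ω)
  approx : ∃ ψ : ℕ → Pt n m → ℝ, (∀ k, IsTest Ω (ψ k)) ∧
    Tendsto (fun k => eLpNorm (fun z => ψ k z - u z) 2 (volume.restrict Ω)) atTop (𝓝 0) ∧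
    Tendsto (fun k => eLpNorm (fun z => grad γ (ψ k) z - U z) 2 (volume.restrict Ω)) atTop (𝓝 0)

lemma H10Pair.h1Pair {γ : ℝ} (hγ : 0 < γ) {Ω : Set (Pt n m)} {u : Pt n m → ℝ}
    {U : Pt n m → Vec n m} (h : H10Pair γ Ω u U) : H1Pair γ Ω u U := by
  obtain ⟨ψ, h0, h1, h2⟩ := h.approx
  exact h1Pair_of_tendsto hγ (fun k => (h0 k).h1Pair hγ) h.memLp h.memLp_grad h1 h2

lemma H10Pair.congr {γ : ℝ} {Ω : Set (Pt n m)} {u v : Pt n m → ℝ}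
    {U V : Pt n m → Vec n m} (h : H10Pair γ Ω u U) (hu : u =ᵐ[volume.restrict Ω] v)
    (hU : U =ᵐ[volume.restrict Ω] V) : H10Pair γ Ω v V := by
  obtain ⟨ψ, h0, h1, h2⟩ := h.approx
  refine ⟨h.memLp.ae_eq hu, h.memLp_grad.ae_eq hU, ψ, h0, ?_, ?_⟩
  · convert h1 using 2 with k
    exact eLpNorm_congr_ae (hu.mono fun z hz => by simp only [hz])
  · convert h2 using 2 with k
    exact eLpNorm_congr_ae (hU.mono fun z hz => by simp only [hz])

lemma MemH10.pair {γ : ℝ} {Ω : Set (Pt n m)} {u : Pt n m → ℝ} (h : MemH10 γ Ω u) :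
    H10Pair γ Ω u (weakGrad γ Ω u) := ⟨h.1.1, h.1.pair.memLp_grad, h.2⟩

lemma H10Pair.weakGrad_ae {γ : ℝ} (hγ : 0 < γ) {Ω : Set (Pt n m)} (hΩ : IsOpen Ω)
    {u : Pt n m → ℝ} {U : Pt n m → Vec n m} (h : H10Pair γ Ω u U) :
    weakGrad γ Ω u =ᵐ[volume.restrict Ω] U := (h.h1Pair hγ).weakGrad_ae hΩ

lemma H10Pair.memH10 {γ : ℝ} (hγ : 0 < γ) {Ω : Set (Pt n m)} (hΩ : IsOpen Ω)
    {u : Pt n m → ℝ} {U : Pt n m → Vec n m} (h : H10Pair γ Ω u U) : MemH10 γ Ω u :=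
  ⟨(h.h1Pair hγ).memH1, (h.congr (ae_eq_refl _) (h.weakGrad_ae hγ hΩ).symm).approx⟩

lemma IsTest.h10Pair {γ : ℝ} (hγ : 0 < γ) {Ω : Set (Pt n m)} {ψ : Pt n m → ℝ}
    (h : IsTest Ω ψ) : H10Pair γ Ω ψ (grad γ ψ) :=
  ⟨h.memLp _ _, h.memLp_grad hγ _ _, fun _ => ψ, fun _ => h, by simp, by simp⟩

lemma tendsto_eLpNorm_add {α E : Type*} [MeasurableSpace α] [NormedAddCommGroup E]
    {μ : Measure α} {u v : ℕ → α → E} {u₀ v₀ : α → E} (hu : ∀ k, MemLp (u k) 2 μ)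
    (hv : ∀ k, MemLp (v k) 2 μ) (hu₀ : MemLp u₀ 2 μ) (hv₀ : MemLp v₀ 2 μ)
    (h1 : Tendsto (fun k => eLpNorm (fun z => u k z - u₀ z) 2 μ) atTop (𝓝 0))
    (h2 : Tendsto (fun k => eLpNorm (fun z => v k z - v₀ z) 2 μ) atTop (𝓝 0)) :
    Tendsto (fun k => eLpNorm (fun z => (u k z + v k z) - (u₀ z + v₀ z)) 2 μ) atTop (𝓝 0) := by
  refine tendsto_of_tendsto_of_tendsto_of_le_of_le tendsto_const_nhds
    (by simpa using h1.add h2) (fun _ => zero_le) fun k => ?_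
  have := eLpNorm_add_le ((hu k).1.sub hu₀.1) ((hv k).1.sub hv₀.1) (μ := μ) (p := 2) (by norm_num)
  refine le_trans (le_of_eq ?_) this
  congr 1
  ext z
  simp only [Pi.add_apply, Pi.sub_apply]
  abel

lemma H10Pair.add {γ : ℝ} (hγ : 0 < γ) {Ω : Set (Pt n m)} {u v : Pt n m → ℝ}
    {U V : Pt n m → Vec n m} (h : H10Pair γ Ω u U) (h' : H10Pair γ Ω v V) :
    H10Pair γ Ω (fun z => u z + v z) (fun z => U z + V z) := by
  obtain ⟨ψ, h0, h1, h2⟩ := h.approx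
  obtain ⟨χ, h0', h1', h2'⟩ := h'.approx
  refine ⟨h.memLp.add h'.memLp, h.memLp_grad.add h'.memLp_grad, fun k z => ψ k z + χ k z,
    fun k => (h0 k).add (h0' k), tendsto_eLpNorm_add (fun k => (h0 k).memLp _ _)
      (fun k => (h0' k).memLp _ _) h.memLp h'.memLp h1 h1', ?_⟩
  have := tendsto_eLpNorm_add (fun k => (h0 k).memLp_grad hγ 2 (volume.restrict Ω))
      (fun k => (h0' k).memLp_grad hγ _ _) h.memLp_grad h'.memLp_grad h2 h2'
  refine this.congr fun k => ?_
  congr 1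
  ext1 z
  congr 1
  have e := grad_sub (γ := γ) ((h0 k).contDiff_one.differentiable one_ne_zero z)
    (((h0' k).const_mul (-1)).contDiff_one.differentiable one_ne_zero z)
  have e' := grad_const_mul (γ := γ) (-1) ((h0' k).contDiff_one.differentiable one_ne_zero z)
  rw [e'] at e
  simpa using e.symm

lemma H10Pair.const_mul {γ : ℝ} {Ω : Set (Pt n m)} {u : Pt n m → ℝ}
    {U : Pt n m → Vec n m} (h : H10Pair γ Ω u U) (c : ℝ) :
    H10Pair γ Ω (fun z => c * u z) (fun z => c • U z) := by
  obtain ⟨ψ, h0, h1, h2⟩ := h.approx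
  refine ⟨h.memLp.const_mul c, h.memLp_grad.const_smul c, fun k z => c * ψ k z,
    fun k => (h0 k).const_mul c, ?_, ?_⟩
  · have : ∀ k, eLpNorm (fun z => c * ψ k z - c * u z) 2 (volume.restrict Ω) =
        ‖c‖ₑ * eLpNorm (fun z => ψ k z - u z) 2 (volume.restrict Ω) := fun k => by
      rw [← eLpNorm_const_smul]; congr 1; ext z; simp [mul_sub]
    simp_rw [this]
    simpa using ENNReal.Tendsto.const_mul h1 (Or.inr (enorm_ne_top (x := c)))
  · have : ∀ k, eLpNorm (fun z => grad γ (fun z => c * ψ k z) z - c • U z) 2 (volume.restrict Ω) =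
        ‖c‖ₑ * eLpNorm (fun z => grad γ (ψ k) z - U z) 2 (volume.restrict Ω) := fun k => by
      rw [← eLpNorm_const_smul]; congr 1; ext1 z
      rw [grad_const_mul c ((h0 k).contDiff_one.differentiable one_ne_zero z)]
      simp [smul_sub]
    simp_rw [this]
    simpa using ENNReal.Tendsto.const_mul h2 (Or.inr (enorm_ne_top (x := c)))

lemma H10Pair.sub {γ : ℝ} (hγ : 0 < γ) {Ω : Set (Pt n m)} {u v : Pt n m → ℝ}
    {U V : Pt n m → Vec n m} (h : H10Pair γ Ω u U) (h' : H10Pair γ Ω v V) :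
    H10Pair γ Ω (fun z => u z - v z) (fun z => U z - V z) := by
  simpa [sub_eq_add_neg] using h.add hγ (h'.const_mul (-1))

/-- The element of the graph space given by a pair of square integrable fields. -/
def toGraph {Ω : Set (Pt n m)} {u : Pt n m → ℝ} {U : Pt n m → Vec n m}
    (hu : MemLp u 2 (volume.restrict Ω)) (hU : MemLp U 2 (volume.restrict Ω)) : GraphSpace Ω :=
  WithLp.toLp 2 (hu.toLp u, hU.toLp U)

/-- The elements of the graph space that come from `H¹_{0,γ}(Ω)`. -/
def h10Graph {γ : ℝ} (hγ : 0 < γ) (Ω : Set (Pt n m)) : Submodule ℝ (GraphSpace Ω) where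
  carrier := {x | H10Pair γ Ω x.fst x.snd}
  add_mem' {x y} hx hy := (H10Pair.add hγ hx hy).congr (Lp.coeFn_add x.fst y.fst).symm
    (Lp.coeFn_add x.snd y.snd).symm
  zero_mem' := (IsTest.h10Pair hγ (ψ := fun _ => 0) ⟨contDiff_const, HasCompactSupport.zero,
    by simp [tsupport]⟩).congr (Lp.coeFn_zero ℝ 2 (volume.restrict Ω)).symm (by
      refine EventuallyEq.trans (Eventually.of_forall fun z => ?_)
        (Lp.coeFn_zero (Vec n m) 2 (volume.restrict Ω)).symm
      exact grad_eq_zero_of_fderiv (by simp))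
  smul_mem' c x hx := (H10Pair.const_mul hx c).congr (Lp.coeFn_smul c x.fst).symm
    (Lp.coeFn_smul c x.snd).symm

lemma toGraph_mem {γ : ℝ} (hγ : 0 < γ) {Ω : Set (Pt n m)} {u : Pt n m → ℝ} {U : Pt n m → Vec n m}
    (h : H10Pair γ Ω u U) : toGraph h.memLp h.memLp_grad ∈ h10Graph hγ Ω :=
  h.congr h.memLp.coeFn_toLp.symm h.memLp_grad.coeFn_toLp.symm

/-- A diagonal argument: the test function number `k` is taken within `1 / (k + 1)` of the `k`-th
term of the sequence. -/
lemma isClosed_h10Graph {γ : ℝ} (hγ : 0 < γ) (Ω : Set (Pt n m)) :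
    IsClosed (h10Graph hγ Ω : Set (GraphSpace Ω)) := by
  refine IsSeqClosed.isClosed fun x y hx hxy => ?_
  have hx' : ∀ k, H10Pair γ Ω (x k).fst (x k).snd := hx
  change H10Pair γ Ω y.fst y.snd
  have c1 : Tendsto (fun k => (x k).fst) atTop (𝓝 y.fst) :=
    ((WithLp.continuous_fst 2 _ _).tendsto y).comp hxy
  have c2 : Tendsto (fun k => (x k).snd) atTop (𝓝 y.snd) :=
    ((WithLp.continuous_snd 2 _ _).tendsto y).comp hxy
  have m1 := Lp.memLp y.fst
  have m2 := Lp.memLp y.snd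
  have d1 := (Lp.tendsto_Lp_iff_tendsto_eLpNorm' _ _).1 c1
  have d2 := (Lp.tendsto_Lp_iff_tendsto_eLpNorm' _ _).1 c2
  have key : ∀ k, ∃ ψ, IsTest Ω ψ ∧
      eLpNorm (fun z => ψ z - (x k).fst z) 2 (volume.restrict Ω) ≤ (k + 1 : ℝ≥0∞)⁻¹ ∧
      eLpNorm (fun z => grad γ ψ z - (x k).snd z) 2 (volume.restrict Ω) ≤ (k + 1 : ℝ≥0∞)⁻¹ := by
    intro k
    obtain ⟨ψ, h0, h1, h2⟩ := (hx' k).approx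
    have hp : (0 : ℝ≥0∞) < (k + 1 : ℝ≥0∞)⁻¹ := by
      simp only [ENNReal.inv_pos]; exact ENNReal.add_ne_top.2 ⟨ENNReal.natCast_ne_top k, by simp⟩
    obtain ⟨j, hj1, hj2⟩ := ((h1.eventually (eventually_le_nhds hp)).and
      (h2.eventually (eventually_le_nhds hp))).exists
    exact ⟨ψ j, h0 j, hj1, hj2⟩
  choose ψ h0 h1 h2 using key
  have t0 : Tendsto (fun k : ℕ => (k + 1 : ℝ≥0∞)⁻¹) atTop (𝓝 0) := by
    have := (tendsto_add_atTop_iff_nat 1).2 ENNReal.tendsto_inv_nat_nhds_zero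
    simpa using this
  refine ⟨m1, m2, ψ, h0, ?_, ?_⟩
  · refine tendsto_of_tendsto_of_tendsto_of_le_of_le tendsto_const_nhds
      (by simpa using t0.add d1) (fun _ => zero_le) fun k => ?_
    refine le_trans (le_of_eq ?_) ((eLpNorm_add_le (((h0 k).memLp 2 _).1.sub (Lp.memLp (x k).fst).1)
      ((Lp.memLp (x k).fst).1.sub m1.1) (by norm_num)).trans (add_le_add (h1 k) le_rfl))
    congr 1; ext z; simp
  · refine tendsto_of_tendsto_of_tendsto_of_le_of_le tendsto_const_nhds
      (by simpa using t0.add d2) (fun _ => zero_le) fun k => ?_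
    refine le_trans (le_of_eq ?_) ((eLpNorm_add_le (((h0 k).memLp_grad hγ 2 _).1.sub
      (Lp.memLp (x k).snd).1)
      ((Lp.memLp (x k).snd).1.sub m2.1) (by norm_num)).trans (add_le_add (h2 k) le_rfl))
    congr 1; ext1 z; simp

/-- A weak limit is still orthogonal to everything orthogonal to `S`, and a closed subspace is its
own double orthogonal complement. -/
lemma mem_of_weak_limit {H : Type*} [NormedAddCommGroup H] [InnerProductSpace ℝ H]
    [CompleteSpace H] (S : Submodule ℝ H) (hS : IsClosed (S : Set H)) {x : ℕ → H} {y : H}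
    (hx : ∀ k, x k ∈ S)
    (hxy : ∀ h : H, Tendsto (fun k => (inner ℝ (x k) h : ℝ)) atTop (𝓝 (inner ℝ y h))) : y ∈ S := by
  have : y ∈ Sᗮᗮ := by
    rw [Submodule.mem_orthogonal']
    intro h hh
    refine tendsto_nhds_unique (hxy h) ?_
    have : ∀ k, (inner ℝ (x k) h : ℝ) = 0 := fun k => (Submodule.mem_orthogonal S h).1 hh _ (hx k)
    simp [this]
  rw [Submodule.orthogonal_orthogonal_eq_closure] at this
  rwa [hS.submodule_topologicalClosure_eq] at this

lemma inner_toLp {α E : Type*} [MeasurableSpace α] {μ : Measure α}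
    [NormedAddCommGroup E] [InnerProductSpace ℝ E] (x : Lp E 2 μ) {B : α → E}
    (hB : MemLp B 2 μ) : inner ℝ x (hB.toLp B) = ∫ z, inner ℝ (x z) (B z) ∂μ := by
  rw [L2.inner_def]
  refine integral_congr_ae ?_
  filter_upwards [hB.coeFn_toLp] with z h2
  rw [h2]

/-- Bounded sequences in `H¹_{0,γ}(Ω)` have weakly convergent subsequences. -/
lemma exists_weak_subseq_h10 {γ : ℝ} (hγ : 0 < γ) {Ω : Set (Pt n m)} {u : ℕ → Pt n m → ℝ}
    {U : ℕ → Pt n m → Vec n m} (h : ∀ k, H10Pair γ Ω (u k) (U k)) {C : ℝ}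
    (hu : ∀ k, eLpNorm (u k) 2 (volume.restrict Ω) ≤ ENNReal.ofReal C)
    (hU : ∀ k, eLpNorm (U k) 2 (volume.restrict Ω) ≤ ENNReal.ofReal C) :
    ∃ (u₀ : Pt n m → ℝ) (U₀ : Pt n m → Vec n m) (s : ℕ → ℕ), StrictMono s ∧ H10Pair γ Ω u₀ U₀ ∧
      (∀ v, MemLp v 2 (volume.restrict Ω) →
        Tendsto (fun k => ∫ z in Ω, u (s k) z * v z) atTop (𝓝 (∫ z in Ω, u₀ z * v z))) ∧
      ∀ V, MemLp V 2 (volume.restrict Ω) →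
        Tendsto (fun k => ∫ z in Ω, inner ℝ (U (s k) z) (V z)) atTop
          (𝓝 (∫ z in Ω, inner ℝ (U₀ z) (V z))) := by
  set x : ℕ → GraphSpace Ω := fun k => toGraph (h k).memLp (h k).memLp_grad with hx
  have hb : ∀ k, ‖x k‖ ≤ max C 0 + max C 0 := by
    intro k
    have hn : ∀ {E : Type} [NormedAddCommGroup E] {f : Pt n m → E}
        (hf : MemLp f 2 (volume.restrict Ω)), eLpNorm f 2 (volume.restrict Ω) ≤ ENNReal.ofReal C →
        ‖hf.toLp f‖ ≤ max C 0 := by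
      intro E _ f hf hC
      rw [Lp.norm_toLp]
      refine (ENNReal.toReal_mono ENNReal.ofReal_ne_top hC).trans ?_
      rw [ENNReal.toReal_ofReal']
    have e : x k = WithLp.toLp 2 ((h k).memLp.toLp (u k), 0) +
        WithLp.toLp 2 (0, (h k).memLp_grad.toLp (U k)) := by
      rw [← WithLp.toLp_add]; simp [hx, toGraph]
    rw [e]
    refine (norm_add_le _ _).trans (add_le_add ?_ ?_)
    · rw [WithLp.norm_toLp_fst]; exact hn _ (hu k)
    · rw [WithLp.norm_toLp_snd]; exact hn _ (hU k)
  obtain ⟨y, s, hs, hlim⟩ := exists_weak_subseq hb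
  have hy : y ∈ h10Graph hγ Ω := mem_of_weak_limit _ (isClosed_h10Graph hγ Ω)
    (fun k => toGraph_mem hγ (h (s k))) hlim
  refine ⟨y.fst, y.snd, s, hs, hy, fun v hv => ?_, fun V hV => ?_⟩
  · have := hlim (WithLp.toLp 2 (hv.toLp v, 0))
    simp only [WithLp.prod_inner_apply, inner_zero_right, add_zero, inner_toLp] at this
    refine Tendsto.congr (fun k => integral_congr_ae ?_) (this.trans_eq ?_)
    · filter_upwards [(h (s k)).memLp.coeFn_toLp] with z hz
      change inner ℝ (((h (s k)).memLp.toLp (u (s k))) z) (v z) = _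
      rw [hz]; simp [mul_comm]
    · congr 1
      refine integral_congr_ae (Eventually.of_forall fun z => ?_)
      simp [mul_comm]
  · have := hlim (WithLp.toLp 2 (0, hV.toLp V))
    simp only [WithLp.prod_inner_apply, inner_zero_right, zero_add, inner_toLp] at this
    refine Tendsto.congr (fun k => integral_congr_ae ?_) this
    filter_upwards [(h (s k)).memLp_grad.coeFn_toLp] with z hz
    change inner ℝ (((h (s k)).memLp_grad.toLp (U (s k))) z) (V z) = _
    rw [hz]

lemma integrable_mul_L2 {α : Type*} [MeasurableSpace α] {μ : Measure α} {f g : α → ℝ}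
    (hf : MemLp f 2 μ) (hg : MemLp g 2 μ) : Integrable (fun z => f z * g z) μ :=
  hf.integrable_mul hg

lemma integrable_inner_L2 {α E : Type*} [MeasurableSpace α] {μ : Measure α}
    [NormedAddCommGroup E] [InnerProductSpace ℝ E] {f g : α → E}
    (hf : MemLp f 2 μ) (hg : MemLp g 2 μ) : Integrable (fun z => inner ℝ (f z) (g z)) μ := by
  refine (integrable_mul_L2 hf.norm hg.norm).mono (hf.1.inner hg.1) (Eventually.of_forall fun z => ?_)
  rw [norm_mul, norm_norm, norm_norm]
  exact norm_inner_le_norm _ _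

lemma exists_subseq_ae {α E : Type*} [MeasurableSpace α] [NormedAddCommGroup E] {μ : Measure α}
    {u : ℕ → α → E} {u₀ : α → E} (hu : ∀ k, AEStronglyMeasurable (u k) μ)
    (hu₀ : AEStronglyMeasurable u₀ μ)
    (h : Tendsto (fun k => eLpNorm (fun z => u k z - u₀ z) 2 μ) atTop (𝓝 0)) :
    ∃ s : ℕ → ℕ, StrictMono s ∧ ∀ᵐ z ∂μ, Tendsto (fun k => u (s k) z) atTop (𝓝 (u₀ z)) :=
  (tendstoInMeasure_of_tendsto_eLpNorm two_ne_zero hu hu₀ h).exists_seq_tendsto_ae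

lemma eLpNorm_restrict_eq {E : Type*} [NormedAddCommGroup E] {Ω : Set (Pt n m)}
    (hΩ : MeasurableSet Ω) {f : Pt n m → E} (h : ∀ z, z ∉ Ω → f z = 0) (p : ℝ≥0∞) :
    eLpNorm f p (volume.restrict Ω) = eLpNorm f p volume := by
  rw [← eLpNorm_indicator_eq_eLpNorm_restrict hΩ]
  congr 1
  ext1 z
  by_cases hz : z ∈ Ω
  · simp [hz]
  · simp [hz, h z hz]

/-- Gradients of approximating test functions have asymptotically bounded norm. -/
lemma tendsto_eLpNorm_of_sub {α E : Type*} [MeasurableSpace α] [NormedAddCommGroup E]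
    {μ : Measure α} {U : ℕ → α → E} {U₀ : α → E} (hU : ∀ k, MemLp (U k) 2 μ) (hU₀ : MemLp U₀ 2 μ)
    (h : Tendsto (fun k => eLpNorm (fun z => U k z - U₀ z) 2 μ) atTop (𝓝 0)) :
    Tendsto (fun k => eLpNorm (U k) 2 μ) atTop (𝓝 (eLpNorm U₀ 2 μ)) := by
  have t := (Lp.tendsto_Lp_iff_tendsto_eLpNorm'' U hU U₀ hU₀).2 h
  have := t.enorm
  simpa only [Lp.enorm_toLp] using this

/-- Fatou's lemma along an almost everywhere convergent subsequence of the approximating test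
functions. The exponent `p` is left free so that the Sobolev and the Poincaré inequality both pass
to `H¹₀` in this way. -/
lemma H10Pair.eLpNorm_le {γ : ℝ} (hγ : 0 < γ) {Ω : Set (Pt n m)} {u : Pt n m → ℝ}
    {U : Pt n m → Vec n m} (h : H10Pair γ Ω u U) {p : ℝ≥0∞} {K : ℝ}
    (hK : ∀ ψ, IsTest Ω ψ → eLpNorm ψ p (volume.restrict Ω) ≤
      ENNReal.ofReal K * eLpNorm (grad γ ψ) 2 (volume.restrict Ω)) :
    eLpNorm u p (volume.restrict Ω) ≤ ENNReal.ofReal K * eLpNorm U 2 (volume.restrict Ω) := by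
  obtain ⟨ψ, h0, h1, h2⟩ := h.approx
  obtain ⟨s, hs, hae⟩ := exists_subseq_ae (fun k => ((h0 k).memLp 2 _).1) h.memLp.1 h1
  refine (Lp.eLpNorm_lim_le_liminf_eLpNorm (fun k => ((h0 (s k)).memLp 2 _).1) u hae).trans ?_
  have t := (tendsto_eLpNorm_of_sub (fun k => (h0 k).memLp_grad hγ 2 _) h.memLp_grad h2).comp
    hs.tendsto_atTop
  have t' := ENNReal.Tendsto.const_mul (a := ENNReal.ofReal K) t (Or.inr ENNReal.ofReal_ne_top)
  refine le_trans (liminf_le_liminf (Eventually.of_forall fun k => hK _ (h0 (s k)))) ?_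
  exact t'.liminf_eq.le

/-- The Sobolev inequality on `H¹_{0,γ}(Ω)`. -/
theorem exists_sobolev_h10 (hn : 1 ≤ n) (hm : 1 ≤ m) {γ : ℝ} (hγ : 0 < γ) :
    ∃ K : ℝ, 0 < K ∧ ∀ (Ω : Set (Pt n m)), IsOpen Ω → ∀ (u : Pt n m → ℝ) (U : Pt n m → Vec n m),
      H10Pair γ Ω u U → eLpNorm u (ENNReal.ofReal (sobExp n m γ)) (volume.restrict Ω) ≤
        ENNReal.ofReal K * eLpNorm U 2 (volume.restrict Ω) := by
  obtain ⟨K, hK, h⟩ := exists_sobolev hn hm hγ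
  refine ⟨K, hK, fun Ω hΩ u U hu => hu.eLpNorm_le hγ fun ψ hψ => ?_⟩
  rw [eLpNorm_restrict_eq hΩ.measurableSet fun z hz => hψ.eq_zero hz,
    eLpNorm_restrict_eq hΩ.measurableSet fun z hz => hψ.grad_eq_zero hz]
  exact h ψ hψ.contDiff_one hψ.compact

/-- The Poincaré inequality on `H¹_{0,γ}(Ω)` for bounded `Ω`. -/
theorem exists_poincare (hn : 1 ≤ n) (hm : 1 ≤ m) {γ : ℝ} (hγ : 0 < γ) {Ω : Set (Pt n m)}
    (hΩ : IsOpen Ω) (hb : Bornology.IsBounded Ω) :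
    ∃ K : ℝ, 0 < K ∧ ∀ (u : Pt n m → ℝ) (U : Pt n m → Vec n m),
      H10Pair γ Ω u U → eLpNorm u 2 (volume.restrict Ω) ≤
        ENNReal.ofReal K * eLpNorm U 2 (volume.restrict Ω) := by
  obtain ⟨C, hC, hFK⟩ := exists_faberKrahn hn hm hγ
  have hQ := homDim_gt_two hn hm hγ
  have fΩ : volume Ω ^ (2 / homDim n m γ) ≠ ⊤ :=
    ENNReal.rpow_ne_top_of_nonneg (by positivity) hb.measure_lt_top.ne
  set D := C * (volume Ω ^ (2 / homDim n m γ)).toReal with hD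
  have hDe : ENNReal.ofReal C * volume Ω ^ (2 / homDim n m γ) = ENNReal.ofReal D := by
    rw [hD, ENNReal.ofReal_mul hC.le, ENNReal.ofReal_toReal fΩ]
  have D0 : 0 ≤ D := by positivity
  -- The summand `1` only keeps the constant positive: `D` vanishes for empty `Ω`.
  refine ⟨√D + 1, by positivity, fun u U hu => hu.eLpNorm_le hγ fun ψ hψ => ?_⟩
  rw [eLpNorm_restrict_eq hΩ.measurableSet fun z hz => hψ.eq_zero hz,
    eLpNorm_restrict_eq hΩ.measurableSet fun z hz => hψ.grad_eq_zero hz]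
  have h1 : eLpNorm ψ 2 volume ^ 2 ≤ (ENNReal.ofReal √D * eLpNorm (grad γ ψ) 2 volume) ^ 2 := by
    rw [mul_pow, eLpNorm_two_sq, eLpNorm_two_sq, ← ENNReal.ofReal_pow (Real.sqrt_nonneg _),
      Real.sq_sqrt D0, ← hDe]
    refine (hFK ψ hψ.contDiff_one hψ.compact).trans ?_
    gcongr
    intro z hz
    by_contra hzΩ
    exact hz (hψ.eq_zero hzΩ)
  have h2 := (ENNReal.pow_le_pow_left_iff two_ne_zero).1 h1
  refine h2.trans ?_
  gcongr
  linarith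

/-- Translation estimate for the extension by zero of a function in `H¹_{0,γ}(Ω)`. -/
lemma H10Pair.lintegral_translate_le {γ : ℝ} (hγ : 0 < γ) {Ω : Set (Pt n m)} (hΩ : IsOpen Ω)
    {u : Pt n m → ℝ} {U : Pt n m → Vec n m} (h : H10Pair γ Ω u U)
    {e : EuclideanSpace ℝ (Fin n)} (he : ‖e‖ = 1) {r : ℝ} (hr : 0 < r)
    {b : Pt n m} (hb : b ∈ avgBox m γ e r) :
    ∫⁻ z in halfSpace e, ‖Ω.indicator u (z + b) - Ω.indicator u z‖ₑ ^ 2 ≤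
      ENNReal.ofReal (20 * r ^ 2) * ∫⁻ z in Ω, ‖U z‖ₑ ^ 2 := by
  obtain ⟨ψ, h0, h1, h2⟩ := h.approx
  obtain ⟨s, hs, hae⟩ := exists_subseq_ae (fun k => ((h0 k).memLp 2 _).1) h.memLp.1 h1
  have hae' : ∀ᵐ z, Tendsto (fun k => ψ (s k) z) atTop (𝓝 (Ω.indicator u z)) := by
    rw [ae_restrict_iff' hΩ.measurableSet] at hae
    filter_upwards [hae] with z hz
    by_cases hzΩ : z ∈ Ω
    · simpa [hzΩ] using hz hzΩ
    · simp [hzΩ, fun k => (h0 (s k)).eq_zero hzΩ]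
  have hae'' : ∀ᵐ z, Tendsto (fun k => ψ (s k) (z + b)) atTop (𝓝 (Ω.indicator u (z + b))) :=
    (quasiMeasurePreserving_add_right volume b).ae hae'
  have c : ∀ k, Continuous (ψ k) := fun k => (h0 k).smooth.continuous
  have b1 : ∀ k, ∫⁻ z in halfSpace e, ‖ψ (s k) (z + b) - ψ (s k) z‖ₑ ^ 2 ≤
      ENNReal.ofReal (20 * r ^ 2) * eLpNorm (grad γ (ψ (s k))) 2 (volume.restrict Ω) ^ 2 := by
    intro k
    rw [eLpNorm_restrict_eq hΩ.measurableSet fun z hz => (h0 (s k)).grad_eq_zero hz, eLpNorm_two_sq]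
    exact lintegral_halfSpace_translate_le hγ (h0 (s k)).contDiff_one he hr hb
  have t := (tendsto_eLpNorm_of_sub (fun k => (h0 k).memLp_grad hγ 2 _) h.memLp_grad h2).comp
    hs.tendsto_atTop
  have t' := ENNReal.Tendsto.const_mul (a := ENNReal.ofReal (20 * r ^ 2)) (ENNReal.Tendsto.pow (n := 2) t)
    (Or.inr ENNReal.ofReal_ne_top)
  rw [← eLpNorm_two_sq (volume.restrict Ω) U]
  calc ∫⁻ z in halfSpace e, ‖Ω.indicator u (z + b) - Ω.indicator u z‖ₑ ^ 2
      = ∫⁻ z in halfSpace e, liminf (fun k => ‖ψ (s k) (z + b) - ψ (s k) z‖ₑ ^ 2) atTop := by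
        refine lintegral_congr_ae (ae_restrict_of_ae ?_)
        filter_upwards [hae', hae''] with z hz1 hz2
        exact (ENNReal.Tendsto.pow (n := 2) (hz2.sub hz1).enorm).liminf_eq.symm
    _ ≤ liminf (fun k => ∫⁻ z in halfSpace e, ‖ψ (s k) (z + b) - ψ (s k) z‖ₑ ^ 2) atTop := by
        refine lintegral_liminf_le' fun k => ?_
        have := c (s k)
        exact Measurable.aemeasurable (by fun_prop)
    _ ≤ _ := (liminf_le_liminf (Eventually.of_forall b1)).trans t'.liminf_eq.le

lemma volume_avgBox_pos {γ : ℝ} (e : EuclideanSpace ℝ (Fin n)) {r : ℝ} (hr : 0 < r) :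
    volume (avgBox m γ e r) ≠ 0 ∧ volume (avgBox m γ e r) ≠ ⊤ := by
  obtain ⟨c, hc, h⟩ := exists_volume_avgBox n m γ
  rw [h e r hr]
  refine ⟨?_, ENNReal.ofReal_ne_top⟩
  simp only [ne_eq, ENNReal.ofReal_eq_zero, not_le]
  positivity

/-- The value `u z` is the average of `u (z + b)` over the box minus the average of `u (z + b) - u
z`. The second average is of order `r` times the gradient; the first is a smoothing of `u`, and this
is the term that becomes small under weak convergence. -/
lemma lintegral_halfSpace_box_le {γ : ℝ} (hγ : 0 < γ) {Ω : Set (Pt n m)} (hΩ : IsOpen Ω)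
    {u : Pt n m → ℝ} {U : Pt n m → Vec n m} (h : H10Pair γ Ω u U) (hu : StronglyMeasurable u)
    {e : EuclideanSpace ℝ (Fin n)} (he : ‖e‖ = 1) {r : ℝ} (hr : 0 < r) :
    volume (avgBox m γ e r) ^ 2 * ∫⁻ z in Ω ∩ halfSpace e, ‖u z‖ₑ ^ 2 ≤
      volume (avgBox m γ e r) ^ 2 * (ENNReal.ofReal (40 * r ^ 2) * ∫⁻ z in Ω, ‖U z‖ₑ ^ 2) +
      2 * ∫⁻ z in Ω, ‖∫ b in avgBox m γ e r, Ω.indicator u (z + b)‖ₑ ^ 2 := by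
  set B := avgBox m γ e r
  have mB : MeasurableSet B := measurableSet_avgBox e r
  obtain ⟨B0, Bt⟩ := volume_avgBox_pos (m := m) (γ := γ) e hr
  set v := Ω.indicator u with hv
  have sv : StronglyMeasurable v := hu.indicator hΩ.measurableSet
  have mv : Measurable v := sv.measurable
  have v2 : MemLp v 2 volume := (memLp_indicator_iff_restrict hΩ.measurableSet).2 h.memLp
  have iv : ∀ z, IntegrableOn (fun b => v (z + b)) B := fun z => by
    have h1 : MemLp (fun b => v (z + b)) 2 volume :=
      v2.comp_measurePreserving (measurePreserving_add_left volume z)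
    have : IsFiniteMeasure (volume.restrict B) := isFiniteMeasure_restrict.2 Bt
    exact (h1.restrict B).integrable (by norm_num)
  have msub : Measurable fun p : Pt n m × Pt n m => ‖v (p.1 + p.2) - v p.1‖ₑ ^ 2 := by fun_prop
  have pt : ∀ z ∈ Ω, volume B ^ 2 * ‖u z‖ₑ ^ 2 ≤
      2 * (volume B * ∫⁻ b in B, ‖v (z + b) - v z‖ₑ ^ 2) + 2 * ‖∫ b in B, v (z + b)‖ₑ ^ 2 := by
    intro z hz
    have e1 : volume B * ‖u z‖ₑ ≤ (∫⁻ b in B, ‖v (z + b) - v z‖ₑ) + ‖∫ b in B, v (z + b)‖ₑ := by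
      have e2 : (volume B).toReal * v z = (∫ b in B, v (z + b)) - ∫ b in B, (v (z + b) - v z) := by
        rw [integral_sub (iv z) (integrableOn_const Bt), setIntegral_const, smul_eq_mul]
        simp [Measure.real]
      have e3 : volume B * ‖u z‖ₑ = ‖(volume B).toReal * v z‖ₑ := by
        rw [enorm_mul, Real.enorm_of_nonneg ENNReal.toReal_nonneg, ENNReal.ofReal_toReal Bt, hv,
          Set.indicator_of_mem hz]
      rw [e3, e2, add_comm]
      refine enorm_sub_le.trans ?_
      gcongr
      exact enorm_integral_le_lintegral_enorm _
    calc volume B ^ 2 * ‖u z‖ₑ ^ 2 = (volume B * ‖u z‖ₑ) ^ 2 := by rw [mul_pow]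
      _ ≤ _ := pow_le_pow_left' e1 2
      _ ≤ _ := ennreal_add_sq_le _ _
      _ ≤ _ := by
        gcongr
        refine (lintegral_sq_le _ ?_).trans_eq (by rw [Measure.restrict_apply_univ])
        exact Measurable.aemeasurable (by fun_prop)
  have mS : Measurable fun z => ‖∫ b in B, v (z + b)‖ₑ ^ 2 := by
    have : StronglyMeasurable fun z => ∫ b in B, v (z + b) := by
      refine StronglyMeasurable.integral_prod_right (f := fun z b => v (z + b)) ?_
      exact (mv.comp measurable_add).stronglyMeasurable
    exact this.measurable.enorm.pow_const 2
  rw [← lintegral_const_mul' _ _ (ENNReal.pow_ne_top Bt)]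
  refine (setLIntegral_mono' (hΩ.measurableSet.inter (measurableSet_halfSpace e))
    fun z hz => pt z hz.1).trans ?_
  rw [lintegral_add_right _ (mS.const_mul 2), lintegral_const_mul _ mS]
  gcongr
  · rw [lintegral_const_mul' _ _ (by simp), lintegral_const_mul' _ _ Bt]
    have : ∫⁻ z in Ω ∩ halfSpace e, ∫⁻ b in B, ‖v (z + b) - v z‖ₑ ^ 2 ≤
        ENNReal.ofReal (20 * r ^ 2) * (∫⁻ z in Ω, ‖U z‖ₑ ^ 2) * volume B := by
      refine (lintegral_mono_set Set.inter_subset_right).trans ?_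
      rw [lintegral_lintegral_swap msub.aemeasurable, ← setLIntegral_const]
      exact setLIntegral_mono' mB fun b hb => h.lintegral_translate_le hγ hΩ he hr hb
    calc _ ≤ 2 * (volume B * (ENNReal.ofReal (20 * r ^ 2) * (∫⁻ z in Ω, ‖U z‖ₑ ^ 2) * volume B)) := by
          gcongr
      _ = _ := by
          have : ENNReal.ofReal (40 * r ^ 2) = 2 * ENNReal.ofReal (20 * r ^ 2) := by
            rw [← ENNReal.ofReal_ofNat 2, ← ENNReal.ofReal_mul (by norm_num)]; congr 1; ring
          rw [this]
          ring
  · exact Set.inter_subset_left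

/-- Rellich's theorem: weak convergence with bounded gradients implies strong `L²` convergence. -/
lemma rellich_aux {γ : ℝ} (hγ : 0 < γ) {Ω : Set (Pt n m)} (hΩ : IsOpen Ω)
    (hb : Bornology.IsBounded Ω) {u : ℕ → Pt n m → ℝ} {U : ℕ → Pt n m → Vec n m}
    (h : ∀ k, H10Pair γ Ω (u k) (U k)) (hu : ∀ k, StronglyMeasurable (u k)) {C : ℝ}
    (hC : ∀ k, eLpNorm (U k) 2 (volume.restrict Ω) ≤ ENNReal.ofReal C)
    (hC' : ∀ k, eLpNorm (u k) 2 (volume.restrict Ω) ≤ ENNReal.ofReal C)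
    (hw : ∀ v, MemLp v 2 (volume.restrict Ω) →
      Tendsto (fun k => ∫ z in Ω, u k z * v z) atTop (𝓝 0))
    {e : EuclideanSpace ℝ (Fin n)} (he : ‖e‖ = 1) :
    Tendsto (fun k => ∫⁻ z in Ω ∩ halfSpace e, ‖u k z‖ₑ ^ 2) atTop (𝓝 0) := by
  set D := ENNReal.ofReal C ^ 2
  have Dt : D ≠ ⊤ := by simp [D]
  have key : ∀ r : ℝ, 0 < r → limsup (fun k => ∫⁻ z in Ω ∩ halfSpace e, ‖u k z‖ₑ ^ 2) atTop ≤
      ENNReal.ofReal (40 * r ^ 2) * D := by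
    intro r hr
    set B := avgBox m γ e r
    have mB : MeasurableSet B := measurableSet_avgBox e r
    obtain ⟨B0, Bt⟩ := volume_avgBox_pos (m := m) (γ := γ) e hr
    -- For fixed `z` the box integral is the pairing of `u k` with a fixed `L²` function, so it
    -- tends to zero by weak convergence. Cauchy–Schwarz bounds it uniformly in `z`, and `Ω` has
    -- finite measure.
    have tS : Tendsto (fun k => ∫⁻ z in Ω, ‖∫ b in B, Ω.indicator (u k) (z + b)‖ₑ ^ 2) atTop
        (𝓝 0) := by
      have e1 : ∀ k z, ∫ b in B, Ω.indicator (u k) (z + b) =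
          ∫ w in Ω, u k w * B.indicator 1 (w - z) := by
        intro k z
        rw [← integral_indicator mB, ← integral_indicator hΩ.measurableSet,
          ← integral_add_left_eq_self
            (Ω.indicator fun w => u k w * B.indicator 1 (w - z)) z]
        refine integral_congr_ae (Eventually.of_forall fun b => ?_)
        by_cases h1 : b ∈ B <;> by_cases h2 : z + b ∈ Ω <;> simp [h1, h2]
      have m2 : ∀ z, MemLp (fun w => B.indicator (1 : Pt n m → ℝ) (w - z)) 2
          (volume.restrict Ω) := by
        intro z
        have : MemLp (B.indicator (1 : Pt n m → ℝ)) 2 volume :=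
          memLp_indicator_const 2 mB 1 (Or.inr Bt)
        exact (this.comp_measurePreserving (measurePreserving_sub_right volume z)).restrict Ω
      have bd : ∀ k z, ‖∫ b in B, Ω.indicator (u k) (z + b)‖ₑ ^ 2 ≤ volume B * D := by
        intro k z
        have mv : Measurable (Ω.indicator (u k)) :=
          ((hu k).indicator hΩ.measurableSet).measurable
        calc ‖∫ b in B, Ω.indicator (u k) (z + b)‖ₑ ^ 2
            ≤ (∫⁻ b in B, ‖Ω.indicator (u k) (z + b)‖ₑ) ^ 2 :=
              pow_le_pow_left' (enorm_integral_le_lintegral_enorm _) 2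
          _ ≤ volume B * ∫⁻ b in B, ‖Ω.indicator (u k) (z + b)‖ₑ ^ 2 :=
              (lintegral_sq_le _ (Measurable.aemeasurable (by fun_prop))).trans_eq
                (by rw [Measure.restrict_apply_univ])
          _ ≤ volume B * ∫⁻ b, ‖Ω.indicator (u k) (z + b)‖ₑ ^ 2 := by
              gcongr; exact Measure.restrict_le_self
          _ = volume B * ∫⁻ b, ‖Ω.indicator (u k) b‖ₑ ^ 2 := by
              rw [lintegral_add_left_eq_self (fun b => ‖Ω.indicator (u k) b‖ₑ ^ 2) z]
          _ = volume B * eLpNorm (u k) 2 (volume.restrict Ω) ^ 2 := by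
              rw [← eLpNorm_two_sq, eLpNorm_indicator_eq_eLpNorm_restrict hΩ.measurableSet]
          _ ≤ _ := mul_le_mul_right (pow_le_pow_left' (hC' k) 2) _
      have := tendsto_lintegral_of_dominated_convergence' (μ := volume.restrict Ω)
        (F := fun k z => ‖∫ b in B, Ω.indicator (u k) (z + b)‖ₑ ^ 2) (f := fun _ => 0)
        (fun _ => volume B * D) (fun k => ?_) (fun k => Eventually.of_forall (bd k)) ?_
        (Eventually.of_forall fun z => ?_)
      · simpa using this
      · have mv : Measurable (Ω.indicator (u k)) :=
          ((hu k).indicator hΩ.measurableSet).measurable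
        have : StronglyMeasurable fun z => ∫ b in B, Ω.indicator (u k) (z + b) := by
          refine StronglyMeasurable.integral_prod_right (f := fun z b => Ω.indicator (u k) (z + b)) ?_
          exact (mv.comp measurable_add).stronglyMeasurable
        exact (this.measurable.enorm.pow_const 2).aemeasurable
      · rw [lintegral_const, Measure.restrict_apply_univ]
        exact ENNReal.mul_ne_top (ENNReal.mul_ne_top Bt Dt) hb.measure_lt_top.ne
      · simp only [e1]
        simpa using ENNReal.Tendsto.pow (n := 2) (hw _ (m2 z)).enorm
    have hle : ∀ k, ∫⁻ z in Ω ∩ halfSpace e, ‖u k z‖ₑ ^ 2 ≤ ENNReal.ofReal (40 * r ^ 2) * D +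
        (volume B ^ 2)⁻¹ * (2 * ∫⁻ z in Ω, ‖∫ b in B, Ω.indicator (u k) (z + b)‖ₑ ^ 2) := by
      intro k
      have h1 := lintegral_halfSpace_box_le hγ hΩ (h k) (hu k) he hr
      have B20 : volume B ^ 2 ≠ 0 := by simpa using B0
      have B2t : volume B ^ 2 ≠ ⊤ := ENNReal.pow_ne_top Bt
      have h2 := mul_le_mul_right h1 ((volume B ^ 2)⁻¹)
      rw [mul_add, ← mul_assoc, ← mul_assoc, ENNReal.inv_mul_cancel B20 B2t, one_mul, one_mul] at h2
      refine h2.trans ?_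
      gcongr
      rw [← eLpNorm_two_sq]
      exact pow_le_pow_left' (hC k) 2
    have t1 := (ENNReal.Tendsto.const_mul (a := (volume B ^ 2)⁻¹)
      (ENNReal.Tendsto.const_mul (a := 2) tS (Or.inr (by simp)))
      (Or.inr (ENNReal.inv_ne_top.2 (pow_ne_zero 2 B0)))).const_add (ENNReal.ofReal (40 * r ^ 2) * D)
    refine (limsup_le_limsup (Eventually.of_forall hle)).trans ?_
    rw [t1.limsup_eq]
    simp
  -- For fixed `r` only the oscillation term of order `r ^ 2` survives the limit in `k`; it
  -- disappears as `r` tends to zero.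
  have tr : Tendsto (fun r : ℝ => ENNReal.ofReal (40 * r ^ 2) * D) (𝓝[>] 0) (𝓝 0) := by
    have h1 : Tendsto (fun r : ℝ => ENNReal.ofReal (40 * r ^ 2)) (𝓝[>] 0) (𝓝 0) := by
      have : Continuous fun r : ℝ => ENNReal.ofReal (40 * r ^ 2) :=
        ENNReal.continuous_ofReal.comp (by fun_prop)
      simpa using (this.tendsto 0).mono_left nhdsWithin_le_nhds
    simpa using ENNReal.Tendsto.mul_const h1 (Or.inr Dt)
  have hl : limsup (fun k => ∫⁻ z in Ω ∩ halfSpace e, ‖u k z‖ₑ ^ 2) atTop ≤ 0 :=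
    ge_of_tendsto tr (eventually_mem_nhdsWithin.mono fun r hr => key r hr)
  exact tendsto_of_le_liminf_of_limsup_le zero_le hl

/-- Compactness in `H¹_{0,γ}(Ω)`: a sequence with bounded gradients has a subsequence converging
in `L²(Ω)` and almost everywhere, with weakly convergent gradients. -/
theorem exists_compact_subseq (hn : 1 ≤ n) (hm : 1 ≤ m) {γ : ℝ} (hγ : 0 < γ) {Ω : Set (Pt n m)}
    (hΩ : IsOpen Ω) (hb : Bornology.IsBounded Ω) {u : ℕ → Pt n m → ℝ}
    {U : ℕ → Pt n m → Vec n m} (h : ∀ k, H10Pair γ Ω (u k) (U k)) {C : ℝ}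
    (hU : ∀ k, eLpNorm (U k) 2 (volume.restrict Ω) ≤ ENNReal.ofReal C) :
    ∃ (u₀ : Pt n m → ℝ) (U₀ : Pt n m → Vec n m) (s : ℕ → ℕ), StrictMono s ∧ H10Pair γ Ω u₀ U₀ ∧
      Tendsto (fun k => eLpNorm (fun z => u (s k) z - u₀ z) 2 (volume.restrict Ω)) atTop (𝓝 0) ∧
      (∀ᵐ z ∂volume.restrict Ω, Tendsto (fun k => u (s k) z) atTop (𝓝 (u₀ z))) ∧
      ∀ V, MemLp V 2 (volume.restrict Ω) →
        Tendsto (fun k => ∫ z in Ω, inner ℝ (U (s k) z) (V z)) atTop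
          (𝓝 (∫ z in Ω, inner ℝ (U₀ z) (V z))) := by
  obtain ⟨K, hK, hP⟩ := exists_poincare hn hm hγ hΩ hb
  set C1 := max C 0
  have hC1 : ∀ k, eLpNorm (U k) 2 (volume.restrict Ω) ≤ ENNReal.ofReal C1 := fun k =>
    (hU k).trans (ENNReal.ofReal_le_ofReal (le_max_left _ _))
  set C2 := max C1 (K * C1)
  have hU2 : ∀ k, eLpNorm (U k) 2 (volume.restrict Ω) ≤ ENNReal.ofReal C2 := fun k =>
    (hC1 k).trans (ENNReal.ofReal_le_ofReal (le_max_left _ _))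
  have hu2 : ∀ k, eLpNorm (u k) 2 (volume.restrict Ω) ≤ ENNReal.ofReal C2 := fun k => by
    refine (hP _ _ (h k)).trans ?_
    refine (mul_le_mul_right (hC1 k) _).trans ?_
    rw [← ENNReal.ofReal_mul hK.le]
    exact ENNReal.ofReal_le_ofReal (le_max_right _ _)
  obtain ⟨u₀, U₀, s, hs, h₀, hw, hW⟩ := exists_weak_subseq_h10 hγ h hu2 hU2
  have hd : ∀ k, H10Pair γ Ω (fun z => u (s k) z - u₀ z) (fun z => U (s k) z - U₀ z) := fun k =>
    (h (s k)).sub hγ h₀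
  set v : ℕ → Pt n m → ℝ := fun k => (hd k).memLp.1.mk _ with hv
  have hvm : ∀ k, StronglyMeasurable (v k) := fun k => (hd k).memLp.1.stronglyMeasurable_mk
  have hvae : ∀ k, (fun z => u (s k) z - u₀ z) =ᵐ[volume.restrict Ω] v k := fun k =>
    (hd k).memLp.1.ae_eq_mk
  have hvp : ∀ k, H10Pair γ Ω (v k) (fun z => U (s k) z - U₀ z) := fun k =>
    (hd k).congr (hvae k) (ae_eq_refl _)
  set C3 := C2 + (eLpNorm U₀ 2 (volume.restrict Ω)).toReal
  have C20 : 0 ≤ C2 := le_trans (le_max_right C 0) (le_max_left _ _)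
  have hV3 : ∀ k, eLpNorm (fun z => U (s k) z - U₀ z) 2 (volume.restrict Ω) ≤
      ENNReal.ofReal C3 := fun k => by
    refine (eLpNorm_sub_le (h (s k)).memLp_grad.1 h₀.memLp_grad.1 (by norm_num)).trans ?_
    rw [ENNReal.ofReal_add C20 ENNReal.toReal_nonneg, ENNReal.ofReal_toReal h₀.memLp_grad.2.ne]
    gcongr
    exact hU2 _
  set C4 := max C3 (K * C3)
  have hV4 : ∀ k, eLpNorm (fun z => U (s k) z - U₀ z) 2 (volume.restrict Ω) ≤
      ENNReal.ofReal C4 := fun k => (hV3 k).trans (ENNReal.ofReal_le_ofReal (le_max_left _ _))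
  have hv4 : ∀ k, eLpNorm (v k) 2 (volume.restrict Ω) ≤ ENNReal.ofReal C4 := fun k => by
    refine (hP _ _ (hvp k)).trans ((mul_le_mul_right (hV3 k) _).trans ?_)
    rw [← ENNReal.ofReal_mul hK.le]
    exact ENNReal.ofReal_le_ofReal (le_max_right _ _)
  have hw0 : ∀ w, MemLp w 2 (volume.restrict Ω) →
      Tendsto (fun k => ∫ z in Ω, v k z * w z) atTop (𝓝 0) := by
    intro w hwm
    have e1 : ∀ k, ∫ z in Ω, v k z * w z = (∫ z in Ω, u (s k) z * w z) - ∫ z in Ω, u₀ z * w z := by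
      intro k
      rw [← integral_sub (integrable_mul_L2 (h (s k)).memLp hwm) (integrable_mul_L2 h₀.memLp hwm)]
      refine integral_congr_ae ?_
      filter_upwards [hvae k] with z hz
      rw [← hz]; simp [sub_mul]
    simp only [e1]
    simpa using (hw w hwm).sub_const (∫ z in Ω, u₀ z * w z)
  obtain ⟨i⟩ : Nonempty (Fin n) := ⟨⟨0, hn⟩⟩
  set e : EuclideanSpace ℝ (Fin n) := EuclideanSpace.single i 1
  have he : ‖e‖ = 1 := by simp [e]
  have t1 := rellich_aux hγ hΩ hb hvp hvm hV4 hv4 hw0 he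
  have t2 := rellich_aux hγ hΩ hb hvp hvm hV4 hv4 hw0 (e := -e) (by simpa using he)
  have t3 : Tendsto (fun k => eLpNorm (v k) 2 (volume.restrict Ω) ^ 2) atTop (𝓝 0) := by
    refine tendsto_of_tendsto_of_tendsto_of_le_of_le tendsto_const_nhds
      (by simpa using t1.add t2) (fun _ => zero_le) fun k => ?_
    simp only []
    rw [eLpNorm_two_sq]
    calc ∫⁻ z in Ω, ‖v k z‖ₑ ^ 2 =
          ∫⁻ z in (Ω ∩ halfSpace e) ∪ (Ω ∩ halfSpace (-e)), ‖v k z‖ₑ ^ 2 := by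
          rw [← Set.inter_union_distrib_left, halfSpace_union, Set.inter_univ]
      _ ≤ _ := lintegral_union_le _ _ _
  have t4 : Tendsto (fun k => eLpNorm (fun z => u (s k) z - u₀ z) 2 (volume.restrict Ω)) atTop
      (𝓝 0) := by
    have := t3.ennrpow_const (1 / 2)
    simp only [← ENNReal.rpow_two, ← ENNReal.rpow_mul] at this
    norm_num at this
    refine this.congr fun k => ?_
    exact eLpNorm_congr_ae (hvae k).symm
  obtain ⟨s', hs', hae⟩ := exists_subseq_ae (fun k => (h (s k)).memLp.1) h₀.memLp.1 t4
  exact ⟨u₀, U₀, s ∘ s', hs.comp hs', h₀, t4.comp hs'.tendsto_atTop, hae,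
    fun V hV => (hW V hV).comp hs'.tendsto_atTop⟩

/-! ### Mollification in the presence of the degenerate weight, and approximation by test functions.
-/

instance : (volume : Measure (Pt n m)).IsNegInvariant :=
  Measure.IsAddHaarMeasure.isNegInvariant_of_regular _

lemma exists_cutoff {Ω K : Set (Pt n m)} (hΩ : IsOpen Ω) (hK : IsCompact K) (hKΩ : K ⊆ Ω) :
    ∃ ζ : Pt n m → ℝ, IsTest Ω ζ ∧ (∀ᶠ z in 𝓝ˢ K, ζ z = 1) ∧ ∀ z, 0 ≤ ζ z ∧ ζ z ≤ 1 := by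
  obtain ⟨L, hL, hKL, hLΩ⟩ := exists_compact_between hK hΩ hKΩ
  obtain ⟨f, h1, h2, h3⟩ := exists_contMDiffMap_one_nhds_of_subset_interior
    (modelWithCornersSelf ℝ (Pt n m)) (n := (⊤ : ℕ∞)) hK.isClosed hKL
  have hs : tsupport f ⊆ L := closure_minimal (fun z hz => by
    by_contra h; exact hz (h2 z h)) hL.isClosed
  exact ⟨f, ⟨f.contMDiff.contDiff, HasCompactSupport.intro hL h2, hs.trans hLΩ⟩, h1, h3⟩

/-- Smooth probability densities supported in the ball of radius `r`. -/
structure IsMollifier (r : ℝ) (ρ : Pt n m → ℝ) : Prop where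
  smooth : ContDiff ℝ ∞ ρ
  nonneg : ∀ z, 0 ≤ ρ z
  integral : ∫ z, ρ z = 1
  supp : ∀ z, ρ z ≠ 0 → ‖z‖ < r

lemma IsMollifier.compact {r : ℝ} {ρ : Pt n m → ℝ} (h : IsMollifier r ρ) : HasCompactSupport ρ := by
  refine HasCompactSupport.intro (isCompact_closedBall 0 r) fun z hz => ?_
  by_contra hc
  exact hz (by simpa using (h.supp z hc).le)

lemma IsMollifier.mono {r r' : ℝ} {ρ : Pt n m → ℝ} (h : IsMollifier r ρ) (hr : r ≤ r') :
    IsMollifier r' ρ := ⟨h.1, h.2, h.3, fun z hz => (h.supp z hz).trans_le hr⟩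

lemma IsMollifier.integrable {r : ℝ} {ρ : Pt n m → ℝ} (h : IsMollifier r ρ) : Integrable ρ :=
  h.smooth.continuous.integrable_of_hasCompactSupport h.compact

lemma IsMollifier.lintegral {r : ℝ} {ρ : Pt n m → ℝ} (h : IsMollifier r ρ) :
    ∫⁻ z, ‖ρ z‖ₑ = 1 := by
  have := ofReal_integral_eq_lintegral_ofReal h.integrable (Eventually.of_forall h.nonneg)
  rw [h.integral] at this
  simp only [ENNReal.ofReal_one] at this
  rw [this]
  exact lintegral_congr fun z => Real.enorm_of_nonneg (h.nonneg z)

/-- The convolution of `v` and `ρ`. -/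
def smoothing (ρ v : Pt n m → ℝ) (z : Pt n m) : ℝ := ∫ t, v t * ρ (z - t)

lemma smoothing_eq_convolution (ρ v : Pt n m → ℝ) :
    smoothing ρ v = MeasureTheory.convolution v ρ (ContinuousLinearMap.mul ℝ ℝ) volume := rfl

lemma IsMollifier.contDiff_smoothing {r : ℝ} {ρ v : Pt n m → ℝ} (h : IsMollifier r ρ)
    (hv : LocallyIntegrable v) : ContDiff ℝ ∞ (smoothing ρ v) := by
  rw [smoothing_eq_convolution]
  exact h.compact.contDiff_convolution_right _ hv h.smooth

lemma IsMollifier.contDiff_one {r : ℝ} {ρ : Pt n m → ℝ} (h : IsMollifier r ρ) :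
    ContDiff ℝ 1 ρ := h.smooth.of_le (by exact_mod_cast le_top)

lemma IsMollifier.fderiv_smoothing {r : ℝ} {ρ v : Pt n m → ℝ} (h : IsMollifier r ρ)
    (hv : LocallyIntegrable v) (z a : Pt n m) :
    fderiv ℝ (smoothing ρ v) z a = ∫ t, v t * fderiv ℝ ρ (z - t) a := by
  rw [smoothing_eq_convolution,
    (h.compact.hasFDerivAt_convolution_right _ hv h.contDiff_one z).fderiv,
    convolution_precompR_apply _ hv (h.compact.fderiv ℝ)
      (h.contDiff_one.continuous_fderiv one_ne_zero)]
  rfl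

lemma smoothing_nonneg {r : ℝ} {ρ v : Pt n m → ℝ} (h : IsMollifier r ρ) (hv : ∀ᵐ z, 0 ≤ v z)
    (z : Pt n m) : 0 ≤ smoothing ρ v z :=
  integral_nonneg_of_ae (hv.mono fun _ ht => mul_nonneg ht (h.nonneg _))

lemma abs_smoothing_le {r : ℝ} {ρ v : Pt n m → ℝ} (h : IsMollifier r ρ) {M : ℝ}
    (hv : ∀ᵐ z, |v z| ≤ M) (z : Pt n m) : |smoothing ρ v z| ≤ M := by
  have h1 : ∫ t, M * ρ (z - t) = M := by
    rw [integral_const_mul, integral_sub_left_eq_self (fun t => ρ t) volume z, h.integral, mul_one]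
  rw [← h1]
  refine norm_integral_le_of_norm_le (f := fun t => v t * ρ (z - t))
    ((h.integrable.comp_sub_left z).const_mul M) (hv.mono fun t ht => ?_)
  rw [norm_mul, Real.norm_of_nonneg (h.nonneg _)]
  exact mul_le_mul_of_nonneg_right ht (h.nonneg _)

lemma smoothing_eq_zero {r : ℝ} {ρ v : Pt n m → ℝ} (h : IsMollifier r ρ) {K : Set (Pt n m)}
    (hv : ∀ z, z ∉ K → v z = 0) {z : Pt n m} (hz : z ∉ Metric.cthickening r K) :
    smoothing ρ v z = 0 := by
  refine integral_eq_zero_of_ae (Eventually.of_forall fun t => ?_)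
  simp only [Pi.zero_apply, mul_eq_zero]
  by_contra! hc
  have ht : t ∈ K := by by_contra h'; exact hc.1 (hv t h')
  refine hz (Metric.mem_cthickening_of_dist_le z t r K ht ?_)
  rw [dist_eq_norm]
  exact (h.supp _ hc.2).le

lemma tendsto_eLpNorm_translate {X : Type*} [NormedAddCommGroup X] [MeasurableSpace X]
    [BorelSpace X] [SecondCountableTopology X] {μ : Measure X} [μ.IsAddLeftInvariant]
    [IsLocallyFiniteMeasure μ] [μ.InnerRegularCompactLTTop] {v : X → ℝ} (hv : MemLp v 2 μ) :
    Tendsto (fun s => eLpNorm (fun z => v (s + z) - v z) 2 μ) (𝓝 0) (𝓝 0) := by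
  let τ : C(X, C(X, X)) := (ContinuousMap.mk (fun a : X × X => a.1 + a.2) continuous_add).curry
  have hτ : ∀ s, MeasurePreserving (τ s) μ μ := fun s => measurePreserving_add_left μ s
  have hc : Continuous fun s : X => Lp.compMeasurePreserving (τ s) (hτ s) (hv.toLp v) :=
    (continuous_const (y := hv.toLp v)).compMeasurePreservingLp τ.continuous hτ (by simp)
  have h2 := ((hc.sub (continuous_const (y := hv.toLp v))).enorm).tendsto 0
  have key : ∀ s, ‖Lp.compMeasurePreserving (τ s) (hτ s) (hv.toLp v) - hv.toLp v‖ₑ =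
      eLpNorm (fun z => v (s + z) - v z) 2 μ := by
    intro s
    rw [Lp.toLp_compMeasurePreserving hv, ← MemLp.toLp_sub, Lp.enorm_toLp]
    rfl
  have h3 := h2.congr key
  rw [Pi.sub_apply, key 0] at h3
  simpa using h3

lemma tendsto_translate_L2 {v : Pt n m → ℝ} (hv : MemLp v 2 volume) :
    Tendsto (fun s => eLpNorm (fun z => v (s + z) - v z) 2 volume) (𝓝 0) (𝓝 0) :=
  tendsto_eLpNorm_translate hv

/-- Mollification converges in `L²`. -/
lemma eventually_smoothing_close {v : Pt n m → ℝ} (hv : MemLp v 2 volume) (hm : Measurable v)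
    {η : ℝ≥0∞} (hη : 0 < η) :
    ∃ r₀ : ℝ, 0 < r₀ ∧ ∀ ρ : Pt n m → ℝ, IsMollifier r₀ ρ →
      eLpNorm (fun z => smoothing ρ v z - v z) 2 volume ≤ η := by
  obtain ⟨r₀, hr₀, hb⟩ := Metric.eventually_nhds_iff.1
    ((tendsto_translate_L2 hv).eventually (eventually_le_nhds hη))
  refine ⟨r₀, hr₀, fun ρ hρ => ?_⟩
  have mρ : Measurable ρ := hρ.smooth.continuous.measurable
  have e1 : ∀ z, smoothing ρ v z - v z = ∫ s, ρ s * (v (-s + z) - v z) := by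
    intro z
    have i1 : Integrable fun s => ρ s * v (-s + z) := by
      have h2 : MemLp (fun s => v (-s + z)) 2 volume := by
        have := hv.comp_measurePreserving (Measure.measurePreserving_sub_left volume z)
        refine this.congr_norm (hm.comp (by fun_prop)).aestronglyMeasurable (Eventually.of_forall fun s => ?_)
        simp [neg_add_eq_sub]
      exact integrable_mul_L2 (hρ.smooth.continuous.memLp_of_hasCompactSupport hρ.compact) h2
    have i2 : Integrable fun s => ρ s * v z := hρ.integrable.mul_const _
    simp only [mul_sub]
    rw [integral_sub i1 i2, integral_mul_const, hρ.integral, one_mul]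
    congr 1
    rw [smoothing, ← integral_sub_left_eq_self _ volume z]
    refine integral_congr_ae (Eventually.of_forall fun s => ?_)
    simp [neg_add_eq_sub, mul_comm]
  have h2 : eLpNorm (fun z => smoothing ρ v z - v z) 2 volume ^ 2 ≤ η ^ 2 := by
    rw [eLpNorm_two_sq]
    calc ∫⁻ z, ‖smoothing ρ v z - v z‖ₑ ^ 2
        ≤ ∫⁻ z, ∫⁻ s, ‖ρ s‖ₑ * ‖v (-s + z) - v z‖ₑ ^ 2 := by
          refine lintegral_mono fun z => ?_
          rw [e1]
          refine (pow_le_pow_left' (enorm_integral_le_lintegral_enorm _) 2).trans ?_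
          -- Cauchy–Schwarz with the density split as `√ρ · √ρ`, that is, Jensen's inequality for
          -- the probability density `ρ`.
          have h3 := lintegral_mul_sq_le volume (f := fun s => ‖ρ s‖ₑ ^ (1 / 2 : ℝ))
            (g := fun s => ‖ρ s‖ₑ ^ (1 / 2 : ℝ) * ‖v (-s + z) - v z‖ₑ)
            (Measurable.aemeasurable (by fun_prop)) (Measurable.aemeasurable (by fun_prop))
          have hh : ∀ a : ℝ≥0∞, (a ^ (1 / 2 : ℝ)) ^ 2 = a := fun a => by
            rw [← ENNReal.rpow_two, ← ENNReal.rpow_mul]; norm_num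
          have hh' : ∀ a : ℝ≥0∞, a ^ (1 / 2 : ℝ) * a ^ (1 / 2 : ℝ) = a := fun a => by
            rw [← sq, hh]
          simp only [mul_pow, hh, ← mul_assoc, hh', hρ.lintegral, one_mul] at h3
          simpa only [enorm_mul] using h3
      _ = ∫⁻ s, ∫⁻ z, ‖ρ s‖ₑ * ‖v (-s + z) - v z‖ₑ ^ 2 := by
          refine lintegral_lintegral_swap (Measurable.aemeasurable ?_)
          simp only [Function.uncurry_def]
          fun_prop
      _ = ∫⁻ s, ‖ρ s‖ₑ * eLpNorm (fun z => v (-s + z) - v z) 2 volume ^ 2 := by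
          refine lintegral_congr fun s => ?_
          rw [lintegral_const_mul' _ _ enorm_ne_top, eLpNorm_two_sq]
      _ ≤ ∫⁻ s, ‖ρ s‖ₑ * η ^ 2 := by
          refine lintegral_mono fun s => ?_
          by_cases hs : ρ s = 0
          · simp [hs]
          · gcongr
            refine hb ?_
            simpa using hρ.supp s hs
      _ = η ^ 2 := by
          rw [lintegral_mul_const _ (by fun_prop), hρ.lintegral, one_mul]
  exact (ENNReal.pow_le_pow_left_iff two_ne_zero).1 h2

/-- A simple case of Young's convolution inequality. -/
lemma lintegral_conv_sq_le {k f : Pt n m → ℝ≥0∞} (hk : Measurable k) (hf : Measurable f) :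
    ∫⁻ z, (∫⁻ t, f t * k (z - t)) ^ 2 ≤ (∫⁻ z, k z) ^ 2 * ∫⁻ t, f t ^ 2 := by
  calc ∫⁻ z, (∫⁻ t, f t * k (z - t)) ^ 2
      ≤ ∫⁻ z, (∫⁻ t, k t) * ∫⁻ t, k (z - t) * f t ^ 2 := by
        refine lintegral_mono fun z => ?_
        have h3 := lintegral_mul_sq_le volume (f := fun t => k (z - t) ^ (1 / 2 : ℝ))
          (g := fun t => k (z - t) ^ (1 / 2 : ℝ) * f t)
          (Measurable.aemeasurable (by fun_prop)) (Measurable.aemeasurable (by fun_prop))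
        have hh : ∀ a : ℝ≥0∞, (a ^ (1 / 2 : ℝ)) ^ 2 = a := fun a => by
          rw [← ENNReal.rpow_two, ← ENNReal.rpow_mul]; norm_num
        have hh' : ∀ a : ℝ≥0∞, a ^ (1 / 2 : ℝ) * a ^ (1 / 2 : ℝ) = a := fun a => by
          rw [← sq, hh]
        simp only [mul_pow, hh, ← mul_assoc, hh'] at h3
        rw [lintegral_sub_left_eq_self k z] at h3
        simpa only [mul_comm (k _) (f _)] using h3
    _ = (∫⁻ t, k t) * ∫⁻ t, ∫⁻ z, k (z - t) * f t ^ 2 := by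
        rw [lintegral_const_mul _ (by
          refine Measurable.lintegral_prod_right' (f := fun p : Pt n m × Pt n m =>
            k (p.1 - p.2) * f p.2 ^ 2) (by fun_prop)), lintegral_lintegral_swap]
        refine Measurable.aemeasurable ?_
        simp only [Function.uncurry_def]
        fun_prop
    _ = (∫⁻ t, k t) * ∫⁻ t, (∫⁻ z, k z) * f t ^ 2 := by
        congr 1
        refine lintegral_congr fun t => ?_
        rw [lintegral_mul_const _ (by fun_prop), lintegral_sub_right_eq_self k t]
    _ = _ := by
        rw [lintegral_const_mul _ (by fun_prop)]; ring

/-- Anisotropic mollifiers: for a fixed function with compact support the commutator with the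
degenerate weight can be made small by taking the width in `x` much smaller than that in `y`. -/
lemma exists_mollifier_commutator {γ : ℝ} (hγ : 0 < γ) {v : Pt n m → ℝ} (hv : MemLp v 2 volume)
    (hm : Measurable v) {R : ℝ} (hR : ∀ z, v z ≠ 0 → ‖z‖ ≤ R) {r : ℝ} (hr : 0 < r) {η : ℝ≥0∞}
    (hη : 0 < η) :
    ∃ ρ : Pt n m → ℝ, IsMollifier r ρ ∧ ∀ j : Fin m,
      eLpNorm (fun z => ∫ t, (1 + γ) * (‖z.1‖ ^ γ - ‖t.1‖ ^ γ) *
        (v t * fderiv ℝ ρ (z - t) (0, EuclideanSpace.single j 1))) 2 volume ≤ η := by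
  set r1 := min r 1 with hr1
  have r10 : 0 < r1 := lt_min hr one_pos
  let b : ContDiffBump (0 : EuclideanSpace ℝ (Fin m)) := ⟨r1 / 2, r1, by linarith, by linarith⟩
  set B := b.normed volume with hB
  have cB : ContDiff ℝ ∞ B := b.contDiff_normed
  have dB : Differentiable ℝ B := cB.differentiable (by simp)
  -- The `y`-profile `B` is fixed before the width in `x`: the `y`-derivative of the kernel then has
  -- `L¹` norm `N j`, whatever the nonnegative `x`-profile of mass one.
  set N : Fin m → ℝ≥0∞ := fun j => ∫⁻ y, ‖fderiv ℝ B y (EuclideanSpace.single j 1)‖ₑ with hN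
  have cdB : ∀ j, Continuous fun y => fderiv ℝ B y (EuclideanSpace.single j 1) := fun j =>
    (cB.continuous_fderiv (by simp)).clm_apply continuous_const
  have Nt : ∀ j, N j ≠ ⊤ := fun j => by
    have : Integrable fun y => fderiv ℝ B y (EuclideanSpace.single j 1) :=
      (cdB j).integrable_of_hasCompactSupport
        (((b.hasCompactSupport_normed (μ := volume)).fderiv ℝ).comp_left
          (g := fun L : EuclideanSpace ℝ (Fin m) →L[ℝ] ℝ => L (EuclideanSpace.single j 1)) rfl)
    exact this.2.ne
  set T : ℝ := ∑ j, (N j).toReal with hT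
  have NT : ∀ j, N j ≤ ENNReal.ofReal T := fun j => by
    rw [← ENNReal.ofReal_toReal (Nt j)]
    exact ENNReal.ofReal_le_ofReal (Finset.single_le_sum
      (f := fun j => (N j).toReal) (fun _ _ => ENNReal.toReal_nonneg) (Finset.mem_univ j))
  have T0 : 0 ≤ T := Finset.sum_nonneg fun _ _ => ENNReal.toReal_nonneg
  set V := eLpNorm v 2 volume with hV
  have Vt : V ≠ ⊤ := hv.2.ne
  -- `w₀` is the tolerated oscillation of the weight. Young's inequality bounds the commutator by
  -- `w₀` times `N j` times the norm of `v`.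
  obtain ⟨w₀, hw, hwη⟩ : ∃ w₀ : ℝ, 0 < w₀ ∧ ENNReal.ofReal w₀ * (ENNReal.ofReal T * V) ≤ η := by
    have ht : Tendsto (fun w₀ : ℝ => ENNReal.ofReal w₀ * (ENNReal.ofReal T * V)) (𝓝[>] 0) (𝓝 0) := by
      have : Tendsto (fun w₀ : ℝ => ENNReal.ofReal w₀) (𝓝[>] 0) (𝓝 0) := by
        simpa using (ENNReal.continuous_ofReal.tendsto 0).mono_left nhdsWithin_le_nhds
      simpa using ENNReal.Tendsto.mul_const this
        (Or.inr (ENNReal.mul_ne_top ENNReal.ofReal_ne_top Vt))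
    obtain ⟨w₀, h1, h2⟩ := ((ht.eventually (eventually_le_nhds hη)).and
      eventually_mem_nhdsWithin).exists
    exact ⟨w₀, h2, h1⟩
  have hcpt : IsCompact (Metric.closedBall (0 : EuclideanSpace ℝ (Fin n)) (R + 1)) :=
    isCompact_closedBall 0 _
  have hunif := hcpt.uniformContinuousOn_of_continuous (f := fun x => (1 + γ) * ‖x‖ ^ γ)
    (continuous_const.mul (continuous_norm.rpow_const fun _ => Or.inr hγ.le)).continuousOn
  obtain ⟨ε₀, hε₀, hmod⟩ := Metric.uniformContinuousOn_iff.1 hunif w₀ hw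
  -- The width in `x` is chosen last, so small that the weight varies by less than `w₀` over the
  -- reach of the kernel. The ball of radius `R + 1` contains all relevant points because `ε ≤ 1`.
  set ε := min ε₀ r1 with hε
  have ε0 : 0 < ε := lt_min hε₀ r10
  let a : ContDiffBump (0 : EuclideanSpace ℝ (Fin n)) := ⟨ε / 2, ε, by linarith, by linarith⟩
  set A := a.normed volume with hA
  have cA : ContDiff ℝ ∞ A := a.contDiff_normed
  set ρ : Pt n m → ℝ := fun z => A z.1 * B z.2 with hρ
  have cρ : ContDiff ℝ ∞ ρ := (cA.comp contDiff_fst).mul (cB.comp contDiff_snd)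
  have sA : ∀ x, A x ≠ 0 → ‖x‖ < ε := fun x hx => by
    have : x ∈ Function.support A := hx
    rw [hA, a.support_normed_eq] at this
    simpa using this
  have sB : ∀ y, B y ≠ 0 → ‖y‖ < r1 := fun y hy => by
    have : y ∈ Function.support B := hy
    rw [hB, b.support_normed_eq] at this
    simpa using this
  have mol : IsMollifier r ρ := by
    refine ⟨cρ, fun z => mul_nonneg (a.nonneg_normed _) (b.nonneg_normed _), ?_, fun z hz => ?_⟩
    · rw [hρ, Measure.volume_eq_prod, integral_prod_mul A B, a.integral_normed, b.integral_normed,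
        one_mul]
    · have h1 := sA z.1 (left_ne_zero_of_mul hz)
      have h2 := sB z.2 (right_ne_zero_of_mul hz)
      rw [Prod.norm_def, max_lt_iff]
      exact ⟨(h1.trans_le (min_le_right _ _)).trans_le (min_le_left _ _),
        h2.trans_le (min_le_left _ _)⟩
  have dρ : ∀ (z : Pt n m) (j : Fin m), fderiv ℝ ρ z (0, EuclideanSpace.single j 1) =
      A z.1 * fderiv ℝ B z.2 (EuclideanSpace.single j 1) := by
    intro z j
    have h1 : HasFDerivAt (fun z : Pt n m => A z.1)
        ((fderiv ℝ A z.1).comp (ContinuousLinearMap.fst ℝ _ _)) z :=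
      ((cA.differentiable (by simp)) z.1).hasFDerivAt.comp z hasFDerivAt_fst
    have h2 : HasFDerivAt (fun z : Pt n m => B z.2)
        ((fderiv ℝ B z.2).comp (ContinuousLinearMap.snd ℝ _ _)) z :=
      (dB z.2).hasFDerivAt.comp z hasFDerivAt_snd
    rw [show fderiv ℝ ρ z = _ from (h1.mul h2).fderiv]
    simp
  refine ⟨ρ, mol, fun j => ?_⟩
  set k : Pt n m → ℝ≥0∞ := fun z => ‖fderiv ℝ ρ z (0, EuclideanSpace.single j 1)‖ₑ with hk
  have ck : Continuous fun z => fderiv ℝ ρ z (0, EuclideanSpace.single j 1) :=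
    (cρ.continuous_fderiv (by simp)).clm_apply continuous_const
  have mk : Measurable k := ck.enorm.measurable
  have ik : ∫⁻ z, k z = N j := by
    have h1 : ∀ z : Pt n m, k z = ‖A z.1‖ₑ * ‖fderiv ℝ B z.2 (EuclideanSpace.single j 1)‖ₑ :=
      fun z => by simp only [hk]; rw [dρ, enorm_mul]
    have mA : Measurable fun x => ‖A x‖ₑ := cA.continuous.enorm.measurable
    have h2 : ∫⁻ x, ‖A x‖ₑ = 1 := by
      have := ofReal_integral_eq_lintegral_ofReal (a.integrable_normed (μ := volume))
        (Eventually.of_forall a.nonneg_normed)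
      rw [a.integral_normed, ENNReal.ofReal_one] at this
      rw [this]
      exact lintegral_congr fun z => Real.enorm_of_nonneg (a.nonneg_normed z)
    simp_rw [h1]
    rw [Measure.volume_eq_prod, lintegral_prod_mul mA.aemeasurable
      (cdB j).enorm.measurable.aemeasurable, h2, one_mul]
  have bound : ∀ z, ‖∫ t, (1 + γ) * (‖z.1‖ ^ γ - ‖t.1‖ ^ γ) *
        (v t * fderiv ℝ ρ (z - t) (0, EuclideanSpace.single j 1))‖ₑ ≤
      ENNReal.ofReal w₀ * ∫⁻ t, ‖v t‖ₑ * k (z - t) := by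
    intro z
    rw [← lintegral_const_mul' _ _ ENNReal.ofReal_ne_top]
    refine (enorm_integral_le_lintegral_enorm _).trans (lintegral_mono fun t => ?_)
    rw [enorm_mul, enorm_mul]
    by_cases h0 : ‖v t‖ₑ * k (z - t) = 0
    · have : ‖v t‖ₑ * ‖fderiv ℝ ρ (z - t) (0, EuclideanSpace.single j 1)‖ₑ = 0 := h0
      rw [enorm_mul, this]; simp
    · have h1 : v t ≠ 0 := fun h => h0 (by simp [h])
      have h2 : A (z - t).1 ≠ 0 := fun h => h0 (by
        rw [show k (z - t) = 0 by simp only [hk]; rw [dρ, h, zero_mul, enorm_zero], mul_zero])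
      have h3 := sA _ h2
      have h4 : ‖t.1‖ ≤ R := (norm_fst_le t).trans (hR t h1)
      have h5 : ‖z.1‖ ≤ R + 1 := by
        have h6 : ‖z.1‖ ≤ ‖t.1‖ + ‖(z - t).1‖ := by
          have : z.1 = t.1 + (z - t).1 := by simp
          calc ‖z.1‖ = ‖t.1 + (z - t).1‖ := by rw [← this]
            _ ≤ _ := norm_add_le _ _
        have h7 : ε ≤ 1 := (min_le_right _ _).trans (min_le_right _ _)
        linarith
      have h8 := hmod z.1 (by simpa using h5) t.1 (by simpa using h4.trans (by linarith)) (by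
        rw [dist_eq_norm]
        exact h3.trans_le (min_le_left _ _))
      rw [← enorm_mul, ← enorm_mul]
      have h9 : ‖(1 + γ) * (‖z.1‖ ^ γ - ‖t.1‖ ^ γ)‖ₑ ≤ ENNReal.ofReal w₀ := by
        rw [← ofReal_norm]
        refine ENNReal.ofReal_le_ofReal ?_
        rw [mul_sub]
        rw [Real.dist_eq] at h8
        exact h8.le
      rw [enorm_mul, enorm_mul (v t)]
      exact mul_le_mul_left h9 _
  have h2 : eLpNorm (fun z => ∫ t, (1 + γ) * (‖z.1‖ ^ γ - ‖t.1‖ ^ γ) *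
        (v t * fderiv ℝ ρ (z - t) (0, EuclideanSpace.single j 1))) 2 volume ^ 2 ≤ η ^ 2 := by
    rw [eLpNorm_two_sq]
    calc _ ≤ ∫⁻ z, (ENNReal.ofReal w₀ * ∫⁻ t, ‖v t‖ₑ * k (z - t)) ^ 2 :=
          lintegral_mono fun z => pow_le_pow_left' (bound z) 2
      _ = ENNReal.ofReal w₀ ^ 2 * ∫⁻ z, (∫⁻ t, ‖v t‖ₑ * k (z - t)) ^ 2 := by
          simp_rw [mul_pow]
          rw [lintegral_const_mul' _ _ (by simp)]
      _ ≤ ENNReal.ofReal w₀ ^ 2 * ((∫⁻ z, k z) ^ 2 * ∫⁻ t, ‖v t‖ₑ ^ 2) := by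
          gcongr
          exact lintegral_conv_sq_le mk (by fun_prop)
      _ = (ENNReal.ofReal w₀ * (N j * V)) ^ 2 := by
          rw [ik, hV, mul_pow, mul_pow, eLpNorm_two_sq]
      _ ≤ _ := pow_le_pow_left' (le_trans (by gcongr; exact NT j) hwη) 2
  exact (ENNReal.pow_le_pow_left_iff two_ne_zero).1 h2

/-- The weak gradient vanishes where the function vanishes on an open set. -/
lemma H1Pair.grad_eq_zero_ae {γ : ℝ} {Ω Ω' : Set (Pt n m)} (hΩ' : IsOpen Ω') (hs : Ω' ⊆ Ω)
    {u : Pt n m → ℝ} {U : Pt n m → Vec n m} (h : H1Pair γ Ω u U)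
    (h0 : ∀ᵐ z ∂volume.restrict Ω', u z = 0) : ∀ᵐ z ∂volume.restrict Ω', U z = 0 := by
  have h1 : H1Pair γ Ω' (fun _ => 0) U := (h.mono hs).congr h0 (ae_eq_refl _)
  have h2 : H1Pair γ Ω' (fun _ => 0) (fun _ : Pt n m => (0 : Vec n m)) :=
    ⟨MemLp.zero', MemLp.zero', fun ψ _ j => by simp⟩
  exact h1.unique hΩ' h2

/-- Extension by zero of a function that vanishes off a compact subset. -/
lemma H1Pair.exists_extension {γ : ℝ} {Ω K : Set (Pt n m)} (hΩ : IsOpen Ω)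
    (hK : IsCompact K) (hKΩ : K ⊆ Ω) {u : Pt n m → ℝ} {U : Pt n m → Vec n m}
    (h : H1Pair γ Ω u U) (h0 : ∀ᵐ z ∂volume.restrict Ω, z ∉ K → u z = 0) :
    ∃ (v : Pt n m → ℝ) (V : Pt n m → Vec n m), H1Pair γ Set.univ v V ∧ Measurable v ∧
      Measurable V ∧ (∀ z, z ∉ K → v z = 0) ∧ (∀ z, z ∉ K → V z = 0) ∧
      v =ᵐ[volume.restrict Ω] u ∧ V =ᵐ[volume.restrict Ω] U := by
  have hd : IsOpen (Ω \ K) := hΩ.sdiff hK.isClosed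
  have mK := hK.measurableSet
  have hU0 : ∀ᵐ z ∂volume.restrict Ω, z ∉ K → U z = 0 := by
    have h1 : ∀ᵐ z ∂volume.restrict (Ω \ K), U z = 0 := by
      refine h.grad_eq_zero_ae hd Set.sdiff_subset ?_
      have h2 := ae_mono (Measure.restrict_mono (Set.sdiff_subset (s := Ω) (t := K)) le_rfl) h0
      filter_upwards [h2, ae_restrict_mem hd.measurableSet] with z hz hz'
      exact hz hz'.2
    rw [ae_restrict_iff' hd.measurableSet] at h1
    rw [ae_restrict_iff' hΩ.measurableSet]
    filter_upwards [h1] with z hz hzΩ hzK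
    exact hz ⟨hzΩ, hzK⟩
  set u' := h.memLp.1.mk u
  set U' := h.memLp_grad.1.mk U
  have ev : K.indicator u' =ᵐ[volume.restrict Ω] u := by
    filter_upwards [h.memLp.1.ae_eq_mk, h0] with z h1 h2
    by_cases hz : z ∈ K
    · rw [Set.indicator_of_mem hz, h1]
    · rw [Set.indicator_of_notMem hz, h2 hz]
  have eV : K.indicator U' =ᵐ[volume.restrict Ω] U := by
    filter_upwards [h.memLp_grad.1.ae_eq_mk, hU0] with z h1 h2
    by_cases hz : z ∈ K
    · rw [Set.indicator_of_mem hz, h1]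
    · rw [Set.indicator_of_notMem hz, h2 hz]
  have zv : ∀ z, z ∉ K → K.indicator u' z = 0 := fun z hz => Set.indicator_of_notMem hz _
  have zV : ∀ z, z ∉ K → K.indicator U' z = 0 := fun z hz => Set.indicator_of_notMem hz _
  have mv : Measurable (K.indicator u') := h.memLp.1.stronglyMeasurable_mk.measurable.indicator mK
  have mV : Measurable (K.indicator U') :=
    h.memLp_grad.1.stronglyMeasurable_mk.measurable.indicator mK
  refine ⟨K.indicator u', K.indicator U', ⟨⟨mv.aestronglyMeasurable, ?_⟩,
    ⟨mV.aestronglyMeasurable, ?_⟩, fun ψ hψ j => ?_⟩, mv, mV, zv, zV, ev, eV⟩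
  · rw [Measure.restrict_univ, ← eLpNorm_restrict_eq hΩ.measurableSet
      (fun z hz => zv z fun h => hz (hKΩ h)), eLpNorm_congr_ae ev]
    exact h.memLp.2
  · rw [Measure.restrict_univ, ← eLpNorm_restrict_eq hΩ.measurableSet
      (fun z hz => zV z fun h => hz (hKΩ h)), eLpNorm_congr_ae eV]
    exact h.memLp_grad.2
  -- A test function on the whole space becomes admissible in `Ω` after multiplication by a cutoff.
  -- As the cutoff is one near `K`, and `u` and `U` vanish off `K`, neither integral changes.
  · obtain ⟨ζ, hζ, h1, -⟩ := exists_cutoff hΩ hK hKΩ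
    have ht : IsTest Ω fun z => ψ z * ζ z := hζ.mul_smooth hψ.smooth
    have h2 := h.weak _ ht j
    rw [Measure.restrict_univ, ← setIntegral_eq_of_zero (Ω := Ω)
      (fun z hz => by rw [zv z fun h => hz (hKΩ h), zero_mul]),
      ← setIntegral_eq_of_zero (Ω := Ω) (f := fun z => K.indicator U' z j * ψ z)
      (fun z hz => by rw [zV z fun h => hz (hKΩ h)]; simp)]
    have hloc : ∀ z ∈ K, ζ =ᶠ[𝓝 z] fun _ => 1 := fun z hz =>
      (eventually_nhdsSet_iff_forall.1 h1) z hz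
    have e1 : ∫ z in Ω, K.indicator u' z * grad γ ψ z j =
        ∫ z in Ω, u z * grad γ (fun z => ψ z * ζ z) z j := by
      refine integral_congr_ae ?_
      filter_upwards [ev, h0] with z hz hz0
      rw [hz]
      by_cases hzK : z ∈ K
      · have : (fun z => ψ z * ζ z) =ᶠ[𝓝 z] ψ := by
          filter_upwards [hloc z hzK] with t ht
          rw [ht, mul_one]
        simp only [grad, this.fderiv_eq]
      · rw [hz0 hzK, zero_mul, zero_mul]
    have e2 : ∫ z in Ω, K.indicator U' z j * ψ z = ∫ z in Ω, U z j * (ψ z * ζ z) := by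
      refine integral_congr_ae ?_
      filter_upwards [eV, hU0] with z hz hz0
      rw [hz]
      by_cases hzK : z ∈ K
      · rw [(hloc z hzK).eq_of_nhds, mul_one]
      · rw [hz0 hzK]; simp
    rw [e1, e2, h2]

lemma norm_vec_le_sum (x : Vec n m) : ‖x‖ ≤ ∑ j, ‖x j‖ := by
  rw [EuclideanSpace.norm_eq]
  refine Real.sqrt_le_iff.2 ⟨Finset.sum_nonneg fun _ _ => norm_nonneg _, ?_⟩
  exact Finset.sum_sq_le_sq_sum_of_nonneg fun _ _ => norm_nonneg _

lemma eLpNorm_vec_le_sum {μ : Measure (Pt n m)} {X : Pt n m → Vec n m}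
    (hX : AEStronglyMeasurable X μ) :
    eLpNorm X 2 μ ≤ ∑ j, eLpNorm (fun z => X z j) 2 μ := by
  have mj : ∀ j, AEStronglyMeasurable (fun z => X z j) μ := fun j =>
    (EuclideanSpace.proj (𝕜 := ℝ) j).continuous.comp_aestronglyMeasurable hX
  calc eLpNorm X 2 μ ≤ eLpNorm (∑ j, fun z => ‖X z j‖) 2 μ := by
        refine eLpNorm_mono fun z => (norm_vec_le_sum (X z)).trans ?_
        simp only [Finset.sum_apply]
        exact Real.le_norm_self _
    _ ≤ ∑ j, eLpNorm (fun z => ‖X z j‖) 2 μ :=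
        eLpNorm_sum_le (fun j _ => (mj j).norm) (by norm_num)
    _ = _ := by simp only [eLpNorm_norm]

/-- The components of the gradient of a smoothing, up to the commutator with the weight. -/
lemma grad_smoothing {γ r : ℝ} (hγ : 0 < γ) {v : Pt n m → ℝ} {V : Pt n m → Vec n m}
    (h : H1Pair γ Set.univ v V) {ρ : Pt n m → ℝ} (hρ : IsMollifier r ρ) (z : Pt n m) :
    (∀ i, grad γ (smoothing ρ v) z (Sum.inl i) = smoothing ρ (fun z => V z (Sum.inl i)) z) ∧
    ∀ j, grad γ (smoothing ρ v) z (Sum.inr j) = smoothing ρ (fun z => V z (Sum.inr j)) z +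
      ∫ t, (1 + γ) * (‖z.1‖ ^ γ - ‖t.1‖ ^ γ) *
        (v t * fderiv ℝ ρ (z - t) (0, EuclideanSpace.single j 1)) := by
  have hv : MemLp v 2 volume := by simpa using h.memLp
  have hloc : LocallyIntegrable v := hv.locallyIntegrable (by norm_num)
  have hη : IsTest Set.univ fun t => ρ (z - t) := by
    refine ⟨hρ.smooth.comp (contDiff_const.sub contDiff_id), ?_, Set.subset_univ _⟩
    exact hρ.compact.comp_homeomorph (Homeomorph.subLeft z)
  have hd : ∀ t a, fderiv ℝ (fun t => ρ (z - t)) t a = -fderiv ℝ ρ (z - t) a := by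
    intro t a
    have h1 : HasFDerivAt (fun t : Pt n m => z - t) (-ContinuousLinearMap.id ℝ (Pt n m)) t := by
      simpa using (hasFDerivAt_id t).const_sub z
    have h2 : HasFDerivAt ρ (fderiv ℝ ρ (z - t)) (z - t) :=
      (hρ.contDiff_one.differentiable one_ne_zero _).hasFDerivAt
    rw [show fderiv ℝ (fun t => ρ (z - t)) t = _ from (h2.comp t h1).fderiv]
    simp
  constructor
  · intro i
    have h1 := h.weak _ hη (Sum.inl i)
    simp only [Measure.restrict_univ] at h1
    rw [grad_inl, hρ.fderiv_smoothing hloc, smoothing, ← neg_inj, ← h1, ← integral_neg]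
    refine integral_congr_ae (Eventually.of_forall fun t => ?_)
    simp only [grad_inl, hd, mul_neg]
  · intro j
    have h1 := h.weak _ hη (Sum.inr j)
    simp only [Measure.restrict_univ] at h1
    have hI : ∀ c : Pt n m → ℝ, Continuous c → Integrable fun t =>
        c t * (v t * fderiv ℝ ρ (z - t) (0, EuclideanSpace.single j 1)) := by
      intro c hc
      have c1 : Continuous fun t => fderiv ℝ ρ (z - t) (0, EuclideanSpace.single j 1) :=
        ((hρ.contDiff_one.continuous_fderiv one_ne_zero).comp (by fun_prop)).clm_apply
          continuous_const
      have c2 : HasCompactSupport fun t => c t *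
          fderiv ℝ ρ (z - t) (0, EuclideanSpace.single j 1) := by
        have h3 : HasCompactSupport fun t => fderiv ℝ ρ t (0, EuclideanSpace.single j 1) :=
          (hρ.compact.fderiv ℝ).comp_left
            (g := fun L : Pt n m →L[ℝ] ℝ => L (0, EuclideanSpace.single j 1)) rfl
        exact (h3.comp_homeomorph (Homeomorph.subLeft z)).mul_left
      have := integrable_mul_L2 hv ((hc.mul c1).memLp_of_hasCompactSupport c2 (p := 2)
        (μ := volume))
      exact this.congr (Eventually.of_forall fun t => by simp only [Pi.mul_apply]; ring)
    have i1 := hI (fun _ => (1 + γ) * ‖z.1‖ ^ γ) continuous_const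
    have e2 : smoothing ρ (fun z => V z (Sum.inr j)) z = ∫ t, (1 + γ) * ‖t.1‖ ^ γ *
        (v t * fderiv ℝ ρ (z - t) (0, EuclideanSpace.single j 1)) := by
      rw [smoothing, ← neg_inj, ← h1, ← integral_neg]
      refine integral_congr_ae (Eventually.of_forall fun t => ?_)
      simp only [grad_inr, hd]; ring
    rw [e2, grad_inr, hρ.fderiv_smoothing hloc, ← integral_const_mul]
    have i2 := hI (fun t => (1 + γ) * ‖t.1‖ ^ γ)
      (continuous_const.mul ((continuous_norm.comp continuous_fst).rpow_const
        fun _ => Or.inr hγ.le))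
    rw [← sub_eq_iff_eq_add', ← integral_sub i1 i2]
    refine integral_congr_ae (Eventually.of_forall fun t => ?_)
    simp only; ring

/-- Approximation by smoothings of a compactly supported function with a weak gradient. -/
lemma H1Pair.exists_smoothing_close {γ : ℝ} (hγ : 0 < γ) {v : Pt n m → ℝ} {V : Pt n m → Vec n m}
    (h : H1Pair γ Set.univ v V) (mv : Measurable v) (mV : Measurable V) {R : ℝ}
    (hR : ∀ z, v z ≠ 0 → ‖z‖ ≤ R) {r : ℝ} (hr : 0 < r) {η : ℝ≥0∞} (hη : 0 < η) :
    ∃ ρ : Pt n m → ℝ, IsMollifier r ρ ∧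
      eLpNorm (fun z => smoothing ρ v z - v z) 2 volume ≤ η ∧
      eLpNorm (fun z => grad γ (smoothing ρ v) z - V z) 2 volume ≤ (n + m : ℕ) * (2 * η) := by
  have hv : MemLp v 2 volume := by simpa using h.memLp
  have hV : MemLp V 2 volume := by simpa using h.memLp_grad
  have mVj : ∀ j, Measurable fun z => V z j := fun j =>
    (EuclideanSpace.proj (𝕜 := ℝ) j).continuous.measurable.comp mV
  obtain ⟨r1, hr1, h1⟩ := eventually_smoothing_close hv mv hη
  choose r2 hr2 h2 using fun j => eventually_smoothing_close (memLp_coord hV j) (mVj j) hη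
  -- A single width suitable for the support, for `v` and for every component of `V`; the
  -- anisotropic kernel is chosen within it. Each of the `n + m` components then contributes at most
  -- `2 * η`, one `η` from smoothing and one from the commutator.
  obtain ⟨r0, ⟨⟨hr0r, hr0r1⟩, hr0r2⟩, hr0⟩ : ∃ r0 : ℝ, ((r0 ≤ r ∧ r0 ≤ r1) ∧
      ∀ j, r0 ≤ r2 j) ∧ 0 < r0 := by
    have hle : ∀ {s : ℝ}, 0 < s → ∀ᶠ x in 𝓝[>] (0 : ℝ), x ≤ s := fun hs =>
      nhdsWithin_le_nhds (eventually_le_nhds hs)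
    exact ((((hle hr).and (hle hr1)).and (eventually_all.2 fun j => hle (hr2 j))).and
      eventually_mem_nhdsWithin).exists
  obtain ⟨ρ, hρ, h3⟩ := exists_mollifier_commutator hγ hv mv hR hr0 hη
  have hloc : LocallyIntegrable v := hv.locallyIntegrable (by norm_num)
  have hlocV : ∀ j, LocallyIntegrable fun z => V z j := fun j =>
    (memLp_coord hV j).locallyIntegrable (by norm_num)
  have cg := continuous_grad hγ
    ((hρ.contDiff_smoothing hloc).of_le (show ((1 : ℕ∞) : WithTop ℕ∞) ≤ _ by exact_mod_cast le_top))
  have cs : ∀ j, Continuous (smoothing ρ fun z => V z j) := fun j =>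
    (hρ.contDiff_smoothing (hlocV j)).continuous
  have cgj : ∀ j, Continuous fun z => grad γ (smoothing ρ v) z j := fun j =>
    (EuclideanSpace.proj (𝕜 := ℝ) j).continuous.comp cg
  refine ⟨ρ, hρ.mono hr0r, h1 ρ (hρ.mono hr0r1), ?_⟩
  refine (eLpNorm_vec_le_sum (cg.aestronglyMeasurable.sub mV.aestronglyMeasurable)).trans ?_
  have hj : ∀ j, eLpNorm (fun z => (grad γ (smoothing ρ v) z - V z) j) 2 volume ≤ 2 * η := by
    intro j
    have e : (fun z => (grad γ (smoothing ρ v) z - V z) j) =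
        (fun z => grad γ (smoothing ρ v) z j - smoothing ρ (fun z => V z j) z) +
          fun z => smoothing ρ (fun z => V z j) z - V z j := by
      funext z
      simp
    rw [e, two_mul]
    refine (eLpNorm_add_le ((cgj j).sub (cs j)).aestronglyMeasurable
      ((cs j).measurable.sub (mVj j)).aestronglyMeasurable (by norm_num)).trans
      (add_le_add ?_ (h2 j ρ (hρ.mono (hr0r2 j))))
    rcases j with i | j
    · simp [(grad_smoothing hγ h hρ _).1]
    · refine (le_of_eq ?_).trans (h3 j)
      congr 1
      funext z
      rw [Pi.sub_apply, (grad_smoothing hγ h hρ _).2, add_sub_cancel_left]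
  refine (Finset.sum_le_sum fun j _ => hj j).trans ?_
  simp

/-- Functions with a weak gradient and compact support in `Ω` are approximated by test functions
supported in a fixed compact set, and the approximation respects signs and bounds. -/
theorem H1Pair.exists_test_approx {γ : ℝ} (hγ : 0 < γ) {Ω K : Set (Pt n m)} (hΩ : IsOpen Ω)
    (hK : IsCompact K) (hKΩ : K ⊆ Ω) {u : Pt n m → ℝ} {U : Pt n m → Vec n m}
    (h : H1Pair γ Ω u U) (h0 : ∀ᵐ z ∂volume.restrict Ω, z ∉ K → u z = 0) :
    ∃ (K' : Set (Pt n m)) (ψ : ℕ → Pt n m → ℝ), IsCompact K' ∧ K' ⊆ Ω ∧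
      (∀ k, IsTest Ω (ψ k)) ∧ (∀ k z, z ∉ K' → ψ k z = 0) ∧
      Tendsto (fun k => eLpNorm (fun z => ψ k z - u z) 2 (volume.restrict Ω)) atTop (𝓝 0) ∧
      Tendsto (fun k => eLpNorm (fun z => grad γ (ψ k) z - U z) 2 (volume.restrict Ω)) atTop
        (𝓝 0) ∧
      ((∀ᵐ z ∂volume.restrict Ω, 0 ≤ u z) → ∀ k z, 0 ≤ ψ k z) ∧
      ∀ M, 0 ≤ M → (∀ᵐ z ∂volume.restrict Ω, |u z| ≤ M) → ∀ k z, |ψ k z| ≤ M := by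
  obtain ⟨v, V, hv, mv, mV, zv, zV, ev, eV⟩ := h.exists_extension hΩ hK hKΩ h0
  obtain ⟨r, hr, hrΩ⟩ := hK.exists_cthickening_subset_open hΩ hKΩ
  obtain ⟨R, hR⟩ := hK.isBounded.exists_norm_le
  have hR' : ∀ z, v z ≠ 0 → ‖z‖ ≤ R := fun z hz => hR z (by by_contra hc; exact hz (zv z hc))
  have hpos : ∀ k : ℕ, (0 : ℝ≥0∞) < (k + 1 : ℝ≥0∞)⁻¹ := fun k =>
    ENNReal.inv_pos.2 (by exact_mod_cast ENNReal.natCast_ne_top (k + 1))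
  choose ρ hρ h1 h2 using fun k : ℕ => hv.exists_smoothing_close hγ mv mV hR' hr (hpos k)
  have hloc : LocallyIntegrable v := by
    have : MemLp v 2 volume := by simpa using hv.memLp
    exact this.locallyIntegrable (by norm_num)
  have z1 : ∀ k z, z ∉ Metric.cthickening r K → smoothing (ρ k) v z = 0 := fun k z hz =>
    smoothing_eq_zero (hρ k) zv hz
  have hcK : IsCompact (Metric.cthickening r K) := hK.cthickening
  have lim0 : Tendsto (fun k : ℕ => (k + 1 : ℝ≥0∞)⁻¹) atTop (𝓝 0) := by
    have := (tendsto_add_atTop_iff_nat 1).2 ENNReal.tendsto_inv_nat_nhds_zero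
    simpa using this
  have ae_of : ∀ {p : ℝ → Prop}, p 0 → (∀ᵐ z ∂volume.restrict Ω, p (u z)) → ∀ᵐ z, p (v z) := by
    intro p p0 hp
    have h3 : ∀ᵐ z ∂volume.restrict Ω, p (v z) := by
      filter_upwards [hp, ev] with z hz hz'
      rwa [hz']
    rw [ae_restrict_iff' hΩ.measurableSet] at h3
    filter_upwards [h3] with z hz
    by_cases hzΩ : z ∈ Ω
    · exact hz hzΩ
    · rw [zv z fun h => hzΩ (hKΩ h)]
      exact p0
  refine ⟨Metric.cthickening r K, fun k => smoothing (ρ k) v, hcK, hrΩ, fun k =>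
    ⟨(hρ k).contDiff_smoothing hloc, HasCompactSupport.intro hcK (z1 k), ?_⟩, z1, ?_, ?_,
    fun hu k => smoothing_nonneg (hρ k) (ae_of le_rfl hu), fun M hM hu k =>
      abs_smoothing_le (hρ k) (ae_of (p := fun x => |x| ≤ M) (by simpa using hM) hu)⟩
  · refine (closure_minimal (fun z hz => ?_) hcK.isClosed).trans hrΩ
    by_contra hc
    exact hz (z1 k z hc)
  · refine tendsto_of_tendsto_of_tendsto_of_le_of_le tendsto_const_nhds lim0 (fun _ => zero_le)
      fun k => ?_
    have e : (fun z => smoothing (ρ k) v z - u z) =ᵐ[volume.restrict Ω]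
        fun z => smoothing (ρ k) v z - v z := by
      filter_upwards [ev] with z hz
      rw [hz]
    simp only
    rw [eLpNorm_congr_ae e]
    exact (eLpNorm_mono_measure _ Measure.restrict_le_self).trans (h1 k)
  · have lim1 : Tendsto (fun k : ℕ => ((n + m : ℕ) : ℝ≥0∞) * (2 * (k + 1 : ℝ≥0∞)⁻¹)) atTop
        (𝓝 0) := by
      have := ENNReal.Tendsto.const_mul (ENNReal.Tendsto.const_mul lim0
        (Or.inr (by simp : (2 : ℝ≥0∞) ≠ ⊤))) (Or.inr (ENNReal.natCast_ne_top (n + m)))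
      simpa using this
    refine tendsto_of_tendsto_of_tendsto_of_le_of_le tendsto_const_nhds lim1 (fun _ => zero_le)
      fun k => ?_
    have e : (fun z => grad γ (smoothing (ρ k) v) z - U z) =ᵐ[volume.restrict Ω]
        fun z => grad γ (smoothing (ρ k) v) z - V z := by
      filter_upwards [eV] with z hz
      rw [hz]
    simp only
    rw [eLpNorm_congr_ae e]
    exact (eLpNorm_mono_measure _ Measure.restrict_le_self).trans (h2 k)

/-! ### Chain rule, positive parts and truncations. -/

lemma tendsto_zero_of_sq {f : ℕ → ℝ≥0∞} (h : Tendsto (fun k => f k ^ 2) atTop (𝓝 0)) :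
    Tendsto f atTop (𝓝 0) := by
  have h1 := h.ennrpow_const (1 / 2)
  rw [ENNReal.zero_rpow_of_pos (by norm_num)] at h1
  refine h1.congr fun k => ?_
  rw [← ENNReal.rpow_two, ← ENNReal.rpow_mul]; norm_num

lemma memLp_of_dominated {α E : Type*} [MeasurableSpace α] [NormedAddCommGroup E] {μ : Measure α}
    {u : ℕ → α → E} {u₀ : α → E} {a : α → ℝ} {p : ℝ≥0∞}
    (hu : ∀ k, AEStronglyMeasurable (u k) μ)
    (ha : MemLp a p μ) (hb : ∀ k, ∀ᵐ z ∂μ, ‖u k z‖ ≤ a z)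
    (hlim : ∀ᵐ z ∂μ, Tendsto (fun k => u k z) atTop (𝓝 (u₀ z))) : MemLp u₀ p μ := by
  refine ha.mono (aestronglyMeasurable_of_tendsto_ae atTop hu hlim) ?_
  filter_upwards [ae_all_iff.2 hb, hlim] with z h1 h2
  exact (le_of_tendsto h2.norm (Eventually.of_forall h1)).trans (Real.le_norm_self _)

lemma tendsto_eLpNorm_of_dominated {α E : Type*} [MeasurableSpace α] [NormedAddCommGroup E]
    {μ : Measure α} {u : ℕ → α → E} {u₀ : α → E} {a : α → ℝ}
    (hu : ∀ k, AEStronglyMeasurable (u k) μ)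
    (ha : MemLp a 2 μ) (hb : ∀ k, ∀ᵐ z ∂μ, ‖u k z‖ ≤ a z)
    (hlim : ∀ᵐ z ∂μ, Tendsto (fun k => u k z) atTop (𝓝 (u₀ z))) :
    Tendsto (fun k => eLpNorm (fun z => u k z - u₀ z) 2 μ) atTop (𝓝 0) := by
  refine tendsto_zero_of_sq ?_
  have hu₀ := aestronglyMeasurable_of_tendsto_ae atTop hu hlim
  simp only [eLpNorm_two_sq]
  have := tendsto_lintegral_of_dominated_convergence' (μ := μ)
    (F := fun k z => ‖u k z - u₀ z‖ₑ ^ 2) (f := fun _ => 0) (fun z => ‖2 * a z‖ₑ ^ 2)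
    (fun k => ((hu k).sub hu₀).enorm.pow_const 2) (fun k => ?_) ?_ ?_
  · simpa using this
  · filter_upwards [ae_all_iff.2 hb, hlim] with z h1 h2
    have h3 := le_of_tendsto h2.norm (Eventually.of_forall h1)
    refine pow_le_pow_left' (enorm_le_iff_norm_le.2 ?_) 2
    calc ‖u k z - u₀ z‖ ≤ ‖u k z‖ + ‖u₀ z‖ := norm_sub_le _ _
      _ ≤ 2 * a z := by linarith [h1 k]
      _ ≤ _ := Real.le_norm_self _
  · rw [← eLpNorm_two_sq]
    exact ENNReal.pow_ne_top (ha.const_mul 2).2.ne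
  · filter_upwards [hlim] with z hz
    have h1 : Tendsto (fun k => ‖u k z - u₀ z‖ₑ) atTop (𝓝 0) := by
      simpa using (hz.sub_const (u₀ z)).enorm
    simpa using ENNReal.Tendsto.pow (n := 2) h1

/-- The form in which regularised nonlinearities converge: pointwise limits of functions and
gradients under `L²` majorants. -/
lemma h1Pair_of_dominated {γ : ℝ} (hγ : 0 < γ) {Ω : Set (Pt n m)} {u : ℕ → Pt n m → ℝ}
    {U : ℕ → Pt n m → Vec n m} {u₀ : Pt n m → ℝ} {U₀ : Pt n m → Vec n m}
    (h : ∀ k, H1Pair γ Ω (u k) (U k)) {a A : Pt n m → ℝ} (ha : MemLp a 2 (volume.restrict Ω))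
    (hA : MemLp A 2 (volume.restrict Ω)) (hb : ∀ k, ∀ᵐ z ∂volume.restrict Ω, ‖u k z‖ ≤ a z)
    (hB : ∀ k, ∀ᵐ z ∂volume.restrict Ω, ‖U k z‖ ≤ A z)
    (h1 : ∀ᵐ z ∂volume.restrict Ω, Tendsto (fun k => u k z) atTop (𝓝 (u₀ z)))
    (h2 : ∀ᵐ z ∂volume.restrict Ω, Tendsto (fun k => U k z) atTop (𝓝 (U₀ z))) :
    H1Pair γ Ω u₀ U₀ :=
  h1Pair_of_tendsto hγ h (memLp_of_dominated (fun k => (h k).memLp.1) ha hb h1)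
    (memLp_of_dominated (fun k => (h k).memLp_grad.1) hA hB h2)
    (tendsto_eLpNorm_of_dominated (fun k => (h k).memLp.1) ha hb h1)
    (tendsto_eLpNorm_of_dominated (fun k => (h k).memLp_grad.1) hA hB h2)

lemma abs_sub_le_of_deriv_le {θ : ℝ → ℝ} {S : Set ℝ} (hS : Convex ℝ S) {C : ℝ}
    (hθ : ∀ s ∈ S, DifferentiableAt ℝ θ s)
    (hL : ∀ s ∈ S, |deriv θ s| ≤ C) {a b : ℝ} (ha : a ∈ S) (hb : b ∈ S) :
    |θ a - θ b| ≤ C * |a - b| :=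
  hS.norm_image_sub_le_of_norm_deriv_le hθ hL hb ha

/-- Chain rule for a `C¹` function with bounded derivative on a set that contains the range, the
whole line or a half line. -/
theorem H1Pair.comp {γ : ℝ} (hγ : 0 < γ) {Ω : Set (Pt n m)} (hΩ : IsOpen Ω) {u : Pt n m → ℝ}
    {U : Pt n m → Vec n m} (h : H1Pair γ Ω u U) {θ : ℝ → ℝ} {S : Set ℝ}
    (hS : S = Set.univ ∨ S = Set.Ici 0) (hθ : ∀ s ∈ S, ContDiffAt ℝ 1 θ s) {C : ℝ}
    (hL : ∀ s ∈ S, |deriv θ s| ≤ C) (h0 : θ 0 = 0) (hu : ∀ᵐ z ∂volume.restrict Ω, u z ∈ S) :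
    H1Pair γ Ω (fun z => θ (u z)) (fun z => deriv θ (u z) • U z) := by
  have hconv : Convex ℝ S := by
    rcases hS with rfl | rfl
    · exact convex_univ
    · exact convex_Ici 0
  have hSc : IsClosed S := by
    rcases hS with rfl | rfl
    · exact isClosed_univ
    · exact isClosed_Ici
  have h0S : (0 : ℝ) ∈ S := by rcases hS with rfl | rfl <;> simp
  have hdiff : ∀ s ∈ S, DifferentiableAt ℝ θ s := fun s hs => (hθ s hs).differentiableAt one_ne_zero
  have hlip : ∀ {a b : ℝ}, a ∈ S → b ∈ S → |θ a - θ b| ≤ C * |a - b| := fun ha hb =>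
    abs_sub_le_of_deriv_le hconv hdiff hL ha hb
  have hcθ : ContinuousOn θ S := fun s hs => (hdiff s hs).continuousAt.continuousWithinAt
  have hcd : ∀ s ∈ S, ContinuousAt (deriv θ) s := fun s hs => by
    have h1 : ContinuousAt (fderiv ℝ θ) s := (hθ s hs).continuousAt_fderiv one_ne_zero
    exact h1.clm_apply continuousAt_const
  have hcdS : ContinuousOn (deriv θ) S := fun s hs => (hcd s hs).continuousWithinAt
  have C0 : 0 ≤ C := (abs_nonneg _).trans (hL 0 h0S)
  have meas : ∀ {η : ℝ → ℝ}, ContinuousOn η S → ∀ {w : Pt n m → ℝ},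
      AEStronglyMeasurable w (volume.restrict Ω) → (∀ᵐ z ∂volume.restrict Ω, w z ∈ S) →
      AEStronglyMeasurable (fun z => η (w z)) (volume.restrict Ω) := by
    intro η hη w hw hwS
    have h1 : Measurable (S.indicator η) := by
      classical
      have := hη.measurable_piecewise (g := fun _ => (0 : ℝ)) continuousOn_const
        hSc.measurableSet
      convert! this using 1
    refine (h1.comp_aemeasurable hw.aemeasurable).aestronglyMeasurable.congr ?_
    filter_upwards [hwS] with z hz
    simp [hz]
  refine ⟨?_, ?_, fun ψ hψ j => ?_⟩
  · refine (h.memLp.const_mul C).mono (meas hcθ h.memLp.1 hu) ?_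
    filter_upwards [hu] with z hz
    have h1 := hlip hz h0S
    rw [h0, sub_zero, sub_zero] at h1
    rw [norm_mul, Real.norm_of_nonneg C0]
    exact h1
  · refine MemLp.mul_bounded h.memLp_grad (meas hcdS h.memLp.1 hu) (C := C) ?_
    filter_upwards [hu] with z hz using hL _ hz
  -- Localisation: `ζ * u` has compact support and is a limit of test functions, for which the chain
  -- rule is classical. Near the support of `ψ` it coincides with `u`.
  · obtain ⟨ζ, hζ, hζ1, hζ01⟩ := exists_cutoff hΩ hψ.compact hψ.supp
    have hv := h.mul_test hγ hζ
    set v : Pt n m → ℝ := fun z => ζ z * u z with hvdef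
    set V : Pt n m → Vec n m := fun z => ζ z • U z + u z • grad γ ζ z with hVdef
    obtain ⟨K', f, -, -, hf, -, hf1, hf2, hf3, -⟩ := hv.exists_test_approx hγ hΩ hζ.compact hζ.supp
      (Eventually.of_forall fun z hz => by
        rw [hvdef]; simp only; rw [image_eq_zero_of_notMem_tsupport hz, zero_mul])
    obtain ⟨s, hs, hae⟩ := exists_subseq_ae
      (fun k => ((hf k).memLp 2 (volume.restrict Ω)).1) hv.memLp.1 hf1
    replace hf1 := hf1.comp hs.tendsto_atTop
    replace hf2 := hf2.comp hs.tendsto_atTop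
    -- The approximation of `ζ * u` keeps nonnegativity, so the half line is admissible: `θ` need
    -- not be regular for negative arguments.
    have hfS : ∀ k z, f k z ∈ S := by
      rcases hS with rfl | rfl
      · simp
      · refine fun k z => hf3 ?_ k z
        filter_upwards [hu] with z hz using mul_nonneg (hζ01 z).1 hz
    have hvS : ∀ᵐ z ∂volume.restrict Ω, v z ∈ S := by
      filter_upwards [hae] with z hz
      exact hSc.mem_of_tendsto hz (Eventually.of_forall fun k => hfS _ z)
    have hθf : ∀ k, ContDiff ℝ 1 fun z => θ (f k z) := fun k =>
      contDiff_iff_contDiffAt.2 fun z =>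
        (hθ _ (hfS k z)).comp z (hf k).contDiff_one.contDiffAt
    have mθf : ∀ k, MemLp (fun z => θ (f k z)) 2 (volume.restrict Ω) := fun k => by
      refine (((hf k).memLp 2 (volume.restrict Ω)).const_mul C).mono
        (hθf k).continuous.aestronglyMeasurable (Eventually.of_forall fun z => ?_)
      have h1 := hlip (hfS k z) h0S
      rw [h0, sub_zero, sub_zero] at h1
      rw [norm_mul, Real.norm_of_nonneg C0]
      exact h1
    have mθv : MemLp (fun z => θ (v z)) 2 (volume.restrict Ω) := by
      refine (hv.memLp.const_mul C).mono (meas hcθ hv.memLp.1 hvS) ?_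
      filter_upwards [hvS] with z hz
      have h1 := hlip hz h0S
      rw [h0, sub_zero, sub_zero] at h1
      rw [norm_mul, Real.norm_of_nonneg C0]
      exact h1
    have mψ := hψ.memLp 2 (volume.restrict Ω)
    have mgψ := memLp_coord (hψ.memLp_grad hγ 2 (volume.restrict Ω)) j
    have lim1 : Tendsto (fun k => ∫ z in Ω, θ (f (s k) z) * grad γ ψ z j) atTop
        (𝓝 (∫ z in Ω, θ (v z) * grad γ ψ z j)) := by
      refine tendsto_integral_mul (fun k => mθf (s k)) mθv mgψ ?_
      have hz : Tendsto (fun k => ENNReal.ofReal C *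
          eLpNorm (fun z => f (s k) z - v z) 2 (volume.restrict Ω)) atTop (𝓝 0) := by
        simpa using ENNReal.Tendsto.const_mul hf1 (Or.inr ENNReal.ofReal_ne_top)
      refine tendsto_of_tendsto_of_tendsto_of_le_of_le tendsto_const_nhds hz (fun _ => zero_le)
        fun k => ?_
      refine eLpNorm_le_mul_eLpNorm_of_ae_le_mul ?_ 2
      filter_upwards [hvS] with z hz
      exact hlip (hfS _ z) hz
    have lim2 : Tendsto (fun k => ∫ z in Ω, grad γ (f (s k)) z j *
        (deriv θ (f (s k) z) * ψ z)) atTop (𝓝 (∫ z in Ω, V z j * (deriv θ (v z) * ψ z))) := by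
      have mk : ∀ k, AEStronglyMeasurable (fun z => deriv θ (f (s k) z) * ψ z)
          (volume.restrict Ω) := fun k =>
        (meas hcdS ((hf (s k)).memLp 2 _).1 (Eventually.of_forall (hfS (s k)))).mul mψ.1
      have hdom : ∀ k, ∀ᵐ z ∂volume.restrict Ω, ‖deriv θ (f (s k) z) * ψ z‖ ≤ C * |ψ z| :=
        fun k => Eventually.of_forall fun z => by
          rw [norm_mul]
          exact mul_le_mul_of_nonneg_right (hL _ (hfS _ z)) (norm_nonneg _)
      have hlim : ∀ᵐ z ∂volume.restrict Ω, Tendsto (fun k => deriv θ (f (s k) z) * ψ z) atTop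
          (𝓝 (deriv θ (v z) * ψ z)) := by
        filter_upwards [hae, hvS] with z hz hzS
        exact ((hcd _ hzS).tendsto.comp hz).mul_const _
      have mC : MemLp (fun z => C * |ψ z|) 2 (volume.restrict Ω) := mψ.norm.const_mul C
      have := tendsto_integral_inner
        (fun k => (mC.mono' (mk k) (hdom k) : MemLp (fun z => deriv θ (f (s k) z) * ψ z) 2 _))
        (fun k => memLp_coord ((hf (s k)).memLp_grad hγ 2 (volume.restrict Ω)) j)
        (memLp_of_dominated mk mC hdom hlim) (memLp_coord hv.memLp_grad j)
        (tendsto_eLpNorm_of_dominated mk mC hdom hlim) (eLpNorm_coord_tendsto hf2 j)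
      simpa using this
    have hk : ∀ k, ∫ z in Ω, θ (f (s k) z) * grad γ ψ z j =
        -∫ z in Ω, grad γ (f (s k)) z j * (deriv θ (f (s k) z) * ψ z) := by
      intro k
      rw [isWeakGrad_of_contDiff hγ Ω (hθf (s k)) ψ hψ j]
      congr 1
      refine integral_congr_ae (Eventually.of_forall fun z => ?_)
      simp only
      rw [grad_comp (hdiff _ (hfS _ z)) ((hf (s k)).contDiff_one.differentiable one_ne_zero z)]
      simp only [PiLp.smul_apply, smul_eq_mul]
      ring
    have key := tendsto_nhds_unique (lim1.congr hk) lim2.neg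
    have hloc : ∀ z ∈ tsupport ψ, ζ =ᶠ[𝓝 z] fun _ => 1 := fun z hz =>
      (eventually_nhdsSet_iff_forall.1 hζ1) z hz
    have e1 : ∀ z, θ (v z) * grad γ ψ z j = θ (u z) * grad γ ψ z j := fun z => by
      by_cases hz : z ∈ tsupport ψ
      · simp only [hvdef, (hloc z hz).eq_of_nhds, one_mul]
      · rw [Grushin.grad_eq_zero hz]; simp
    have e2 : ∀ z, V z j * (deriv θ (v z) * ψ z) = (deriv θ (u z) • U z) j * ψ z := fun z => by
      by_cases hz : z ∈ tsupport ψ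
      · have h1 : grad γ ζ z = 0 := grad_eq_zero_of_fderiv (by
          rw [(hloc z hz).fderiv_eq]; simp)
        simp only [hvdef, hVdef, (hloc z hz).eq_of_nhds, one_mul, h1, smul_zero, add_zero, one_smul,
          PiLp.smul_apply, smul_eq_mul]
        ring
      · rw [image_eq_zero_of_notMem_tsupport hz]; simp
    simp only [e1, e2] at key
    exact key

lemma exists_bound_of_tendsto {f : ℕ → ℝ≥0∞} {l : ℝ≥0∞} (hl : l ≠ ⊤) (hf : ∀ k, f k ≠ ⊤)
    (h : Tendsto f atTop (𝓝 l)) : ∃ C : ℝ, 0 ≤ C ∧ ∀ k, f k ≤ ENNReal.ofReal C := by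
  obtain ⟨C, hC⟩ := ((ENNReal.tendsto_toReal hl).comp h).bddAbove_range
  refine ⟨C, ENNReal.toReal_nonneg.trans (hC ⟨0, rfl⟩), fun k => ?_⟩
  rw [← ENNReal.ofReal_toReal (hf k)]
  exact ENNReal.ofReal_le_ofReal (hC ⟨k, rfl⟩)

/-- The weak gradient vanishes almost everywhere on the zero level set. -/
lemma H1Pair.grad_eq_zero_of_eq_zero {γ : ℝ} (hγ : 0 < γ) {Ω : Set (Pt n m)} (hΩ : IsOpen Ω)
    {u : Pt n m → ℝ} {U : Pt n m → Vec n m} (h : H1Pair γ Ω u U) :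
    ∀ᵐ z ∂volume.restrict Ω, u z = 0 → U z = 0 := by
  set θ : ℕ → ℝ → ℝ := fun k t => (k + 1 : ℝ)⁻¹ * Real.arctan ((k + 1) * t) with hθ
  have kpos : ∀ k : ℕ, (0 : ℝ) < k + 1 := fun k => by positivity
  have hd : ∀ k t, HasDerivAt (θ k) (1 / (1 + ((k + 1) * t) ^ 2)) t := by
    intro k t
    have h1 : HasDerivAt (fun t : ℝ => ((k : ℝ) + 1) * t) (k + 1) t := by
      simpa using (hasDerivAt_id t).const_mul ((k : ℝ) + 1)
    have h2 := (h1.arctan).const_mul ((k : ℝ) + 1)⁻¹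
    convert! h2 using 1
    field_simp [(kpos k).ne']
  have hd1 : ∀ k t, |deriv (θ k) t| ≤ 1 := by
    intro k t
    rw [(hd k t).deriv, abs_of_nonneg (by positivity), div_le_one (by positivity)]
    nlinarith [sq_nonneg ((k + 1 : ℝ) * t)]
  have h00 : ∀ k, θ k 0 = 0 := fun k => by simp [hθ]
  have hc : ∀ k, ContDiff ℝ 1 (θ k) := fun k =>
    contDiff_const.mul (Real.contDiff_arctan.comp (contDiff_const.mul contDiff_id))
  have hp := fun k => h.comp hγ hΩ (Or.inl rfl) (fun s _ => (hc k).contDiffAt)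
    (fun s _ => hd1 k s) (h00 k) (Eventually.of_forall fun _ => Set.mem_univ _)
  -- `θ k` tends to zero uniformly while its derivative tends to the indicator of `{0}`. The zero
  -- function therefore has the weak gradient `U` restricted to `{u = 0}`, and uniqueness makes this
  -- restriction vanish.
  have h1 : H1Pair γ Ω (fun _ => (0 : ℝ)) ({z | u z = 0}.indicator U) := by
    refine h1Pair_of_dominated hγ hp h.memLp.norm h.memLp_grad.norm
      (fun k => Eventually.of_forall fun z => ?_) (fun k => Eventually.of_forall fun z => ?_)
      (Eventually.of_forall fun z => ?_) (Eventually.of_forall fun z => ?_)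
    · have := abs_sub_le_of_deriv_le convex_univ (fun s _ => (hd k s).differentiableAt)
        (fun s _ => hd1 k s) (Set.mem_univ (u z)) (Set.mem_univ 0)
      simpa [h00] using this
    · rw [norm_smul]
      exact mul_le_of_le_one_left (norm_nonneg _) (hd1 k _)
    · have hz : Tendsto (fun k : ℕ => (k + 1 : ℝ)⁻¹ * (Real.pi / 2)) atTop (𝓝 0) := by
        simpa using (tendsto_one_div_add_atTop_nhds_zero_nat (𝕜 := ℝ)).mul_const (Real.pi / 2)
      refine squeeze_zero_norm (fun k => ?_) hz
      rw [norm_mul, Real.norm_of_nonneg (inv_pos.2 (kpos k)).le]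
      refine mul_le_mul_of_nonneg_left ?_ (inv_pos.2 (kpos k)).le
      exact abs_le.2 ⟨(Real.neg_pi_div_two_lt_arctan _).le, (Real.arctan_lt_pi_div_two _).le⟩
    · by_cases hz : u z = 0
      · rw [Set.indicator_of_mem (by exact hz)]
        simp [(hd _ _).deriv, hz]
      · rw [Set.indicator_of_notMem (by exact hz)]
        have : Tendsto (fun k : ℕ => deriv (θ k) (u z)) atTop (𝓝 0) := by
          simp only [(hd _ _).deriv, one_div]
          refine Filter.Tendsto.inv_tendsto_atTop (tendsto_atTop_add_const_left _ _ ?_)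
          simp only [mul_pow]
          refine Tendsto.atTop_mul_const (by positivity) ?_
          exact (tendsto_pow_atTop two_ne_zero).comp
            (tendsto_atTop_add_const_right _ _ tendsto_natCast_atTop_atTop)
        simpa using this.smul_const (U z)
  have h2 : H1Pair γ Ω (fun _ => (0 : ℝ)) (fun _ : Pt n m => (0 : Vec n m)) :=
    ⟨MemLp.zero', MemLp.zero', fun ψ _ j => by simp⟩
  filter_upwards [h1.unique hΩ h2] with z hz hz0
  rwa [Set.indicator_of_mem (by exact hz0)] at hz

lemma H1Pair.abs {γ : ℝ} (hγ : 0 < γ) {Ω : Set (Pt n m)} (hΩ : IsOpen Ω)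
    {u : Pt n m → ℝ} {U : Pt n m → Vec n m} (h : H1Pair γ Ω u U) :
    H1Pair γ Ω (fun z => |u z|) (fun z => (u z / |u z|) • U z) := by
  set ε : ℕ → ℝ := fun k => 1 / (k + 1) with hε
  have ε0 : ∀ k, 0 < ε k := fun k => by simp only [hε]; positivity
  have εlim : Tendsto ε atTop (𝓝 0) := tendsto_one_div_add_atTop_nhds_zero_nat
  -- Subtracting `ε k` gives the value zero at zero that the chain rule asks for. The derivative at
  -- zero is zero, in agreement with the default value `0 / 0 = 0` in the limiting gradient.
  set θ : ℕ → ℝ → ℝ := fun k t => √(t ^ 2 + ε k ^ 2) - ε k with hθ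
  have hpos : ∀ k t, 0 < t ^ 2 + ε k ^ 2 := fun k t => by have := ε0 k; positivity
  have hd : ∀ k t, HasDerivAt (θ k) (t / √(t ^ 2 + ε k ^ 2)) t := by
    intro k t
    have h1 : HasDerivAt (fun t : ℝ => t ^ 2 + ε k ^ 2) (2 * t) t := by
      simpa using (hasDerivAt_pow 2 t).add_const (ε k ^ 2)
    have h2 := (h1.sqrt (hpos k t).ne').sub_const (ε k)
    convert! h2 using 1
    rw [mul_div_mul_left _ _ two_ne_zero]
  have hd1 : ∀ k t, |deriv (θ k) t| ≤ 1 := by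
    intro k t
    rw [(hd k t).deriv, abs_div, abs_of_nonneg (Real.sqrt_nonneg _),
      div_le_one (Real.sqrt_pos.2 (hpos k t))]
    exact Real.abs_le_sqrt (by nlinarith [sq_nonneg (ε k)])
  have h00 : ∀ k, θ k 0 = 0 := fun k => by simp [hθ, Real.sqrt_sq (ε0 k).le]
  have hc : ∀ k, ContDiff ℝ 1 (θ k) := fun k =>
    (((contDiff_id.pow 2).add contDiff_const).sqrt fun t => (hpos k t).ne').sub contDiff_const
  have hp := fun k => h.comp hγ hΩ (Or.inl rfl) (fun s _ => (hc k).contDiffAt)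
    (fun s _ => hd1 k s) (h00 k) (Eventually.of_forall fun _ => Set.mem_univ _)
  have hsq : ∀ t : ℝ, Tendsto (fun k => √(t ^ 2 + ε k ^ 2)) atTop (𝓝 |t|) := fun t => by
    have : Tendsto (fun k => √(t ^ 2 + ε k ^ 2)) atTop (𝓝 (√(t ^ 2 + 0 ^ 2))) :=
      ((εlim.pow 2).const_add (t ^ 2)).sqrt
    simpa [Real.sqrt_sq_eq_abs] using this
  refine h1Pair_of_dominated hγ hp h.memLp.norm h.memLp_grad.norm
      (fun k => Eventually.of_forall fun z => ?_) (fun k => Eventually.of_forall fun z => ?_)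
      (Eventually.of_forall fun z => ?_) (Eventually.of_forall fun z => ?_)
  · have := abs_sub_le_of_deriv_le convex_univ (fun s _ => (hd k s).differentiableAt)
      (fun s _ => hd1 k s) (Set.mem_univ (u z)) (Set.mem_univ 0)
    simpa [h00] using this
  · rw [norm_smul]
    exact mul_le_of_le_one_left (norm_nonneg _) (hd1 k _)
  · simpa using (hsq (u z)).sub εlim
  · by_cases hz : u z = 0
    · simp [(hd _ _).deriv, hz]
    · simp only [(hd _ _).deriv]
      exact (tendsto_const_nhds.div (hsq _) (by simpa using hz)).smul_const _

/-- The positive part is half the sum of `u` and `|u|`. -/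
lemma H1Pair.posPart {γ : ℝ} (hγ : 0 < γ) {Ω : Set (Pt n m)} (hΩ : IsOpen Ω)
    {u : Pt n m → ℝ} {U : Pt n m → Vec n m} (h : H1Pair γ Ω u U) :
    H1Pair γ Ω (fun z => max (u z) 0) ({z | 0 < u z}.indicator U) := by
  refine ((h.const_mul (1 / 2)).add hγ ((h.abs hγ hΩ).const_mul (1 / 2))).congr
    (Eventually.of_forall fun z => ?_) ?_
  · rcases le_total 0 (u z) with hz | hz
    · simp only [abs_of_nonneg hz, max_eq_left hz]; ring
    · simp only [abs_of_nonpos hz, max_eq_right hz]; ring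
  · filter_upwards [h.grad_eq_zero_of_eq_zero hγ hΩ] with z hz
    rcases lt_trichotomy 0 (u z) with h1 | h1 | h1
    · rw [Set.indicator_of_mem (by exact h1), abs_of_pos h1, div_self h1.ne', one_smul, ← add_smul]
      norm_num
    · rw [Set.indicator_of_notMem (by simp [← h1]), hz h1.symm]; simp
    · rw [Set.indicator_of_notMem (by simpa using h1.le), abs_of_neg h1, div_neg,
        div_self h1.ne, smul_smul, ← add_smul]
      norm_num

lemma H1Pair.h10Pair_of_compact {γ : ℝ} (hγ : 0 < γ) {Ω K : Set (Pt n m)} (hΩ : IsOpen Ω)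
    (hK : IsCompact K) (hKΩ : K ⊆ Ω) {u : Pt n m → ℝ} {U : Pt n m → Vec n m}
    (h : H1Pair γ Ω u U) (h0 : ∀ᵐ z ∂volume.restrict Ω, z ∉ K → u z = 0) : H10Pair γ Ω u U := by
  obtain ⟨-, ψ, -, -, h1, -, h2, h3, -⟩ := h.exists_test_approx hγ hΩ hK hKΩ h0
  exact ⟨h.memLp, h.memLp_grad, ψ, h1, h2, h3⟩

/-- Almost everywhere limits of bounded sequences in `H¹₀`. -/
lemma exists_h10Pair_of_ae_limit (hn : 1 ≤ n) (hm : 1 ≤ m) {γ : ℝ} (hγ : 0 < γ)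
    {Ω : Set (Pt n m)} (hΩ : IsOpen Ω) (hb : Bornology.IsBounded Ω) {u : ℕ → Pt n m → ℝ}
    {U : ℕ → Pt n m → Vec n m} (h : ∀ k, H10Pair γ Ω (u k) (U k)) {C : ℝ}
    (hU : ∀ k, eLpNorm (U k) 2 (volume.restrict Ω) ≤ ENNReal.ofReal C) {u₀ : Pt n m → ℝ}
    (hlim : ∀ᵐ z ∂volume.restrict Ω, Tendsto (fun k => u k z) atTop (𝓝 (u₀ z))) :
    ∃ (U₀ : Pt n m → Vec n m) (s : ℕ → ℕ), StrictMono s ∧ H10Pair γ Ω u₀ U₀ ∧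
      ∀ V, MemLp V 2 (volume.restrict Ω) →
        Tendsto (fun k => ∫ z in Ω, inner ℝ (U (s k) z) (V z)) atTop
          (𝓝 (∫ z in Ω, inner ℝ (U₀ z) (V z))) := by
  obtain ⟨u₁, U₀, s, hs, h1, -, h2, h3⟩ := exists_compact_subseq hn hm hγ hΩ hb h hU
  refine ⟨U₀, s, hs, h1.congr ?_ (ae_eq_refl _), h3⟩
  filter_upwards [hlim, h2] with z hz hz'
  exact tendsto_nhds_unique hz' (hz.comp hs.tendsto_atTop)

/-- The truncation `min(h, ψ⁺)` of a nonnegative function by a test function. -/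
lemma H1Pair.min_test {γ : ℝ} (hγ : 0 < γ) {Ω : Set (Pt n m)} (hΩ : IsOpen Ω)
    {h : Pt n m → ℝ} {H : Pt n m → Vec n m} (hh : H1Pair γ Ω h H)
    (h0 : ∀ᵐ z ∂volume.restrict Ω, 0 ≤ h z) {ψ : Pt n m → ℝ} (hψ : IsTest Ω ψ) :
    ∃ W : Pt n m → Vec n m, H10Pair γ Ω (fun z => min (h z) (max (ψ z) 0)) W ∧
      ∀ z, ‖W z‖ ≤ ‖H z‖ + ‖grad γ ψ z‖ := by
  have h1 := (hψ.h1Pair hγ (Ω := Ω)).posPart hγ hΩ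
  have h2 := (hh.sub hγ h1).posPart hγ hΩ
  have h3 := hh.sub hγ h2
  have e : (fun z => h z - max (h z - max (ψ z) 0) 0) = fun z => min (h z) (max (ψ z) 0) := by
    funext z
    rcases le_total (h z) (max (ψ z) 0) with hz | hz
    · rw [max_eq_right (sub_nonpos.2 hz), min_eq_left hz, sub_zero]
    · rw [max_eq_left (sub_nonneg.2 hz), min_eq_right hz, sub_sub_cancel]
  rw [e] at h3
  refine ⟨_, h3.h10Pair_of_compact hγ hΩ hψ.compact hψ.supp ?_, fun z => ?_⟩
  · filter_upwards [h0] with z hz hz'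
    rw [image_eq_zero_of_notMem_tsupport hz', max_self, min_eq_right hz]
  · have h4 : ‖{z | 0 < ψ z}.indicator (grad γ ψ) z‖ ≤ ‖grad γ ψ z‖ :=
      norm_indicator_le_norm_self _ _
    by_cases hz : z ∈ {z | 0 < h z - max (ψ z) 0}
    · rw [Set.indicator_of_mem hz, sub_sub_cancel]
      exact h4.trans (le_add_of_nonneg_left (norm_nonneg _))
    · rw [Set.indicator_of_notMem hz, sub_zero]
      exact le_add_of_nonneg_right (norm_nonneg _)

/-- For `0 ≤ h ≤ k` with `h ∈ H¹` and `k ∈ H¹₀`, the function `h` is the limit of bounded compactly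
supported functions below it. -/
lemma H1Pair.exists_approx_of_le (hn : 1 ≤ n) (hm : 1 ≤ m) {γ : ℝ} (hγ : 0 < γ)
    {Ω : Set (Pt n m)} (hΩ : IsOpen Ω) (hb : Bornology.IsBounded Ω) {h k : Pt n m → ℝ}
    {H K : Pt n m → Vec n m} (hh : H1Pair γ Ω h H) (hk : H10Pair γ Ω k K)
    (h0 : ∀ᵐ z ∂volume.restrict Ω, 0 ≤ h z) (hle : ∀ᵐ z ∂volume.restrict Ω, h z ≤ k z) :
    ∃ (ψ : ℕ → Pt n m → ℝ) (W : ℕ → Pt n m → Vec n m), (∀ j, IsTest Ω (ψ j)) ∧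
      (∀ j, H10Pair γ Ω (fun z => min (h z) (max (ψ j z) 0)) (W j)) ∧
      (∀ᵐ z ∂volume.restrict Ω,
        Tendsto (fun j => min (h z) (max (ψ j z) 0)) atTop (𝓝 (h z))) ∧
      H10Pair γ Ω h H ∧ ∀ V, MemLp V 2 (volume.restrict Ω) →
        Tendsto (fun j => ∫ z in Ω, inner ℝ (W j z) (V z)) atTop
          (𝓝 (∫ z in Ω, inner ℝ (H z) (V z))) := by
  obtain ⟨ψ, hψ, h1, h2⟩ := hk.approx
  obtain ⟨s, hs, hae⟩ := exists_subseq_ae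
    (fun j => ((hψ j).memLp 2 (volume.restrict Ω)).1) hk.memLp.1 h1
  choose W hW hWle using fun j => hh.min_test hγ hΩ h0 (hψ (s j))
  obtain ⟨C, hC0, hC⟩ := exists_bound_of_tendsto hk.memLp_grad.2.ne
    (fun j => ((hψ j).memLp_grad hγ 2 (volume.restrict Ω)).2.ne)
    (tendsto_eLpNorm_of_sub (fun j => (hψ j).memLp_grad hγ 2 _) hk.memLp_grad h2)
  have hWb : ∀ j, eLpNorm (W j) 2 (volume.restrict Ω) ≤
      ENNReal.ofReal ((eLpNorm H 2 (volume.restrict Ω)).toReal + C) := by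
    intro j
    rw [ENNReal.ofReal_add ENNReal.toReal_nonneg hC0, ENNReal.ofReal_toReal hh.memLp_grad.2.ne]
    have h3 : eLpNorm (W j) 2 (volume.restrict Ω) ≤
        eLpNorm ((fun z => ‖H z‖) + fun z => ‖grad γ (ψ (s j)) z‖) 2 (volume.restrict Ω) :=
      eLpNorm_mono fun z => (hWle j z).trans (Real.le_norm_self _)
    refine h3.trans ((eLpNorm_add_le hh.memLp_grad.1.norm
      ((hψ (s j)).memLp_grad hγ 2 _).1.norm (by norm_num)).trans ?_)
    rw [eLpNorm_norm, eLpNorm_norm]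
    exact add_le_add le_rfl (hC _)
  have hlim : ∀ᵐ z ∂volume.restrict Ω,
      Tendsto (fun j => min (h z) (max (ψ (s j) z) 0)) atTop (𝓝 (h z)) := by
    filter_upwards [hae, h0, hle] with z h3 h4 h5
    have : Tendsto (fun j => min (h z) (max (ψ (s j) z) 0)) atTop (𝓝 (min (h z) (max (k z) 0))) :=
      tendsto_const_nhds.min (h3.max tendsto_const_nhds)
    rwa [max_eq_left (h4.trans h5), min_eq_left h5] at this
  obtain ⟨U₀, t, ht, h3, h4⟩ := exists_h10Pair_of_ae_limit hn hm hγ hΩ hb hW hWb hlim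
  have hU : U₀ =ᵐ[volume.restrict Ω] H := (h3.h1Pair hγ).unique hΩ hh
  refine ⟨fun j => ψ (s (t j)), fun j => W (t j), fun j => hψ _, fun j => hW _, ?_,
    h3.congr (ae_eq_refl _) hU, fun V hV => ?_⟩
  · filter_upwards [hlim] with z hz using hz.comp ht.tendsto_atTop
  · rw [integral_congr_ae (show (fun z => inner ℝ (H z) (V z)) =ᵐ[volume.restrict Ω]
      fun z => inner ℝ (U₀ z) (V z) from hU.mono fun z hz => by simp only [hz])]
    exact h4 V hV

/-- This puts `(w - φ₂)⁺` into `H¹₀` although `φ₂` itself need not vanish on the boundary: it lies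
below the sum of `w⁺` and the negative part of `φ₂`. -/
lemma H1Pair.h10Pair_of_le (hn : 1 ≤ n) (hm : 1 ≤ m) {γ : ℝ} (hγ : 0 < γ)
    {Ω : Set (Pt n m)} (hΩ : IsOpen Ω) (hb : Bornology.IsBounded Ω) {h k : Pt n m → ℝ}
    {H K : Pt n m → Vec n m} (hh : H1Pair γ Ω h H) (hk : H10Pair γ Ω k K)
    (h0 : ∀ᵐ z ∂volume.restrict Ω, 0 ≤ h z) (hle : ∀ᵐ z ∂volume.restrict Ω, h z ≤ k z) :
    H10Pair γ Ω h H := by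
  obtain ⟨-, -, -, -, -, h1, -⟩ := hh.exists_approx_of_le hn hm hγ hΩ hb hk h0 hle
  exact h1

/-- The positive parts of the approximating test functions lie in `H¹₀` with bounded gradients, so
their almost everywhere limit does too; uniqueness identifies its gradient. -/
lemma H10Pair.posPart (hn : 1 ≤ n) (hm : 1 ≤ m) {γ : ℝ} (hγ : 0 < γ)
    {Ω : Set (Pt n m)} (hΩ : IsOpen Ω) (hb : Bornology.IsBounded Ω) {u : Pt n m → ℝ}
    {U : Pt n m → Vec n m} (h : H10Pair γ Ω u U) :
    H10Pair γ Ω (fun z => max (u z) 0) ({z | 0 < u z}.indicator U) := by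
  have hp := (h.h1Pair hγ).posPart hγ hΩ
  obtain ⟨ψ, hψ, h1, h2⟩ := h.approx
  obtain ⟨s, hs, hae⟩ := exists_subseq_ae
    (fun j => ((hψ j).memLp 2 (volume.restrict Ω)).1) h.memLp.1 h1
  obtain ⟨C, hC0, hC⟩ := exists_bound_of_tendsto h.memLp_grad.2.ne
    (fun j => ((hψ j).memLp_grad hγ 2 (volume.restrict Ω)).2.ne)
    (tendsto_eLpNorm_of_sub (fun j => (hψ j).memLp_grad hγ 2 _) h.memLp_grad h2)
  have hW : ∀ j, H10Pair γ Ω (fun z => max (ψ (s j) z) 0)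
      ({z | 0 < ψ (s j) z}.indicator (grad γ (ψ (s j)))) := fun j =>
    (((hψ (s j)).h1Pair hγ (Ω := Ω)).posPart hγ hΩ).h10Pair_of_compact hγ hΩ (hψ (s j)).compact
      (hψ (s j)).supp (Eventually.of_forall fun z hz => by
        rw [image_eq_zero_of_notMem_tsupport hz, max_self])
  obtain ⟨U₀, t, ht, h3, -⟩ := exists_h10Pair_of_ae_limit hn hm hγ hΩ hb hW (C := C)
    (fun j => (eLpNorm_mono fun z => norm_indicator_le_norm_self _ _).trans (hC _))
    (u₀ := fun z => max (u z) 0) (by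
      filter_upwards [hae] with z hz using hz.max tendsto_const_nhds)
  exact h3.congr (ae_eq_refl _) ((h3.h1Pair hγ).unique hΩ hp)

/-! ### Extension of distributional inequalities to bounded test functions. -/

/-- Fatou's lemma for Bochner integrals of nonnegative functions. -/
lemma integrable_of_fatou {α : Type*} [MeasurableSpace α] {μ : Measure α} {f : ℕ → α → ℝ}
    {f₀ : α → ℝ} (hf : ∀ k, Integrable (f k) μ) (h0 : ∀ k, ∀ᵐ z ∂μ, 0 ≤ f k z) {c : ℕ → ℝ}
    {c₀ : ℝ} (hc : ∀ k, ∫ z, f k z ∂μ ≤ c k) (hcl : Tendsto c atTop (𝓝 c₀))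
    (hlim : ∀ᵐ z ∂μ, Tendsto (fun k => f k z) atTop (𝓝 (f₀ z))) :
    Integrable f₀ μ ∧ ∫ z, f₀ z ∂μ ≤ c₀ := by
  have m0 : AEStronglyMeasurable f₀ μ :=
    aestronglyMeasurable_of_tendsto_ae atTop (fun k => (hf k).1) hlim
  have p0 : ∀ᵐ z ∂μ, 0 ≤ f₀ z := by
    filter_upwards [ae_all_iff.2 h0, hlim] with z h1 h2
    exact ge_of_tendsto' h2 h1
  have h1 : ∫⁻ z, ENNReal.ofReal (f₀ z) ∂μ ≤ ENNReal.ofReal c₀ := by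
    calc ∫⁻ z, ENNReal.ofReal (f₀ z) ∂μ
        = ∫⁻ z, liminf (fun k => ENNReal.ofReal (f k z)) atTop ∂μ := by
          refine lintegral_congr_ae ?_
          filter_upwards [hlim] with z hz
          exact ((ENNReal.continuous_ofReal.tendsto _).comp hz).liminf_eq.symm
      _ ≤ liminf (fun k => ∫⁻ z, ENNReal.ofReal (f k z) ∂μ) atTop :=
          lintegral_liminf_le' fun k => (hf k).1.aemeasurable.ennreal_ofReal
      _ ≤ liminf (fun k => ENNReal.ofReal (c k)) atTop := by
          refine liminf_le_liminf (Eventually.of_forall fun k => ?_)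
          rw [← ofReal_integral_eq_lintegral_ofReal (hf k) (h0 k)]
          exact ENNReal.ofReal_le_ofReal (hc k)
      _ = ENNReal.ofReal c₀ := ((ENNReal.continuous_ofReal.tendsto _).comp hcl).liminf_eq
  have hi : Integrable f₀ μ := by
    refine ⟨m0, ?_⟩
    rw [hasFiniteIntegral_iff_ofReal p0]
    exact h1.trans_lt ENNReal.ofReal_lt_top
  refine ⟨hi, ?_⟩
  have c0 : 0 ≤ c₀ := ge_of_tendsto' hcl fun k => (integral_nonneg_of_ae (h0 k)).trans (hc k)
  rw [← ofReal_integral_eq_lintegral_ofReal hi p0] at h1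
  exact (ENNReal.ofReal_le_ofReal_iff c0).1 h1

/-- A distributional inequality extends to bounded functions with compact support. -/
lemma distrib_ineq_of_compact {γ : ℝ} (hγ : 0 < γ) {Ω K : Set (Pt n m)} (hΩ : IsOpen Ω)
    {q : Pt n m → Vec n m} (hq : MemLp q 2 (volume.restrict Ω)) {b : Pt n m → ℝ}
    (hb : LocallyIntegrableOn b Ω)
    (h : ∀ ψ, IsTest Ω ψ → (∀ z, 0 ≤ ψ z) → 0 ≤ ∫ z in Ω, (inner ℝ (q z) (grad γ ψ z) + b z * ψ z))
    (hK : IsCompact K) (hKΩ : K ⊆ Ω) {v : Pt n m → ℝ} {V : Pt n m → Vec n m}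
    (hv : H1Pair γ Ω v V) (hvK : ∀ᵐ z ∂volume.restrict Ω, z ∉ K → v z = 0)
    (v0 : ∀ᵐ z ∂volume.restrict Ω, 0 ≤ v z) {M : ℝ} (hM : 0 ≤ M)
    (vM : ∀ᵐ z ∂volume.restrict Ω, |v z| ≤ M) :
    Integrable (fun z => b z * v z) (volume.restrict Ω) ∧
      0 ≤ (∫ z in Ω, inner ℝ (q z) (V z)) + ∫ z in Ω, b z * v z := by
  obtain ⟨K', ψ, hK', hK'Ω, hψ, hψ0, h1, h2, h3, h4⟩ := hv.exists_test_approx hγ hΩ hK hKΩ hvK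
  replace h3 := h3 v0
  replace h4 := h4 M hM vM
  obtain ⟨s, hs, hae⟩ := exists_subseq_ae
    (fun k => ((hψ k).memLp 2 (volume.restrict Ω)).1) hv.memLp.1 h1
  have bK : IntegrableOn b K' := hb.integrableOn_compact_subset hK'Ω hK'
  have hbm : AEStronglyMeasurable b (volume.restrict Ω) := hb.aestronglyMeasurable
  -- The approximations share the compact set `K'` and the bound `M`, so local integrability of `b`
  -- is enough for dominated convergence.
  have dom : Integrable (K'.indicator fun z => M * |b z|) (volume.restrict Ω) :=
    (integrable_indicator_iff hK'.measurableSet).2 (bK.norm.const_mul M) |>.restrict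
  have hdom : ∀ k, ∀ᵐ z ∂volume.restrict Ω, ‖b z * ψ (s k) z‖ ≤ K'.indicator (fun z => M * |b z|) z :=
    fun k => Eventually.of_forall fun z => by
      by_cases hz : z ∈ K'
      · rw [Set.indicator_of_mem hz, norm_mul, mul_comm]
        exact mul_le_mul_of_nonneg_right (h4 _ _) (abs_nonneg _)
      · rw [Set.indicator_of_notMem hz, hψ0 _ _ hz]; simp
  have hmeas : ∀ k, AEStronglyMeasurable (fun z => b z * ψ (s k) z) (volume.restrict Ω) :=
    fun k => hbm.mul ((hψ (s k)).memLp 2 _).1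
  have hlim : ∀ᵐ z ∂volume.restrict Ω,
      Tendsto (fun k => b z * ψ (s k) z) atTop (𝓝 (b z * v z)) := by
    filter_upwards [hae] with z hz using hz.const_mul _
  have l1 := tendsto_integral_of_dominated_convergence _ hmeas dom hdom hlim
  have l2 := tendsto_integral_inner (fun _ => hq)
    (fun k => (hψ (s k)).memLp_grad hγ 2 (volume.restrict Ω)) hq hv.memLp_grad
    (eLpNorm_const_tendsto q) (h2.comp hs.tendsto_atTop)
  refine ⟨dom.mono' (hbm.mul hv.memLp.1) ?_, ge_of_tendsto' (l2.add l1) fun k => ?_⟩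
  · filter_upwards [ae_all_iff.2 hdom, hlim] with z h5 h6
    exact le_of_tendsto' h6.norm h5
  · rw [← integral_add (integrable_inner_L2 hq ((hψ (s k)).memLp_grad hγ 2 _))
      (dom.mono' (hmeas k) (hdom k))]
    exact h _ (hψ _) (h3 _)

/-- A distributional inequality extends to bounded functions in `H¹₀`, provided that the positive
part of the lower order term is integrable. -/
lemma distrib_ineq_of_h10 (hn : 1 ≤ n) (hm : 1 ≤ m) {γ : ℝ} (hγ : 0 < γ) {Ω : Set (Pt n m)}
    (hΩ : IsOpen Ω) (hΩb : Bornology.IsBounded Ω)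
    {q : Pt n m → Vec n m} (hq : MemLp q 2 (volume.restrict Ω)) {b : Pt n m → ℝ}
    (hb : LocallyIntegrableOn b Ω)
    (h : ∀ ψ, IsTest Ω ψ → (∀ z, 0 ≤ ψ z) → 0 ≤ ∫ z in Ω, (inner ℝ (q z) (grad γ ψ z) + b z * ψ z))
    {v : Pt n m → ℝ} {V : Pt n m → Vec n m}
    (hv : H10Pair γ Ω v V) (v0 : ∀ᵐ z ∂volume.restrict Ω, 0 ≤ v z) {M : ℝ} (hM : 0 ≤ M)
    (vM : ∀ᵐ z ∂volume.restrict Ω, |v z| ≤ M)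
    (hB : Integrable (fun z => max (b z) 0 * v z) (volume.restrict Ω)) :
    Integrable (fun z => b z * v z) (volume.restrict Ω) ∧
      0 ≤ (∫ z in Ω, inner ℝ (q z) (V z)) + ∫ z in Ω, b z * v z := by
  -- The functions `min(v, ψ⁺)` have compact support and stay between `0` and `v`. Their gradients
  -- converge only weakly, which suffices because `q` is fixed.
  obtain ⟨ψ, W, hψ, hW, hlim, -, hweak⟩ := (hv.h1Pair hγ).exists_approx_of_le hn hm hγ hΩ hΩb hv v0
    (Eventually.of_forall fun _ => le_rfl)
  have hbm : AEStronglyMeasurable b (volume.restrict Ω) := hb.aestronglyMeasurable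
  set w : ℕ → Pt n m → ℝ := fun j z => min (v z) (max (ψ j z) 0) with hw
  have w0 : ∀ j, ∀ᵐ z ∂volume.restrict Ω, 0 ≤ w j z := fun j => by
    filter_upwards [v0] with z hz using le_min hz (le_max_right _ _)
  have wv : ∀ j z, w j z ≤ v z := fun j z => min_le_left _ _
  have key : ∀ j, Integrable (fun z => b z * w j z) (volume.restrict Ω) ∧
      0 ≤ (∫ z in Ω, inner ℝ (q z) (W j z)) + ∫ z in Ω, b z * w j z := by
    intro j
    refine distrib_ineq_of_compact hγ hΩ hq hb h (hψ j).compact (hψ j).supp ((hW j).h1Pair hγ)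
      ?_ (w0 j) hM ?_
    · filter_upwards [v0] with z hz hz'
      simp only [hw, image_eq_zero_of_notMem_tsupport hz', max_self, min_eq_right hz]
    · filter_upwards [w0 j, vM] with z h1 h2
      rw [abs_of_nonneg h1]
      exact (wv j z).trans ((le_abs_self _).trans h2)
  have l1 : Tendsto (fun j => ∫ z in Ω, inner ℝ (q z) (W j z)) atTop
      (𝓝 (∫ z in Ω, inner ℝ (q z) (V z))) := by
    simpa only [real_inner_comm] using hweak q hq
  have hBw : ∀ j, Integrable (fun z => max (b z) 0 * w j z) (volume.restrict Ω) := fun j => by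
    refine hB.mono' ((hbm.sup aestronglyMeasurable_const).mul (hW j).memLp.1) ?_
    filter_upwards [w0 j] with z h1
    rw [norm_mul, Real.norm_of_nonneg (le_max_right _ _), Real.norm_of_nonneg h1]
    exact mul_le_mul_of_nonneg_left (wv j z) (le_max_right _ _)
  have hbeq : ∀ (x y : ℝ), max (-x) 0 * y = max x 0 * y - x * y := fun x y => by
    rcases le_total 0 x with hx | hx
    · rw [max_eq_right (neg_nonpos.2 hx), max_eq_left hx]; ring
    · rw [max_eq_left (neg_nonneg.2 hx), max_eq_right hx]; ring
  -- The inequality for the truncations itself bounds the integrals of `b⁻ w`, since `b⁻ w = b⁺ w -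
  -- b w`. Integrability of `b⁻ v` is therefore a conclusion and needs no assumption.
  have hneg := integrable_of_fatou (μ := volume.restrict Ω)
    (f := fun j z => max (-b z) 0 * w j z) (f₀ := fun z => max (-b z) 0 * v z)
    (c := fun j => (∫ z in Ω, max (b z) 0 * v z) + ∫ z in Ω, inner ℝ (q z) (W j z))
    (fun j => by simp only [hbeq]; exact (hBw j).sub (key j).1)
    (fun j => by filter_upwards [w0 j] with z h1 using mul_nonneg (le_max_right _ _) h1)
    (fun j => by
      simp only [hbeq]
      rw [integral_sub (hBw j) (key j).1]
      have h1 : ∫ z in Ω, max (b z) 0 * w j z ≤ ∫ z in Ω, max (b z) 0 * v z :=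
        integral_mono (hBw j) hB fun z => mul_le_mul_of_nonneg_left (wv j z) (le_max_right _ _)
      linarith [(key j).2])
    (l1.const_add _) (by filter_upwards [hlim] with z hz using hz.const_mul _)
  have hbv : Integrable (fun z => b z * v z) (volume.restrict Ω) := by
    refine (hB.sub hneg.1).congr (Eventually.of_forall fun z => ?_)
    simp only [Pi.sub_apply, hbeq]; ring
  refine ⟨hbv, ?_⟩
  have l2 : Tendsto (fun j => ∫ z in Ω, b z * w j z) atTop (𝓝 (∫ z in Ω, b z * v z)) := by
    refine tendsto_integral_of_dominated_convergence (fun z => |b z * v z|)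
      (fun j => (key j).1.1) hbv.norm (fun j => ?_) ?_
    · filter_upwards [w0 j, v0] with z h1 h2
      rw [norm_mul, Real.norm_of_nonneg h1, abs_mul, abs_of_nonneg h2]
      exact mul_le_mul_of_nonneg_left (wv j z) (abs_nonneg _)
    · filter_upwards [hlim] with z hz using hz.const_mul _
  exact ge_of_tendsto' (l1.add l2) fun j => (key j).2

/-! ### Pointwise convexity of the nonlinearity, and measurability of superpositions. -/

/-- The real part of a convex function with values in `(-∞, ∞]`. -/
lemma convexOn_toReal {H : ℝ → EReal} (hbot : ∀ t, H t ≠ ⊥)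
    (hconv : ∀ s t a b : ℝ, 0 < a → 0 < b → a + b = 1 →
      H (a * s + b * t) ≤ (a : EReal) * H s + (b : EReal) * H t) :
    ConvexOn ℝ {s | H s < ⊤} fun s => (H s).toReal := by
  have key : ∀ s t a b : ℝ, H s < ⊤ → H t < ⊤ → 0 < a → 0 < b → a + b = 1 →
      H (a * s + b * t) ≤ ((a * (H s).toReal + b * (H t).toReal : ℝ) : EReal) := by
    intro s t a b hs ht ha hb hab
    refine (hconv s t a b ha hb hab).trans (le_of_eq ?_)
    push_cast
    rw [EReal.coe_toReal hs.ne (hbot s), EReal.coe_toReal ht.ne (hbot t)]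
  refine convexOn_iff_forall_pos.2 ⟨convex_iff_forall_pos.2 ?_, ?_⟩
  · intro s hs t ht a b ha hb hab
    exact (key s t a b hs ht ha hb hab).trans_lt (EReal.coe_lt_top _)
  · intro s hs t ht a b ha hb hab
    have h1 := EReal.toReal_le_toReal (key s t a b hs ht ha hb hab) (hbot _) (EReal.coe_ne_top _)
    rwa [EReal.toReal_coe] at h1

/-- Convex primitives with values in `EReal` lie above their tangents. -/
lemma tangent_le_of_convex {H : ℝ → EReal} {h : ℝ → EReal}
    (hbot : ∀ t, H t ≠ ⊥)
    (hconv : ∀ s t a b : ℝ, 0 < a → 0 < b → a + b = 1 →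
      H (a * s + b * t) ≤ (a : EReal) * H s + (b : EReal) * H t)
    (hder : ∀ t ∈ interior {s : ℝ | H s < ⊤},
      ∃ d : ℝ, HasDerivAt (fun s => (H s).toReal) d t ∧ h t = (d : EReal))
    (hcH : ContinuousOn H {s : ℝ | H s < ⊤}) (hch : ContinuousOn h {s : ℝ | H s < ⊤}) {s t : ℝ}
    (hs : H s < ⊤) (ht : H t < ⊤) (hts : h s ≠ ⊤) (hbs : h s ≠ ⊥) :
    (h s).toReal * (t - s) ≤ (H t).toReal - (H s).toReal := by
  have hφ := convexOn_toReal hbot hconv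
  set D := {s : ℝ | H s < ⊤} with hD
  have hDo : D.OrdConnected := hφ.1.ordConnected
  have l1 : ∀ {l : Filter ℝ}, l ≤ 𝓝[D] s → Tendsto (fun r => (H r).toReal) l (𝓝 (H s).toReal) :=
    fun hl => (EReal.tendsto_toReal hs.ne (hbot s)).comp ((hcH s hs).mono_left hl)
  have l2 : ∀ {l : Filter ℝ}, l ≤ 𝓝[D] s → Tendsto (fun r => (h r).toReal) l (𝓝 (h s).toReal) :=
    fun hl => (EReal.tendsto_toReal hts hbs).comp ((hch s hs).mono_left hl)
  have fin : ∀ {l : Filter ℝ} [l.NeBot], l ≤ 𝓝[D] s → (∀ᶠ r in l, (h r).toReal * (t - r) ≤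
      (H t).toReal - (H r).toReal) → (h s).toReal * (t - s) ≤ (H t).toReal - (H s).toReal := by
    intro l _ hl he
    have l3 : Tendsto (fun r => t - r) l (𝓝 (t - s)) :=
      (tendsto_id.mono_left (hl.trans nhdsWithin_le_nhds)).const_sub t
    exact le_of_tendsto_of_tendsto ((l2 hl).mul l3) ((l1 hl).const_sub _) he
  -- `s` may be an end point of the domain, where no derivative is given. The inequality is taken at
  -- points `r` strictly between `s` and `t`, which are interior, and passes to `s` by continuity of
  -- `H` and `h` on the domain.
  rcases lt_trichotomy s t with hst | rfl | hst
  · have hsub : Set.Icc s t ⊆ D := hDo.out hs ht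
    have hint : Set.Ioo s t ⊆ interior D :=
      interior_maximal (Set.Ioo_subset_Icc_self.trans hsub) isOpen_Ioo
    have := left_nhdsWithin_Ioo_neBot hst
    refine fin (l := 𝓝[Set.Ioo s t] s) (nhdsWithin_mono s (Set.Ioo_subset_Icc_self.trans hsub)) ?_
    · filter_upwards [self_mem_nhdsWithin] with r hr
      obtain ⟨d, hd1, hd2⟩ := hder r (hint hr)
      have h3 := hφ.le_slope_of_hasDerivAt (interior_subset (hint hr)) ht hr.2 hd1
      rw [slope_def_field, le_div_iff₀ (sub_pos.2 hr.2)] at h3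
      rwa [hd2, EReal.toReal_coe]
  · simp
  · have hsub : Set.Icc t s ⊆ D := hDo.out ht hs
    have hint : Set.Ioo t s ⊆ interior D :=
      interior_maximal (Set.Ioo_subset_Icc_self.trans hsub) isOpen_Ioo
    have := right_nhdsWithin_Ioo_neBot hst
    refine fin (l := 𝓝[Set.Ioo t s] s) (nhdsWithin_mono s (Set.Ioo_subset_Icc_self.trans hsub)) ?_
    · filter_upwards [self_mem_nhdsWithin] with r hr
      obtain ⟨d, hd1, hd2⟩ := hder r (hint hr)
      have h3 := hφ.slope_le_of_hasDerivAt ht (interior_subset (hint hr)) hr.1 hd1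
      rw [slope_def_field, div_le_iff₀ (sub_pos.2 hr.1)] at h3
      rw [hd2, EReal.toReal_coe]
      linarith

/-- The pointwise consequences of convexity, valid for almost every `z`. -/
structure ConvexAt (g G : ℝ → EReal) : Prop where
  bot : ∀ t, G t ≠ ⊥
  dom : ∀ {s r t : ℝ}, s ≤ r → r ≤ t → G s < ⊤ → G t < ⊤ → G r < ⊤
  finite : ∀ {s r t : ℝ}, s < r → r < t → G s < ⊤ → G t < ⊤ → g r ≠ ⊤ ∧ g r ≠ ⊥
  tangent : ∀ {s t : ℝ}, G s < ⊤ → G t < ⊤ → g s ≠ ⊤ → g s ≠ ⊥ →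
    (g s).toReal * (t - s) ≤ (G t).toReal - (G s).toReal
  convexOn : ConvexOn ℝ {s | G s < ⊤} fun s => (G s).toReal
  cont_g : ContinuousOn g {s | G s < ⊤}
  cont_G : ContinuousOn G {s | G s < ⊤}

lemma ConvexPrimitive.convexAt {γ : ℝ} {Ω : Set (Pt n m)} (hΩ : IsOpen Ω)
    {g G : Pt n m → ℝ → EReal} (h : ConvexPrimitive γ Ω g G) :
    ∀ᵐ z ∂volume.restrict Ω, ConvexAt (g z) (G z) := by
  filter_upwards [h.convex, h.deriv, h.continuous_G, h.continuous_g,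
    ae_restrict_mem hΩ.measurableSet] with z h1 h2 h3 h4 h5
  have hb := h.G_ne_bot z h5
  have hφ := convexOn_toReal hb h1
  have hDo := hφ.1.ordConnected
  refine ⟨hb, fun h6 h7 h8 h9 => hDo.out h8 h9 ⟨h6, h7⟩, fun {s r t} h6 h7 h8 h9 => ?_,
    fun h6 h7 h8 h9 => tangent_le_of_convex hb h1 h2 h3 h4 h6 h7 h8 h9, hφ, h4, h3⟩
  have hint : Set.Ioo s t ⊆ interior {s | G z s < ⊤} :=
    interior_maximal (Set.Ioo_subset_Icc_self.trans (hDo.out h8 h9)) isOpen_Ioo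
  obtain ⟨d, -, hd⟩ := h2 r (hint ⟨h6, h7⟩)
  rw [hd]
  exact ⟨EReal.coe_ne_top _, EReal.coe_ne_bot _⟩

lemma ConvexAt.finite_between {g G : ℝ → EReal} (h : ConvexAt g G) {s r t : ℝ} (hsr : s ≤ r)
    (hrt : r ≤ t) (hs : G s < ⊤) (ht : G t < ⊤) (gs : g s ≠ ⊤ ∧ g s ≠ ⊥)
    (gt : g t ≠ ⊤ ∧ g t ≠ ⊥) : g r ≠ ⊤ ∧ g r ≠ ⊥ := by
  rcases hsr.eq_or_lt with rfl | h1
  · exact gs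
  rcases hrt.eq_or_lt with rfl | h2
  · exact gt
  exact h.finite h1 h2 hs ht

/-- The tangent inequalities at `s` and at `t` add up to `(g s - g t) (t - s) ≤ 0`. -/
lemma ConvexAt.mono {g G : ℝ → EReal} (h : ConvexAt g G) {s t : ℝ} (hst : s ≤ t)
    (hs : G s < ⊤) (ht : G t < ⊤) (gs : g s ≠ ⊤ ∧ g s ≠ ⊥)
    (gt : g t ≠ ⊤ ∧ g t ≠ ⊥) : (g s).toReal ≤ (g t).toReal := by
  rcases hst.eq_or_lt with rfl | h1
  · exact le_rfl
  have h2 := h.tangent hs ht gs.1 gs.2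
  have h3 := h.tangent ht hs gt.1 gt.2
  by_contra! hc
  nlinarith [mul_pos (sub_pos.2 hc) (sub_pos.2 h1)]

/-- Measurability of a superposition with a function that is continuous on order intervals. -/
lemma aemeasurable_comp_of_continuousOn {μ : Measure (Pt n m)} {H : Pt n m → ℝ → EReal}
    (hH : ∀ t, AEMeasurable (fun z => H z t) μ) {φ u ψ : Pt n m → ℝ} (hφ : AEMeasurable φ μ)
    (hu : AEMeasurable u μ) (hψ : AEMeasurable ψ μ) (h1 : ∀ᵐ z ∂μ, φ z ≤ u z ∧ u z ≤ ψ z)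
    (hc : ∀ᵐ z ∂μ, ContinuousOn (H z) (Set.Icc (φ z) (ψ z))) {H₀ : Pt n m → EReal}
    (hH₀ : AEMeasurable H₀ μ) (h0 : ∀ᵐ z ∂μ, φ z = ψ z → H z (u z) = H₀ z) :
    AEMeasurable (fun z => H z (u z)) μ := by
  classical
  obtain ⟨e, he⟩ := exists_surjective_nat ℚ
  set φ' := hφ.mk φ
  set u' := hu.mk u
  set ψ' := hψ.mk ψ
  -- Rational points near `u z` inside the interval are available only if the interval is
  -- nondegenerate; elsewhere `H₀` supplies the value. The alternative `¬ good z` in `p` merely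
  -- makes the search for an index always succeed.
  set good : Pt n m → Prop := fun z => φ' z < ψ' z ∧ φ' z ≤ u' z ∧ u' z ≤ ψ' z with hgood
  set p : ℕ → ℕ → Pt n m → Prop := fun k i z => (φ' z ≤ (e i : ℝ) ∧ (e i : ℝ) ≤ ψ' z ∧
    |(e i : ℝ) - u' z| < 1 / (k + 1)) ∨ ¬ good z with hp
  have mgood : MeasurableSet {z | good z} :=
    (measurableSet_lt hφ.measurable_mk hψ.measurable_mk).inter
      ((measurableSet_le hφ.measurable_mk hu.measurable_mk).inter
        (measurableSet_le hu.measurable_mk hψ.measurable_mk))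
  have mp : ∀ k i, MeasurableSet {z | p k i z} := fun k i =>
    ((measurableSet_le hφ.measurable_mk measurable_const).inter
      ((measurableSet_le measurable_const hψ.measurable_mk).inter
        (measurableSet_lt ((measurable_const.sub hu.measurable_mk).abs) measurable_const))).union
      mgood.compl
  have ex : ∀ k z, ∃ i, p k i z := by
    intro k z
    by_cases hz : good z
    · have hk : (0 : ℝ) < 1 / (k + 1) := by positivity
      obtain ⟨q, hq1, hq2⟩ : ∃ q : ℚ, max (φ' z) (u' z - 1 / (k + 1)) < q ∧
          (q : ℝ) < min (ψ' z) (u' z + 1 / (k + 1)) := by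
        refine exists_rat_btwn (lt_min (max_lt hz.1 ?_) (max_lt ?_ ?_))
        · linarith [hz.2.2]
        · linarith [hz.2.1]
        · linarith
      obtain ⟨i, rfl⟩ := he q
      refine ⟨i, Or.inl ⟨((le_max_left _ _).trans_lt hq1).le, (hq2.trans_le (min_le_left _ _)).le,
        abs_lt.2 ⟨?_, ?_⟩⟩⟩
      · linarith [(le_max_right _ _).trans_lt hq1]
      · linarith [hq2.trans_le (min_le_right _ _)]
    · exact ⟨0, Or.inr hz⟩
  set H' : ℕ → Pt n m → EReal := fun i => (hH (e i)).mk _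
  have mH' : ∀ k, Measurable fun z => H' (Nat.find (ex k z)) z := fun k =>
    Measurable.find (fun i => (hH (e i)).measurable_mk) (mp k) (ex k)
  have hev : ∀ᵐ z ∂μ, ∀ i, H z (e i) = H' i z := ae_all_iff.2 fun i => (hH (e i)).ae_eq_mk
  have h2 : AEMeasurable (fun z => if good z then H z (u z) else H z (u z)) μ := by
    have h3 : AEMeasurable (fun z => H z (u z)) (μ.restrict {z | good z}) := by
      refine aemeasurable_of_tendsto_metrizable_ae atTop (fun k => (mH' k).aemeasurable) ?_
      filter_upwards [ae_restrict_mem mgood, ae_restrict_of_ae hev, ae_restrict_of_ae hc,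
        ae_restrict_of_ae hφ.ae_eq_mk, ae_restrict_of_ae hψ.ae_eq_mk,
        ae_restrict_of_ae hu.ae_eq_mk, ae_restrict_of_ae h1] with z k1 k2 k3 k4 k5 k6 k7
      have k8 : ∀ k, φ' z ≤ (e (Nat.find (ex k z)) : ℝ) ∧ (e (Nat.find (ex k z)) : ℝ) ≤ ψ' z ∧
          |(e (Nat.find (ex k z)) : ℝ) - u' z| < 1 / (k + 1) := fun k =>
        (Nat.find_spec (ex k z)).resolve_right fun hc => hc k1
      have k9 : Tendsto (fun k => (e (Nat.find (ex k z)) : ℝ)) atTop (𝓝 (u z)) := by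
        rw [tendsto_iff_norm_sub_tendsto_zero]
        refine squeeze_zero (fun _ => norm_nonneg _) (fun k => ?_)
          (tendsto_one_div_add_atTop_nhds_zero_nat (𝕜 := ℝ))
        rw [k6]
        exact (k8 k).2.2.le
      have k10 := (k3 (u z) k7).tendsto.comp (tendsto_nhdsWithin_iff.2 ⟨k9,
        Eventually.of_forall fun k => by rw [k4, k5]; exact ⟨(k8 k).1, (k8 k).2.1⟩⟩)
      refine k10.congr fun k => ?_
      exact k2 _
    have h4 : AEMeasurable (fun z => H z (u z)) (μ.restrict {z | good z}ᶜ) := by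
      refine (hH₀.restrict (s := {z | good z}ᶜ)).congr ?_
      filter_upwards [ae_restrict_mem mgood.compl, ae_restrict_of_ae h0,
        ae_restrict_of_ae hφ.ae_eq_mk, ae_restrict_of_ae hψ.ae_eq_mk,
        ae_restrict_of_ae hu.ae_eq_mk, ae_restrict_of_ae h1] with z k1 k2 k4 k5 k6 k7
      refine (k2 ?_).symm
      by_contra hne
      refine k1 ⟨?_, ?_, ?_⟩
      · rw [show φ' z = φ z from k4.symm, show ψ' z = ψ z from k5.symm]
        exact lt_of_le_of_ne (k7.1.trans k7.2) hne
      · rw [show φ' z = φ z from k4.symm, show u' z = u z from k6.symm]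
        exact k7.1
      · rw [show ψ' z = ψ z from k5.symm, show u' z = u z from k6.symm]
        exact k7.2
    simp only [ite_self]
    have h5 := aemeasurable_union_iff.2 ⟨h3, h4⟩
    rwa [Set.union_compl_self, Measure.restrict_univ] at h5
  simpa using h2

lemma IsCaratheodory.aemeasurable_comp {Ω : Set (Pt n m)} {f : Pt n m → ℝ → ℝ}
    (hf : IsCaratheodory Ω f) {u : Pt n m → ℝ} (hu : AEMeasurable u (volume.restrict Ω)) :
    AEMeasurable (fun z => f z (u z)) (volume.restrict Ω) := by
  have h1 : AEMeasurable (fun z => ((f z (u z) : ℝ) : EReal)) (volume.restrict Ω) := by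
    -- The auxiliary interval from `u - 1` to `u + 1` is never degenerate, so the value of `H₀` is
    -- immaterial.
    refine aemeasurable_comp_of_continuousOn (H := fun z t => ((f z t : ℝ) : EReal))
      (fun t => (hf.measurable t).coe_real_ereal) (hu.sub_const 1) hu (hu.add_const 1)
      (Eventually.of_forall fun z => ⟨by linarith, by linarith⟩) ?_ aemeasurable_const (H₀ := 0)
      (Eventually.of_forall fun z hz => by linarith)
    filter_upwards [hf.continuous] with z hz
    exact (continuous_coe_real_ereal.comp hz).continuousOn
  simpa using h1.ereal_toReal

/-- Convexity data of the nonlinearity at a point, on the interval `[a, b]`. -/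
structure ConvexBetween (g G : ℝ → EReal) (a b : ℝ) : Prop where
  conv : ConvexAt g G
  le : a ≤ b
  G_left : G a < ⊤
  G_right : G b < ⊤
  g_left : g a ≠ ⊤ ∧ g a ≠ ⊥
  g_right : g b ≠ ⊤ ∧ g b ≠ ⊥

section ConvexBetween

variable {g G : ℝ → EReal} {a b s t : ℝ}

lemma ConvexBetween.G_lt_top (h : ConvexBetween g G a b) (hs : s ∈ Set.Icc a b) : G s < ⊤ :=
  h.conv.dom hs.1 hs.2 h.G_left h.G_right

lemma ConvexBetween.g_finite (h : ConvexBetween g G a b) (hs : s ∈ Set.Icc a b) :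
    g s ≠ ⊤ ∧ g s ≠ ⊥ :=
  h.conv.finite_between hs.1 hs.2 h.G_left h.G_right h.g_left h.g_right

lemma ConvexBetween.mono (h : ConvexBetween g G a b) (hs : s ∈ Set.Icc a b)
    (ht : t ∈ Set.Icc a b) (hst : s ≤ t) : (g s).toReal ≤ (g t).toReal :=
  h.conv.mono hst (h.G_lt_top hs) (h.G_lt_top ht) (h.g_finite hs) (h.g_finite ht)

lemma ConvexBetween.abs_g_le (h : ConvexBetween g G a b) (hs : s ∈ Set.Icc a b) :
    |(g s).toReal| ≤ |(g a).toReal| + |(g b).toReal| := by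
  have h1 := h.mono ⟨le_rfl, h.le⟩ hs hs.1
  have h2 := h.mono hs ⟨h.le, le_rfl⟩ hs.2
  rw [abs_le]
  constructor
  · linarith [neg_abs_le (g a).toReal, abs_nonneg (g b).toReal]
  · linarith [le_abs_self (g b).toReal, abs_nonneg (g a).toReal]

lemma ConvexBetween.tangent (h : ConvexBetween g G a b) (hs : s ∈ Set.Icc a b)
    (ht : t ∈ Set.Icc a b) : (g s).toReal * (t - s) ≤ (G t).toReal - (G s).toReal :=
  h.conv.tangent (h.G_lt_top hs) (h.G_lt_top ht) (h.g_finite hs).1 (h.g_finite hs).2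

/-- The tangents at `s` and at `t` enclose the remainder of the first order expansion. This replaces
differentiability of `G` at end points of its domain, where only continuity of `g` is available. -/
lemma ConvexBetween.abs_sub_sub_le (h : ConvexBetween g G a b) (hs : s ∈ Set.Icc a b)
    (ht : t ∈ Set.Icc a b) : |(G t).toReal - (G s).toReal - (g s).toReal * (t - s)| ≤
      |(g t).toReal - (g s).toReal| * |t - s| := by
  have h1 := h.tangent hs ht
  have h2 := h.tangent ht hs
  rw [abs_of_nonneg (by linarith), ← abs_mul]
  refine le_trans ?_ (le_abs_self _)
  linarith

lemma ConvexBetween.abs_sub_le (h : ConvexBetween g G a b) (hs : s ∈ Set.Icc a b)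
    (ht : t ∈ Set.Icc a b) :
    |(G t).toReal - (G s).toReal| ≤ (|(g a).toReal| + |(g b).toReal|) * |t - s| := by
  have h1 := h.tangent hs ht
  have h2 := h.tangent ht hs
  have h3 : |(g s).toReal * (t - s)| ≤ (|(g a).toReal| + |(g b).toReal|) * |t - s| := by
    rw [abs_mul]; exact mul_le_mul_of_nonneg_right (h.abs_g_le hs) (abs_nonneg _)
  have h4 : |(g t).toReal * (s - t)| ≤ (|(g a).toReal| + |(g b).toReal|) * |t - s| := by
    rw [abs_mul, abs_sub_comm s t]
    exact mul_le_mul_of_nonneg_right (h.abs_g_le ht) (abs_nonneg _)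
  rw [abs_le] at h3 h4 ⊢
  constructor <;> linarith

lemma ConvexBetween.continuousOn_g (h : ConvexBetween g G a b) :
    ContinuousOn (fun s => (g s).toReal) (Set.Icc a b) := fun s hs =>
  ((EReal.tendsto_toReal (h.g_finite hs).1 (h.g_finite hs).2).comp
    ((h.conv.cont_g s (h.G_lt_top hs)).mono_left (nhdsWithin_mono s fun _ hr => h.G_lt_top hr)))

lemma ConvexBetween.continuousOn_G (h : ConvexBetween g G a b) :
    ContinuousOn (fun s => (G s).toReal) (Set.Icc a b) := fun s hs =>
  ((EReal.tendsto_toReal (h.G_lt_top hs).ne (h.conv.bot s)).comp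
    ((h.conv.cont_G s (h.G_lt_top hs)).mono_left (nhdsWithin_mono s fun _ hr => h.G_lt_top hr)))

end ConvexBetween

/-! ### Existence of a minimizer between the subsolution and the supersolution. -/

lemma exists_bound_of_memLp_top {μ : Measure (Pt n m)} {φ : Pt n m → ℝ} (h : MemLp φ ⊤ μ) :
    ∃ M : ℝ, 0 < M ∧ ∀ᵐ z ∂μ, |φ z| ≤ M := by
  have h1 := h.2
  rw [eLpNorm_exponent_top] at h1
  refine ⟨(eLpNormEssSup φ μ).toReal + 1, by positivity, ?_⟩
  filter_upwards [ae_le_eLpNormEssSup (f := φ) (μ := μ)] with z hz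
  have h2 := ENNReal.toReal_mono h1.ne hz
  simp only [toReal_enorm, Real.norm_eq_abs] at h2
  linarith

lemma isFiniteMeasure_restrict {Ω : Set (Pt n m)} (h : Bornology.IsBounded Ω) :
    IsFiniteMeasure (volume.restrict Ω) :=
  ⟨by rw [Measure.restrict_apply_univ]; exact h.measure_lt_top⟩

lemma one_le_dualExp (hn : 1 ≤ n) (hm : 1 ≤ m) {γ : ℝ} (hγ : 0 < γ) :
    1 ≤ ENNReal.ofReal (2 * homDim n m γ / (homDim n m γ + 2)) := by
  have h := homDim_gt_two hn hm hγ
  rw [ENNReal.one_le_ofReal, le_div_iff₀ (by linarith)]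
  linarith

lemma integrable_of_dualExp (hn : 1 ≤ n) (hm : 1 ≤ m) {γ : ℝ} (hγ : 0 < γ) {Ω : Set (Pt n m)}
    (hb : Bornology.IsBounded Ω) {a : Pt n m → ℝ}
    (h : MemLp a (ENNReal.ofReal (2 * homDim n m γ / (homDim n m γ + 2))) (volume.restrict Ω)) :
    Integrable a (volume.restrict Ω) := by
  have := isFiniteMeasure_restrict hb
  exact h.integrable (one_le_dualExp hn hm hγ)

/-- Bounds for `f` and its primitive on bounded sets of values. -/
lemma exists_bound_primitive (hn : 1 ≤ n) (hm : 1 ≤ m) {γ : ℝ} (hγ : 0 < γ) {Ω : Set (Pt n m)}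
    (hΩ : IsOpen Ω) (hb : Bornology.IsBounded Ω) {f F : Pt n m → ℝ → ℝ} (hf : LocalGrowth γ Ω f)
    (hF : IsPrimitive Ω f F) {M : ℝ} (hM : 0 < M) :
    ∃ a A : Pt n m → ℝ,
      MemLp a (ENNReal.ofReal (2 * homDim n m γ / (homDim n m γ + 2))) (volume.restrict Ω) ∧
      Integrable a (volume.restrict Ω) ∧ Integrable A (volume.restrict Ω) ∧
      ∀ᵐ z ∂volume.restrict Ω, 0 ≤ a z ∧ (∀ t, |t| ≤ M → |f z t| ≤ a z ∧ |F z t| ≤ A z) ∧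
        ∀ s t, |s| ≤ M → |t| ≤ M → |F z s - F z t| ≤ a z * |s - t| := by
  obtain ⟨a, ha, a0, hfa⟩ := hf.bound M hM
  have hai := integrable_of_dualExp hn hm hγ hb ha
  refine ⟨a, fun z => |F z 0| + a z * M, ha, hai, hF.integrable_zero.norm.add (hai.mul_const M), ?_⟩
  filter_upwards [hfa, hF.deriv, ae_restrict_mem hΩ.measurableSet] with z h1 h2 h3
  have lip : ∀ s t, |s| ≤ M → |t| ≤ M → |F z s - F z t| ≤ a z * |s - t| := by
    intro s t hs ht
    refine (convex_Icc (-M) M).norm_image_sub_le_of_norm_hasDerivWithin_le (f := F z)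
      (f' := f z) (fun x _ => (h2 x).hasDerivWithinAt) (fun x hx => h1 x (abs_le.2 hx))
      (abs_le.1 ht) (abs_le.1 hs)
  refine ⟨a0 z h3, fun t ht => ⟨h1 t ht, ?_⟩, lip⟩
  have h4 := lip t 0 ht (by simpa using hM.le)
  rw [sub_zero] at h4
  have h5 := abs_sub_abs_le_abs_sub (F z t) (F z 0)
  have h6 := mul_le_mul_of_nonneg_left ht (a0 z h3)
  linarith

/-- The value of the functional where it is finite. -/
def energyValue (γ : ℝ) (Ω : Set (Pt n m)) (G : Pt n m → ℝ → EReal) (F : Pt n m → ℝ → ℝ)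
    (u : Pt n m → ℝ) : ℝ :=
  (1 / 2) * (∫ z in Ω, ‖weakGrad γ Ω u z‖ ^ 2) + (∫ z in Ω, (G z (u z)).toReal)
    - ∫ z in Ω, F z (u z)

lemma energy_eq {γ : ℝ} {Ω : Set (Pt n m)} {G : Pt n m → ℝ → EReal} {F : Pt n m → ℝ → ℝ}
    {u : Pt n m → ℝ} (h1 : MemL1 Ω fun z => G z (u z))
    (h2 : Integrable (fun z => F z (u z)) (volume.restrict Ω)) :
    energy γ Ω G F u = (energyValue γ Ω G F u : EReal) := by
  rw [energy, if_pos ⟨h1, h2⟩]; rfl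

/-- A bounded ordered pair of a subsolution and a supersolution, with the standing hypotheses on
the problem. -/
structure OrderedPair (γ : ℝ) (Ω : Set (Pt n m)) (g G : Pt n m → ℝ → EReal)
    (f F : Pt n m → ℝ → ℝ) (φ₁ φ₂ : Pt n m → ℝ) : Prop where
  one_le_n : 1 ≤ n
  one_le_m : 1 ≤ m
  pos : 0 < γ
  isOpen : IsOpen Ω
  bounded : Bornology.IsBounded Ω
  growth : LocalGrowth γ Ω f
  convex : ConvexPrimitive γ Ω g G
  primitive : IsPrimitive Ω f F
  sub : IsSubsolution γ Ω g f φ₁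
  super : IsSupersolution γ Ω g f φ₂
  bdd₁ : MemLp φ₁ ⊤ (volume.restrict Ω)
  bdd₂ : MemLp φ₂ ⊤ (volume.restrict Ω)
  le : ∀ᵐ z ∂volume.restrict Ω, φ₁ z ≤ φ₂ z
  G_loc₁ : MemL1loc Ω fun z => G z (φ₁ z)
  G_loc₂ : MemL1loc Ω fun z => G z (φ₂ z)

section OrderedPair

variable {γ : ℝ} {Ω : Set (Pt n m)} {g G : Pt n m → ℝ → EReal} {f F : Pt n m → ℝ → ℝ}
  {φ₁ φ₂ : Pt n m → ℝ}

/-- `G` is finite at `φ₁` and `φ₂` because it is locally integrable along them, and `g` is finite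
there by the definition of sub- and supersolutions. Convexity then controls every value in between.
-/
lemma OrderedPair.convexBetween (h : OrderedPair γ Ω g G f F φ₁ φ₂) :
    ∀ᵐ z ∂volume.restrict Ω, ConvexBetween (g z) (G z) (φ₁ z) (φ₂ z) := by
  filter_upwards [h.convex.convexAt h.isOpen, h.le, h.G_loc₁.1, h.G_loc₂.1, h.sub.g_loc.1,
    h.super.g_loc.1] with z h1 h2 h3 h4 h5 h6
  exact ⟨h1, h2, h3.1.lt_top, h4.1.lt_top, h5, h6⟩

lemma OrderedPair.exists_bound (h : OrderedPair γ Ω g G f F φ₁ φ₂) :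
    ∃ M : ℝ, 0 < M ∧ ∀ᵐ z ∂volume.restrict Ω, ∀ t, φ₁ z ≤ t → t ≤ φ₂ z → |t| ≤ M := by
  obtain ⟨M₁, h1, h2⟩ := exists_bound_of_memLp_top h.bdd₁
  obtain ⟨M₂, h3, h4⟩ := exists_bound_of_memLp_top h.bdd₂
  refine ⟨max M₁ M₂, lt_max_of_lt_left h1, ?_⟩
  filter_upwards [h2, h4] with z h5 h6 t h7 h8
  rw [abs_le] at *
  constructor
  · linarith [le_max_left M₁ M₂]
  · linarith [le_max_right M₁ M₂]

lemma aemeasurable_toReal_of_loc {H : Pt n m → EReal} {Ω : Set (Pt n m)} (h : MemL1loc Ω H) :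
    AEMeasurable (fun z => (((H z).toReal : ℝ) : EReal)) (volume.restrict Ω) :=
  (h.2.aestronglyMeasurable.aemeasurable).coe_real_ereal

/-- On the set where `φ₁ = φ₂`, continuity on the interval gives nothing; there measurability is
that of `G(·, φ₁)`, which comes from its local integrability. -/
lemma OrderedPair.aemeasurable_G (h : OrderedPair γ Ω g G f F φ₁ φ₂) {u : Pt n m → ℝ}
    (hu : AEMeasurable u (volume.restrict Ω))
    (hle : ∀ᵐ z ∂volume.restrict Ω, φ₁ z ≤ u z ∧ u z ≤ φ₂ z) :
    AEMeasurable (fun z => G z (u z)) (volume.restrict Ω) := by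
  refine aemeasurable_comp_of_continuousOn h.convex.measurable_G
    h.sub.memH1.1.1.aemeasurable hu h.super.memH1.1.1.aemeasurable hle ?_
    (aemeasurable_toReal_of_loc h.G_loc₁) ?_
  · filter_upwards [h.convexBetween] with z hz
    exact hz.conv.cont_G.mono fun r hr => hz.G_lt_top hr
  · filter_upwards [hle, h.G_loc₁.1] with z h1 h2 h3
    have : u z = φ₁ z := le_antisymm (h1.2.trans h3.ge) h1.1
    rw [this, EReal.coe_toReal h2.1 h2.2]

lemma OrderedPair.aemeasurable_g (h : OrderedPair γ Ω g G f F φ₁ φ₂) {u : Pt n m → ℝ}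
    (hu : AEMeasurable u (volume.restrict Ω))
    (hle : ∀ᵐ z ∂volume.restrict Ω, φ₁ z ≤ u z ∧ u z ≤ φ₂ z) :
    AEMeasurable (fun z => g z (u z)) (volume.restrict Ω) := by
  refine aemeasurable_comp_of_continuousOn h.convex.measurable_g
    h.sub.memH1.1.1.aemeasurable hu h.super.memH1.1.1.aemeasurable hle ?_
    (aemeasurable_toReal_of_loc h.sub.g_loc) ?_
  · filter_upwards [h.convexBetween] with z hz
    exact hz.conv.cont_g.mono fun r hr => hz.G_lt_top hr
  · filter_upwards [hle, h.sub.g_loc.1] with z h1 h2 h3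
    have : u z = φ₁ z := le_antisymm (h1.2.trans h3.ge) h1.1
    rw [this, EReal.coe_toReal h2.1 h2.2]

/-- A function between the subsolution and the supersolution has bounded energy terms. -/
lemma OrderedPair.exists_lower_bound (h : OrderedPair γ Ω g G f F φ₁ φ₂) :
    ∃ a A B : Pt n m → ℝ,
      MemLp a (ENNReal.ofReal (2 * homDim n m γ / (homDim n m γ + 2))) (volume.restrict Ω) ∧
      Integrable a (volume.restrict Ω) ∧ Integrable A (volume.restrict Ω) ∧
      Integrable B (volume.restrict Ω) ∧
      ∀ᵐ z ∂volume.restrict Ω, 0 ≤ a z ∧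
        (∀ t ∈ Set.Icc (φ₁ z) (φ₂ z), |f z t| ≤ a z ∧ |F z t| ≤ A z ∧
          0 ≤ (G z t).toReal + B z) ∧
        ∀ s ∈ Set.Icc (φ₁ z) (φ₂ z), ∀ t ∈ Set.Icc (φ₁ z) (φ₂ z),
          |F z s - F z t| ≤ a z * |s - t| := by
  obtain ⟨M, hM, hbd⟩ := h.exists_bound
  obtain ⟨a, A, ha, hai, hA, hb⟩ := exists_bound_primitive h.one_le_n h.one_le_m h.pos h.isOpen
    h.bounded h.growth h.primitive hM
  obtain ⟨a₂, a₃, h2, h3, p2, p3, hlow⟩ := h.convex.lower_bound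
  have h2i := integrable_of_dualExp h.one_le_n h.one_le_m h.pos h.bounded h2
  refine ⟨a, A, fun z => a₂ z * M + a₃ z, ha, hai, hA, (h2i.mul_const M).add h3, ?_⟩
  filter_upwards [hb, hlow, h.convexBetween, hbd, ae_restrict_mem h.isOpen.measurableSet] with z
    h4 h5 h6 h7 h8
  refine ⟨h4.1, fun t ht => ⟨(h4.2.1 t (h7 t ht.1 ht.2)).1, (h4.2.1 t (h7 t ht.1 ht.2)).2, ?_⟩,
    fun s hs t ht => h4.2.2 s t (h7 s hs.1 hs.2) (h7 t ht.1 ht.2)⟩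
  have h9 := EReal.toReal_le_toReal (h5 t) (EReal.coe_ne_bot _) (h6.G_lt_top ht).ne
  rw [EReal.toReal_coe] at h9
  have h10 := mul_le_mul_of_nonneg_left (h7 t ht.1 ht.2) (p2 z h8)
  linarith

lemma OrderedPair.integrable_F (h : OrderedPair γ Ω g G f F φ₁ φ₂) {u : Pt n m → ℝ}
    (hu : AEMeasurable u (volume.restrict Ω))
    (hle : ∀ᵐ z ∂volume.restrict Ω, φ₁ z ≤ u z ∧ u z ≤ φ₂ z) :
    Integrable (fun z => F z (u z)) (volume.restrict Ω) := by
  obtain ⟨a, A, B, -, -, hA, -, hb⟩ := h.exists_lower_bound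
  refine hA.mono' (h.primitive.caratheodory.aemeasurable_comp hu).aestronglyMeasurable ?_
  filter_upwards [hb, hle] with z h1 h2
  exact (h1.2.1 _ h2).2.1

/-- The norm of the gradient is weakly lower semicontinuous. -/
lemma integral_norm_sq_le_of_weak {μ : Measure (Pt n m)} {W : ℕ → Pt n m → Vec n m}
    {U : Pt n m → Vec n m} (hW : ∀ k, MemLp (W k) 2 μ) (hU : MemLp U 2 μ)
    (h : Tendsto (fun k => ∫ z, inner ℝ (W k z) (U z) ∂μ) atTop (𝓝 (∫ z, inner ℝ (U z) (U z) ∂μ)))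
    {l : ℝ} (hl : Tendsto (fun k => ∫ z, ‖W k z‖ ^ 2 ∂μ) atTop (𝓝 l)) :
    ∫ z, ‖U z‖ ^ 2 ∂μ ≤ l := by
  have isq : ∀ {X : Pt n m → Vec n m}, MemLp X 2 μ → Integrable (fun z => ‖X z‖ ^ 2) μ := fun hX =>
    (integrable_inner_L2 hX hX).congr (Eventually.of_forall fun z => by
      simp only [real_inner_self_eq_norm_sq])
  simp only [real_inner_self_eq_norm_sq] at h
  have h1 : ∫ z, ‖U z‖ ^ 2 ∂μ ≤ (1 / 2) * l + (1 / 2) * ∫ z, ‖U z‖ ^ 2 ∂μ := by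
    refine le_of_tendsto_of_tendsto' h ((hl.const_mul (1 / 2)).add_const _) fun k => ?_
    rw [← integral_const_mul, ← integral_const_mul,
      ← integral_add ((isq (hW k)).const_mul _) ((isq hU).const_mul _)]
    refine integral_mono (integrable_inner_L2 (hW k) hU)
      (((isq (hW k)).const_mul _).add ((isq hU).const_mul _)) fun z => ?_
    have h2 := real_inner_le_norm (W k z) (U z)
    simp only
    nlinarith [sq_nonneg (‖W k z‖ - ‖U z‖)]
  linarith

/-- The functional attains its minimum over the order interval. -/
theorem OrderedPair.exists_minimizer (h : OrderedPair γ Ω g G f F φ₁ φ₂)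
    (hw : ∃ w ∈ orderInterval γ Ω φ₁ φ₂, MemL1 Ω (fun z => G z (w z))) :
    ∃ u ∈ orderInterval γ Ω φ₁ φ₂, MemL1 Ω (fun z => G z (u z)) ∧
      ∀ w ∈ orderInterval γ Ω φ₁ φ₂, MemL1 Ω (fun z => G z (w z)) →
        energyValue γ Ω G F u ≤ energyValue γ Ω G F w := by
  obtain ⟨a, A, B, -, -, hA, hB, hbd⟩ := h.exists_lower_bound
  have hF : ∀ w ∈ orderInterval γ Ω φ₁ φ₂, Integrable (fun z => F z (w z)) (volume.restrict Ω) :=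
    fun w hw => h.integrable_F hw.1.1.1.1.aemeasurable hw.2
  set S : Set ℝ := {x | ∃ w ∈ orderInterval γ Ω φ₁ φ₂, MemL1 Ω (fun z => G z (w z)) ∧
    x = energyValue γ Ω G F w} with hS
  have lower : ∀ w ∈ orderInterval γ Ω φ₁ φ₂, MemL1 Ω (fun z => G z (w z)) →
      -(∫ z in Ω, B z) - (∫ z in Ω, A z) + (1 / 2) * (∫ z in Ω, ‖weakGrad γ Ω w z‖ ^ 2) ≤
        energyValue γ Ω G F w := by
    intro w hw hG
    have h1 : -(∫ z in Ω, B z) ≤ ∫ z in Ω, (G z (w z)).toReal := by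
      rw [← integral_neg]
      refine integral_mono_ae hB.neg hG.2 ?_
      filter_upwards [hbd, hw.2] with z h2 h3
      have := (h2.2.1 _ h3).2.2
      linarith
    have h2 : ∫ z in Ω, F z (w z) ≤ ∫ z in Ω, A z := by
      refine integral_mono_ae (hF w hw) hA ?_
      filter_upwards [hbd, hw.2] with z h2 h3
      exact (le_abs_self _).trans (h2.2.1 _ h3).2.1
    unfold energyValue
    linarith
  have hbdd : BddBelow S := by
    refine ⟨-(∫ z in Ω, B z) - (∫ z in Ω, A z), ?_⟩
    rintro x ⟨w, hw, hG, rfl⟩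
    have h1 : 0 ≤ ∫ z in Ω, ‖weakGrad γ Ω w z‖ ^ 2 := integral_nonneg fun _ => sq_nonneg _
    linarith [lower w hw hG]
  have hne : S.Nonempty := by
    obtain ⟨w, hw, hG⟩ := hw
    exact ⟨_, w, hw, hG, rfl⟩
  obtain ⟨x, -, hx, hxS⟩ := exists_seq_tendsto_sInf hne hbdd
  choose w hwK hwG hxw using hxS
  have isq : ∀ {X : Pt n m → Vec n m}, MemLp X 2 (volume.restrict Ω) →
      Integrable (fun z => ‖X z‖ ^ 2) (volume.restrict Ω) := fun hX =>
    (integrable_inner_L2 hX hX).congr (Eventually.of_forall fun z => by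
      simp only [real_inner_self_eq_norm_sq])
  obtain ⟨Cx, hCx⟩ := hx.bddAbove_range
  set R : ℝ := 2 * (Cx + (∫ z in Ω, B z) + ∫ z in Ω, A z) with hR
  have hgb : ∀ k, ∫ z in Ω, ‖weakGrad γ Ω (w k) z‖ ^ 2 ≤ R := fun k => by
    have h1 := lower (w k) (hwK k) (hwG k)
    have h2 : x k ≤ Cx := hCx ⟨k, rfl⟩
    rw [← hxw] at h1
    linarith
  have hg0 : ∀ k, 0 ≤ ∫ z in Ω, ‖weakGrad γ Ω (w k) z‖ ^ 2 := fun k =>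
    integral_nonneg fun _ => sq_nonneg _
  have hp : ∀ k, H10Pair γ Ω (w k) (weakGrad γ Ω (w k)) := fun k => (hwK k).1.pair
  -- The Dirichlet integrals are made to converge beforehand, so that the bounds for the integrals
  -- of `G` have a limit.
  obtain ⟨l, -, s, hs, hl⟩ := tendsto_subseq_of_bounded (Metric.isBounded_Icc 0 R)
    (fun k => Set.mem_Icc.2 ⟨hg0 k, hgb k⟩)
  have hU : ∀ k, eLpNorm (weakGrad γ Ω (w (s k))) 2 (volume.restrict Ω) ≤
      ENNReal.ofReal (√R) := by
    intro k
    rw [← ENNReal.pow_le_pow_left_iff two_ne_zero, eLpNorm_two_sq,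
      ← ENNReal.ofReal_pow (Real.sqrt_nonneg _), Real.sq_sqrt ((hg0 0).trans (hgb 0))]
    have h1 : ∫⁻ z in Ω, ‖weakGrad γ Ω (w (s k)) z‖ₑ ^ 2 =
        ENNReal.ofReal (∫ z in Ω, ‖weakGrad γ Ω (w (s k)) z‖ ^ 2) := by
      rw [ofReal_integral_eq_lintegral_ofReal (isq (hp (s k)).memLp_grad)
        (Eventually.of_forall fun _ => sq_nonneg _)]
      refine lintegral_congr fun z => ?_
      rw [← ofReal_norm, ENNReal.ofReal_pow (norm_nonneg _)]
    rw [h1]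
    exact ENNReal.ofReal_le_ofReal (hgb _)
  obtain ⟨u, U, r, hr, huU, -, hae, hweak⟩ := exists_compact_subseq h.one_le_n h.one_le_m h.pos
    h.isOpen h.bounded (fun k => hp (s k)) hU
  have huK : u ∈ orderInterval γ Ω φ₁ φ₂ := by
    refine ⟨huU.memH10 h.pos h.isOpen, ?_⟩
    filter_upwards [hae, ae_all_iff.2 fun k => (hwK k).2] with z h1 h2
    exact ⟨ge_of_tendsto' h1 fun k => (h2 _).1, le_of_tendsto' h1 fun k => (h2 _).2⟩
  have hUw := huU.weakGrad_ae h.pos h.isOpen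
  have hgu : ∫ z in Ω, ‖weakGrad γ Ω u z‖ ^ 2 ≤ l := by
    rw [integral_congr_ae (hUw.mono fun z hz => by simp only [hz] :
      (fun z => ‖weakGrad γ Ω u z‖ ^ 2) =ᵐ[volume.restrict Ω] fun z => ‖U z‖ ^ 2)]
    exact integral_norm_sq_le_of_weak (fun k => (hp (s (r k))).memLp_grad) huU.memLp_grad
      (hweak U huU.memLp_grad) (hl.comp hr.tendsto_atTop)
  have hFl : Tendsto (fun k => ∫ z in Ω, F z (w (s (r k)) z)) atTop (𝓝 (∫ z in Ω, F z (u z))) := by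
    refine tendsto_integral_of_dominated_convergence A (fun k => (hF _ (hwK _)).1) hA
      (fun k => ?_) ?_
    · filter_upwards [hbd, (hwK (s (r k))).2] with z h1 h2 using (h1.2.1 _ h2).2.1
    · filter_upwards [h.primitive.deriv, hae] with z h1 h2
      exact (h1 _).continuousAt.tendsto.comp h2
  have hxl : Tendsto (fun k => x (s (r k))) atTop (𝓝 (sInf S)) :=
    hx.comp (hs.tendsto_atTop.comp hr.tendsto_atTop)
  -- The integral of `G` equals the energy minus terms with known limits. Fatou's lemma for the
  -- nonnegative functions `G + B` yields both integrability of `G(·, u)` and the inequality for its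
  -- integral.
  have hfat := integrable_of_fatou (μ := volume.restrict Ω)
    (f := fun k z => (G z (w (s (r k)) z)).toReal + B z) (f₀ := fun z => (G z (u z)).toReal + B z)
    (c := fun k => x (s (r k)) - (1 / 2) * (∫ z in Ω, ‖weakGrad γ Ω (w (s (r k))) z‖ ^ 2) +
      (∫ z in Ω, F z (w (s (r k)) z)) + ∫ z in Ω, B z)
    (c₀ := sInf S - (1 / 2) * l + (∫ z in Ω, F z (u z)) + ∫ z in Ω, B z)
    (fun k => (hwG _).2.add hB)
    (fun k => by
      filter_upwards [hbd, (hwK (s (r k))).2] with z h1 h2 using (h1.2.1 _ h2).2.2)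
    (fun k => by
      rw [integral_add (hwG _).2 hB, hxw]
      unfold energyValue
      linarith)
    (((hxl.sub ((hl.comp hr.tendsto_atTop).const_mul (1 / 2))).add hFl).add_const _)
    (by
      filter_upwards [h.convexBetween, hae, ae_all_iff.2 fun k => (hwK k).2, huK.2] with z h1 h2 h3 h4
      refine Tendsto.add_const _ ?_
      exact (h1.continuousOn_G _ h4).tendsto.comp (tendsto_nhdsWithin_iff.2 ⟨h2,
        Eventually.of_forall fun k => h3 _⟩))
  have hGu : Integrable (fun z => (G z (u z)).toReal) (volume.restrict Ω) := by
    refine (hfat.1.sub hB).congr (Eventually.of_forall fun z => ?_)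
    simp
  refine ⟨u, huK, ⟨?_, hGu⟩, fun w' hw' hG' => ?_⟩
  · filter_upwards [h.convexBetween, huK.2] with z h1 h2
    exact ⟨(h1.G_lt_top h2).ne, h1.conv.bot _⟩
  · refine le_trans ?_ (csInf_le hbdd ⟨w', hw', hG', rfl⟩)
    have h1 := hfat.2
    rw [integral_add hGu hB] at h1
    unfold energyValue
    linarith

end OrderedPair

/-! ### First variation with truncation: the minimizer is a weak solution. -/

lemma integrable_mul_test {Ω : Set (Pt n m)} {b : Pt n m → ℝ} (hb : LocallyIntegrableOn b Ω)
    {ψ : Pt n m → ℝ} (hψ : IsTest Ω ψ) : Integrable (fun z => b z * ψ z) (volume.restrict Ω) := by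
  have bK : IntegrableOn b (tsupport ψ) := hb.integrableOn_compact_subset hψ.supp hψ.compact
  have h1 : IntegrableOn (fun z => b z * ψ z) (tsupport ψ) :=
    bK.mul_continuousOn hψ.smooth.continuous.continuousOn hψ.compact
  exact (h1.integrable_of_forall_notMem_eq_zero fun z hz => by
    rw [image_eq_zero_of_notMem_tsupport hz, mul_zero]).restrict

/-- The truncated variation `u + σ min(tψ, d)`, where `d = σ (φ - u) ≥ 0`, lies between `u` and
`φ`. -/
lemma truncated_mem_Icc {a b u φ σ x : ℝ} (hσ : σ = 1 ∨ σ = -1) (hu : u ∈ Set.Icc a b)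
    (hφ : φ ∈ Set.Icc a b) (hd : 0 ≤ σ * (φ - u)) (hx : 0 ≤ x) :
    u + σ * (x - max (x - σ * (φ - u)) 0) ∈ Set.Icc a b := by
  have h1 : 0 ≤ x - max (x - σ * (φ - u)) 0 := sub_nonneg.2 (max_le (by linarith) hx)
  have h2 : x - max (x - σ * (φ - u)) 0 ≤ σ * (φ - u) := by
    linarith [le_max_left (x - σ * (φ - u)) 0]
  obtain ⟨hu1, hu2⟩ := hu
  obtain ⟨hφ1, hφ2⟩ := hφ
  rcases hσ with rfl | rfl
  · constructor <;> linarith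
  · constructor <;> linarith

/-- If `φ = u`, the truncation cancels the variation altogether and the correction term alone gives
the value, for every `j`. If the gap is positive, the truncation is inactive for large `j`, and an
ordinary difference quotient remains. -/
lemma ConvexBetween.tendsto_variation {g G : ℝ → EReal} {a b : ℝ} (h : ConvexBetween g G a b)
    {f F : ℝ → ℝ} (hF : ∀ t, HasDerivAt F (f t) t) {u φ σ ψ : ℝ} (hσ : σ = 1 ∨ σ = -1)
    (hu : u ∈ Set.Icc a b) (hφ : φ ∈ Set.Icc a b) (hd : 0 ≤ σ * (φ - u)) (hψ : 0 ≤ ψ) {t : ℕ → ℝ}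
    (ht : ∀ j, 0 < t j) (htl : Tendsto t atTop (𝓝 0)) :
    Tendsto (fun j => (t j)⁻¹ *
      ((G (u + σ * (t j * ψ - max (t j * ψ - σ * (φ - u)) 0))).toReal - (G u).toReal -
        (F (u + σ * (t j * ψ - max (t j * ψ - σ * (φ - u)) 0)) - F u) +
        σ * ((g φ).toReal - f φ) * max (t j * ψ - σ * (φ - u)) 0)) atTop
      (𝓝 (σ * ((g u).toReal - f u) * ψ)) := by
  rcases hd.eq_or_lt with hd0 | hd0
  · have hφu : φ = u := by
      rcases hσ with rfl | rfl <;> linarith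
    subst hφu
    refine tendsto_const_nhds.congr fun j => ?_
    have h1 : t j * ψ - σ * (φ - φ) = t j * ψ := by ring
    rw [h1, max_eq_left (mul_nonneg (ht j).le hψ)]
    simp only [sub_self, mul_zero, add_zero, zero_add]
    field_simp [(ht j).ne']
  · have hev : ∀ᶠ j in atTop, t j * ψ < σ * (φ - u) := by
      have : Tendsto (fun j => t j * ψ) atTop (𝓝 0) := by simpa using htl.mul_const ψ
      exact this.eventually (eventually_lt_nhds hd0)
    have hx : Tendsto (fun j => u + σ * (t j * ψ)) atTop (𝓝 u) := by
      have : Tendsto (fun j => u + σ * (t j * ψ)) atTop (𝓝 (u + σ * (0 * ψ))) :=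
        ((htl.mul_const ψ).const_mul σ).const_add u
      simpa using this
    have hmem : ∀ᶠ j in atTop, u + σ * (t j * ψ) ∈ Set.Icc a b := by
      filter_upwards [hev] with j hj
      have := truncated_mem_Icc hσ hu hφ hd (mul_nonneg (ht j).le hψ)
      rwa [max_eq_right (by linarith), sub_zero] at this
    have lG : Tendsto (fun j => (t j)⁻¹ * ((G (u + σ * (t j * ψ))).toReal - (G u).toReal)) atTop
        (𝓝 (σ * (g u).toReal * ψ)) := by
      rw [tendsto_iff_norm_sub_tendsto_zero]
      have l1 : Tendsto (fun j => |(g (u + σ * (t j * ψ))).toReal - (g u).toReal| * ψ) atTop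
          (𝓝 0) := by
        have := ((h.continuousOn_g u hu).tendsto.comp
          (tendsto_nhdsWithin_iff.2 ⟨hx, hmem⟩)).sub_const (g u).toReal
        simpa using (this.abs).mul_const ψ
      refine squeeze_zero' (Eventually.of_forall fun _ => norm_nonneg _) ?_ l1
      filter_upwards [hmem] with j hj
      have h1 := h.abs_sub_sub_le hu hj
      have h2 : (t j)⁻¹ * ((G (u + σ * (t j * ψ))).toReal - (G u).toReal) - σ * (g u).toReal * ψ =
          (t j)⁻¹ * ((G (u + σ * (t j * ψ))).toReal - (G u).toReal -
            (g u).toReal * (u + σ * (t j * ψ) - u)) := by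
        field_simp [(ht j).ne']
        ring
      have h3 : |u + σ * (t j * ψ) - u| = t j * ψ := by
        rw [add_sub_cancel_left, abs_mul, abs_of_nonneg (mul_nonneg (ht j).le hψ)]
        rcases hσ with rfl | rfl <;> simp
      rw [h3] at h1
      rw [h2, norm_mul, Real.norm_of_nonneg (inv_pos.2 (ht j)).le]
      calc (t j)⁻¹ * ‖_‖ ≤ (t j)⁻¹ * (|(g (u + σ * (t j * ψ))).toReal - (g u).toReal| * (t j * ψ)) :=
            mul_le_mul_of_nonneg_left h1 (inv_pos.2 (ht j)).le
        _ = _ := by field_simp [(ht j).ne']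
    have lF : Tendsto (fun j => (t j)⁻¹ * (F (u + σ * (t j * ψ)) - F u)) atTop
        (𝓝 (σ * f u * ψ)) := by
      have h1 : HasDerivAt (fun s : ℝ => u + σ * (s * ψ)) (σ * ψ) 0 := by
        simpa using (((hasDerivAt_id (0 : ℝ)).mul_const ψ).const_mul σ).const_add u
      have h2 : HasDerivAt F (f u) (u + σ * (0 * ψ)) := by simpa using hF u
      have h3 := (h2.comp 0 h1).tendsto_slope_zero
      have h4 := h3.comp (tendsto_nhdsWithin_iff.2
        ⟨htl, Eventually.of_forall fun j => (ht j).ne'⟩)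
      have e : σ * f u * ψ = f u * (σ * ψ) := by ring
      rw [e]
      refine h4.congr fun j => ?_
      simp
    have hlim := lG.sub lF
    have e : σ * (g u).toReal * ψ - σ * f u * ψ = σ * ((g u).toReal - f u) * ψ := by ring
    rw [e] at hlim
    refine hlim.congr' ?_
    filter_upwards [hev] with j hj
    rw [max_eq_right (by linarith), sub_zero, mul_zero, add_zero]
    ring

/-- The bound is linear in `x`; with `x = t ψ` it provides, after division by `t`, a majorant
independent of `t`. -/
lemma ConvexBetween.abs_variation_le {g G : ℝ → EReal} {a b : ℝ} (h : ConvexBetween g G a b)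
    {f F : ℝ → ℝ} {c : ℝ} (hf : ∀ s ∈ Set.Icc a b, |f s| ≤ c)
    (hF : ∀ s ∈ Set.Icc a b, ∀ t ∈ Set.Icc a b, |F s - F t| ≤ c * |s - t|)
    {u φ σ x : ℝ} (hσ : σ = 1 ∨ σ = -1)
    (hu : u ∈ Set.Icc a b) (hφ : φ ∈ Set.Icc a b) (hd : 0 ≤ σ * (φ - u)) (hx : 0 ≤ x) :
    |(G (u + σ * (x - max (x - σ * (φ - u)) 0))).toReal - (G u).toReal -
        (F (u + σ * (x - max (x - σ * (φ - u)) 0)) - F u) +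
        σ * ((g φ).toReal - f φ) * max (x - σ * (φ - u)) 0| ≤
      2 * (|(g a).toReal| + |(g b).toReal| + c) * x := by
  have hw := truncated_mem_Icc hσ hu hφ hd hx
  set y := max (x - σ * (φ - u)) 0 with hy
  have y0 : 0 ≤ y := le_max_right _ _
  have yx : y ≤ x := max_le (by linarith) hx
  have c0 : 0 ≤ c := (abs_nonneg _).trans (hf u hu)
  set w := u + σ * (x - y) with hwdef
  have hwu : |w - u| ≤ x := by
    rw [hwdef, add_sub_cancel_left, abs_mul, abs_of_nonneg (by linarith : 0 ≤ x - y)]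
    rcases hσ with rfl | rfl <;> simp <;> linarith
  have h1 := h.abs_sub_le hu hw
  have h2 := hF w hw u hu
  have h3 : |σ * ((g φ).toReal - f φ) * y| ≤ (|(g a).toReal| + |(g b).toReal| + c) * x := by
    rw [abs_mul, abs_mul, abs_of_nonneg y0]
    have h4 : |σ| = 1 := by rcases hσ with rfl | rfl <;> simp
    rw [h4, one_mul]
    refine mul_le_mul ?_ yx y0 (by positivity)
    exact (abs_sub _ _).trans (add_le_add (h.abs_g_le hφ) (hf φ hφ))
  have h5 : (|(g a).toReal| + |(g b).toReal|) * |w - u| ≤ (|(g a).toReal| + |(g b).toReal|) * x :=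
    mul_le_mul_of_nonneg_left hwu (by positivity)
  have h6 : c * |w - u| ≤ c * x := mul_le_mul_of_nonneg_left hwu c0
  calc _ ≤ |(G w).toReal - (G u).toReal| + |F w - F u| + |σ * ((g φ).toReal - f φ) * y| :=
        (abs_add_le _ _).trans (add_le_add_left (abs_sub _ _) _)
    _ ≤ _ := by linarith

/-- Where the truncation acts, the competitor has the gradient `q` of `φ`. With `D = σ (q - U)` the
two sides differ exactly by `‖D‖² / 2`, which is discarded. -/
lemma gradient_variation_le {σ t : ℝ} (hσ : σ = 1 ∨ σ = -1) (U q p : Vec n m) :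
    (1 / 2) * ‖U + σ • (t • p - (t • p - σ • (q - U)))‖ ^ 2 - (1 / 2) * ‖U‖ ^ 2 +
        inner ℝ (σ • q) (t • p - σ • (q - U)) ≤
      t * (inner ℝ (σ • U) p + inner ℝ (σ • (q - U)) p) := by
  have hσ2 : σ * σ = 1 := by rcases hσ with rfl | rfl <;> norm_num
  set D := σ • (q - U) with hD
  have hq : σ • q = D + σ • U := by rw [hD]; module
  rw [sub_sub_cancel, norm_add_sq_real, hq]
  simp only [inner_add_left, inner_sub_right, inner_smul_right, inner_smul_left, norm_smul,
    real_inner_self_eq_norm_sq, RCLike.conj_to_real, mul_pow]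
  have h1 : ‖σ‖ ^ 2 = 1 := by rw [Real.norm_eq_abs, sq_abs, sq, hσ2]
  rw [h1]
  nlinarith [sq_nonneg ‖D‖]

section OrderedPair

variable {γ : ℝ} {Ω : Set (Pt n m)} {g G : Pt n m → ℝ → EReal} {f F : Pt n m → ℝ → ℝ}
  {φ₁ φ₂ : Pt n m → ℝ}

lemma integrable_norm_sq {μ : Measure (Pt n m)} {X : Pt n m → Vec n m} (hX : MemLp X 2 μ) :
    Integrable (fun z => ‖X z‖ ^ 2) μ :=
  (integrable_inner_L2 hX hX).congr (Eventually.of_forall fun z => by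
    simp only [real_inner_self_eq_norm_sq])

/-- A minimizer over the order interval satisfies a one-sided inequality with test functions, in
the direction of a sub- or supersolution `φ`. -/
theorem OrderedPair.variational_ineq (h : OrderedPair γ Ω g G f F φ₁ φ₂) {u : Pt n m → ℝ}
    (hu : u ∈ orderInterval γ Ω φ₁ φ₂) (hG : MemL1 Ω (fun z => G z (u z)))
    (hmin : ∀ w ∈ orderInterval γ Ω φ₁ φ₂, MemL1 Ω (fun z => G z (w z)) →
        energyValue γ Ω G F u ≤ energyValue γ Ω G F w)
    {φ : Pt n m → ℝ} {σ : ℝ} (hσ : σ = 1 ∨ σ = -1) (hφ : MemH1 γ Ω φ)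
    (hφm : ∀ᵐ z ∂volume.restrict Ω, φ z ∈ Set.Icc (φ₁ z) (φ₂ z))
    (hd : ∀ᵐ z ∂volume.restrict Ω, 0 ≤ σ * (φ z - u z))
    (hb : LocallyIntegrableOn (fun z => σ * ((g z (φ z)).toReal - f z (φ z))) Ω)
    (hineq : ∀ ψ, IsTest Ω ψ → (∀ z, 0 ≤ ψ z) →
      0 ≤ ∫ z in Ω, (inner ℝ (σ • weakGrad γ Ω φ z) (grad γ ψ z) +
        σ * ((g z (φ z)).toReal - f z (φ z)) * ψ z))
    {ψ : Pt n m → ℝ} (hψ : IsTest Ω ψ) (ψ0 : ∀ z, 0 ≤ ψ z) :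
    0 ≤ (∫ z in Ω, inner ℝ (σ • weakGrad γ Ω u z) (grad γ ψ z)) +
      ∫ z in Ω, σ * ((g z (u z)).toReal - f z (u z)) * ψ z := by
  have hγ := h.pos
  have hΩ := h.isOpen
  obtain ⟨a, A, B, -, hai, hA, hB, hbd⟩ := h.exists_lower_bound
  set U := weakGrad γ Ω u with hU
  set q := weakGrad γ Ω φ with hq
  have pu : H10Pair γ Ω u U := hu.1.pair
  have pφ : H1Pair γ Ω φ q := hφ.pair
  have mq : MemLp (fun z => σ • q z) 2 (volume.restrict Ω) := pφ.memLp_grad.const_smul σ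
  have mp : MemLp (grad γ ψ) 2 (volume.restrict Ω) := hψ.memLp_grad hγ 2 _
  set d : Pt n m → ℝ := fun z => σ * (φ z - u z) with hdd
  set D : Pt n m → Vec n m := fun z => σ • (q z - U z) with hDD
  have pd : H1Pair γ Ω d D := (pφ.sub hγ (pu.h1Pair hγ)).const_mul σ
  set t : ℕ → ℝ := fun j => 1 / (j + 1) with htdef
  have ht : ∀ j, 0 < t j := fun j => by simp only [htdef]; positivity
  have htl : Tendsto t atTop (𝓝 0) := tendsto_one_div_add_atTop_nhds_zero_nat
  -- The part of `t ψ` exceeding the gap `d`. It is removed from the variation and serves instead as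
  -- a test function in the inequality for `φ`.
  set y : ℕ → Pt n m → ℝ := fun j z => max (t j * ψ z - d z) 0 with hy
  set Y : ℕ → Pt n m → Vec n m := fun j =>
    {z | 0 < t j * ψ z - d z}.indicator fun z => t j • grad γ ψ z - D z with hY
  have py : ∀ j, H1Pair γ Ω (y j) (Y j) := fun j =>
    (((hψ.h1Pair hγ (Ω := Ω)).const_mul (t j)).sub hγ pd).posPart hγ hΩ
  have y0 : ∀ j z, 0 ≤ y j z := fun j z => le_max_right _ _
  have yψ : ∀ j, ∀ᵐ z ∂volume.restrict Ω, y j z ≤ t j * ψ z := fun j => by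
    filter_upwards [hd] with z hz
    exact max_le (sub_le_self _ hz) (mul_nonneg (ht j).le (ψ0 z))
  have yK : ∀ j, ∀ᵐ z ∂volume.restrict Ω, z ∉ tsupport ψ → y j z = 0 := fun j => by
    filter_upwards [yψ j] with z h1 h2
    rw [image_eq_zero_of_notMem_tsupport h2, mul_zero] at h1
    exact le_antisymm h1 (y0 j z)
  obtain ⟨Mψ, hMψ⟩ := hψ.compact.exists_bound_of_continuous hψ.smooth.continuous
  have Mψ0 : 0 ≤ Mψ := (norm_nonneg _).trans (hMψ 0)
  have dist := fun j => distrib_ineq_of_compact hγ hΩ mq hb hineq hψ.compact hψ.supp (py j) (yK j)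
    (Eventually.of_forall (y0 j)) (mul_nonneg (ht j).le Mψ0) (by
      filter_upwards [yψ j] with z h1
      rw [abs_of_nonneg (y0 j z)]
      exact h1.trans (mul_le_mul_of_nonneg_left ((le_abs_self _).trans (hMψ z)) (ht j).le))
  set k : ℕ → Pt n m → ℝ := fun j z => t j * ψ z - y j z with hk
  have pk : ∀ j, H10Pair γ Ω (k j) (fun z => t j • grad γ ψ z - Y j z) := fun j =>
    (((hψ.h1Pair hγ (Ω := Ω)).const_mul (t j)).sub hγ (py j)).h10Pair_of_compact hγ hΩ hψ.compact
      hψ.supp (by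
        filter_upwards [yK j] with z h1 h2
        rw [h1 h2, image_eq_zero_of_notMem_tsupport h2, mul_zero, sub_zero])
  set w : ℕ → Pt n m → ℝ := fun j z => u z + σ * k j z with hw
  set W : ℕ → Pt n m → Vec n m := fun j z => U z + σ • (t j • grad γ ψ z - Y j z) with hW
  have pw : ∀ j, H10Pair γ Ω (w j) (W j) := fun j => pu.add hγ ((pk j).const_mul σ)
  have wm : ∀ j, ∀ᵐ z ∂volume.restrict Ω, w j z ∈ Set.Icc (φ₁ z) (φ₂ z) := fun j => by
    filter_upwards [hφm, hd, hu.2] with z h1 h2 h3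
    exact truncated_mem_Icc hσ h3 h1 h2 (mul_nonneg (ht j).le (ψ0 z))
  have wK : ∀ j, w j ∈ orderInterval γ Ω φ₁ φ₂ := fun j => ⟨(pw j).memH10 hγ hΩ, wm j⟩
  have hcb := h.convexBetween
  -- the dominating function
  set B₀ : Pt n m → ℝ := fun z => |(g z (φ₁ z)).toReal| + |(g z (φ₂ z)).toReal| + a z with hB₀
  have hB₀l : LocallyIntegrableOn B₀ Ω := by
    have h1 : LocallyIntegrableOn (fun z => |(g z (φ₁ z)).toReal|) Ω := h.sub.g_loc.2.norm
    have h2 : LocallyIntegrableOn (fun z => |(g z (φ₂ z)).toReal|) Ω := h.super.g_loc.2.norm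
    exact (h1.add h2).add (show IntegrableOn a Ω volume from hai).locallyIntegrableOn
  have hB₀ψ := integrable_mul_test hB₀l hψ
  have Gw : ∀ j, MemL1 Ω fun z => G z (w j z) := fun j => by
    refine ⟨?_, ?_⟩
    · filter_upwards [hcb, wm j] with z h1 h2
      exact ⟨(h1.G_lt_top h2).ne, h1.conv.bot _⟩
    · refine (hG.2.norm.add ((hB₀ψ.const_mul (t j)))).mono'
        (h.aemeasurable_G (pw j).memLp.1.aemeasurable (wm j)).ereal_toReal.aestronglyMeasurable ?_
      filter_upwards [hcb, wm j, hu.2, yψ j, hbd] with z h1 h2 h3 h4 h5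
      have h6 := h1.abs_sub_le h3 h2
      have h7 : |w j z - u z| ≤ t j * ψ z := by
        have h8 : 0 ≤ k j z := sub_nonneg.2 h4
        have h9 : w j z - u z = σ * k j z := add_sub_cancel_left _ _
        rw [h9, abs_mul, abs_of_nonneg h8]
        have : |σ| = 1 := by rcases hσ with rfl | rfl <;> simp
        rw [this, one_mul]
        exact sub_le_self _ (y0 j z)
      have h10 : (|(g z (φ₁ z)).toReal| + |(g z (φ₂ z)).toReal|) * |w j z - u z| ≤
          B₀ z * (t j * ψ z) :=
        mul_le_mul (le_add_of_nonneg_right h5.1) h7 (abs_nonneg _) (by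
          have := h5.1; simp only [hB₀]; positivity)
      have h11 := abs_sub_abs_le_abs_sub (G z (w j z)).toReal (G z (u z)).toReal
      simp only [Pi.add_apply, Real.norm_eq_abs]
      linarith
  have Fi : ∀ {v : Pt n m → ℝ}, v ∈ orderInterval γ Ω φ₁ φ₂ →
      Integrable (fun z => F z (v z)) (volume.restrict Ω) := fun hv =>
    h.integrable_F hv.1.1.1.1.aemeasurable hv.2
  -- The lower order terms of the energy difference and of the inequality for `φ` tested with `y`,
  -- added and divided by `t`.
  set E : ℕ → Pt n m → ℝ := fun j z => (t j)⁻¹ * ((G z (w j z)).toReal - (G z (u z)).toReal -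
    (F z (w j z) - F z (u z)) + σ * ((g z (φ z)).toReal - f z (φ z)) * y j z) with hE
  have Ei : ∀ j, Integrable (E j) (volume.restrict Ω) := fun j =>
    ((((Gw j).2.sub hG.2).sub ((Fi (wK j)).sub (Fi hu))).add (dist j).1).const_mul _
  have Elim : Tendsto (fun j => ∫ z in Ω, E j z) atTop
      (𝓝 (∫ z in Ω, σ * ((g z (u z)).toReal - f z (u z)) * ψ z)) := by
    refine tendsto_integral_of_dominated_convergence (fun z => 2 * (B₀ z * ψ z))
      (fun j => (Ei j).1) (hB₀ψ.const_mul 2) (fun j => ?_) ?_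
    · filter_upwards [hcb, hbd, hφm, hd, hu.2] with z h1 h2 h3 h4 h5
      have h6 := h1.abs_variation_le (f := f z) (F := F z) (fun s hs => (h2.2.1 s hs).1) h2.2.2 hσ
        h5 h3 h4 (mul_nonneg (ht j).le (ψ0 z))
      simp only [hE]
      rw [norm_mul, Real.norm_of_nonneg (inv_pos.2 (ht j)).le, inv_mul_le_iff₀ (ht j)]
      refine h6.trans (le_of_eq ?_)
      simp only [hB₀]; ring
    · filter_upwards [hcb, h.primitive.deriv, hφm, hd, hu.2] with z h1 h2 h3 h4 h5
      exact h1.tendsto_variation h2 hσ h5 h3 h4 (ψ0 z) ht htl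
  set T : ℕ → Pt n m → ℝ := fun j => {z | 0 < t j * ψ z - d z}.indicator fun z =>
    inner ℝ (D z) (grad γ ψ z) with hT
  have iD : Integrable (fun z => inner ℝ (D z) (grad γ ψ z)) (volume.restrict Ω) :=
    integrable_inner_L2 pd.memLp_grad mp
  have mset : ∀ j, NullMeasurableSet {z | 0 < t j * ψ z - d z} (volume.restrict Ω) := fun j =>
    nullMeasurableSet_lt aemeasurable_const
      ((hψ.smooth.continuous.aemeasurable.const_mul (t j)).sub pd.memLp.1.aemeasurable)
  have Ti : ∀ j, Integrable (T j) (volume.restrict Ω) := fun j => iD.indicator₀ (mset j)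
  -- Where `d > 0` the indicator is eventually zero, and where `d = 0` the gradient `D` vanishes
  -- almost everywhere.
  have Tlim : Tendsto (fun j => ∫ z in Ω, T j z) atTop (𝓝 0) := by
    have h0 : ∫ z in Ω, (0 : ℝ) = 0 := integral_zero _ _
    rw [← h0]
    refine tendsto_integral_of_dominated_convergence _ (fun j => (Ti j).1) iD.norm
      (fun j => Eventually.of_forall fun z => norm_indicator_le_norm_self _ _) ?_
    filter_upwards [pd.grad_eq_zero_of_eq_zero hγ hΩ, hd] with z h1 h2
    rcases h2.eq_or_lt with h3 | h3
    · have : D z = 0 := h1 h3.symm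
      refine tendsto_const_nhds.congr fun j => ?_
      simp only [hT, Set.indicator_apply, this, inner_zero_left, ite_self]
    · have h4 : Tendsto (fun j => t j * ψ z) atTop (𝓝 0) := by simpa using htl.mul_const (ψ z)
      refine tendsto_const_nhds.congr' ?_
      filter_upwards [h4.eventually (eventually_lt_nhds h3)] with j hj
      simp only [hT]
      rw [Set.indicator_of_notMem]
      simp only [Set.mem_ofPred_eq, not_lt, hdd]
      linarith
  have iU : Integrable (fun z => inner ℝ (σ • U z) (grad γ ψ z)) (volume.restrict Ω) :=
    integrable_inner_L2 (pu.memLp_grad.const_smul σ) mp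
  have ip : Integrable (fun z => ‖grad γ ψ z‖ ^ 2) (volume.restrict Ω) := integrable_norm_sq mp
  -- Minimality at the competitor `w j` and the inequality for `φ` tested with `y j` are added and
  -- divided by `t j`. The two gradient estimates, on and off the set where the truncation acts, are
  -- merged into one bound.
  have main : ∀ j, 0 ≤ (∫ z in Ω, inner ℝ (σ • U z) (grad γ ψ z)) + (∫ z in Ω, T j z) +
      t j * ((1 / 2) * ∫ z in Ω, ‖grad γ ψ z‖ ^ 2) + ∫ z in Ω, E j z := by
    intro j
    have h1 := hmin (w j) (wK j) (Gw j)
    have hWw : (∫ z in Ω, ‖weakGrad γ Ω (w j) z‖ ^ 2) = ∫ z in Ω, ‖W j z‖ ^ 2 :=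
      integral_congr_ae (((pw j).weakGrad_ae hγ hΩ).mono fun z hz => by simp only [hz])
    unfold energyValue at h1
    rw [hWw] at h1
    have iW := integrable_norm_sq (pw j).memLp_grad
    have iUU := integrable_norm_sq pu.memLp_grad
    have iY := integrable_inner_L2 mq (py j).memLp_grad
    have h2 : (∫ z in Ω, ((1 / 2) * ‖W j z‖ ^ 2 - (1 / 2) * ‖U z‖ ^ 2 +
          inner ℝ (σ • q z) (Y j z))) ≤
        ∫ z in Ω, t j * (inner ℝ (σ • U z) (grad γ ψ z) + T j z +
          t j * ((1 / 2) * ‖grad γ ψ z‖ ^ 2)) := by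
      refine integral_mono (((iW.const_mul _).sub (iUU.const_mul _)).add iY)
        (((iU.add (Ti j)).add ((ip.const_mul _).const_mul _)).const_mul _) fun z => ?_
      simp only [hW, hY, hT]
      by_cases hz : z ∈ {z | 0 < t j * ψ z - d z}
      · simp only [Set.indicator_of_mem hz]
        have h3 := gradient_variation_le (t := t j) hσ (U z) (q z) (grad γ ψ z)
        have h4 : 0 ≤ t j * (t j * (1 / 2 * ‖grad γ ψ z‖ ^ 2)) := by
          have := ht j; positivity
        simp only [hDD] at h3 ⊢
        linarith
      · simp only [Set.indicator_of_notMem hz, sub_zero, inner_zero_right, add_zero]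
        rw [norm_add_sq_real, inner_smul_right, inner_smul_right, inner_smul_left, norm_smul,
          norm_smul, mul_pow, mul_pow]
        have h4 : ‖σ‖ ^ 2 = 1 := by rcases hσ with rfl | rfl <;> simp
        rw [h4, Real.norm_of_nonneg (ht j).le]
        simp only [RCLike.conj_to_real]
        apply le_of_eq
        ring
    have iWU : Integrable (fun z => (1 / 2) * ‖W j z‖ ^ 2 - (1 / 2) * ‖U z‖ ^ 2)
        (volume.restrict Ω) := (iW.const_mul _).sub (iUU.const_mul _)
    have iUT : Integrable (fun z => inner ℝ (σ • U z) (grad γ ψ z) + T j z)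
        (volume.restrict Ω) := iU.add (Ti j)
    rw [integral_add iWU iY, integral_sub (iW.const_mul _) (iUU.const_mul _), integral_const_mul,
      integral_const_mul, integral_const_mul, integral_add iUT ((ip.const_mul _).const_mul _),
      integral_add iU (Ti j), integral_const_mul, integral_const_mul] at h2
    have h3 : t j * ∫ z in Ω, E j z = (∫ z in Ω, (G z (w j z)).toReal) -
        (∫ z in Ω, (G z (u z)).toReal) - ((∫ z in Ω, F z (w j z)) - ∫ z in Ω, F z (u z)) +
        ∫ z in Ω, σ * ((g z (φ z)).toReal - f z (φ z)) * y j z := by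
      have iG : Integrable (fun z => (G z (w j z)).toReal - (G z (u z)).toReal)
        (volume.restrict Ω) := (Gw j).2.sub hG.2
      have iF : Integrable (fun z => F z (w j z) - F z (u z)) (volume.restrict Ω) :=
        (Fi (wK j)).sub (Fi hu)
      have iGF : Integrable (fun z => (G z (w j z)).toReal - (G z (u z)).toReal -
        (F z (w j z) - F z (u z))) (volume.restrict Ω) := iG.sub iF
      simp only [hE]
      rw [integral_const_mul, mul_inv_cancel_left₀ (ht j).ne',
        integral_add iGF (dist j).1, integral_sub iG iF,
        integral_sub (Gw j).2 hG.2, integral_sub (Fi (wK j)) (Fi hu)]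
    have h4 := (dist j).2
    refine nonneg_of_mul_nonneg_right (a := t j) ?_ (ht j)
    linarith
  have hlim : Tendsto (fun j => (∫ z in Ω, inner ℝ (σ • U z) (grad γ ψ z)) + (∫ z in Ω, T j z) +
      t j * ((1 / 2) * ∫ z in Ω, ‖grad γ ψ z‖ ^ 2) + ∫ z in Ω, E j z) atTop
      (𝓝 ((∫ z in Ω, inner ℝ (σ • U z) (grad γ ψ z)) + 0 + 0 * ((1 / 2) *
        ∫ z in Ω, ‖grad γ ψ z‖ ^ 2) + ∫ z in Ω, σ * ((g z (u z)).toReal - f z (u z)) * ψ z)) :=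
    ((tendsto_const_nhds.add Tlim).add (htl.mul_const _)).add Elim
  have := ge_of_tendsto' hlim main
  simpa using this

end OrderedPair

section OrderedPair

variable {γ : ℝ} {Ω : Set (Pt n m)} {g G : Pt n m → ℝ → EReal} {f F : Pt n m → ℝ → ℝ}
  {φ₁ φ₂ : Pt n m → ℝ}

lemma weakIntegrand_eq (φ v : Pt n m → ℝ) (V : Pt n m → Vec n m) (z : Pt n m) :
    weakIntegrand γ Ω g f φ v V z =
      inner ℝ (weakGrad γ Ω φ z) (V z) + ((g z (φ z)).toReal - f z (φ z)) * v z := by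
  rw [weakIntegrand]; ring

lemma OrderedPair.integrable_f (h : OrderedPair γ Ω g G f F φ₁ φ₂) {u : Pt n m → ℝ}
    (hu : AEMeasurable u (volume.restrict Ω))
    (hle : ∀ᵐ z ∂volume.restrict Ω, φ₁ z ≤ u z ∧ u z ≤ φ₂ z) :
    Integrable (fun z => f z (u z)) (volume.restrict Ω) := by
  obtain ⟨a, A, B, -, ha, -, -, hb⟩ := h.exists_lower_bound
  refine ha.mono' (h.growth.caratheodory.aemeasurable_comp hu).aestronglyMeasurable ?_
  filter_upwards [hb, hle] with z h1 h2
  exact (h1.2.1 _ h2).1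

/-- By monotonicity `g(·, u)` lies between `g(·, φ₁)` and `g(·, φ₂)`, which are locally integrable.
-/
lemma OrderedPair.memL1loc_g (h : OrderedPair γ Ω g G f F φ₁ φ₂) {u : Pt n m → ℝ}
    (hu : AEMeasurable u (volume.restrict Ω))
    (hle : ∀ᵐ z ∂volume.restrict Ω, φ₁ z ≤ u z ∧ u z ≤ φ₂ z) :
    MemL1loc Ω fun z => g z (u z) := by
  have hcb := h.convexBetween
  refine ⟨?_, ?_⟩
  · filter_upwards [hcb, hle] with z h1 h2 using h1.g_finite h2
  · have h1 : LocallyIntegrableOn (fun z => |(g z (φ₁ z)).toReal|) Ω := h.sub.g_loc.2.norm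
    have h2 : LocallyIntegrableOn (fun z => |(g z (φ₂ z)).toReal|) Ω := h.super.g_loc.2.norm
    have hm := (h.aemeasurable_g hu hle).ereal_toReal.aestronglyMeasurable
    have hdom : ∀ᵐ z ∂volume.restrict Ω, ‖(g z (u z)).toReal‖ ≤
        |(g z (φ₁ z)).toReal| + |(g z (φ₂ z)).toReal| := by
      filter_upwards [hcb, hle] with z h3 h4 using h3.abs_g_le h4
    rw [locallyIntegrableOn_iff h.isOpen.isLocallyClosed]
    intro K hKΩ hK
    have h3 := (h1.add h2).integrableOn_compact_subset hKΩ hK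
    exact h3.mono' (hm.mono_measure (Measure.restrict_mono hKΩ le_rfl))
      (ae_mono (Measure.restrict_mono hKΩ le_rfl) hdom)

lemma OrderedPair.posPart_mem (h : OrderedPair γ Ω g G f F φ₁ φ₂) {u : Pt n m → ℝ}
    (hu : MemH10 γ Ω u) : MemH10 γ Ω fun z => max (u z) 0 :=
  (hu.pair.posPart h.one_le_n h.one_le_m h.pos h.isOpen h.bounded).memH10 h.pos h.isOpen

lemma OrderedPair.negPart_mem (h : OrderedPair γ Ω g G f F φ₁ φ₂) {u : Pt n m → ℝ}
    (hu : MemH10 γ Ω u) : MemH10 γ Ω fun z => max (-u z) 0 := by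
  have := ((hu.pair.const_mul (-1)).posPart h.one_le_n h.one_le_m h.pos h.isOpen
    h.bounded).memH10 h.pos h.isOpen
  simpa using this

lemma OrderedPair.integral_weakIntegrand (h : OrderedPair γ Ω g G f F φ₁ φ₂) {u : Pt n m → ℝ}
    (hu : MemH1 γ Ω u) (hg : MemL1loc Ω fun z => g z (u z))
    (hf : LocallyIntegrableOn (fun z => f z (u z)) Ω) {ψ : Pt n m → ℝ} (hψ : IsTest Ω ψ) :
    ∫ z in Ω, weakIntegrand γ Ω g f u ψ (grad γ ψ) z =
      (∫ z in Ω, inner ℝ (weakGrad γ Ω u z) (grad γ ψ z)) +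
        ∫ z in Ω, ((g z (u z)).toReal - f z (u z)) * ψ z := by
  simp only [weakIntegrand_eq]
  exact integral_add (integrable_inner_L2 hu.pair.memLp_grad (hψ.memLp_grad h.pos 2 _))
    (integrable_mul_test (hg.2.sub hf) hψ)

/-- A minimizer of the functional over the order interval is a weak solution. -/
theorem OrderedPair.isWeakSolution (h : OrderedPair γ Ω g G f F φ₁ φ₂) {u : Pt n m → ℝ}
    (hu : u ∈ orderInterval γ Ω φ₁ φ₂) (hG : MemL1 Ω (fun z => G z (u z)))
    (hmin : ∀ w ∈ orderInterval γ Ω φ₁ φ₂, MemL1 Ω (fun z => G z (w z)) →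
        energyValue γ Ω G F u ≤ energyValue γ Ω G F w) : IsWeakSolution γ Ω g f u := by
  have mu : AEMeasurable u (volume.restrict Ω) := hu.1.1.1.1.aemeasurable
  have hg := h.memL1loc_g mu hu.2
  have hf : LocallyIntegrableOn (fun z => f z (u z)) Ω :=
    (show IntegrableOn (fun z => f z (u z)) Ω volume from
      h.integrable_f mu hu.2).locallyIntegrableOn
  have b₁ : LocallyIntegrableOn (fun z => (g z (φ₁ z)).toReal - f z (φ₁ z)) Ω :=
    h.sub.g_loc.2.sub h.sub.f_loc
  have b₂ : LocallyIntegrableOn (fun z => (g z (φ₂ z)).toReal - f z (φ₂ z)) Ω :=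
    h.super.g_loc.2.sub h.super.f_loc
  have key₂ : ∀ ψ, IsTest Ω ψ → (∀ z, 0 ≤ ψ z) →
      0 ≤ ∫ z in Ω, weakIntegrand γ Ω g f u ψ (grad γ ψ) z := by
    intro ψ hψ ψ0
    have := h.variational_ineq hu hG hmin (φ := φ₂) (σ := 1) (Or.inl rfl) h.super.memH1
      (h.le.mono fun z hz => ⟨hz, le_rfl⟩) (by
        filter_upwards [hu.2] with z hz
        linarith [hz.2]) (by simpa using b₂) (fun η hη η0 => by
        simpa only [weakIntegrand_eq, one_smul, one_mul] using h.super.ineq η hη η0) hψ ψ0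
    rw [h.integral_weakIntegrand hu.1.1 hg hf hψ]
    simpa using this
  have key₁ : ∀ ψ, IsTest Ω ψ → (∀ z, 0 ≤ ψ z) →
      ∫ z in Ω, weakIntegrand γ Ω g f u ψ (grad γ ψ) z ≤ 0 := by
    intro ψ hψ ψ0
    have := h.variational_ineq hu hG hmin (φ := φ₁) (σ := -1) (Or.inr rfl) h.sub.memH1
      (h.le.mono fun z hz => ⟨le_rfl, hz⟩) (by
        filter_upwards [hu.2] with z hz
        linarith [hz.1]) (by
        refine b₁.neg.congr (Eventually.of_forall fun z => ?_)
        simp) (fun η hη η0 => by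
        have h1 := h.sub.ineq η hη η0
        rw [← neg_nonneg, ← integral_neg] at h1
        refine h1.trans (le_of_eq (integral_congr_ae (Eventually.of_forall fun z => ?_)))
        simp only [weakIntegrand_eq, neg_smul, one_smul, inner_neg_left]
        ring) hψ ψ0
    rw [h.integral_weakIntegrand hu.1.1 hg hf hψ]
    simp only [neg_smul, one_smul, inner_neg_left, neg_mul, one_mul, integral_neg] at this
    linarith
  exact ⟨⟨hu.1.1, h.posPart_mem hu.1, hg, hf, key₁⟩, ⟨hu.1.1, h.negPart_mem hu.1, hg, hf, key₂⟩⟩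

/-- A supersolution that agrees with a weak solution almost everywhere is a weak solution. -/
lemma IsSupersolution.isWeakSolution_of_ae_eq (hγ : 0 < γ) (hΩ : IsOpen Ω) {u φ : Pt n m → ℝ}
    (hφ : IsSupersolution γ Ω g f φ) (hu : IsWeakSolution γ Ω g f u)
    (he : u =ᵐ[volume.restrict Ω] φ) : IsWeakSolution γ Ω g f φ := by
  have hgr : weakGrad γ Ω φ =ᵐ[volume.restrict Ω] weakGrad γ Ω u :=
    (hu.1.memH1.pair.congr he (ae_eq_refl _)).weakGrad_ae hΩ
  refine ⟨⟨hφ.memH1, ?_, hφ.g_loc, hφ.f_loc, fun ψ hψ ψ0 => ?_⟩, hφ⟩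
  · refine (hu.1.posPart.pair.congr ?_ (ae_eq_refl _)).memH10 hγ hΩ
    filter_upwards [he] with z hz
    rw [hz]
  · refine (le_of_eq (integral_congr_ae ?_)).trans (hu.1.ineq ψ hψ ψ0)
    filter_upwards [he, hgr] with z h1 h2
    rw [weakIntegrand, weakIntegrand, h1, h2]

end OrderedPair

/-! ### Strict inequality below the supersolution: vanishing gradients and the logarithmic estimate.
-/

/-- A function with vanishing weak gradient is invariant under small translations in directions
controlled by the gradient. -/
lemma H1Pair.ae_translate_eq {γ : ℝ} (hγ : 0 < γ) {z₀ : Pt n m} {R : ℝ} (hR : 0 < R)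
    {χ : Pt n m → ℝ} (hχ : H1Pair γ (Metric.ball z₀ R) χ fun _ => 0) {A A' : Set (Pt n m)}
    (hA : MeasurableSet A) (hA' : MeasurableSet A') (hAb : A ⊆ Metric.ball z₀ (R / 2))
    (hA'b : A' ⊆ Metric.ball z₀ (R / 2)) {h : Pt n m}
    (hAA : ∀ z ∈ A, ∀ s ∈ Set.Ioc (0 : ℝ) 1, z + s • h ∈ A') {C : ℝ}
    (hC : ∀ (ψ : Pt n m → ℝ), ∀ z ∈ A', ‖fderiv ℝ ψ z h‖ ≤ C * ‖grad γ ψ z‖) :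
    ∀ᵐ z ∂volume.restrict A, χ (z + h) = χ z := by
  set B := Metric.ball z₀ R with hB
  have hBo : IsOpen B := Metric.isOpen_ball
  have hK : IsCompact (Metric.closedBall z₀ (R / 2)) := isCompact_closedBall _ _
  have hKB : Metric.closedBall z₀ (R / 2) ⊆ B := Metric.closedBall_subset_ball (by linarith)
  obtain ⟨ζ, hζ, hζ1, -⟩ := exists_cutoff hBo hK hKB
  have hloc : ∀ z ∈ Metric.ball z₀ (R / 2), ζ =ᶠ[𝓝 z] fun _ => 1 := fun z hz =>
    (eventually_nhdsSet_iff_forall.1 hζ1) z (Metric.ball_subset_closedBall hz)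
  have hv := hχ.mul_test hγ hζ
  obtain ⟨-, ψ, -, -, hψ, -, h1, h2, -⟩ := hv.exists_test_approx hγ hBo hζ.compact hζ.supp
    (Eventually.of_forall fun z hz => by
      rw [image_eq_zero_of_notMem_tsupport hz, zero_mul])
  obtain ⟨s, hs, hae⟩ := exists_subseq_ae
    (fun k => ((hψ k).memLp 2 (volume.restrict B)).1) hv.memLp.1 h1
  have hsubB : Metric.ball z₀ (R / 2) ⊆ B := Metric.ball_subset_closedBall.trans hKB
  have hae' : ∀ᵐ z, z ∈ Metric.ball z₀ (R / 2) →
      Tendsto (fun k => ψ (s k) z) atTop (𝓝 (χ z)) := by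
    rw [ae_restrict_iff' hBo.measurableSet] at hae
    filter_upwards [hae] with z hz hz'
    have := hz (hsubB hz')
    rwa [(hloc z hz').eq_of_nhds, one_mul] at this
  have hae'' : ∀ᵐ z, z + h ∈ Metric.ball z₀ (R / 2) →
      Tendsto (fun k => ψ (s k) (z + h)) atTop (𝓝 (χ (z + h))) :=
    (measurePreserving_add_right volume h).quasiMeasurePreserving.ae hae'
  have hAh : ∀ z ∈ A, z + h ∈ A' := fun z hz => by
    simpa using hAA z hz 1 (by simp)
  have hgr : Tendsto (fun k => ∫⁻ z in A', ‖fderiv ℝ (ψ (s k)) z h‖ₑ ^ 2) atTop (𝓝 0) := by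
    have h3 : Tendsto (fun k => ENNReal.ofReal (C ^ 2) * eLpNorm (fun z => grad γ (ψ (s k)) z -
        (ζ z • (0 : Vec n m) + χ z • grad γ ζ z)) 2 (volume.restrict B) ^ 2) atTop (𝓝 0) := by
      have := ENNReal.Tendsto.const_mul (ENNReal.Tendsto.pow (n := 2) (h2.comp hs.tendsto_atTop))
        (Or.inr (ENNReal.ofReal_ne_top (r := C ^ 2)))
      simpa using this
    refine tendsto_of_tendsto_of_tendsto_of_le_of_le tendsto_const_nhds h3 (fun _ => zero_le)
      fun k => ?_
    simp only
    rw [eLpNorm_two_sq, ← lintegral_const_mul' _ _ ENNReal.ofReal_ne_top]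
    calc ∫⁻ z in A', ‖fderiv ℝ (ψ (s k)) z h‖ₑ ^ 2
        ≤ ∫⁻ z in A', ENNReal.ofReal (C ^ 2) * ‖grad γ (ψ (s k)) z -
          (ζ z • (0 : Vec n m) + χ z • grad γ ζ z)‖ₑ ^ 2 := by
          refine setLIntegral_mono' hA' fun z hz => ?_
          have h4 : grad γ ζ z = 0 := grad_eq_zero_of_fderiv (by
            rw [(hloc z (hA'b hz)).fderiv_eq]; simp)
          rw [h4, smul_zero, smul_zero, add_zero, sub_zero]
          exact enorm_sq_le_ofReal (hC _ z hz)
      _ ≤ _ := lintegral_mono_set (hA'b.trans hsubB)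
  have hfat : ∫⁻ z in A, ‖χ (z + h) - χ z‖ₑ ^ 2 ≤ 0 := by
    calc ∫⁻ z in A, ‖χ (z + h) - χ z‖ₑ ^ 2
        = ∫⁻ z in A, liminf (fun k => ‖ψ (s k) (z + h) - ψ (s k) z‖ₑ ^ 2) atTop := by
          refine lintegral_congr_ae ?_
          filter_upwards [ae_restrict_of_ae hae', ae_restrict_of_ae hae'',
            ae_restrict_mem hA] with z k1 k2 k3
          have k4 := ((k2 (hA'b (hAh z k3))).sub (k1 (hAb k3))).enorm
          exact (ENNReal.Tendsto.pow (n := 2) k4).liminf_eq.symm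
      _ ≤ liminf (fun k => ∫⁻ z in A, ‖ψ (s k) (z + h) - ψ (s k) z‖ₑ ^ 2) atTop :=
          lintegral_liminf_le fun k => by
            have := (hψ (s k)).smooth.continuous
            exact ((this.comp (continuous_add_const h)).sub this).enorm.measurable.pow_const 2
      _ ≤ liminf (fun k => ∫⁻ z in A', ‖fderiv ℝ (ψ (s k)) z h‖ₑ ^ 2) atTop :=
          liminf_le_liminf (Eventually.of_forall fun k =>
            lintegral_translate_sub_le (hψ (s k)).contDiff_one hA' hAA hA)
      _ = 0 := hgr.liminf_eq
  have m1 : AEMeasurable (fun z => ‖χ (z + h) - χ z‖ₑ ^ 2) (volume.restrict A) := by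
    have m2 : AEMeasurable χ (volume.restrict A) :=
      aemeasurable_of_tendsto_metrizable_ae atTop
        (fun k => (hψ (s k)).smooth.continuous.aemeasurable) (by
          filter_upwards [ae_restrict_of_ae hae', ae_restrict_mem hA] with z k1 k3
          exact k1 (hAb k3))
    have m3 : AEMeasurable (fun z => χ (z + h)) (volume.restrict A) :=
      aemeasurable_of_tendsto_metrizable_ae atTop
        (fun k => ((hψ (s k)).smooth.continuous.comp (continuous_add_const h)).aemeasurable) (by
          filter_upwards [ae_restrict_of_ae hae'', ae_restrict_mem hA] with z k1 k3
          exact k1 (hA'b (hAh z k3)))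
    exact (m3.sub m2).enorm.pow_const 2
  filter_upwards [(lintegral_eq_zero_iff' m1).1 (le_antisymm hfat zero_le)] with z hz
  have h5 : ‖χ (z + h) - χ z‖ₑ = 0 := by simpa using hz
  exact sub_eq_zero.1 (enorm_eq_zero.1 h5)

lemma ae_fst_ne_zero (hn : 1 ≤ n) : ∀ᵐ z : Pt n m, z.1 ≠ 0 := by
  have : Nonempty (Fin n) := ⟨⟨0, hn⟩⟩
  have h1 : ∀ᵐ x : EuclideanSpace ℝ (Fin n), x ≠ 0 := by
    rw [ae_iff]; simp
  exact Measure.quasiMeasurePreserving_fst.ae h1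

/-- The translation is split into its `x`- and `y`-parts. The `y`-part is applied at the shifted
point `z + (h.1, 0)`, hence is proved on the larger ball of radius `R / 4`. -/
lemma H1Pair.ae_translate_eq_of_small (hn : 1 ≤ n) {γ : ℝ} (hγ : 0 < γ) {z₀ : Pt n m} {R : ℝ}
    (hR : 0 < R) {χ : Pt n m → ℝ} (hχ : H1Pair γ (Metric.ball z₀ R) χ fun _ => 0) {h : Pt n m}
    (hh : ‖h‖ < R / 8) : ∀ᵐ z ∂volume.restrict (Metric.ball z₀ (R / 8)), χ (z + h) = χ z := by
  have hnorm : ∀ {a : Pt n m} {s : ℝ}, ‖a‖ < R / 8 → s ∈ Set.Ioc (0 : ℝ) 1 → ‖s • a‖ < R / 8 := by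
    intro a s ha hs
    rw [norm_smul, Real.norm_of_nonneg hs.1.le]
    exact (mul_le_of_le_one_left (norm_nonneg _) hs.2).trans_lt ha
  have hmove : ∀ {z a : Pt n m} {r : ℝ}, z ∈ Metric.ball z₀ r → ‖a‖ < R / 8 →
      z + a ∈ Metric.ball z₀ (r + R / 8) := by
    intro z a r hz ha
    rw [mem_ball_iff_norm] at *
    calc ‖z + a - z₀‖ = ‖(z - z₀) + a‖ := by congr 1; abel
      _ ≤ ‖z - z₀‖ + ‖a‖ := norm_add_le _ _
      _ < _ := by linarith
  have hx : ‖((h.1, 0) : Pt n m)‖ < R / 8 := by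
    refine lt_of_le_of_lt ?_ hh
    simp [Prod.norm_def]
  have hy : ‖((0, h.2) : Pt n m)‖ < R / 8 := by
    refine lt_of_le_of_lt ?_ hh
    simp [Prod.norm_def]
  have sub : ∀ {r : ℝ}, r ≤ R / 2 → Metric.ball z₀ r ⊆ Metric.ball z₀ (R / 2) := fun hr =>
    Metric.ball_subset_ball hr
  have sx := hχ.ae_translate_eq hγ hR (A := Metric.ball z₀ (R / 8)) (A' := Metric.ball z₀ (R / 2))
    (h := (h.1, 0)) measurableSet_ball measurableSet_ball (sub (by linarith)) le_rfl
    (fun z hz s hs => sub (by linarith) (hmove hz (hnorm hx hs)))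
    (C := ‖h.1‖) (fun ψ z _ => norm_fderiv_x_le ψ z h.1)
  -- Translations in `y` preserve the sets `‖x‖ ≥ 1 / (k + 1)`, on which `y`-derivatives are
  -- controlled by the Grushin gradient. The union of these sets misses only the null set `{x = 0}`.
  have sy : ∀ᵐ z ∂volume.restrict (Metric.ball z₀ (R / 4)), χ (z + (0, h.2)) = χ z := by
    have h1 : ∀ k : ℕ, ∀ᵐ z ∂volume.restrict (Metric.ball z₀ (R / 4) ∩
        {z | 1 / ((k : ℝ) + 1) ≤ ‖z.1‖}), χ (z + (0, h.2)) = χ z := by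
      intro k
      have mδ : MeasurableSet {z : Pt n m | 1 / ((k : ℝ) + 1) ≤ ‖z.1‖} :=
        measurableSet_le measurable_const measurable_fst.norm
      refine hχ.ae_translate_eq hγ hR (A := Metric.ball z₀ (R / 4) ∩ _)
        (A' := Metric.ball z₀ (R / 2) ∩ {z | 1 / ((k : ℝ) + 1) ≤ ‖z.1‖})
        (measurableSet_ball.inter mδ) (measurableSet_ball.inter mδ)
        (Set.inter_subset_left.trans (sub (by linarith))) Set.inter_subset_left
        (fun z hz s hs => ⟨sub (by linarith) (hmove hz.1 (hnorm hy hs)), ?_⟩)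
        (C := ‖h.2‖ * (1 / ((k : ℝ) + 1)) ^ (-γ)) (fun ψ z hz =>
          norm_fderiv_y_le hγ ψ (by positivity) hz.2 h.2)
      have := hz.2
      simpa using this
    have h2 : ∀ k : ℕ, ∀ᵐ z : Pt n m, z ∈ Metric.ball z₀ (R / 4) →
        1 / ((k : ℝ) + 1) ≤ ‖z.1‖ → χ (z + (0, h.2)) = χ z := by
      intro k
      have h3 := h1 k
      rw [ae_restrict_iff' (measurableSet_ball.inter
        (measurableSet_le measurable_const measurable_fst.norm))] at h3
      filter_upwards [h3] with z hz k1 k2 using hz ⟨k1, k2⟩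
    rw [ae_restrict_iff' measurableSet_ball]
    filter_upwards [ae_all_iff.2 h2, ae_fst_ne_zero hn] with z h3 h4 h5
    obtain ⟨k, hk⟩ := exists_nat_one_div_lt (norm_pos_iff.2 h4)
    exact h3 k h5 hk.le
  rw [ae_restrict_iff' measurableSet_ball] at sx sy ⊢
  have sy' := (measurePreserving_add_right (volume : Measure (Pt n m))
    (h.1, 0)).quasiMeasurePreserving.ae sy
  filter_upwards [sx, sy'] with z h1 h2 h3
  have h4 := h2 (Metric.ball_subset_ball (by linarith) (hmove h3 hx))
  rw [h1 h3, add_assoc] at h4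
  simpa using h4

/-- Functions with vanishing weak gradient are locally constant. -/
lemma H1Pair.ae_const_of_grad_eq_zero (hn : 1 ≤ n) {γ : ℝ} (hγ : 0 < γ) {z₀ : Pt n m} {R : ℝ}
    (hR : 0 < R) {χ : Pt n m → ℝ} (hχ : H1Pair γ (Metric.ball z₀ R) χ fun _ => 0) :
    ∃ c, ∀ᵐ z ∂volume.restrict (Metric.ball z₀ (R / 16)), χ z = c := by
  set B := Metric.ball z₀ (R / 16) with hB
  have mB : MeasurableSet B := measurableSet_ball
  have sub : B ⊆ Metric.ball z₀ R := Metric.ball_subset_ball (by linarith)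
  have hm : AEMeasurable χ (volume.restrict B) :=
    (hχ.memLp.1.aemeasurable).mono_measure (Measure.restrict_mono sub le_rfl)
  set η := B.indicator (hm.mk χ) with hη
  have mη : Measurable η := hm.measurable_mk.indicator mB
  have eη : ∀ᵐ z, z ∈ B → η z = χ z := by
    rw [← ae_restrict_iff' mB]
    filter_upwards [hm.ae_eq_mk, ae_restrict_mem mB] with z h1 h2
    rw [hη, Set.indicator_of_mem h2, h1]
  set one : Pt n m → ℝ≥0∞ := B.indicator 1 with hone
  have mone : Measurable one := measurable_one.indicator mB
  have hmk : Measurable fun p : Pt n m × Pt n m => one p.1 * one p.2 * ‖η p.2 - η p.1‖ₑ := by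
    fun_prop
  -- Invariance is known almost everywhere for each single `h`. Fubini's theorem turns this into
  -- equality of `η` at almost every pair of points of `B`; the radius `R / 16` keeps their
  -- differences below `R / 8`.
  have hdouble : ∫⁻ z, ∫⁻ w, one z * one w * ‖η w - η z‖ₑ = 0 := by
    calc ∫⁻ z, ∫⁻ w, one z * one w * ‖η w - η z‖ₑ
        = ∫⁻ z, ∫⁻ h, one z * one (z + h) * ‖η (z + h) - η z‖ₑ := by
          refine lintegral_congr fun z => ?_
          exact (lintegral_add_left_eq_self (fun w => one z * one w * ‖η w - η z‖ₑ) z).symm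
      _ = ∫⁻ h, ∫⁻ z, one z * one (z + h) * ‖η (z + h) - η z‖ₑ := by
          refine lintegral_lintegral_swap (Measurable.aemeasurable ?_)
          simp only [Function.uncurry_def]
          fun_prop
      _ = 0 := by
          rw [lintegral_eq_zero_iff']
          · refine Eventually.of_forall fun h => ?_
            simp only [Pi.zero_apply]
            refine (lintegral_congr_ae ?_).trans lintegral_zero
            have e2 := (measurePreserving_add_right (volume : Measure (Pt n m))
              h).quasiMeasurePreserving.ae eη
            by_cases hh : ‖h‖ < R / 8
            · have h1 := hχ.ae_translate_eq_of_small hn hγ hR hh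
              rw [ae_restrict_iff' measurableSet_ball] at h1
              filter_upwards [h1, eη, e2] with z k1 k2 k3
              by_cases hz : z ∈ B
              · by_cases hz' : z + h ∈ B
                · rw [k3 hz', k2 hz, k1 (Metric.ball_subset_ball (by linarith) hz), sub_self]
                  simp
                · simp [hone, hz']
              · simp [hone, hz]
            · filter_upwards with z
              by_cases hz : z ∈ B
              · have hz' : z + h ∉ B := fun hz' => hh (by
                  rw [hB, mem_ball_iff_norm] at hz hz'
                  calc ‖h‖ = ‖(z + h - z₀) - (z - z₀)‖ := by congr 1; abel
                    _ ≤ ‖z + h - z₀‖ + ‖z - z₀‖ := norm_sub_le _ _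
                    _ < R / 8 := by linarith)
                simp [hone, hz']
              · simp [hone, hz]
          · refine Measurable.aemeasurable (Measurable.lintegral_prod_right'
              (f := fun p : Pt n m × Pt n m =>
                one p.2 * one (p.2 + p.1) * ‖η (p.2 + p.1) - η p.2‖ₑ) ?_)
            fun_prop
  rw [lintegral_eq_zero_iff' (Measurable.lintegral_prod_right' hmk).aemeasurable] at hdouble
  have hpos : volume B ≠ 0 := (Metric.measure_ball_pos volume z₀ (by linarith)).ne'
  obtain ⟨z, hzB, hz⟩ : ∃ z ∈ B, ∫⁻ w, one z * one w * ‖η w - η z‖ₑ = 0 := by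
    by_contra! hc
    refine hpos (measure_mono_null (fun z hz => ?_) (ae_iff.1 hdouble))
    exact hc z hz
  refine ⟨η z, ?_⟩
  rw [lintegral_eq_zero_iff' (by fun_prop)] at hz
  rw [ae_restrict_iff' mB]
  filter_upwards [hz, eη] with w h1 h2 h3
  rw [← h2 h3]
  have h4 : ‖η w - η z‖ₑ = 0 := by simpa [hone, hzB, h3] using h1
  exact sub_eq_zero.1 (enorm_eq_zero.1 h4)

/-- With `D` and `p` the gradients of `d` and `ψ`, the vector paired with `D` is the gradient of `ψ²
/ (d + ε)` in the shape given by the product and chain rules. The bound is Young's inequality. -/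
lemma inner_caccioppoli_le {ψ d ε : ℝ} (hε : 0 < ε) (hd : 0 ≤ d) (D p : Vec n m) :
    inner ℝ D ((ψ • (ψ • ((-((d + ε) ^ 2)⁻¹) • D) + ((d + ε)⁻¹ - ε⁻¹) • p) +
      (ψ * ((d + ε)⁻¹ - ε⁻¹)) • p) + ε⁻¹ • (ψ • p + ψ • p)) ≤
      -(1 / 2) * ‖(ψ / (d + ε)) • D‖ ^ 2 + 2 * ‖p‖ ^ 2 := by
  have hP : 0 < d + ε := by linarith
  have h1 : 0 ≤ ‖(ψ / (d + ε)) • D - (2 : ℝ) • p‖ ^ 2 := by positivity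
  rw [norm_sub_sq_real, norm_smul (2 : ℝ), inner_smul_left, inner_smul_right] at h1
  have h2 : ‖(ψ / (d + ε)) • D‖ ^ 2 = (ψ / (d + ε)) ^ 2 * inner ℝ D D := by
    rw [norm_smul, mul_pow, real_inner_self_eq_norm_sq, Real.norm_eq_abs, sq_abs]
  have h3 : inner ℝ D ((ψ • (ψ • ((-((d + ε) ^ 2)⁻¹) • D) + ((d + ε)⁻¹ - ε⁻¹) • p) +
      (ψ * ((d + ε)⁻¹ - ε⁻¹)) • p) + ε⁻¹ • (ψ • p + ψ • p)) =
      -((ψ / (d + ε)) ^ 2 * inner ℝ D D) + 2 * (ψ / (d + ε)) * inner ℝ D p := by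
    simp only [inner_add_right, inner_smul_right, div_eq_mul_inv, inv_pow, mul_pow]
    ring
  simp only [Real.norm_ofNat, conj_trivial] at h1
  rw [h3, ← h2]
  nlinarith

/-- The logarithmic Caccioppoli inequality. -/
lemma H1Pair.caccioppoli_log {γ : ℝ} (hγ : 0 < γ) {B : Set (Pt n m)} (hB : IsOpen B)
    {d : Pt n m → ℝ} {D : Pt n m → Vec n m} (h : H1Pair γ B d D)
    (d0 : ∀ᵐ z ∂volume.restrict B, 0 ≤ d z) {M : ℝ} (hM : 0 ≤ M)
    (hineq : ∀ ψ, IsTest B ψ → (∀ z, 0 ≤ ψ z) →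
      0 ≤ ∫ z in B, (inner ℝ (D z) (grad γ ψ z) + M * d z * ψ z))
    {ψ : Pt n m → ℝ} (hψ : IsTest B ψ) {ε : ℝ} (hε : 0 < ε) :
    Integrable (fun z => ‖(ψ z / (d z + ε)) • D z‖ ^ 2) (volume.restrict B) ∧
    ∫ z in B, ‖(ψ z / (d z + ε)) • D z‖ ^ 2 ≤
      4 * (∫ z in B, ‖grad γ ψ z‖ ^ 2) + 2 * M * ∫ z in B, ψ z ^ 2 := by
  -- The constant makes `θ` vanish at zero, as the chain rule requires. Adding `ε⁻¹ * ψ²` afterwards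
  -- restores the intended test function `ψ² / (d + ε)`.
  set θ : ℝ → ℝ := fun s => (s + ε)⁻¹ - ε⁻¹ with hθ
  have hder : ∀ s ∈ Set.Ici (0 : ℝ), HasDerivAt θ (-((s + ε) ^ 2)⁻¹) s := by
    intro s hs
    have h1 : s + ε ≠ 0 := by have := Set.mem_Ici.1 hs; positivity
    have h2 := ((hasDerivAt_id s).add_const ε).inv h1
    have h3 := h2.sub_const ε⁻¹
    refine h3.congr_deriv ?_
    simp [neg_div]
  have hcomp := h.comp hγ hB (θ := θ) (C := (ε ^ 2)⁻¹) (Or.inr rfl) (fun s hs => by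
      have h1 : s + ε ≠ 0 := by have := Set.mem_Ici.1 hs; positivity
      exact ((contDiffAt_id.add contDiffAt_const).inv h1).sub contDiffAt_const)
    (fun s hs => by
      have h1 : ε ≤ s + ε := by have := Set.mem_Ici.1 hs; linarith
      rw [(hder s hs).deriv, abs_neg, abs_of_nonneg (by positivity)]
      gcongr) (by simp [hθ]) d0
  have hv := (((hcomp.mul_test hγ hψ).mul_test hγ hψ).add hγ
    (((hψ.h1Pair hγ (Ω := B)).mul_test hγ hψ).const_mul ε⁻¹))
  obtain ⟨C, hC⟩ := hψ.compact.exists_bound_of_continuous hψ.smooth.continuous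
  have hC0 : 0 ≤ C := (norm_nonneg _).trans (hC 0)
  have hval : ∀ z, ψ z * (ψ z * θ (d z)) + ε⁻¹ * (ψ z * ψ z) = ψ z ^ 2 * (d z + ε)⁻¹ := by
    intro z; simp only [hθ]; ring
  have hb : LocallyIntegrableOn (fun z => M * d z) B :=
    locallyIntegrableOn_of_memLp hB (h.const_mul M).memLp
  obtain ⟨i1, i2⟩ := distrib_ineq_of_compact hγ hB h.memLp_grad hb hineq hψ.compact hψ.supp hv
    (Eventually.of_forall fun z hz => by
      rw [hval, image_eq_zero_of_notMem_tsupport hz]; simp)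
    (by
      filter_upwards [d0] with z hz
      rw [hval]; positivity)
    (M := C ^ 2 * ε⁻¹) (by positivity)
    (by
      filter_upwards [d0] with z hz
      rw [hval, abs_of_nonneg (by positivity)]
      have := hC z
      rw [Real.norm_eq_abs] at this
      have h1 : ψ z ^ 2 ≤ C ^ 2 := by
        rw [← sq_abs]; gcongr
      have h2 : (d z + ε)⁻¹ ≤ ε⁻¹ := by
        gcongr; linarith
      gcongr)
  have mdψ : MemLp (fun z => (ψ z / (d z + ε)) • D z) 2 (volume.restrict B) := by
    refine MemLp.mul_bounded h.memLp_grad (C := C * ε⁻¹) ?_ ?_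
    · exact (hψ.smooth.continuous.aemeasurable.div
        (h.memLp.1.aemeasurable.add_const ε)).aestronglyMeasurable
    · filter_upwards [d0] with z hz
      rw [abs_div, div_eq_mul_inv, abs_of_nonneg (a := d z + ε) (by positivity)]
      have h2 : (d z + ε)⁻¹ ≤ ε⁻¹ := by
        gcongr; linarith
      have h1 : |ψ z| ≤ C := hC z
      gcongr
  have I1 := integrable_norm_sq mdψ
  have I2 := integrable_norm_sq (hψ.memLp_grad hγ 2 (volume.restrict B))
  have I3 : Integrable (fun z => ψ z ^ 2) (volume.restrict B) :=
    (hψ.memLp 2 (volume.restrict B)).integrable_sq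
  refine ⟨I1, ?_⟩
  -- The quotient `d / (d + ε)` is at most one, so the zero order term is bounded independently of
  -- `ε`.
  have e1 : ∫ z in B, M * d z * (ψ z * (ψ z * θ (d z)) + ε⁻¹ * (ψ z * ψ z)) ≤
      ∫ z in B, M * ψ z ^ 2 := by
    refine integral_mono_ae i1 (I3.const_mul M) ?_
    filter_upwards [d0] with z hz
    rw [hval]
    have h1 : d z * (d z + ε)⁻¹ ≤ 1 := by
      rw [← div_eq_mul_inv, div_le_one (by positivity)]; linarith
    calc M * d z * (ψ z ^ 2 * (d z + ε)⁻¹) = M * ψ z ^ 2 * (d z * (d z + ε)⁻¹) := by ring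
      _ ≤ M * ψ z ^ 2 * 1 := by gcongr
      _ = _ := mul_one _
  have I4 : Integrable (fun z => -(1 / 2) * ‖(ψ z / (d z + ε)) • D z‖ ^ 2 +
      2 * ‖grad γ ψ z‖ ^ 2) (volume.restrict B) := (I1.const_mul _).add (I2.const_mul 2)
  have e2 := integral_mono_ae (integrable_inner_L2 h.memLp_grad hv.memLp_grad) I4 (by
    filter_upwards [d0] with z hz
    rw [(hder (d z) hz).deriv]
    exact inner_caccioppoli_le hε hz (D z) (grad γ ψ z))
  rw [integral_add (I1.const_mul _) (I2.const_mul 2), integral_const_mul, integral_const_mul] at e2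
  rw [integral_const_mul] at e1
  linarith

/-- A nonnegative function satisfying the logarithmic estimate has an indicator of its positivity
set with vanishing weak gradient. -/
lemma H1Pair.indicator_pos {γ : ℝ} (hγ : 0 < γ) {B : Set (Pt n m)} (hB : IsOpen B)
    (hBb : Bornology.IsBounded B)
    {d : Pt n m → ℝ} {D : Pt n m → Vec n m} (h : H1Pair γ B d D)
    (d0 : ∀ᵐ z ∂volume.restrict B, 0 ≤ d z) {N : ℝ} (dN : ∀ᵐ z ∂volume.restrict B, d z ≤ N)
    {M : ℝ} (hM : 0 ≤ M)
    (hineq : ∀ ψ, IsTest B ψ → (∀ z, 0 ≤ ψ z) →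
      0 ≤ ∫ z in B, (inner ℝ (D z) (grad γ ψ z) + M * d z * ψ z)) :
    H1Pair γ B ({z | 0 < d z}.indicator 1) fun _ => 0 := by
  have hfin := isFiniteMeasure_restrict hBb
  have mpos : NullMeasurableSet {z | 0 < d z} (volume.restrict B) :=
    nullMeasurableSet_lt aemeasurable_const h.memLp.1.aemeasurable
  have mχ : MemLp ({z | 0 < d z}.indicator (1 : Pt n m → ℝ)) 2 (volume.restrict B) := by
    refine MemLp.of_bound ((aemeasurable_one.indicator₀ mpos).aestronglyMeasurable) 1
      (Eventually.of_forall fun z => ?_)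
    by_cases hz : z ∈ {z | 0 < d z}
    · simp [Set.indicator_of_mem hz]
    · simp [Set.indicator_of_notMem hz]
  refine ⟨mχ, MemLp.zero, fun ψ hψ j => ?_⟩
  obtain ⟨N', hN'⟩ := exists_nat_ge N
  -- `e k` plays the role of `1 / ε`. The functions `log(1 + d/ε) / log(1 + 1/ε)` are zero where `d
  -- = 0` and tend to one where `d > 0`.
  set e : ℕ → ℝ := fun k => (k : ℝ) + 2 with he
  set L : ℕ → ℝ := fun k => Real.log (1 + e k) with hL
  have epos : ∀ k, 0 < e k := fun k => by simp only [he]; positivity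
  have Lpos : ∀ k, 0 < L k := fun k => Real.log_pos (by linarith [epos k])
  have Ltop : Tendsto L atTop atTop := by
    refine Real.tendsto_log_atTop.comp (tendsto_atTop_add_const_left _ _ ?_)
    exact tendsto_atTop_add_const_right _ _ tendsto_natCast_atTop_atTop
  have hw : ∀ k, H1Pair γ B (fun z => (L k)⁻¹ * Real.log (1 + e k * d z))
      (fun z => (L k)⁻¹ • ((d z + (e k)⁻¹)⁻¹ • D z)) := by
    intro k
    have hp : ∀ s ∈ Set.Ici (0 : ℝ), 0 < 1 + e k * s := fun s hs => by
      have := mul_nonneg (epos k).le (Set.mem_Ici.1 hs); linarith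
    have hder : ∀ s ∈ Set.Ici (0 : ℝ), HasDerivAt (fun s => Real.log (1 + e k * s))
        ((s + (e k)⁻¹)⁻¹) s := by
      intro s hs
      have h1 := (((hasDerivAt_id s).const_mul (e k)).const_add 1).log (hp s hs).ne'
      refine h1.congr_deriv ?_
      have := (hp s hs).ne'
      have := (epos k).ne'
      simp only [id, mul_one]
      rw [← inv_div]
      congr 1
      field_simp
      ring
    have h1 := (h.comp hγ hB (θ := fun s => Real.log (1 + e k * s)) (C := e k) (Or.inr rfl)
      (fun s hs => (contDiffAt_const.add (contDiffAt_const.mul contDiffAt_id)).log (hp s hs).ne')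
      (fun s hs => by
        have hs' := Set.mem_Ici.1 hs
        have := epos k
        rw [(hder s hs).deriv, abs_of_nonneg (by positivity)]
        refine inv_le_of_inv_le₀ (by positivity) ?_
        linarith) (by simp) d0).const_mul (L k)⁻¹
    refine h1.congr EventuallyEq.rfl ?_
    filter_upwards [d0] with z hz
    rw [(hder (d z) hz).deriv]
  have hwb : ∀ k, ∀ᵐ z ∂volume.restrict B,
      ‖((L k)⁻¹ * Real.log (1 + e k * d z)) * grad γ ψ z j‖ ≤ (N' + 1) * ‖grad γ ψ z j‖ := by
    intro k
    filter_upwards [d0, dN] with z h0 hN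
    have ek := epos k
    -- Bernoulli's inequality: it bounds the normalised logarithm by `N' + 1` uniformly in `k`.
    have h1 : 1 + e k * d z ≤ (1 + e k) ^ (N' + 1) := by
      calc 1 + e k * d z ≤ 1 + ((N' + 1 : ℕ) : ℝ) * e k := by
            push_cast; nlinarith
        _ ≤ _ := one_add_mul_le_pow (by linarith) _
    have h2 : Real.log (1 + e k * d z) ≤ (N' + 1) * L k := by
      have := Real.log_le_log (by positivity) h1
      rw [Real.log_pow] at this
      push_cast at this; exact this
    have h3 : 0 ≤ Real.log (1 + e k * d z) := Real.log_nonneg (by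
      have := mul_nonneg ek.le h0; linarith)
    rw [norm_mul, Real.norm_of_nonneg (mul_nonneg (inv_nonneg.2 (Lpos k).le) h3)]
    gcongr
    rw [inv_mul_le_iff₀ (Lpos k)]
    linarith
  have hwl : ∀ᵐ z ∂volume.restrict B, Tendsto (fun k => (L k)⁻¹ * Real.log (1 + e k * d z)) atTop
      (𝓝 ({z | 0 < d z}.indicator 1 z)) := by
    filter_upwards [d0] with z h0
    rcases h0.eq_or_lt with h0 | h0
    · rw [Set.indicator_of_notMem (by simp [← h0])]
      simp [← h0]
    · rw [Set.indicator_of_mem (by simpa using h0)]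
      obtain ⟨c, hc⟩ : ∃ c, ∀ k, |Real.log (1 + e k * d z) - L k| ≤ c := by
        refine ⟨|Real.log (min (d z) 1)| + |Real.log (max (d z) 1)|, fun k => ?_⟩
        have ek := epos k
        have u1 : 1 + e k * d z ≤ max (d z) 1 * (1 + e k) := by
          have := le_max_left (d z) 1
          have := le_max_right (d z) 1
          nlinarith
        have u2 : min (d z) 1 * (1 + e k) ≤ 1 + e k * d z := by
          have := min_le_left (d z) 1
          have := min_le_right (d z) 1
          nlinarith
        have pm : 0 < min (d z) 1 := lt_min h0 one_pos
        have pM : 0 < max (d z) 1 := lt_max_of_lt_right one_pos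
        have v1 := Real.log_le_log (by positivity) u1
        have v2 := Real.log_le_log (by positivity) u2
        rw [Real.log_mul pM.ne' (by positivity)] at v1
        rw [Real.log_mul pm.ne' (by positivity)] at v2
        have w1 := le_abs_self (Real.log (max (d z) 1))
        have w2 := neg_abs_le (Real.log (min (d z) 1))
        have w3 := abs_nonneg (Real.log (max (d z) 1))
        have w4 := abs_nonneg (Real.log (min (d z) 1))
        simp only [hL]
        rw [abs_le]; constructor <;> linarith
      have h1 : Tendsto (fun k => c * (L k)⁻¹) atTop (𝓝 0) := by
        simpa using Ltop.inv_tendsto_atTop.const_mul c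
      rw [Pi.one_apply, tendsto_iff_norm_sub_tendsto_zero]
      refine squeeze_zero (fun _ => norm_nonneg _) (fun k => ?_) h1
      have : (L k)⁻¹ * Real.log (1 + e k * d z) - 1 =
          (Real.log (1 + e k * d z) - L k) * (L k)⁻¹ := by
        have := (Lpos k).ne'
        field_simp
      rw [this, norm_mul, Real.norm_of_nonneg (inv_nonneg.2 (Lpos k).le)]
      have := (Lpos k).le
      gcongr
      exact hc k
  have mg := memLp_coord (hψ.memLp_grad hγ 2 (volume.restrict B)) j
  have lim1 : Tendsto (fun k => ∫ z in B, ((L k)⁻¹ * Real.log (1 + e k * d z)) * grad γ ψ z j)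
      atTop (𝓝 (∫ z in B, {z | 0 < d z}.indicator 1 z * grad γ ψ z j)) := by
    refine tendsto_integral_of_dominated_convergence (fun z => (N' + 1) * ‖grad γ ψ z j‖)
      (fun k => ((hw k).memLp.1.mul mg.1))
      ((mg.integrable one_le_two).norm.const_mul _) hwb ?_
    filter_upwards [hwl] with z hz using hz.mul_const _
  -- The gradient paired with `ψ` is `1 / L k` times a quantity that the logarithmic Caccioppoli
  -- inequality bounds uniformly in `k`.
  have lim2 : Tendsto (fun k => ∫ z in B, ((L k)⁻¹ * Real.log (1 + e k * d z)) * grad γ ψ z j)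
      atTop (𝓝 0) := by
    set c := (∫ z in B, (1 : ℝ)) + (4 * (∫ z in B, ‖grad γ ψ z‖ ^ 2) +
      2 * M * ∫ z in B, ψ z ^ 2) with hc
    have h1 : Tendsto (fun k => c * (L k)⁻¹) atTop (𝓝 0) := by
      simpa using Ltop.inv_tendsto_atTop.const_mul c
    refine squeeze_zero_norm (fun k => ?_) h1
    rw [(hw k).weak ψ hψ j, norm_neg]
    obtain ⟨I1, I2⟩ := h.caccioppoli_log hγ hB d0 hM hineq hψ (inv_pos.2 (epos k))
    have I3 : Integrable (fun z => (1 : ℝ) + ‖(ψ z / (d z + (e k)⁻¹)) • D z‖ ^ 2)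
        (volume.restrict B) := (integrable_const _).add I1
    calc ‖∫ z in B, ((L k)⁻¹ • ((d z + (e k)⁻¹)⁻¹ • D z)) j * ψ z‖
        ≤ ∫ z in B, (L k)⁻¹ * (1 + ‖(ψ z / (d z + (e k)⁻¹)) • D z‖ ^ 2) := by
          refine norm_integral_le_of_norm_le (I3.const_mul _) (Eventually.of_forall fun z => ?_)
          have h2 : ((L k)⁻¹ • ((d z + (e k)⁻¹)⁻¹ • D z)) j * ψ z =
              (L k)⁻¹ * ((ψ z / (d z + (e k)⁻¹)) • D z) j := by
            simp only [PiLp.smul_apply, smul_eq_mul]; ring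
          rw [h2, norm_mul, Real.norm_of_nonneg (inv_nonneg.2 (Lpos k).le)]
          have := (Lpos k).le
          gcongr
          have h3 := PiLp.norm_apply_le ((ψ z / (d z + (e k)⁻¹)) • D z) j
          nlinarith [sq_nonneg (‖(ψ z / (d z + (e k)⁻¹)) • D z‖ - 1)]
      _ ≤ c * (L k)⁻¹ := by
          rw [integral_const_mul, integral_add (integrable_const _) I1, mul_comm]
          have := (Lpos k).le
          gcongr
          exact add_le_add le_rfl I2
  rw [tendsto_nhds_unique lim1 lim2]
  simp

/-- The points with a ball on which `p` holds almost everywhere, and those with a ball on which it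
fails almost everywhere, form two disjoint open sets covering `Ω`. Connectedness leaves only one of
them. -/
lemma ae_or_of_locally {Ω : Set (Pt n m)} (hΩ : IsOpen Ω) (hΩc : IsConnected Ω) {p : Pt n m → Prop}
    (hloc : ∀ z ∈ Ω, ∃ r : ℝ, 0 < r ∧ ((∀ᵐ w ∂volume.restrict (Metric.ball z r), p w) ∨
      ∀ᵐ w ∂volume.restrict (Metric.ball z r), ¬ p w)) :
    (∀ᵐ z ∂volume.restrict Ω, p z) ∨ ∀ᵐ z ∂volume.restrict Ω, ¬ p z := by
  set S : (Pt n m → Prop) → Set (Pt n m) := fun q =>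
    {z | ∃ r : ℝ, 0 < r ∧ ∀ᵐ w ∂volume.restrict (Metric.ball z r), q w} with hS
  have mono : ∀ {q : Pt n m → Prop} {A A' : Set (Pt n m)}, A' ⊆ A →
      (∀ᵐ w ∂volume.restrict A, q w) → ∀ᵐ w ∂volume.restrict A', q w := fun hs h =>
    ae_mono (Measure.restrict_mono hs le_rfl) h
  have hopen : ∀ q, IsOpen (S q) := by
    intro q
    rw [Metric.isOpen_iff]
    rintro z ⟨r, hr, h⟩
    refine ⟨r, hr, fun z' hz' => ⟨r - dist z' z, by simpa using hz', mono ?_ h⟩⟩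
    exact Metric.ball_subset_ball' (by simp)
  have hdis : Disjoint (S p) (S fun w => ¬ p w) := by
    rw [Set.disjoint_left]
    rintro z ⟨r, hr, h⟩ ⟨r', hr', h'⟩
    have h1 := mono (Metric.ball_subset_ball (x := z) (min_le_left r r')) h
    have h2 := mono (Metric.ball_subset_ball (x := z) (min_le_right r r')) h'
    have h3 : ∀ᵐ w ∂volume.restrict (Metric.ball z (min r r')), False := by
      filter_upwards [h1, h2] with w k1 k2 using k2 k1
    rw [ae_iff] at h3
    simp only [not_false_eq_true] at h3
    exact (Metric.measure_ball_pos volume z (lt_min hr hr')).ne' (by simpa using h3)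
  have hfin : ∀ q : Pt n m → Prop, Ω ⊆ S q → ∀ᵐ z ∂volume.restrict Ω, q z := by
    intro q hq
    have : volume (Ω ∩ {z | ¬ q z}) = 0 := by
      refine measure_null_of_locally_null _ fun z hz => ?_
      obtain ⟨r, hr, h⟩ := hq hz.1
      rw [ae_restrict_iff' measurableSet_ball, ae_iff] at h
      refine ⟨Metric.ball z r ∩ {z | ¬ q z}, ?_, measure_mono_null (fun w hw => ?_) h⟩
      · exact mem_nhdsWithin.2 ⟨Metric.ball z r, Metric.isOpen_ball, Metric.mem_ball_self hr,
          fun w hw => ⟨hw.1, hw.2.2⟩⟩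
      · exact fun hc => hw.2 (hc hw.1)
    rw [ae_restrict_iff' hΩ.measurableSet, ae_iff]
    refine measure_mono_null (fun w hw => ?_) this
    simp only [Set.mem_ofPred_eq, Classical.not_imp] at hw
    exact hw
  rcases hΩc.isPreconnected.subset_or_subset (hopen p) (hopen fun w => ¬ p w) hdis
    (fun z hz => by
      obtain ⟨r, hr, h | h⟩ := hloc z hz
      · exact Or.inl ⟨r, hr, h⟩
      · exact Or.inr ⟨r, hr, h⟩) with h | h
  · exact Or.inl (hfin _ h)
  · exact Or.inr (hfin _ h)

variable {γ : ℝ} {Ω : Set (Pt n m)} {g G : Pt n m → ℝ → EReal} {f F : Pt n m → ℝ → ℝ}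
  {φ₁ φ₂ : Pt n m → ℝ}

/-- The inequality for `u` is subtracted from that for `φ₂`. The quotient condition bounds the
increment of `g` by `M (φ₂ - u)` and that of `-f` by the same amount, whence `2 * M`. -/
lemma OrderedPair.diff_ineq (h : OrderedPair γ Ω g G f F φ₁ φ₂) {u : Pt n m → ℝ}
    (hu : u ∈ orderInterval γ Ω φ₁ φ₂) (hus : IsSubsolution γ Ω g f u) {B : Set (Pt n m)}
    (hBΩ : B ⊆ Ω) {M : ℝ}
    (hM : ∀ᵐ z ∂volume.restrict B, ∀ t : ℝ, φ₁ z ≤ t → t < φ₂ z →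
      (g z (φ₂ z) - g z t) / ((φ₂ z - t : ℝ) : EReal) ≤ (M : EReal) ∧
      -M ≤ (f z (φ₂ z) - f z t) / (φ₂ z - t)) (mB : MeasurableSet B)
    {ψ : Pt n m → ℝ} (hψ : IsTest B ψ) (ψ0 : ∀ z, 0 ≤ ψ z) :
    0 ≤ ∫ z in B, (inner ℝ (weakGrad γ Ω φ₂ z - weakGrad γ Ω u z) (grad γ ψ z) +
      (2 * M) * (φ₂ z - u z) * ψ z) := by
  have hψΩ := hψ.mono hBΩ
  have p2 := h.super.memH1.pair
  have pu := hus.memH1.pair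
  have s2 := h.super.ineq ψ hψΩ ψ0
  have su := hus.ineq ψ hψΩ ψ0
  rw [h.integral_weakIntegrand h.super.memH1 h.super.g_loc h.super.f_loc hψΩ] at s2
  rw [h.integral_weakIntegrand hus.memH1 hus.g_loc hus.f_loc hψΩ] at su
  have mg := hψ.memLp_grad h.pos 2 (volume.restrict Ω)
  have i1 := integrable_inner_L2 p2.memLp_grad mg
  have i2 := integrable_inner_L2 pu.memLp_grad mg
  have b2 := integrable_mul_test (h.super.g_loc.2.sub h.super.f_loc) hψΩ
  have bu := integrable_mul_test (hus.g_loc.2.sub hus.f_loc) hψΩ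
  have i3 : Integrable (fun z => (2 * M) * (φ₂ z - u z) * ψ z) (volume.restrict Ω) :=
    integrable_mul_L2 ((p2.sub h.pos pu).const_mul (2 * M)).memLp
      (hψ.memLp 2 (volume.restrict Ω))
  have i4 : Integrable (fun z => inner ℝ (weakGrad γ Ω φ₂ z - weakGrad γ Ω u z) (grad γ ψ z))
      (volume.restrict Ω) := integrable_inner_L2 (p2.memLp_grad.sub pu.memLp_grad) mg
  have e0 : ∀ z, z ∉ B → inner ℝ (weakGrad γ Ω φ₂ z - weakGrad γ Ω u z) (grad γ ψ z) +
      (2 * M) * (φ₂ z - u z) * ψ z = 0 := by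
    intro z hz
    rw [hψ.eq_zero hz, hψ.grad_eq_zero hz]; simp
  rw [setIntegral_eq_of_zero e0, ← setIntegral_eq_of_zero (Ω := Ω) (fun z hz => e0 z
    fun hz' => hz (hBΩ hz')), integral_add i4 i3]
  have e1 : ∫ z in Ω, inner ℝ (weakGrad γ Ω φ₂ z - weakGrad γ Ω u z) (grad γ ψ z) =
      (∫ z in Ω, inner ℝ (weakGrad γ Ω φ₂ z) (grad γ ψ z)) -
        ∫ z in Ω, inner ℝ (weakGrad γ Ω u z) (grad γ ψ z) := by
    rw [← integral_sub i1 i2]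
    exact integral_congr_ae (Eventually.of_forall fun z => inner_sub_left _ _ _)
  have e2 : (∫ z in Ω, ((g z (φ₂ z)).toReal - f z (φ₂ z)) * ψ z) -
      ∫ z in Ω, ((g z (u z)).toReal - f z (u z)) * ψ z ≤
      ∫ z in Ω, (2 * M) * (φ₂ z - u z) * ψ z := by
    have b2' : Integrable (fun z => ((g z (φ₂ z)).toReal - f z (φ₂ z)) * ψ z)
      (volume.restrict Ω) := b2
    have bu' : Integrable (fun z => ((g z (u z)).toReal - f z (u z)) * ψ z)
      (volume.restrict Ω) := bu
    rw [← integral_sub b2' bu']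
    refine integral_mono_ae (b2'.sub bu') i3 ?_
    rw [ae_restrict_iff' mB] at hM
    filter_upwards [ae_restrict_of_ae hM, h.convexBetween, hu.2] with z k1 k2 k3
    by_cases hz : z ∈ B
    · rw [← sub_mul]
      refine mul_le_mul_of_nonneg_right ?_ (ψ0 z)
      rcases k3.2.eq_or_lt with k4 | k4
      · rw [k4]; simp
      · obtain ⟨q1, q2⟩ := k1 hz (u z) k3.1 k4
        have hd : 0 < φ₂ z - u z := sub_pos.2 k4
        have f2 := k2.g_finite ⟨k3.1.trans k3.2, le_rfl⟩
        have fu := k2.g_finite k3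
        rw [← EReal.coe_toReal f2.1 f2.2, ← EReal.coe_toReal fu.1 fu.2, ← EReal.coe_sub,
          ← EReal.coe_div, EReal.coe_le_coe_iff, div_le_iff₀ hd] at q1
        rw [le_div_iff₀ hd] at q2
        linarith
    · simp [hψ.eq_zero hz]
  linarith

/-- Under the local one-sided Lipschitz condition, a solution below a supersolution which is not
a solution stays strictly below it. -/
theorem OrderedPair.lt_of_quotientCondition (h : OrderedPair γ Ω g G f F φ₁ φ₂)
    (hΩc : IsConnected Ω) (hq : QuotientCondition Ω g f φ₁ φ₂)
    (hφ₂ : ¬ IsWeakSolution γ Ω g f φ₂) {u : Pt n m → ℝ} (hu : u ∈ orderInterval γ Ω φ₁ φ₂)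
    (hus : IsWeakSolution γ Ω g f u) : ∀ᵐ z ∂volume.restrict Ω, u z < φ₂ z := by
  have hloc : ∀ z ∈ Ω, ∃ r : ℝ, 0 < r ∧
      ((∀ᵐ w ∂volume.restrict (Metric.ball z r), u w < φ₂ w) ∨
        ∀ᵐ w ∂volume.restrict (Metric.ball z r), ¬ u w < φ₂ w) := by
    intro z₀ hz₀
    obtain ⟨R, hR, hRΩ⟩ := Metric.nhds_basis_closedBall.mem_iff.1 (h.isOpen.mem_nhds hz₀)
    have hBΩ : Metric.ball z₀ R ⊆ Ω := Metric.ball_subset_closedBall.trans hRΩ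
    have hcl : closure (Metric.ball z₀ R) ⊆ Metric.closedBall z₀ R :=
      Metric.closure_ball_subset_closedBall
    obtain ⟨M, hM, hMq⟩ := hq (Metric.ball z₀ R) Metric.isOpen_ball
      ⟨Metric.nonempty_ball.2 hR, (convex_ball z₀ R).isPreconnected⟩
      ((isCompact_closedBall z₀ R).of_isClosed_subset isClosed_closure hcl) (hcl.trans hRΩ)
    have hmono : ∀ {q : Pt n m → Prop}, (∀ᵐ w ∂volume.restrict Ω, q w) →
        ∀ᵐ w ∂volume.restrict (Metric.ball z₀ R), q w := fun hq' =>
      ae_mono (Measure.restrict_mono hBΩ le_rfl) hq'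
    obtain ⟨N, hN, hNb⟩ := h.exists_bound
    have hpair := (h.super.memH1.pair.sub h.pos hus.1.memH1.pair).mono hBΩ
    have hχ := hpair.indicator_pos h.pos Metric.isOpen_ball Metric.isBounded_ball
      (hmono (by filter_upwards [hu.2] with z hz using sub_nonneg.2 hz.2)) (N := 2 * N)
      (hmono (by
        filter_upwards [hu.2, hNb] with z h1 h2
        have h3 := abs_le.1 (h2 _ h1.1 h1.2)
        have h4 := abs_le.1 (h2 _ (h1.1.trans h1.2) le_rfl)
        linarith)) (M := 2 * M) (by linarith)
      (fun ψ hψ ψ0 => h.diff_ineq hu hus.1 hBΩ hMq measurableSet_ball hψ ψ0)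
    obtain ⟨c, hc⟩ := hχ.ae_const_of_grad_eq_zero h.one_le_n h.pos hR
    refine ⟨R / 16, by linarith, ?_⟩
    by_cases hc0 : c = 0
    · right
      filter_upwards [hc] with w hw hlt
      rw [hc0, Set.indicator_of_mem (by simpa using hlt)] at hw
      simp at hw
    · left
      filter_upwards [hc] with w hw
      by_contra hlt
      rw [Set.indicator_of_notMem (by simpa using hlt)] at hw
      exact hc0 hw.symm
  rcases ae_or_of_locally h.isOpen hΩc hloc with h1 | h1
  · exact h1
  · exact absurd (h.super.isWeakSolution_of_ae_eq h.pos h.isOpen hus (by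
      filter_upwards [h1, hu.2] with z k1 k2 using le_antisymm k2.2 (not_lt.1 k1))) hφ₂

/-! ### Local minimality: energy above the supersolution and the blow-up argument. -/

lemma eLpNorm_ofReal {α E : Type*} [MeasurableSpace α] [NormedAddCommGroup E] (μ : Measure α)
    (f : α → E) {p : ℝ} (hp : 0 < p) :
    eLpNorm f (ENNReal.ofReal p) μ = (∫⁻ a, ‖f a‖ₑ ^ p ∂μ) ^ (1 / p) := by
  rw [eLpNorm_eq_lintegral_rpow_enorm_toReal (by simpa using hp) ENNReal.ofReal_ne_top,
    ENNReal.toReal_ofReal hp.le]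

lemma lintegral_mul_rpow_le {α : Type*} [MeasurableSpace α] {μ : Measure α} {p q r : ℝ}
    (hr : 0 < r) (hpq : p.HolderConjugate (q / r)) {a d : α → ℝ} (ha : AEMeasurable a μ)
    (hd : AEMeasurable d μ) :
    ∫⁻ z, ‖a z‖ₑ * ‖d z‖ₑ ^ r ∂μ ≤
      eLpNorm a (ENNReal.ofReal p) μ * eLpNorm d (ENNReal.ofReal q) μ ^ r := by
  have hq : 0 < q := by
    have := hpq.symm.pos
    rwa [lt_div_iff₀ hr, zero_mul] at this
  refine (ENNReal.lintegral_mul_le_Lp_mul_Lq μ hpq ha.enorm (hd.enorm.pow_const r)).trans ?_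
  rw [eLpNorm_ofReal μ a hpq.pos, eLpNorm_ofReal μ d hq]
  gcongr
  rw [← ENNReal.rpow_mul]
  refine le_of_eq ?_
  congr 1
  · refine lintegral_congr fun z => ?_
    rw [← ENNReal.rpow_mul, mul_div_cancel₀ _ hr.ne']
  · field_simp

/-- The critical weight `a` is split into a bounded simple function, for which convergence in `L^r`
suffices, and a remainder of small norm, for which boundedness in `L^q` suffices. -/
lemma tendsto_lintegral_mul_rpow {α : Type*} [MeasurableSpace α] {μ : Measure α} {p q r : ℝ}
    (hr : 0 < r) (hpq : p.HolderConjugate (q / r)) {a : α → ℝ}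
    (ha : MemLp a (ENNReal.ofReal p) μ) {d : ℕ → α → ℝ} (hd : ∀ k, AEMeasurable (d k) μ) {C : ℝ}
    (hC : ∀ k, eLpNorm (d k) (ENNReal.ofReal q) μ ≤ ENNReal.ofReal C)
    (h0 : Tendsto (fun k => ∫⁻ z, ‖d k z‖ₑ ^ r ∂μ) atTop (𝓝 0)) :
    Tendsto (fun k => ∫⁻ z, ‖a z‖ₑ * ‖d k z‖ₑ ^ r ∂μ) atTop (𝓝 0) := by
  rw [ENNReal.tendsto_nhds_zero]
  intro ε hε
  rcases eq_or_ne ε ⊤ with rfl | hε'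
  · simp
  -- The summand `1` only makes the division by `c` legitimate.
  set c : ℝ≥0∞ := ENNReal.ofReal C ^ r + 1 with hc
  have hc0 : c ≠ 0 := by simp [hc]
  have hct : c ≠ ⊤ := by
    simp [hc, ENNReal.rpow_eq_top_iff, not_lt.2 hr.le]
  obtain ⟨b, hb, -⟩ := ha.exists_simpleFunc_eLpNorm_sub_lt ENNReal.ofReal_ne_top
    (ε := ε / 2 / c) (ENNReal.div_pos (ENNReal.half_pos hε.ne').ne' hct).ne'
  obtain ⟨N, hN⟩ := b.exists_forall_norm_le
  have hN' : ∀ z, ‖b z‖ₑ ≤ ENNReal.ofReal N := fun z => by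
    rw [← ofReal_norm]; exact ENNReal.ofReal_le_ofReal (hN z)
  have h1 : Tendsto (fun k => ENNReal.ofReal N * ∫⁻ z, ‖d k z‖ₑ ^ r ∂μ) atTop (𝓝 0) := by
    simpa using ENNReal.Tendsto.const_mul h0 (Or.inr ENNReal.ofReal_ne_top)
  filter_upwards [ENNReal.tendsto_nhds_zero.1 h1 (ε / 2) (ENNReal.half_pos hε.ne')] with k hk
  have m1 := ha.1.aemeasurable.sub b.measurable.aemeasurable
  calc ∫⁻ z, ‖a z‖ₑ * ‖d k z‖ₑ ^ r ∂μ
      ≤ ∫⁻ z, (‖(a - b) z‖ₑ * ‖d k z‖ₑ ^ r + ENNReal.ofReal N * ‖d k z‖ₑ ^ r) ∂μ := by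
        refine lintegral_mono fun z => ?_
        simp only
        rw [← add_mul]
        gcongr
        calc ‖a z‖ₑ = ‖(a - b) z + b z‖ₑ := by simp
          _ ≤ ‖(a - b) z‖ₑ + ‖b z‖ₑ := enorm_add_le _ _
          _ ≤ _ := by gcongr; exact hN' z
    _ = (∫⁻ z, ‖(a - b) z‖ₑ * ‖d k z‖ₑ ^ r ∂μ) + ENNReal.ofReal N * ∫⁻ z, ‖d k z‖ₑ ^ r ∂μ := by
        rw [lintegral_add_left' (f := fun z => ‖(a - b) z‖ₑ * ‖d k z‖ₑ ^ r)
          (m1.enorm.mul ((hd k).enorm.pow_const r)),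
          lintegral_const_mul'' _ ((hd k).enorm.pow_const r)]
    _ ≤ ε / 2 / c * c + ε / 2 := by
        gcongr
        refine (lintegral_mul_rpow_le hr hpq m1 (hd k)).trans ?_
        gcongr
        refine le_add_right ?_
        gcongr
        exact hC k
    _ = ε := by rw [ENNReal.div_mul_cancel hc0 hct, ENNReal.add_halves]

/-- A coefficient in `L^{Q/2}` is thus paired with the square of a function in the critical Sobolev
space; the next lemma is the analogous duality for functions in `L^{2Q/(Q+2)}`. -/
lemma holderConjugate_half_homDim (hn : 1 ≤ n) (hm : 1 ≤ m) {γ : ℝ} (hγ : 0 < γ) :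
    (homDim n m γ / 2).HolderConjugate (sobExp n m γ / 2) := by
  have hQ := homDim_gt_two hn hm hγ
  rw [Real.holderConjugate_iff]
  refine ⟨by linarith, ?_⟩
  unfold sobExp
  have : homDim n m γ - 2 ≠ 0 := by linarith
  field_simp
  ring

lemma holderConjugate_dualExp (hn : 1 ≤ n) (hm : 1 ≤ m) {γ : ℝ} (hγ : 0 < γ) :
    (2 * homDim n m γ / (homDim n m γ + 2)).HolderConjugate (sobExp n m γ / 1) := by
  have hQ := homDim_gt_two hn hm hγ
  have h0 : 0 < homDim n m γ + 2 := by linarith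
  rw [Real.holderConjugate_iff]
  refine ⟨by rw [lt_div_iff₀ h0]; linarith, ?_⟩
  unfold sobExp
  have : homDim n m γ - 2 ≠ 0 := by linarith
  field_simp
  ring

/-- Functions in the dual Sobolev exponent act continuously along compact sequences. -/
lemma tendsto_integral_mul_of_dualExp (hn : 1 ≤ n) (hm : 1 ≤ m) {γ : ℝ} (hγ : 0 < γ)
    {Ω : Set (Pt n m)} (hΩ : IsOpen Ω) (hΩb : Bornology.IsBounded Ω) {b : Pt n m → ℝ}
    (hb : MemLp b (ENNReal.ofReal (2 * homDim n m γ / (homDim n m γ + 2))) (volume.restrict Ω))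
    {u : ℕ → Pt n m → ℝ} {U : ℕ → Pt n m → Vec n m} {u₀ : Pt n m → ℝ} {U₀ : Pt n m → Vec n m}
    (h : ∀ k, H10Pair γ Ω (u k) (U k)) (h₀ : H10Pair γ Ω u₀ U₀) {C : ℝ}
    (hC : ∀ k, eLpNorm (U k) 2 (volume.restrict Ω) ≤ ENNReal.ofReal C)
    (hlim : Tendsto (fun k => eLpNorm (fun z => u k z - u₀ z) 2 (volume.restrict Ω)) atTop
      (𝓝 0)) :
    (∀ k, Integrable (fun z => b z * u k z) (volume.restrict Ω)) ∧
    Integrable (fun z => b z * u₀ z) (volume.restrict Ω) ∧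
    Tendsto (fun k => ∫ z in Ω, b z * u k z) atTop (𝓝 (∫ z in Ω, b z * u₀ z)) := by
  have hfin := isFiniteMeasure_restrict hΩb
  obtain ⟨K, hK, hS⟩ := exists_sobolev_h10 (m := m) hn hm hγ
  have hint : ∀ v V, H10Pair γ Ω v V → Integrable (fun z => b z * v z) (volume.restrict Ω) := by
    intro v V hv
    refine ⟨hb.1.mul hv.memLp.1, ?_⟩
    have h1 := lintegral_mul_rpow_le one_pos (holderConjugate_dualExp hn hm hγ)
      hb.1.aemeasurable hv.memLp.1.aemeasurable
    simp only [ENNReal.rpow_one, ← enorm_mul] at h1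
    refine h1.trans_lt (ENNReal.mul_lt_top hb.2 ((hS Ω hΩ v V hv).trans_lt ?_))
    exact ENNReal.mul_lt_top ENNReal.ofReal_lt_top hv.memLp_grad.2
  have i0 := hint _ _ h₀
  refine ⟨fun k => hint _ _ (h k), i0, ?_⟩
  obtain ⟨C₀, hC₀⟩ : ∃ C₀ : ℝ, eLpNorm U₀ 2 (volume.restrict Ω) ≤ ENNReal.ofReal C₀ :=
    ⟨_, (ENNReal.ofReal_toReal h₀.memLp_grad.2.ne).ge⟩
  have hd : ∀ k, H10Pair γ Ω (fun z => u k z - u₀ z) (fun z => U k z - U₀ z) :=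
    fun k => (h k).sub hγ h₀
  have lim := tendsto_lintegral_mul_rpow one_pos (holderConjugate_dualExp hn hm hγ) hb
    (fun k => (hd k).memLp.1.aemeasurable) (C := (ENNReal.ofReal K *
      (ENNReal.ofReal C + ENNReal.ofReal C₀)).toReal) (fun k => by
        rw [ENNReal.ofReal_toReal (by finiteness)]
        refine (hS Ω hΩ _ _ (hd k)).trans ?_
        gcongr
        exact (eLpNorm_sub_le (h k).memLp_grad.1 h₀.memLp_grad.1 one_le_two).trans
          (add_le_add (hC k) hC₀)) (by
      have h1 : Tendsto (fun k => volume.restrict Ω Set.univ *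
          eLpNorm (fun z => u k z - u₀ z) 2 (volume.restrict Ω) ^ 2) atTop (𝓝 0) := by
        have := ENNReal.Tendsto.const_mul (ENNReal.Tendsto.pow (n := 2) hlim)
          (Or.inr (measure_ne_top (volume.restrict Ω) Set.univ))
        simpa using this
      refine tendsto_zero_of_sq (tendsto_of_tendsto_of_tendsto_of_le_of_le tendsto_const_nhds h1
        (fun _ => zero_le) fun k => ?_)
      simp only [ENNReal.rpow_one]
      rw [eLpNorm_two_sq]
      exact lintegral_sq_le _ (hd k).memLp.1.aemeasurable.enorm)
  refine tendsto_iff_norm_sub_tendsto_zero.2 ?_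
  have lim' := (ENNReal.tendsto_toReal ENNReal.zero_ne_top).comp lim
  refine squeeze_zero (fun _ => norm_nonneg _) (fun k => ?_) lim'
  rw [← integral_sub (hint _ _ (h k)) i0]
  refine (norm_integral_le_integral_norm _).trans (le_of_eq ?_)
  rw [integral_norm_eq_lintegral_enorm (f := fun z => b z * u k z - b z * u₀ z)
    ((hint _ _ (h k)).sub i0).1]
  simp only [Function.comp, ENNReal.rpow_one, ← enorm_mul, mul_sub]

/-- Integration of `f r ≤ f s + a (r - s)` over the interval, carried out as monotonicity of the
difference. -/
lemma primitive_le_of_oneSidedLipschitz {f F : ℝ → ℝ} (hF : ∀ t, HasDerivAt F (f t) t)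
    {s t a : ℝ} (hst : s ≤ t) (ha : ∀ r ∈ Set.Ioo s t, f r - f s ≤ a * (r - s)) :
    F t - F s ≤ f s * (t - s) + a / 2 * (t - s) ^ 2 := by
  have hd : ∀ r, HasDerivAt (fun r => F r - f s * (r - s) - a / 2 * (r - s) ^ 2)
      (f r - f s - a * (r - s)) r := by
    intro r
    have h1 := (hasDerivAt_id r).sub_const s
    refine (((hF r).sub (h1.const_mul (f s))).sub ((h1.pow 2).const_mul (a / 2))).congr_deriv ?_
    simp; ring
  have h2 := antitoneOn_of_deriv_nonpos (convex_Icc s t)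
    (fun r _ => (hd r).continuousAt.continuousWithinAt)
    (fun r _ => (hd r).differentiableAt.differentiableWithinAt) (fun r hr => by
      rw [interior_Icc] at hr
      rw [(hd r).deriv]; linarith [ha r hr]) (Set.left_mem_Icc.2 hst) (Set.right_mem_Icc.2 hst) hst
  simp only [sub_self] at h2
  linarith

/-- The part of a competitor above the supersolution vanishes on the boundary. -/
lemma OrderedPair.h10Pair_excess (h : OrderedPair γ Ω g G f F φ₁ φ₂) {w : Pt n m → ℝ}
    (hw : MemH10 γ Ω w) :
    H10Pair γ Ω (fun z => max (w z - φ₂ z) 0)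
      ({z | 0 < w z - φ₂ z}.indicator fun z => weakGrad γ Ω w z - weakGrad γ Ω φ₂ z) := by
  refine ((hw.1.pair.sub h.pos h.super.memH1.pair).posPart h.pos h.isOpen).h10Pair_of_le
    h.one_le_n h.one_le_m h.pos h.isOpen h.bounded
    ((hw.pair.posPart h.one_le_n h.one_le_m h.pos h.isOpen h.bounded).add h.pos
      h.super.negPart.pair) ?_ ?_
  · exact Eventually.of_forall fun z => le_max_right _ _
  · refine Eventually.of_forall fun z => max_le ?_ ?_
    · have := le_max_left (w z) 0
      have := le_max_left (-φ₂ z) 0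
      linarith
    · have := le_max_right (w z) 0
      have := le_max_right (-φ₂ z) 0
      linarith

/-- The supersolution inequality is tested with the excess `(w - φ₂)⁺`. The required integrability
from above comes from convexity: the tangent at `φ₂` gives `g(φ₂) (w - φ₂) ≤ G(w) - G(φ₂)` on the
excess set, and `G(φ₂)` is bounded below by `-B`. -/
lemma OrderedPair.super_ineq_excess (h : OrderedPair γ Ω g G f F φ₁ φ₂) {M : ℝ} (hM : 0 ≤ M)
    (hφM : ∀ᵐ z ∂volume.restrict Ω, |φ₂ z| ≤ M) {w : Pt n m → ℝ}
    (hw : MemH10 γ Ω w) (hwM : ∀ᵐ z ∂volume.restrict Ω, |w z| ≤ M)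
    (hGw : MemL1 Ω fun z => G z (w z)) :
    Integrable (fun z => ((g z (φ₂ z)).toReal - f z (φ₂ z)) * max (w z - φ₂ z) 0)
      (volume.restrict Ω) ∧
    0 ≤ (∫ z in Ω, inner ℝ (weakGrad γ Ω φ₂ z)
      ({z | 0 < w z - φ₂ z}.indicator (fun z => weakGrad γ Ω w z - weakGrad γ Ω φ₂ z) z)) +
      ∫ z in Ω, ((g z (φ₂ z)).toReal - f z (φ₂ z)) * max (w z - φ₂ z) 0 := by
  have hH := h.h10Pair_excess hw
  obtain ⟨a, A, B, -, ha, -, hB, hb⟩ := h.exists_lower_bound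
  have hle₂ : ∀ᵐ z ∂volume.restrict Ω, φ₁ z ≤ φ₂ z ∧ φ₂ z ≤ φ₂ z := by
    filter_upwards [h.le] with z hz using ⟨hz, le_rfl⟩
  have mφ := h.super.memH1.1.1.aemeasurable
  have mg : AEMeasurable (fun z => (g z (φ₂ z)).toReal) (volume.restrict Ω) :=
    (h.aemeasurable_g mφ hle₂).ereal_toReal
  have mf : AEMeasurable (fun z => f z (φ₂ z)) (volume.restrict Ω) :=
    h.growth.caratheodory.aemeasurable_comp mφ
  have hhM : ∀ᵐ z ∂volume.restrict Ω, |max (w z - φ₂ z) 0| ≤ 2 * M := by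
    filter_upwards [hwM, hφM] with z h1 h2
    have h1 := abs_le.1 h1
    have h2 := abs_le.1 h2
    rw [abs_of_nonneg (le_max_right _ _)]
    exact max_le (by linarith) (by linarith)
  have hloc : LocallyIntegrableOn (fun z => (g z (φ₂ z)).toReal - f z (φ₂ z)) Ω :=
    h.super.g_loc.2.sub h.super.f_loc
  refine distrib_ineq_of_h10 h.one_le_n h.one_le_m h.pos h.isOpen h.bounded
    h.super.memH1.pair.memLp_grad hloc (fun ψ hψ ψ0 => ?_) hH
    (Eventually.of_forall fun z => le_max_right _ _) (by linarith) hhM ?_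
  · have := h.super.ineq ψ hψ ψ0
    simpa only [weakIntegrand_eq] using this
  · refine Integrable.mono' (g := fun z => |(G z (w z)).toReal| + |B z| + 2 * M * |a z|)
      ((hGw.2.abs.add hB.abs).add (ha.abs.const_mul _)) ?_ ?_
    · exact ((mg.sub mf).max aemeasurable_const |>.mul hH.memLp.1.aemeasurable).aestronglyMeasurable
    · filter_upwards [hb, hhM, h.convex.convexAt h.isOpen, h.convexBetween, hGw.1] with
        z h1 h2 h3 h4 h5
      have hmem : φ₂ z ∈ Set.Icc (φ₁ z) (φ₂ z) := ⟨h4.le, le_rfl⟩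
      have h6 := h1.2.1 _ hmem
      have hh0 : 0 ≤ max (w z - φ₂ z) 0 := le_max_right _ _
      rw [abs_of_nonneg hh0] at h2
      rw [Real.norm_of_nonneg (mul_nonneg (le_max_right _ _) hh0)]
      have e1 := le_abs_self (a z)
      have e2 := neg_abs_le (f z (φ₂ z))
      have e3 := le_abs_self (B z)
      have e4 := le_abs_self (G z (w z)).toReal
      have e5 : |f z (φ₂ z)| * max (w z - φ₂ z) 0 ≤ |a z| * (2 * M) := by
        refine mul_le_mul (h6.1.trans e1) h2 hh0 (abs_nonneg _)
      have e6 := abs_nonneg (B z)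
      have e7 := abs_nonneg (G z (w z)).toReal
      have e8 := abs_nonneg (a z)
      rcases le_or_gt (w z) (φ₂ z) with h7 | h7
      · rw [max_eq_right (sub_nonpos.2 h7), mul_zero]
        positivity
      · have e9 : max (w z - φ₂ z) 0 = w z - φ₂ z := max_eq_left (by linarith)
        have f2 := h4.g_finite hmem
        have h8 := h3.tangent (h4.G_lt_top hmem) (lt_top_iff_ne_top.2 h5.1) f2.1 f2.2
        rw [← e9] at h8
        rcases le_total ((g z (φ₂ z)).toReal - f z (φ₂ z)) 0 with h9 | h9
        · rw [max_eq_right h9, zero_mul]; positivity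
        · rw [max_eq_left h9, sub_mul]
          have := neg_abs_le (f z (φ₂ z) * max (w z - φ₂ z) 0)
          rw [abs_mul, abs_of_nonneg hh0] at this
          linarith [h6.2.2]

/-- On the excess set `p` is the gradient of the competitor and `q` that of `φ₂`; the Dirichlet part
of the comparison is an identity, so the whole of `‖∇h‖² / 2` is available later. -/
lemma inner_excess_eq (p q : Vec n m) :
    (1 / 2) * ‖q‖ ^ 2 + (1 / 2) * ‖p - q‖ ^ 2 + inner ℝ q (p - q) = (1 / 2) * ‖p‖ ^ 2 := by
  rw [norm_sub_sq_real, inner_sub_right, real_inner_self_eq_norm_sq, real_inner_comm]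
  ring

/-- Comparison of the energy of a competitor with that of its truncation at the supersolution. -/
theorem OrderedPair.energy_comparison (h : OrderedPair γ Ω g G f F φ₁ φ₂) {u : Pt n m → ℝ}
    (hu : u ∈ orderInterval γ Ω φ₁ φ₂) (hG : MemL1 Ω (fun z => G z (u z)))
    (hmin : ∀ w ∈ orderInterval γ Ω φ₁ φ₂, MemL1 Ω (fun z => G z (w z)) →
      energyValue γ Ω G F u ≤ energyValue γ Ω G F w) {M : ℝ} (hM : 0 ≤ M)
    (hφM : ∀ᵐ z ∂volume.restrict Ω, |φ₂ z| ≤ M) {a : Pt n m → ℝ}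
    (ha : Integrable a (volume.restrict Ω))
    (hlip : ∀ᵐ z ∂volume.restrict Ω, ∀ s t : ℝ, s ≠ t → |s| ≤ M → |t| ≤ M →
      (f z s - f z t) / (s - t) ≤ a z) {w : Pt n m → ℝ}
    (hw : MemH10 γ Ω w) (hw₁ : ∀ᵐ z ∂volume.restrict Ω, φ₁ z ≤ w z)
    (hwM : ∀ᵐ z ∂volume.restrict Ω, |w z| ≤ M) (hGw : MemL1 Ω fun z => G z (w z))
    (hFw : Integrable (fun z => F z (w z)) (volume.restrict Ω)) :
    Integrable (fun z => a z * max (w z - φ₂ z) 0 ^ 2) (volume.restrict Ω) ∧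
    energyValue γ Ω G F u + (1 / 2) * (∫ z in Ω, ‖{z | 0 < w z - φ₂ z}.indicator
      (fun z => weakGrad γ Ω w z - weakGrad γ Ω φ₂ z) z‖ ^ 2) +
      ((∫ z in Ω, inner ℝ (weakGrad γ Ω φ₂ z)
      ({z | 0 < w z - φ₂ z}.indicator (fun z => weakGrad γ Ω w z - weakGrad γ Ω φ₂ z) z)) +
      ∫ z in Ω, ((g z (φ₂ z)).toReal - f z (φ₂ z)) * max (w z - φ₂ z) 0) ≤
      energyValue γ Ω G F w + (1 / 2) * ∫ z in Ω, a z * max (w z - φ₂ z) 0 ^ 2 := by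
  obtain ⟨ib, -⟩ := h.super_ineq_excess hM hφM hw hwM hGw
  have hH := h.h10Pair_excess hw
  set H := {z | 0 < w z - φ₂ z}.indicator fun z => weakGrad γ Ω w z - weakGrad γ Ω φ₂ z with hHdef
  -- The truncated competitor lies in the order interval, so its energy is at least that of `u`.
  set k : Pt n m → ℝ := fun z => min (w z) (φ₂ z) with hk
  have hkpair : H10Pair γ Ω k fun z => weakGrad γ Ω w z - H z := by
    refine (hw.pair.sub h.pos hH).congr (Eventually.of_forall fun z => ?_) EventuallyEq.rfl
    simp only [hk]
    rcases le_total (w z) (φ₂ z) with h1 | h1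
    · rw [max_eq_right (by linarith), min_eq_left h1, sub_zero]
    · rw [max_eq_left (by linarith), min_eq_right h1]; ring
  have hkle : ∀ᵐ z ∂volume.restrict Ω, φ₁ z ≤ k z ∧ k z ≤ φ₂ z := by
    filter_upwards [hw₁, h.le] with z h1 h2 using ⟨le_min h1 h2, min_le_right _ _⟩
  have hkK : k ∈ orderInterval γ Ω φ₁ φ₂ := ⟨hkpair.memH10 h.pos h.isOpen, hkle⟩
  have mk := hkpair.memLp.1.aemeasurable
  obtain ⟨a', A', B, -, -, -, hB, hb⟩ := h.exists_lower_bound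
  have hcv := h.convex.convexAt h.isOpen
  have hGk : MemL1 Ω fun z => G z (k z) := by
    refine ⟨?_, ?_⟩
    · filter_upwards [h.convexBetween, hkle, hcv] with z h1 h2 h3
      exact ⟨(h1.G_lt_top h2).ne, h3.bot _⟩
    · refine Integrable.mono' (g := fun z => |(G z (w z)).toReal| + |(G z (u z)).toReal| + |B z|)
        ((hGw.2.abs.add hG.2.abs).add hB.abs)
        (h.aemeasurable_G mk hkle).ereal_toReal.aestronglyMeasurable ?_
      filter_upwards [hb, h.convexBetween, hkle, hcv, hGw.1, hu.2] with z h1 h2 h3 h4 h5 h6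
      have e1 := (h1.2.1 _ h3).2.2
      have e2 := le_abs_self (B z)
      have e3 := abs_nonneg (B z)
      have e4 := le_abs_self (G z (w z)).toReal
      have e5 := le_abs_self (G z (u z)).toReal
      have e6 := abs_nonneg (G z (w z)).toReal
      have e7 := abs_nonneg (G z (u z)).toReal
      rw [Real.norm_eq_abs, abs_le]
      refine ⟨by linarith, ?_⟩
      rcases le_total (w z) (φ₂ z) with h7 | h7
      · have : k z = w z := min_eq_left h7
        rw [this]; linarith
      · have : k z = φ₂ z := min_eq_right h7
        rw [this]
        -- `G(·, φ₂)` is only known to be locally integrable. Since `u ≤ φ₂ ≤ w` here, convexity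
        -- bounds it by the larger of two integrable functions.
        have h8 := h4.convexOn.le_max_of_mem_Icc (h2.G_lt_top h6)
          (lt_top_iff_ne_top.2 h5.1) ⟨h6.2, h7⟩
        exact h8.trans (max_le (by linarith) (by linarith))
  have hFk := h.integrable_F mk hkle
  have hmk := hmin k hkK hGk
  have ia : Integrable (fun z => a z * max (w z - φ₂ z) 0 ^ 2) (volume.restrict Ω) := by
    refine Integrable.mono' (ha.abs.const_mul ((2 * M) ^ 2))
      (ha.1.mul (hH.memLp.1.pow 2)) ?_
    filter_upwards [hwM, hφM] with z h1 h2
    have h1 := abs_le.1 h1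
    have h2 := abs_le.1 h2
    have h3 : 0 ≤ max (w z - φ₂ z) 0 := le_max_right _ _
    have h4 : max (w z - φ₂ z) 0 ≤ 2 * M := max_le (by linarith) (by linarith)
    rw [norm_mul, Real.norm_eq_abs, Real.norm_of_nonneg (by positivity), mul_comm]
    gcongr
  refine ⟨ia, ?_⟩
  have p2 := h.super.memH1.pair
  have e1 : (1 / 2) * (∫ z in Ω, ‖weakGrad γ Ω k z‖ ^ 2) + (1 / 2) * (∫ z in Ω, ‖H z‖ ^ 2) +
      (∫ z in Ω, inner ℝ (weakGrad γ Ω φ₂ z) (H z)) =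
      (1 / 2) * ∫ z in Ω, ‖weakGrad γ Ω w z‖ ^ 2 := by
    have i1 := (integrable_norm_sq hkpair.memLp_grad).const_mul (1 / 2)
    have i2 := (integrable_norm_sq hH.memLp_grad).const_mul (1 / 2)
    have i3 := integrable_inner_L2 p2.memLp_grad hH.memLp_grad
    have i4 : Integrable (fun z => (1 / 2) * ‖weakGrad γ Ω w z - H z‖ ^ 2 + (1 / 2) * ‖H z‖ ^ 2)
      (volume.restrict Ω) := i1.add i2
    have e2 : ∫ z in Ω, ‖weakGrad γ Ω k z‖ ^ 2 = ∫ z in Ω, ‖weakGrad γ Ω w z - H z‖ ^ 2 := by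
      refine integral_congr_ae ?_
      filter_upwards [hkpair.weakGrad_ae h.pos h.isOpen] with z hz
      rw [hz]
    rw [e2, ← integral_const_mul, ← integral_const_mul, ← integral_const_mul,
      ← integral_add i1 i2, ← integral_add i4 i3]
    refine integral_congr_ae (Eventually.of_forall fun z => ?_)
    simp only
    by_cases hz : z ∈ {z | 0 < w z - φ₂ z}
    · rw [hHdef, Set.indicator_of_mem hz, sub_sub_cancel]
      exact inner_excess_eq _ _
    · rw [hHdef, Set.indicator_of_notMem hz]; simp
  have e3 : (∫ z in Ω, (G z (k z)).toReal) - (∫ z in Ω, F z (k z)) +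
      (∫ z in Ω, ((g z (φ₂ z)).toReal - f z (φ₂ z)) * max (w z - φ₂ z) 0) ≤
      (∫ z in Ω, (G z (w z)).toReal) - (∫ z in Ω, F z (w z)) +
      (1 / 2) * ∫ z in Ω, a z * max (w z - φ₂ z) 0 ^ 2 := by
    have i1 : Integrable (fun z => (G z (k z)).toReal - F z (k z)) (volume.restrict Ω) :=
      hGk.2.sub hFk
    have i2 : Integrable (fun z => (G z (w z)).toReal - F z (w z)) (volume.restrict Ω) :=
      hGw.2.sub hFw
    have i3 := ia.const_mul (1 / 2)
    rw [← integral_sub hGk.2 hFk, ← integral_sub hGw.2 hFw, ← integral_add i1 ib,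
      ← integral_const_mul, ← integral_add i2 i3]
    refine integral_mono_ae (i1.add ib) (i2.add i3) ?_
    filter_upwards [h.convexBetween, hcv, hGw.1, hlip, hwM, hφM, h.primitive.deriv] with
      z h1 h2 h3 h4 h5 h6 h7
    rcases le_or_gt (w z) (φ₂ z) with h8 | h8
    · have : k z = w z := min_eq_left h8
      rw [this, max_eq_right (by linarith)]; simp
    · have e4 : k z = φ₂ z := min_eq_right h8.le
      have e5 : max (w z - φ₂ z) 0 = w z - φ₂ z := max_eq_left (by linarith)
      have hmem : φ₂ z ∈ Set.Icc (φ₁ z) (φ₂ z) := ⟨h1.le, le_rfl⟩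
      have f2 := h1.g_finite hmem
      -- The tangent at `φ₂` bounds `G(w)` from below, and the one-sided Lipschitz condition bounds
      -- `F(w)` from above up to the quadratic error `a h² / 2`.
      have h9 := h2.tangent (h1.G_lt_top hmem) (lt_top_iff_ne_top.2 h3.1) f2.1 f2.2
      have h10 := primitive_le_of_oneSidedLipschitz h7 (a := a z) h8.le (fun r hr => by
        have h11 := h4 r (φ₂ z) hr.1.ne' (by
          rw [abs_le] at *; constructor <;> linarith [hr.1, hr.2]) h6
        rwa [div_le_iff₀ (sub_pos.2 hr.1)] at h11)
      rw [e4, e5]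
      linarith
  unfold energyValue at hmk ⊢
  linarith

lemma ofReal_integral_norm_sq {μ : Measure (Pt n m)} {X : Pt n m → Vec n m} (hX : MemLp X 2 μ) :
    ENNReal.ofReal (∫ z, ‖X z‖ ^ 2 ∂μ) = eLpNorm X 2 μ ^ 2 := by
  rw [eLpNorm_two_sq, ofReal_integral_eq_lintegral_ofReal (integrable_norm_sq hX)
    (Eventually.of_forall fun z => by positivity)]
  refine lintegral_congr fun z => ?_
  rw [← ofReal_norm, ENNReal.ofReal_pow (norm_nonneg _)]

lemma tendsto_eLpNorm_indicator {α : Type*} [MeasurableSpace α] {μ : Measure α} {p : ℝ}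
    (hp : 0 < p) {a : α → ℝ} (ha : MemLp a (ENNReal.ofReal p) μ) {S : ℕ → Set α}
    (mS : ∀ k, NullMeasurableSet (S k) μ) (hS : ∀ᵐ z ∂μ, ∀ᶠ k in atTop, z ∉ S k) :
    Tendsto (fun k => eLpNorm ((S k).indicator a) (ENNReal.ofReal p) μ) atTop (𝓝 0) := by
  have hfin : ∫⁻ z, ‖a z‖ₑ ^ p ∂μ ≠ ⊤ := by
    have := (lintegral_rpow_enorm_lt_top_of_eLpNorm_lt_top (p := ENNReal.ofReal p)
      (by simpa using hp) ENNReal.ofReal_ne_top ha.2).ne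
    rwa [ENNReal.toReal_ofReal hp.le] at this
  have h1 : Tendsto (fun k => ∫⁻ z, ‖(S k).indicator a z‖ₑ ^ p ∂μ) atTop (𝓝 0) := by
    have := tendsto_lintegral_of_dominated_convergence' (μ := μ)
      (F := fun k z => ‖(S k).indicator a z‖ₑ ^ p) (f := fun _ => 0) (fun z => ‖a z‖ₑ ^ p)
      (fun k => (ha.1.aemeasurable.indicator₀ (mS k)).enorm.pow_const p)
      (fun k => Eventually.of_forall fun z => by
        simp only
        gcongr
        exact enorm_indicator_le_enorm_self _ _) hfin (by
        filter_upwards [hS] with z hz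
        refine tendsto_const_nhds.congr' ?_
        filter_upwards [hz] with k hk
        rw [Set.indicator_of_notMem hk]; simp [hp])
    simpa using this
  have h2 := h1.ennrpow_const (1 / p)
  rw [ENNReal.zero_rpow_of_pos (by positivity)] at h2
  simpa only [eLpNorm_ofReal μ _ hp] using h2

/-- A quadratic form with critical coefficient is dominated by the energy along functions
concentrating on shrinking sets. -/
lemma exists_integral_mul_sq_le (hn : 1 ≤ n) (hm : 1 ≤ m) {γ : ℝ} (hγ : 0 < γ)
    {Ω : Set (Pt n m)} (hΩ : IsOpen Ω) {a : Pt n m → ℝ}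
    (ha : MemLp a (ENNReal.ofReal (homDim n m γ / 2)) (volume.restrict Ω))
    {h : ℕ → Pt n m → ℝ} {H : ℕ → Pt n m → Vec n m} (hh : ∀ k, H10Pair γ Ω (h k) (H k))
    (h0 : ∀ᵐ z ∂volume.restrict Ω, ∀ᶠ k in atTop, h k z = 0) :
    ∃ k, ∫ z in Ω, a z * h k z ^ 2 ≤ ∫ z in Ω, ‖H k z‖ ^ 2 := by
  obtain ⟨K, hK, hS⟩ := exists_sobolev_h10 (m := m) hn hm hγ
  have hQ := homDim_gt_two hn hm hγ
  have mS : ∀ k, NullMeasurableSet {z | h k z ≠ 0} (volume.restrict Ω) := fun k =>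
    (nullMeasurableSet_eq_fun (hh k).memLp.1.aemeasurable aemeasurable_const).compl
  -- Only the values of `a` on `{h k ≠ 0}` matter. Their `L^{Q/2}` norm tends to zero, so by Hölder
  -- and Sobolev the quadratic form is eventually absorbed by the energy.
  have h1 := tendsto_eLpNorm_indicator (by linarith) ha mS (by
    filter_upwards [h0] with z hz
    filter_upwards [hz] with k hk
    simpa using hk)
  have h2 := ENNReal.Tendsto.mul_const (b := ENNReal.ofReal K ^ 2) h1
    (Or.inr (by finiteness))
  rw [zero_mul] at h2
  obtain ⟨k, hk⟩ := ((ENNReal.tendsto_nhds_zero.1 h2) 1 one_pos).exists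
  refine ⟨k, ?_⟩
  have i2 : 0 ≤ ∫ z in Ω, ‖H k z‖ ^ 2 := integral_nonneg fun z => by positivity
  rw [← ENNReal.ofReal_le_ofReal_iff i2, ofReal_integral_norm_sq (hh k).memLp_grad]
  calc ENNReal.ofReal (∫ z in Ω, a z * h k z ^ 2)
      ≤ ‖∫ z in Ω, a z * h k z ^ 2‖ₑ := Real.ofReal_le_enorm _
    _ ≤ ∫⁻ z in Ω, ‖a z * h k z ^ 2‖ₑ := enorm_integral_le_lintegral_enorm _
    _ = ∫⁻ z in Ω, ‖{z | h k z ≠ 0}.indicator a z‖ₑ * ‖h k z‖ₑ ^ (2 : ℝ) := by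
        refine lintegral_congr fun z => ?_
        by_cases hz : h k z = 0
        · simp [hz]
        · rw [Set.indicator_of_mem (by simpa using hz), enorm_mul, enorm_pow]
          norm_cast
    _ ≤ _ := lintegral_mul_rpow_le two_pos (holderConjugate_half_homDim hn hm hγ)
        (ha.1.aemeasurable.indicator₀ (mS k)) (hh k).memLp.1.aemeasurable
    _ ≤ eLpNorm ({z | h k z ≠ 0}.indicator a) (ENNReal.ofReal (homDim n m γ / 2))
        (volume.restrict Ω) * (ENNReal.ofReal K * eLpNorm (H k) 2 (volume.restrict Ω)) ^
        (2 : ℝ) := by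
        gcongr
        exact hS Ω hΩ _ _ (hh k)
    _ = (eLpNorm ({z | h k z ≠ 0}.indicator a) (ENNReal.ofReal (homDim n m γ / 2))
        (volume.restrict Ω) * ENNReal.ofReal K ^ 2) * eLpNorm (H k) 2 (volume.restrict Ω) ^ 2 := by
        rw [ENNReal.rpow_two, mul_pow, mul_assoc]
    _ ≤ 1 * eLpNorm (H k) 2 (volume.restrict Ω) ^ 2 := by gcongr
    _ = _ := one_mul _

/-- Blow-up limit of functions on which the linearised energy is smaller than the quadratic
error. -/
lemma exists_blowUp_limit (hn : 1 ≤ n) (hm : 1 ≤ m) {γ : ℝ} (hγ : 0 < γ)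
    {Ω : Set (Pt n m)} (hΩ : IsOpen Ω) (hΩb : Bornology.IsBounded Ω) {a p e : Pt n m → ℝ}
    (ha : MemLp a (ENNReal.ofReal (homDim n m γ / 2)) (volume.restrict Ω))
    (he : MemLp e (ENNReal.ofReal (2 * homDim n m γ / (homDim n m γ + 2))) (volume.restrict Ω))
    (p0 : ∀ᵐ z ∂volume.restrict Ω, 0 ≤ p z) {q : Pt n m → Vec n m}
    (hq : MemLp q 2 (volume.restrict Ω))
    {h : ℕ → Pt n m → ℝ} {H : ℕ → Pt n m → Vec n m} (hh : ∀ k, H10Pair γ Ω (h k) (H k))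
    (h0 : ∀ k, ∀ᵐ z ∂volume.restrict Ω, 0 ≤ h k z)
    (ib : ∀ k, Integrable (fun z => (p z - e z) * h k z) (volume.restrict Ω))
    (hL : ∀ k, 0 ≤ (∫ z in Ω, inner ℝ (q z) (H k z)) + ∫ z in Ω, (p z - e z) * h k z)
    (hlt : ∀ k, (1 / 2) * (∫ z in Ω, ‖H k z‖ ^ 2) + ((∫ z in Ω, inner ℝ (q z) (H k z)) +
      ∫ z in Ω, (p z - e z) * h k z) < (1 / 2) * ∫ z in Ω, a z * h k z ^ 2)
    (hlim : Tendsto (fun k => ∫ z in Ω, a z * h k z ^ 2) atTop (𝓝 0)) :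
    ∃ v V, H10Pair γ Ω v V ∧ (∀ᵐ z ∂volume.restrict Ω, 0 ≤ v z) ∧
      ¬ (∀ᵐ z ∂volume.restrict Ω, v z = 0) ∧
      Integrable (fun z => inner ℝ (q z) (V z) + (p z - e z) * v z) (volume.restrict Ω) ∧
      ∫ z in Ω, (inner ℝ (q z) (V z) + (p z - e z) * v z) ≤ 0 := by
  -- Normalisation by the quadratic form rather than by the gradient: the gradients stay bounded
  -- because the form dominates them, and the form keeps the value one, which will prevent a zero
  -- limit.
  set s : ℕ → ℝ := fun k => √(∫ z in Ω, a z * h k z ^ 2) with hs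
  have Hnn : ∀ k, 0 ≤ ∫ z in Ω, ‖H k z‖ ^ 2 := fun k => integral_nonneg fun z => by positivity
  have Ipos : ∀ k, 0 < ∫ z in Ω, a z * h k z ^ 2 := fun k => by
    have := hlt k; have := hL k; have := Hnn k; linarith
  have spos : ∀ k, 0 < s k := fun k => Real.sqrt_pos.2 (Ipos k)
  have ssq : ∀ k, s k ^ 2 = ∫ z in Ω, a z * h k z ^ 2 := fun k => Real.sq_sqrt (Ipos k).le
  have slim : Tendsto s atTop (𝓝 0) := by
    have := (Real.continuous_sqrt.tendsto 0).comp hlim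
    rwa [Real.sqrt_zero] at this
  set v : ℕ → Pt n m → ℝ := fun k z => (s k)⁻¹ * h k z with hv
  set V : ℕ → Pt n m → Vec n m := fun k z => (s k)⁻¹ • H k z with hV
  have hvV : ∀ k, H10Pair γ Ω (v k) (V k) := fun k => (hh k).const_mul _
  have v0 : ∀ k, ∀ᵐ z ∂volume.restrict Ω, 0 ≤ v k z := fun k => by
    filter_upwards [h0 k] with z hz
    exact mul_nonneg (inv_nonneg.2 (spos k).le) hz
  have hVb : ∀ k, eLpNorm (V k) 2 (volume.restrict Ω) ≤ ENNReal.ofReal 1 := by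
    intro k
    have h1 : ∫ z in Ω, ‖V k z‖ ^ 2 ≤ 1 := by
      have h2 : ∀ z, ‖V k z‖ ^ 2 = (s k ^ 2)⁻¹ * ‖H k z‖ ^ 2 := fun z => by
        simp only [hV]
        rw [norm_smul, mul_pow, Real.norm_eq_abs, sq_abs, inv_pow]
      simp only [h2]
      rw [integral_const_mul, inv_mul_le_iff₀ (pow_pos (spos k) 2), ssq]
      have := hlt k; have := hL k
      linarith
    have h3 : eLpNorm (V k) 2 (volume.restrict Ω) ^ 2 ≤ 1 ^ 2 := by
      rw [← ofReal_integral_norm_sq (hvV k).memLp_grad, one_pow, ← ENNReal.ofReal_one]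
      exact ENNReal.ofReal_le_ofReal h1
    rw [ENNReal.ofReal_one]
    exact (ENNReal.pow_le_pow_left_iff two_ne_zero).1 h3
  -- The linear terms scale by `1 / s` and the quadratic ones by `1 / s ^ 2`, so the linear
  -- functional at `v k` is at most `s k / 2` and has nonpositive limit.
  have Lle : ∀ k, (∫ z in Ω, inner ℝ (q z) (V k z)) + ∫ z in Ω, (p z - e z) * v k z ≤
      s k / 2 := by
    intro k
    have h1 : (∫ z in Ω, inner ℝ (q z) (V k z)) = (s k)⁻¹ * ∫ z in Ω, inner ℝ (q z) (H k z) := by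
      rw [← integral_const_mul]
      exact integral_congr_ae (Eventually.of_forall fun z => inner_smul_right _ _ _)
    have h2 : ∫ z in Ω, (p z - e z) * v k z = (s k)⁻¹ * ∫ z in Ω, (p z - e z) * h k z := by
      rw [← integral_const_mul]
      exact integral_congr_ae (Eventually.of_forall fun z => by simp only [hv]; ring)
    rw [h1, h2, ← mul_add, inv_mul_le_iff₀ (spos k)]
    have := hlt k; have := Hnn k; have := ssq k
    nlinarith
  obtain ⟨w, W, σ, hσ, hwW, hL2, hae, hweak⟩ := exists_compact_subseq hn hm hγ hΩ hΩb hvV hVb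
  have w0 : ∀ᵐ z ∂volume.restrict Ω, 0 ≤ w z := by
    filter_upwards [hae, ae_all_iff.2 v0] with z h1 h2
    exact ge_of_tendsto' h1 fun k => h2 _
  obtain ⟨ie, ie0, lime⟩ := tendsto_integral_mul_of_dualExp hn hm hγ hΩ hΩb he
    (fun k => hvV (σ k)) hwW (fun k => hVb (σ k)) hL2
  have ibv : ∀ k, Integrable (fun z => (p z - e z) * v k z) (volume.restrict Ω) := fun k => by
    refine ((ib k).const_mul (s k)⁻¹).congr (Eventually.of_forall fun z => ?_)
    simp only [hv]; ring
  have ip : ∀ k, Integrable (fun z => p z * v (σ k) z) (volume.restrict Ω) := fun k => by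
    refine ((ibv (σ k)).add (ie k)).congr (Eventually.of_forall fun z => ?_)
    simp only [Pi.add_apply]; ring
  -- No integrability beyond the products is known for `p`, so its term passes to the limit by
  -- Fatou's lemma; the terms with `e` and `q` converge by duality.
  obtain ⟨ip0, hp0⟩ := integrable_of_fatou ip (fun k => by
      filter_upwards [p0, v0 (σ k)] with z h1 h2 using mul_nonneg h1 h2)
    (c := fun k => s (σ k) / 2 - (∫ z in Ω, inner ℝ (V (σ k) z) (q z)) +
      ∫ z in Ω, e z * v (σ k) z) (fun k => by
      have h1 : ∫ z in Ω, p z * v (σ k) z =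
          (∫ z in Ω, (p z - e z) * v (σ k) z) + ∫ z in Ω, e z * v (σ k) z := by
        rw [← integral_add (ibv (σ k)) (ie k)]
        exact integral_congr_ae (Eventually.of_forall fun z => by simp only; ring)
      have h3 : (∫ z in Ω, inner ℝ (q z) (V (σ k) z)) = ∫ z in Ω, inner ℝ (V (σ k) z) (q z) :=
        integral_congr_ae (Eventually.of_forall fun z => real_inner_comm _ _)
      have h4 := Lle (σ k)
      linarith)
    (((((slim.comp hσ.tendsto_atTop).div_const 2).sub (hweak q hq)).add lime))
    (f₀ := fun z => p z * w z) (by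
      filter_upwards [hae] with z hz using hz.const_mul _)
  have iq := integrable_inner_L2 hq hwW.memLp_grad
  have ib0 : Integrable (fun z => (p z - e z) * w z) (volume.restrict Ω) := by
    refine (ip0.sub ie0).congr (Eventually.of_forall fun z => ?_)
    simp only [Pi.sub_apply]; ring
  refine ⟨w, W, hwW, w0, fun hzero => ?_, iq.add ib0, ?_⟩
  -- If the limit were zero, `v` would tend to zero in `L²` with bounded critical norm, and then the
  -- integrals of `a v²` would tend to zero instead of being equal to one.
  · have e1 : Tendsto (fun k => ∫⁻ z in Ω, ‖v (σ k) z‖ₑ ^ (2 : ℝ)) atTop (𝓝 0) := by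
      have h1 : ∀ k, ∫⁻ z in Ω, ‖v (σ k) z‖ₑ ^ (2 : ℝ) =
          eLpNorm (fun z => v (σ k) z - w z) 2 (volume.restrict Ω) ^ 2 := by
        intro k
        rw [eLpNorm_two_sq]
        refine lintegral_congr_ae ?_
        filter_upwards [hzero] with z hz
        rw [hz, sub_zero, ENNReal.rpow_two]
      simp only [h1]
      simpa using ENNReal.Tendsto.pow (n := 2) hL2
    obtain ⟨K, hK, hS⟩ := exists_sobolev_h10 (m := m) hn hm hγ
    have e2 := tendsto_lintegral_mul_rpow two_pos (holderConjugate_half_homDim hn hm hγ) ha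
      (fun k => (hvV (σ k)).memLp.1.aemeasurable) (C := K) (fun k => by
        refine (hS Ω hΩ _ _ (hvV (σ k))).trans ?_
        calc ENNReal.ofReal K * eLpNorm (V (σ k)) 2 (volume.restrict Ω)
            ≤ ENNReal.ofReal K * ENNReal.ofReal 1 := by gcongr; exact hVb _
          _ = _ := by simp) e1
    have e3 : ∀ k, (1 : ℝ≥0∞) ≤ ∫⁻ z in Ω, ‖a z‖ₑ * ‖v (σ k) z‖ₑ ^ (2 : ℝ) := by
      intro k
      have h1 : ∫ z in Ω, a z * v (σ k) z ^ 2 = 1 := by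
        have h2 : ∀ z, a z * v (σ k) z ^ 2 = (s (σ k) ^ 2)⁻¹ * (a z * h (σ k) z ^ 2) := fun z => by
          simp only [hv]; rw [mul_pow, inv_pow]; ring
        simp only [h2]
        rw [integral_const_mul, ← ssq, inv_mul_cancel₀ (pow_pos (spos _) 2).ne']
      calc (1 : ℝ≥0∞) = ‖∫ z in Ω, a z * v (σ k) z ^ 2‖ₑ := by rw [h1]; simp
        _ ≤ ∫⁻ z in Ω, ‖a z * v (σ k) z ^ 2‖ₑ := enorm_integral_le_lintegral_enorm _
        _ = _ := by
          refine lintegral_congr fun z => ?_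
          rw [enorm_mul, enorm_pow, ENNReal.rpow_two]
    have e4 := ge_of_tendsto' e2 e3
    simp at e4
  · rw [integral_add iq ib0]
    have h1 : ∫ z in Ω, p z * w z = (∫ z in Ω, (p z - e z) * w z) + ∫ z in Ω, e z * w z := by
      rw [← integral_add ib0 ie0]
      exact integral_congr_ae (Eventually.of_forall fun z => by simp only; ring)
    have h3 : (∫ z in Ω, inner ℝ (q z) (W z)) = ∫ z in Ω, inner ℝ (W z) (q z) :=
      integral_congr_ae (Eventually.of_forall fun z => real_inner_comm _ _)
    rw [h1, zero_div] at hp0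
    linarith

lemma exists_of_energyOn_lt {K : Set (Pt n m → ℝ)} {u w : Pt n m → ℝ} {c : ℝ}
    (hu : energyOn γ Ω G F K u = c) (hlt : energyOn γ Ω G F K w < energyOn γ Ω G F K u) :
    w ∈ K ∧ MemL1 Ω (fun z => G z (w z)) ∧ Integrable (fun z => F z (w z)) (volume.restrict Ω) ∧
      energyValue γ Ω G F w < c := by
  rw [hu] at hlt
  have hwK : w ∈ K := by
    by_contra hc
    rw [energyOn, if_neg hc] at hlt
    exact not_top_lt hlt
  rw [energyOn, if_pos hwK] at hlt
  by_cases hc : MemL1 Ω (fun z => G z (w z)) ∧ Integrable (fun z => F z (w z)) (volume.restrict Ω)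
  · rw [energy_eq hc.1 hc.2, EReal.coe_lt_coe_iff] at hlt
    exact ⟨hwK, hc.1, hc.2, hlt⟩
  · rw [energy, if_neg hc] at hlt
    exact absurd hlt not_top_lt

lemma eLpNorm_weakGrad {u : Pt n m → ℝ} (hu : MemH10 γ Ω u) :
    eLpNorm (weakGrad γ Ω u) 2 (volume.restrict Ω) = ENNReal.ofReal (h10Norm γ Ω u) := by
  have h1 := ofReal_integral_norm_sq hu.pair.memLp_grad
  rw [← Real.sq_sqrt (integral_nonneg fun z => by positivity),
    ENNReal.ofReal_pow (Real.sqrt_nonneg _)] at h1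
  exact ((ENNReal.pow_right_strictMono two_ne_zero).injective h1).symm

/-- Competitors of smaller energy approaching `u` in norm contain a sequence approaching it
almost everywhere. -/
lemma exists_seq_ae_tendsto (hn : 1 ≤ n) (hm : 1 ≤ m) (hγ : 0 < γ) (hΩ : IsOpen Ω)
    (hΩb : Bornology.IsBounded Ω) {u : Pt n m → ℝ} (hu : MemH10 γ Ω u)
    {P : (Pt n m → ℝ) → Prop} (h : ∀ ρ : ℝ, 0 < ρ → ∃ w, MemH10 γ Ω w ∧
      h10Norm γ Ω (fun z => w z - u z) < ρ ∧ P w) :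
    ∃ w : ℕ → Pt n m → ℝ, (∀ k, MemH10 γ Ω (w k) ∧ P (w k)) ∧
      ∀ᵐ z ∂volume.restrict Ω, Tendsto (fun k => w k z) atTop (𝓝 (u z)) := by
  choose w hw hwu hP using fun k : ℕ => h (1 / ((k : ℝ) + 1)) (by positivity)
  obtain ⟨K, hK, hpo⟩ := exists_poincare hn hm hγ hΩ hΩb
  have hlim : Tendsto (fun k => eLpNorm (fun z => w k z - u z) 2 (volume.restrict Ω)) atTop
      (𝓝 0) := by
    have h1 : Tendsto (fun k : ℕ => ENNReal.ofReal K * ENNReal.ofReal (1 / ((k : ℝ) + 1))) atTop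
        (𝓝 0) := by
      have h2 : Tendsto (fun k : ℕ => ENNReal.ofReal (1 / ((k : ℝ) + 1))) atTop (𝓝 0) := by
        rw [← ENNReal.ofReal_zero]
        exact ENNReal.tendsto_ofReal tendsto_one_div_add_atTop_nhds_zero_nat
      simpa using ENNReal.Tendsto.const_mul h2 (Or.inr (ENNReal.ofReal_ne_top (r := K)))
    refine tendsto_of_tendsto_of_tendsto_of_le_of_le tendsto_const_nhds h1 (fun _ => zero_le)
      fun k => ?_
    have hd := ((hw k).pair.sub hγ hu.pair).memH10 hγ hΩ
    refine (hpo _ _ hd.pair).trans ?_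
    rw [eLpNorm_weakGrad hd]
    gcongr
    exact (hwu k).le
  obtain ⟨σ, -, hσ⟩ := exists_subseq_ae (fun k => (hw k).pair.memLp.1) hu.pair.memLp.1 hlim
  exact ⟨fun k => w (σ k), fun k => ⟨hw _, hP _⟩, hσ⟩

/-- The strict inequality is stated for integrals of positive and negative parts, where `+∞` is
allowed. For an integrable integrand it becomes positivity of the ordinary integral, as needed at
the blow-up limit. -/
lemma IsStrictSupersolution.integral_pos {φ : Pt n m → ℝ} (h : IsStrictSupersolution γ Ω g f φ)
    (hγ : 0 < γ) (hΩ : IsOpen Ω) {v : Pt n m → ℝ} {V : Pt n m → Vec n m} (hv : H10Pair γ Ω v V)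
    (v0 : ∀ᵐ z ∂volume.restrict Ω, 0 ≤ v z) (hv' : ¬ ∀ᵐ z ∂volume.restrict Ω, v z = 0)
    (hi : Integrable (fun z => inner ℝ (weakGrad γ Ω φ z) (V z) +
      ((g z (φ z)).toReal - f z (φ z)) * v z) (volume.restrict Ω)) :
    0 < ∫ z in Ω, (inner ℝ (weakGrad γ Ω φ z) (V z) +
      ((g z (φ z)).toReal - f z (φ z)) * v z) := by
  have h1 := h.strict v (hv.memH10 hγ hΩ) v0 hv'
  have h2 : (fun z => inner ℝ (weakGrad γ Ω φ z) (V z) +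
      ((g z (φ z)).toReal - f z (φ z)) * v z) =ᵐ[volume.restrict Ω]
      weakIntegrand γ Ω g f φ v (weakGrad γ Ω v) := by
    filter_upwards [hv.weakGrad_ae hγ hΩ] with z hz
    rw [weakIntegrand_eq, hz]
  have hi' := hi.congr h2
  rw [integral_congr_ae h2, integral_eq_lintegral_pos_part_sub_lintegral_neg_part hi', sub_pos]
  exact (ENNReal.toReal_lt_toReal (h1.trans_le le_top).ne hi'.lintegral_lt_top.ne).2 h1

/-- A minimizer between a subsolution and a supersolution minimizes the energy locally above the
supersolution as well. -/
theorem OrderedPair.isLocalMinimizer (h : OrderedPair γ Ω g G f F φ₁ φ₂)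
    (hlip : LocalOneSidedLipschitz γ Ω f) {u : Pt n m → ℝ}
    (hu : u ∈ orderInterval γ Ω φ₁ φ₂) (hG : MemL1 Ω (fun z => G z (u z)))
    (hmin : ∀ w ∈ orderInterval γ Ω φ₁ φ₂, MemL1 Ω (fun z => G z (w z)) →
      energyValue γ Ω G F u ≤ energyValue γ Ω G F w)
    (hcond : (∀ᵐ z ∂volume.restrict Ω, u z < φ₂ z) ∨ IsStrictSupersolution γ Ω g f φ₂)
    {v : Pt n m → ℝ} (hvb : MemLp v ⊤ (volume.restrict Ω))
    (huv : ∀ᵐ z ∂volume.restrict Ω, u z ≤ v z) :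
    IsLocalMinimizer γ Ω G F (orderInterval γ Ω φ₁ v) u := by
  have huK : u ∈ orderInterval γ Ω φ₁ v := ⟨hu.1, by
    filter_upwards [hu.2, huv] with z h1 h2 using ⟨h1.1, h2⟩⟩
  have hFu := h.integrable_F hu.1.pair.memLp.1.aemeasurable hu.2
  have hval : energyOn γ Ω G F (orderInterval γ Ω φ₁ v) u = energyValue γ Ω G F u := by
    rw [energyOn, if_pos huK, energy_eq hG hFu]
  refine ⟨hu.1, by rw [hval]; exact EReal.coe_lt_top _, ?_⟩
  -- Of competitors with smaller energy tending to `u` in norm, only the smaller energy and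
  -- convergence almost everywhere along a sequence are retained.
  by_contra! hcon
  obtain ⟨w, hw, hlim⟩ := exists_seq_ae_tendsto h.one_le_n h.one_le_m h.pos h.isOpen h.bounded hu.1
    (P := fun w => energyOn γ Ω G F (orderInterval γ Ω φ₁ v) w <
      energyOn γ Ω G F (orderInterval γ Ω φ₁ v) u) fun ρ hρ => by
      obtain ⟨w, h1, h2, h3⟩ := hcon ρ hρ
      exact ⟨w, h1, h2, h3⟩
  have hwP := fun k => exists_of_energyOn_lt hval (hw k).2
  obtain ⟨M₁, hM₁, hb₁⟩ := h.exists_bound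
  obtain ⟨M₂, hM₂, hb₂⟩ := exists_bound_of_memLp_top hvb
  have hM : 0 < M₁ + M₂ := add_pos hM₁ hM₂
  have hφM : ∀ᵐ z ∂volume.restrict Ω, |φ₂ z| ≤ M₁ + M₂ := by
    filter_upwards [hb₁, h.le] with z h1 h2
    linarith [h1 _ h2 le_rfl]
  have hwM : ∀ k, ∀ᵐ z ∂volume.restrict Ω, |w k z| ≤ M₁ + M₂ := fun k => by
    filter_upwards [hb₁, h.le, (hwP k).1.2, hb₂] with z h1 h2 h3 h4
    have h5 := abs_le.1 (h1 _ le_rfl h2)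
    have h6 := abs_le.1 h4
    exact abs_le.2 ⟨by linarith, by linarith⟩
  obtain ⟨a, ha, -, hal⟩ := hlip (M₁ + M₂) hM
  have hfin := isFiniteMeasure_restrict h.bounded
  have hQ := homDim_gt_two h.one_le_n h.one_le_m h.pos
  have ia : Integrable a (volume.restrict Ω) := ha.integrable (by
    rw [← ENNReal.ofReal_one]; exact ENNReal.ofReal_le_ofReal (by linarith))
  have hpair := fun k => h.h10Pair_excess (hw k).1
  have hcomp := fun k => h.energy_comparison hu hG hmin hM.le hφM ia hal (hw k).1
    (by filter_upwards [(hwP k).1.2] with z hz using hz.1) (hwM k) (hwP k).2.1 (hwP k).2.2.1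
  have hsup := fun k => h.super_ineq_excess hM.le hφM (hw k).1 (hwM k) (hwP k).2.1
  rcases hcond with hc | hc
  -- Where `u < φ₂` the excess is eventually zero, so for some `k` the quadratic error is absorbed
  -- and the energy comparison contradicts the choice of `w k`.
  · obtain ⟨k, hk⟩ := exists_integral_mul_sq_le h.one_le_n h.one_le_m h.pos h.isOpen ha hpair (by
      filter_upwards [hc, hlim] with z h1 h2
      filter_upwards [h2.eventually (eventually_lt_nhds h1)] with k hk
      exact max_eq_right (by linarith))
    have := (hcomp k).2
    have := (hsup k).2
    have := (hwP k).2.2.2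
    linarith
  · have hle₂ : ∀ᵐ z ∂volume.restrict Ω, φ₁ z ≤ φ₂ z ∧ φ₂ z ≤ φ₂ z := by
      filter_upwards [h.le] with z hz using ⟨hz, le_rfl⟩
    have mφ := h.super.memH1.1.1.aemeasurable
    obtain ⟨a₄, ha₄, -, hf₄⟩ := h.growth.bound (M₁ + M₂) hM
    have hf₂ : MemLp (fun z => f z (φ₂ z))
        (ENNReal.ofReal (2 * homDim n m γ / (homDim n m γ + 2))) (volume.restrict Ω) := by
      refine ha₄.mono (h.growth.caratheodory.aemeasurable_comp mφ).aestronglyMeasurable ?_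
      filter_upwards [hf₄, hφM] with z h1 h2
      exact (h1 _ h2).trans (le_abs_self _)
    -- Only `g⁻` and `f` at `φ₂` are known to lie in the dual space. The part `g⁺` may fail to and
    -- is kept apart as the nonnegative term treated by Fatou's lemma.
    have hsplit : ∀ z, (g z (φ₂ z)).toReal - f z (φ₂ z) = max (g z (φ₂ z)).toReal 0 -
        (max (-(g z (φ₂ z)).toReal) 0 + f z (φ₂ z)) := by
      intro z
      rcases le_total 0 (g z (φ₂ z)).toReal with h1 | h1
      · rw [max_eq_left h1, max_eq_right (by linarith)]; ring
      · rw [max_eq_right h1, max_eq_left (by linarith)]; ring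
    -- The excess is bounded by `2 * (M₁ + M₂)` and tends to zero almost everywhere because the
    -- limit `u` of the competitors lies below `φ₂`.
    have hI : Tendsto (fun k => ∫ z in Ω, a z * max (w k z - φ₂ z) 0 ^ 2) atTop (𝓝 0) := by
      have := tendsto_integral_of_dominated_convergence (μ := volume.restrict Ω)
        (F := fun k z => a z * max (w k z - φ₂ z) 0 ^ 2) (f := fun _ => 0)
        (fun z => (2 * (M₁ + M₂)) ^ 2 * |a z|) (fun k => (hcomp k).1.1) (ia.abs.const_mul _)
        (fun k => by
          filter_upwards [hwM k, hφM] with z h1 h2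
          have h1 := abs_le.1 h1
          have h2 := abs_le.1 h2
          have h3 : 0 ≤ max (w k z - φ₂ z) 0 := le_max_right _ _
          have h4 : max (w k z - φ₂ z) 0 ≤ 2 * (M₁ + M₂) := max_le (by linarith) (by linarith)
          rw [norm_mul, Real.norm_eq_abs, Real.norm_of_nonneg (by positivity), mul_comm]
          gcongr) (by
          filter_upwards [hlim, hu.2] with z h1 h2
          have h3 := (((h1.sub_const (φ₂ z)).max (tendsto_const_nhds (x := (0 : ℝ)))).pow 2).const_mul
            (a z)
          rwa [max_eq_right (by linarith), zero_pow two_ne_zero, mul_zero] at h3)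
      simpa using this
    obtain ⟨y, Y, hy, y0, hy', hi, hle⟩ := exists_blowUp_limit h.one_le_n h.one_le_m h.pos h.isOpen
      h.bounded ha (hc.g_negPart.add hf₂)
      (p := fun z => max (g z (φ₂ z)).toReal 0) (Eventually.of_forall fun z => le_max_right _ _)
      h.super.memH1.pair.memLp_grad hpair
      (fun k => Eventually.of_forall fun z => le_max_right _ _)
      (fun k => by simpa only [Pi.add_apply, ← hsplit] using (hsup k).1)
      (fun k => by simpa only [Pi.add_apply, ← hsplit] using (hsup k).2)
      (fun k => by
        simp only [Pi.add_apply, ← hsplit]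
        have := (hcomp k).2
        have := (hwP k).2.2.2
        linarith) hI
    simp only [Pi.add_apply, ← hsplit] at hi hle
    exact absurd hle (not_le.2 (hc.integral_pos h.pos h.isOpen hy y0 hy' hi))

end Grushin

end

/-! ### Assembly of the conclusions for one and the same minimizer. -/

theorem mainTheorem5 {n m : ℕ} (hn : 1 ≤ n) (hm : 1 ≤ m) {γ : ℝ} (hγ : 0 < γ)
    (Ω : Set (Grushin.Pt n m)) (hΩo : IsOpen Ω) (hΩc : IsConnected Ω)
    (hΩb : Bornology.IsBounded Ω)
    (g G : Grushin.Pt n m → ℝ → EReal) (f F : Grushin.Pt n m → ℝ → ℝ)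
    (hA1 : Grushin.LocalGrowth γ Ω f) (hA2 : Grushin.ConvexPrimitive γ Ω g G)
    (hA3 : Grushin.LocalOneSidedLipschitz γ Ω f) (hF : Grushin.IsPrimitive Ω f F)
    (φ₁ φ₂ : Grushin.Pt n m → ℝ)
    (hφ₁ : Grushin.IsSubsolution γ Ω g f φ₁) (hφ₂ : Grushin.IsSupersolution γ Ω g f φ₂)
    (hφ₂' : ¬ Grushin.IsWeakSolution γ Ω g f φ₂)
    (hb₁ : MemLp φ₁ ⊤ (volume.restrict Ω)) (hb₂ : MemLp φ₂ ⊤ (volume.restrict Ω))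
    (hle : ∀ᵐ z ∂volume.restrict Ω, φ₁ z ≤ φ₂ z)
    (hG₁ : Grushin.MemL1loc Ω (fun z => G z (φ₁ z)))
    (hG₂ : Grushin.MemL1loc Ω (fun z => G z (φ₂ z)))
    (hw : ∃ w ∈ Grushin.orderInterval γ Ω φ₁ φ₂, Grushin.MemL1 Ω (fun z => G z (w z)))
    (hcond : Grushin.QuotientCondition Ω g f φ₁ φ₂ ∨ Grushin.IsStrictSupersolution γ Ω g f φ₂) :
    ∃ u : Grushin.Pt n m → ℝ, Grushin.IsWeakSolution γ Ω g f u ∧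
      (∀ᵐ z ∂volume.restrict Ω, φ₁ z ≤ u z ∧ u z ≤ φ₂ z) ∧
      (∀ v : Grushin.Pt n m → ℝ, Grushin.MemH10 γ Ω v → MemLp v ⊤ (volume.restrict Ω) →
        (∀ᵐ z ∂volume.restrict Ω, u z ≤ v z) →
        Grushin.IsLocalMinimizer γ Ω G F (Grushin.orderInterval γ Ω φ₁ v) u) ∧
      (Grushin.QuotientCondition Ω g f φ₁ φ₂ → ∀ᵐ z ∂volume.restrict Ω, u z < φ₂ z) := by
  have h : Grushin.OrderedPair γ Ω g G f F φ₁ φ₂ :=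
    ⟨hn, hm, hγ, hΩo, hΩb, hA1, hA2, hF, hφ₁, hφ₂, hb₁, hb₂, hle, hG₁, hG₂⟩
  obtain ⟨u, hu, hGu, hmin⟩ := h.exists_minimizer hw
  have hus := h.isWeakSolution hu hGu hmin
  have hlt : Grushin.QuotientCondition Ω g f φ₁ φ₂ → ∀ᵐ z ∂volume.restrict Ω, u z < φ₂ z :=
    fun hq => h.lt_of_quotientCondition hΩc hq hφ₂' hu hus
  exact ⟨u, hus, hu.2, fun v _ hvb huv =>
    h.isLocalMinimizer hA3 hu hGu hmin (hcond.imp_left hlt) hvb huv, hlt⟩
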